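/- **Notation.** Let $n\ge 1$. For $a\in\mathbb Z$ put $[a]=\frac{q^a-q^{-a}}{q-q^{-1}}\in\mathbb C(q)$, for $0\le b\le a$ let $[a,b]=\frac{[a]!}{[b]!\,[a-b]!}$ with $[a]!=[a][a-1]\cdots[1]$, and let $f\mapsto\overline f$ be the $\mathbb C$-linear field involution of $\mathbb C(q)$ with $\overline q=q^{-1}$. Let $U=U_q(\mathfrak{sl}_2)$ be the $\mathbb C(q)$-algebra with generators $E,F,K,K^{-1}$ and relations $KE=q^2EK$, $KF=q^{-2}FK$, $KK^{-1}=1=K^{-1}K$, $EF-FE=\frac{K-K^{-1}}{q-q^{-1}}$. Let $V_n$ be the $U$-module with $\mathbb C(q)$-basis $v_0,\dots,v_n$ (the canonical basis) and $$K^{\pm1}v_k=q^{\pm(2k-n)}v_k,\qquad Ev_k=[k+1]v_{k+1},\qquad Fv_k=[n-k+1]v_{k-1}\qquad(v_{-1}=v_{n+1}=0).$$ Let $\langle\,,\rangle:V_n\times V_n\to\mathbb C(q)$ be the form, antilinear (with respect to $\overline{\phantom f}$) in the first and linear in the second variable, with $\langle v_k,v_l\rangle=\delta_{k,l}\,q^{k(n-k)}[n,k]$.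 The dual canonical basis $v^0,\dots,v^n$ is given by $\langle v_l,v^k\rangle=\delta_{k,l}q^{k(n-k)}$, that is, $v_k=[n,k]v^k$. Let $\sigma_n$ be the $\mathbb C(q)$-linear map with $\sigma_n(v_k)=v_{n-k}$, and $\psi_n$ the antilinear map with $\psi_n(v_k)=v_k$. For $I\subseteq\{0,\dots,n\}$ let $C^I=H^\bullet(\mathrm G_I;\mathbb C)$ be the graded cohomology ring of the variety of partial flags in $\mathbb C^n$ with dimensions in $I$. In Borel's description this is the ring of invariants under $W_I$ in the coinvariant algebra $\mathbb C[x_1,\dots,x_n]/(\text{symmetric polynomials without constant term})$, with $\deg x_k=2$, where $W_I\subseteq S_n$ is the group of permutations preserving $\{1,\dots,i\}$ for every $i\in I$. For $J\subseteq I$ there is an inclusion $C^J\subseteq C^I$, along which modules are restricted ($\operatorname{Res}^I_J$). Write $C^{i}=C^{\{i\}}$, $C^{i,j}=C^{\{i,j\}}$. Let $C^i\text{-gmod}$ be the category of finitely generated $\mathbb Z$-graded $C^i$-modules with degree-preserving homomorphisms, with grading shifts $(M\langle k\rangle)_j=M_{j-k}$. Let $\mathcal C=\bigoplus_{i=0}^nC^i\text{-gmod}$,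 and define functors by $$E_i=\operatorname{Res}^{i,i+1}_{i+1}C^{i,i+1}\otimes_{C^i}(-)\,\langle -n+i+1\rangle\ (0\le i<n),\qquad F_i=\operatorname{Res}^{i-1,i}_{i-1}C^{i-1,i}\otimes_{C^i}(-)\,\langle -i+1\rangle\ (0<i\le n),$$ $E_n=0$, $F_0=0$, $K_i^{\pm1}=\langle\pm(2i-n)\rangle$, and $E=\bigoplus_iE_i$, $F=\bigoplus_iF_i$, $K^{\pm1}=\bigoplus_iK_i^{\pm1}$, as endofunctors of $\mathcal C$. For $m\ge0$ let $Q_m=\bigoplus_{k=0}^{m-1}\mathrm{ID}\langle m-1-2k\rangle$. Let $S_i$ be the trivial simple $C^i$-module $\mathbb C$ in degree $0$, and let $\mathbb V_iT_i$ be the projective cover of $S_i\langle -i(n-i)\rangle$. Let $[\mathcal C]$ be the Grothendieck group of $\mathcal C$ with respect to short exact sequences, a $\mathbb Z[q,q^{-1}]$-module through $q^k[M]=[M\langle k\rangle]$, and put $\mathbf G=\mathbb C(q)\otimes_{\mathbb Z[q,q^{-1}]}[\mathcal C]$. We also write $[M]$ for $1\otimes[M]\in\mathbf G$. **Theorem.**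 The projective covers $\mathbb V_iT_i$ exist, and the following hold. (a) The functors $E,F,K,K^{-1}$ are exact and there are isomorphisms of functors $$KE\cong\langle2\rangle EK,\qquad KF\cong\langle-2\rangle FK,\qquad KK^{-1}\cong\mathrm{ID}\cong K^{-1}K,$$ $$E_{i-1}F_i\cong F_{i+1}E_i\oplus Q_{2i-n}\quad\text{if }2i-n\ge0,\qquad F_{i+1}E_i\cong E_{i-1}F_i\oplus Q_{n-2i}\quad\text{if }n-2i>0,$$ for $0\le i\le n$, where $E_{i-1}F_i$ is $0$ for $i=0$ and $F_{i+1}E_i$ is $0$ for $i=n$. In $[\mathcal C]$ one has $(q-q^{-1})\big([EFM]-[FEM]\big)=[KM]-[K^{-1}M]$ for every $M\in\mathcal C$. Hence the functors induce a $U$-module structure on $\mathbf G$, in which each of the generators $E,F,K,K^{-1}$ maps $[M]$ to the class of the value of the corresponding functor at $M$. (b) There is an isomorphism of $U$-modules $\Phi:V_n\to\mathbf G$ with $\Phi(v^i)=[S_i]$ and $\Phi(v_i)=[\mathbb V_iT_i]$ for $0\le i\le n$. It also has the properties stated in (c), (d) and (e). (c) There is an equivalence of categories $\hat\sigma_n:\mathcal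 C\to\mathcal C$ with $\hat\sigma_n(S_i)\cong S_{n-i}$, $\hat\sigma_n(\mathbb V_iT_i)\cong\mathbb V_{n-i}T_{n-i}$, $$\hat\sigma_n\hat\sigma_n\cong\mathrm{ID},\quad\hat\sigma_nE\hat\sigma_n\cong F,\quad\hat\sigma_nF\hat\sigma_n\cong E,\quad\hat\sigma_nK\hat\sigma_n\cong K^{-1},\quad\hat\sigma_n\langle k\rangle\hat\sigma_n\cong\langle k\rangle\ (k\in\mathbb Z),$$ and it induces $\sigma_n$: $[\hat\sigma_nM]=\Phi\,\sigma_n\,\Phi^{-1}[M]$ for all $M\in\mathcal C$. (d) The graded duality $\hat\psi_n=\mathrm d=\operatorname{Hom}_{\mathbb C}(-,\mathbb C)$, with $(\mathrm dM)_j=\operatorname{Hom}_{\mathbb C}(M_{-j},\mathbb C)$, is a contravariant equivalence from $\mathcal C$ to itself with $\hat\psi_n(\mathbb V_iT_i)\cong\mathbb V_iT_i$, $$\hat\psi_n\hat\psi_n\cong\mathrm{ID},\quad\hat\psi_nE\hat\psi_n\cong E,\quad\hat\psi_nF\hat\psi_n\cong F,\quad\hat\psi_nK\hat\psi_n\cong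 K^{-1},\quad\hat\psi_n\langle k\rangle\hat\psi_n\cong\langle-k\rangle\ (k\in\mathbb Z),$$ and it induces $\psi_n$: $[\hat\psi_nM]=\Phi\,\psi_n\,\Phi^{-1}[M]$ for all $M\in\mathcal C$. (e) Let $M,N\in\mathcal C$. All the spaces $\operatorname{Ext}^j_{\mathcal C}(M,N\langle-i\rangle)$ are finite dimensional; for fixed $i$ only finitely many of them are nonzero; and there is $b$ such that all of them vanish for $i>b$. The semilinear form is $$\big\langle\Phi^{-1}[M],\Phi^{-1}[N]\big\rangle=\sum_{i\in\mathbb Z}\Big(\sum_{j\ge0}(-1)^j\dim_{\mathbb C}\operatorname{Ext}^j_{\mathcal C}(M,N\langle-i\rangle)\Big)q^i,$$ where the rational function on the left is expanded at $q=\infty$, that is, as a Laurent series in $q^{-1}$. (f) The following are pairs (left adjoint, right adjoint) of functors on $\mathcal C$: $$(E,\,FK^{-1}\langle1\rangle),\quad(F,\,EK\langle1\rangle),\quad(K,K^{-1}),\quad(K^{-1},K),\quad(\langle-k\rangle,\langle k\rangle)\ (k\in\mathbb Z).$$ -/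

import Mathlib

open CategoryTheory CategoryTheory.Limits
open scoped TensorProduct LaurentPolynomial

namespace SlTwoCat

noncomputable section

/-! ## The quantum group and its representation -/

/-- The field `ℂ(q)`. -/
abbrev Cq : Type := RatFunc ℂ

/-- The indeterminate `q`. -/
def q : Cq := RatFunc.X

/-- The quantum integer `[a] = (q ^ a - q ^ (-a)) / (q - q⁻¹)`. -/
def qInt (a : ℤ) : Cq := (q ^ a - q ^ (-a)) / (q - q⁻¹)

/-- The quantum factorial `[a]! = [a] [a-1] ⋯ [1]`. -/
def qFact : ℕ → Cq
  | 0 => 1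
  | a + 1 => qInt (a + 1) * qFact a

/-- The quantum binomial coefficient `[a, b] = [a]! / ([b]! [a-b]!)`, for `0 ≤ b ≤ a`. -/
def qBinom (a b : ℕ) : Cq := qFact a / (qFact b * qFact (a - b))

theorem q_ne_zero : q ≠ 0 := RatFunc.X_ne_zero

theorem transcendental_q : Transcendental ℂ q := by
  have h : Transcendental ℂ (algebraMap (Polynomial ℂ) Cq Polynomial.X) :=
    (transcendental_algebraMap_iff (RatFunc.algebraMap_injective ℂ)).2
      (Polynomial.transcendental_X ℂ)
  rwa [RatFunc.algebraMap_X] at h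

theorem transcendental_q_inv : Transcendental ℂ q⁻¹ := fun h =>
  transcendental_q (by simpa using h.inv)

theorem q_zpow_ne_one (a : ℤ) (ha : a ≠ 0) : q ^ a ≠ 1 := by
  have key : ∀ k : ℕ, k ≠ 0 → q ^ k ≠ 1 := fun k hk h => by
    refine transcendental_q ⟨Polynomial.X ^ k - 1, ?_, by simp [h]⟩
    exact (Polynomial.monic_X_pow_sub_C (1 : ℂ) hk).ne_zero
  intro h
  rcases Int.natAbs_eq a with h' | h'
  · rw [h', zpow_natCast] at h
    exact key _ (Int.natAbs_ne_zero.2 ha) h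
  · rw [h', zpow_neg, zpow_natCast, inv_eq_one] at h
    exact key _ (Int.natAbs_ne_zero.2 ha) h

theorem q_sub_inv_ne_zero : q - q⁻¹ ≠ 0 := by
  intro h
  apply q_zpow_ne_one 2 (by norm_num)
  have h1 : q = q⁻¹ := sub_eq_zero.1 h
  have h2 : q * q = 1 := by
    nth_rewrite 2 [h1]
    exact mul_inv_cancel₀ q_ne_zero
  rw [show (2 : ℤ) = 1 + 1 by norm_num, zpow_add₀ q_ne_zero, zpow_one, h2]

theorem qInt_ne_zero {a : ℤ} (ha : a ≠ 0) : qInt a ≠ 0 := by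
  refine div_ne_zero (fun h => ?_) q_sub_inv_ne_zero
  apply q_zpow_ne_one (a + a) (by omega)
  have h1 : q ^ a = q ^ (-a) := sub_eq_zero.1 h
  rw [zpow_add₀ q_ne_zero]
  nth_rewrite 2 [h1]
  rw [← zpow_add₀ q_ne_zero]
  simp

theorem qFact_ne_zero (a : ℕ) : qFact a ≠ 0 := by
  induction a with
  | zero => exact one_ne_zero
  | succ a ih => exact mul_ne_zero (qInt_ne_zero (by omega)) ih

theorem qBinom_ne_zero (a b : ℕ) : qBinom a b ≠ 0 :=
  div_ne_zero (qFact_ne_zero a) (mul_ne_zero (qFact_ne_zero b) (qFact_ne_zero _))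

/-- The `ℂ`-linear bar involution of `ℂ(q)` which sends `q` to `q⁻¹`. -/
def bar : Cq →ₐ[ℂ] Cq :=
  RatFunc.liftAlgHom (Polynomial.aeval q⁻¹)
    (fun p hp => by
      rw [Submonoid.mem_comap, mem_nonZeroDivisors_iff_ne_zero]
      exact fun h => transcendental_q_inv ⟨p, nonZeroDivisors.ne_zero hp, h⟩)

theorem bar_q : bar q = q⁻¹ := by
  simp [bar, q, RatFunc.liftAlgHom_apply]

/-- The four generators of the quantum group. -/
inductive Gen
  | E
  | F
  | K
  | Kinv

/-- The free `ℂ(q)`-algebra on the four generators. -/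
abbrev FreeGen : Type := FreeAlgebra Cq Gen

/-- The defining relations of the quantum group. -/
inductive UqRel : FreeGen → FreeGen → Prop
  | KE : UqRel (FreeAlgebra.ι Cq Gen.K * FreeAlgebra.ι Cq Gen.E)
      (q ^ 2 • (FreeAlgebra.ι Cq Gen.E * FreeAlgebra.ι Cq Gen.K))
  | KF : UqRel (FreeAlgebra.ι Cq Gen.K * FreeAlgebra.ι Cq Gen.F)
      (q⁻¹ ^ 2 • (FreeAlgebra.ι Cq Gen.F * FreeAlgebra.ι Cq Gen.K))
  | KKinv : UqRel (FreeAlgebra.ι Cq Gen.K * FreeAlgebra.ι Cq Gen.Kinv) 1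
  | KinvK : UqRel (FreeAlgebra.ι Cq Gen.Kinv * FreeAlgebra.ι Cq Gen.K) 1
  | EF : UqRel
      (FreeAlgebra.ι Cq Gen.E * FreeAlgebra.ι Cq Gen.F -
        FreeAlgebra.ι Cq Gen.F * FreeAlgebra.ι Cq Gen.E)
      ((q - q⁻¹)⁻¹ • (FreeAlgebra.ι Cq Gen.K - FreeAlgebra.ι Cq Gen.Kinv))

/-- The quantum group `U_q(sl_2)`: the associative `ℂ(q)`-algebra generated by
`E, F, K, K⁻¹` subject to the usual relations. -/
abbrev Uq : Type := RingQuot UqRel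

/-- A generator, as an element of `U_q(sl_2)`. -/
def gen (g : Gen) : Uq := RingQuot.mkAlgHom Cq UqRel (FreeAlgebra.ι Cq g)

/-- The underlying space of the `(n+1)`-dimensional representation `V_n`: coordinates with
respect to the canonical basis `v_0, …, v_n`. -/
abbrev V (n : ℕ) : Type := Fin (n + 1) → Cq

/-- The canonical basis `v_0, …, v_n` of `V_n`. -/
def can (n : ℕ) (k : Fin (n + 1)) : V n := Pi.basisFun Cq (Fin (n + 1)) k

/-- `E v_k = [k+1] v_{k+1}`, with `v_{n+1} = 0`. -/
def actE (n : ℕ) : Module.End Cq (V n) :=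
  (Pi.basisFun Cq (Fin (n + 1))).constr Cq fun k =>
    if h : (k : ℕ) + 1 < n + 1 then qInt (k + 1) • can n ⟨k + 1, h⟩ else 0

/-- `F v_k = [n-k+1] v_{k-1}`, with `v_{-1} = 0`. -/
def actF (n : ℕ) : Module.End Cq (V n) :=
  (Pi.basisFun Cq (Fin (n + 1))).constr Cq fun k =>
    if 0 < (k : ℕ) then qInt (n - k + 1) • can n ⟨k - 1, by omega⟩ else 0

/-- `K v_k = q ^ (2k-n) v_k`. -/
def actK (n : ℕ) : Module.End Cq (V n) :=
  (Pi.basisFun Cq (Fin (n + 1))).constr Cq fun k => q ^ (2 * (k : ℤ) - n) • can n k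

/-- `K⁻¹ v_k = q ^ (-(2k-n)) v_k`. -/
def actKinv (n : ℕ) : Module.End Cq (V n) :=
  (Pi.basisFun Cq (Fin (n + 1))).constr Cq fun k => q ^ (-(2 * (k : ℤ) - n)) • can n k

theorem actE_can (n : ℕ) (k : Fin (n + 1)) : actE n (can n k) =
    if h : (k : ℕ) + 1 < n + 1 then qInt (k + 1) • can n ⟨k + 1, h⟩ else 0 :=
  Module.Basis.constr_basis _ _ _ _

theorem actF_can (n : ℕ) (k : Fin (n + 1)) : actF n (can n k) =
    if 0 < (k : ℕ) then qInt (n - k + 1) • can n ⟨k - 1, by omega⟩ else 0 :=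
  Module.Basis.constr_basis _ _ _ _

theorem actK_can (n : ℕ) (k : Fin (n + 1)) :
    actK n (can n k) = q ^ (2 * (k : ℤ) - n) • can n k :=
  Module.Basis.constr_basis _ _ _ _

theorem actKinv_can (n : ℕ) (k : Fin (n + 1)) :
    actKinv n (can n k) = q ^ (-(2 * (k : ℤ) - n)) • can n k :=
  Module.Basis.constr_basis _ _ _ _

theorem qInt_identity (a b : ℤ) :
    qInt a * qInt (b + 1) - qInt (a + 1) * qInt b = qInt (a - b) := by
  have h0 := q_ne_zero
  have h1 := q_sub_inv_ne_zero
  simp only [qInt, neg_add, sub_eq_add_neg a b, neg_neg, zpow_add₀ h0, zpow_one,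
    zpow_neg]
  have ha : q ^ a ≠ 0 := zpow_ne_zero _ h0
  have hb : q ^ b ≠ 0 := zpow_ne_zero _ h0
  rw [div_mul_div_comm, div_mul_div_comm, ← sub_div, div_eq_div_iff (mul_ne_zero h1 h1) h1]
  field_simp
  ring

theorem V_hom_ext {n : ℕ} {f g : Module.End Cq (V n)}
    (h : ∀ k, f (can n k) = g (can n k)) : f = g :=
  (Pi.basisFun Cq (Fin (n + 1))).ext h

theorem act_rel (n : ℕ) :
    actK n * actE n = q ^ 2 • (actE n * actK n) ∧
    actK n * actF n = q⁻¹ ^ 2 • (actF n * actK n) ∧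
    actK n * actKinv n = 1 ∧ actKinv n * actK n = 1 ∧
    actE n * actF n - actF n * actE n = (q - q⁻¹)⁻¹ • (actK n - actKinv n) := by
  have h0 := q_ne_zero
  refine ⟨V_hom_ext fun k => ?_, V_hom_ext fun k => ?_, V_hom_ext fun k => ?_,
    V_hom_ext fun k => ?_, V_hom_ext fun k => ?_⟩
  · simp only [Module.End.mul_apply, LinearMap.smul_apply, actK_can, map_smul, actE_can]
    split_ifs with h
    · simp only [map_smul, actK_can, smul_smul]
      congr 1
      have : (2 * (((k : ℕ) + 1 : ℕ) : ℤ) - n) = 2 + (2 * (k : ℤ) - n) := by push_cast; ring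
      rw [this, zpow_add₀ h0, zpow_ofNat]
      ring
    · simp
  · simp only [Module.End.mul_apply, LinearMap.smul_apply, actK_can, map_smul, actF_can]
    split_ifs with h
    · simp only [map_smul, actK_can, smul_smul]
      congr 1
      have : (2 * (((k : ℕ) - 1 : ℕ) : ℤ) - n) = -2 + (2 * (k : ℤ) - n) := by
        rw [Nat.cast_sub (by omega)]; push_cast; ring
      rw [this, zpow_add₀ h0, zpow_neg, inv_pow, zpow_ofNat]
      ring
    · simp
  · simp only [Module.End.mul_apply, actK_can, actKinv_can, map_smul, smul_smul,
      ← zpow_add₀ h0, Module.End.one_apply]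
    simp
  · simp only [Module.End.mul_apply, actK_can, actKinv_can, map_smul, smul_smul,
      ← zpow_add₀ h0, Module.End.one_apply]
    simp
  · simp only [Module.End.mul_apply, LinearMap.sub_apply, LinearMap.smul_apply, actK_can,
      actKinv_can, ← sub_smul, smul_smul]
    have e1 : actE n (actF n (can n k)) = (qInt k * qInt (n - k + 1)) • can n k := by
      rw [actF_can]
      split_ifs with h
      · rw [map_smul, actE_can, dif_pos (by simp; omega), smul_smul, mul_comm]
        congr 2
        · simp only []
          rw [Nat.cast_sub (by omega)]; push_cast; ring_nf
        · ext; simp; omega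
      · have : (k : ℕ) = 0 := by omega
        simp [this, qInt]
    have e2 : actF n (actE n (can n k)) = (qInt (k + 1) * qInt (n - k)) • can n k := by
      rw [actE_can]
      split_ifs with h
      · rw [map_smul, actF_can, if_pos (by simp), smul_smul]
        congr 2
        simp only []
        push_cast; ring_nf
      · have : (k : ℕ) = n := by omega
        simp [this, qInt]
    rw [e1, e2, ← sub_smul, qInt_identity]
    rw [show (k : ℤ) - (n - k) = 2 * k - n by ring, qInt, div_eq_inv_mul]

/-- The representation of `U_q(sl_2)` on `V_n`. -/
def repV (n : ℕ) : Uq →ₐ[Cq] Module.End Cq (V n) :=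
  RingQuot.liftAlgHom Cq
    ⟨FreeAlgebra.lift Cq fun g => match g with
      | Gen.E => actE n
      | Gen.F => actF n
      | Gen.K => actK n
      | Gen.Kinv => actKinv n, by
    obtain ⟨h1, h2, h3, h4, h5⟩ := act_rel n
    intro x y h
    cases h <;> simp only [map_mul, map_sub, map_smul, map_one, FreeAlgebra.lift_ι_apply]
    exacts [h1, h2, h3, h4, h5]⟩

theorem repV_gen (n : ℕ) : repV n (gen Gen.E) = actE n ∧ repV n (gen Gen.F) = actF n ∧
    repV n (gen Gen.K) = actK n ∧ repV n (gen Gen.Kinv) = actKinv n := by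
  simp [repV, gen]

/-- The semilinear form on `V_n`, antilinear in the first and linear in the second variable,
with `⟨v_k, v_l⟩ = δ_{k,l} q ^ (k (n-k)) [n, k]`. -/
def form (n : ℕ) (x y : V n) : Cq :=
  ∑ k : Fin (n + 1), bar (x k) * y k * (q ^ ((k : ℕ) * (n - k)) * qBinom n k)

/-- The dual canonical basis `v^0, …, v^n`: it satisfies `v_k = [n, k] v^k`. -/
def dualCan (n : ℕ) (k : Fin (n + 1)) : V n := (qBinom n k)⁻¹ • can n k

/-- The dual canonical basis is characterised by `⟨v_l, v^k⟩ = δ_{k,l} q ^ (k (n-k))`. -/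
theorem form_can_dualCan (n : ℕ) (l k : Fin (n + 1)) :
    form n (can n l) (dualCan n k) = if k = l then q ^ ((k : ℕ) * (n - k)) else 0 := by
  have h := qBinom_ne_zero n k
  simp only [form, can, dualCan, Pi.basisFun_apply, Pi.smul_apply, smul_eq_mul]
  split_ifs with hkl
  · subst hkl
    rw [Finset.sum_eq_single k]
    · simp only [Pi.single_eq_same, map_one]
      field_simp
    · intro b _ hb
      simp [hb]
    · simp
  · refine Finset.sum_eq_zero fun b _ => ?_
    by_cases hb : b = l
    · subst hb
      simp [Ne.symm hkl]
    · simp [hb]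

/-- The `ℂ(q)`-linear involution `σ_n` of `V_n` with `σ_n v_k = v_{n-k}`. -/
def sigmaV (n : ℕ) : V n →ₗ[Cq] V n := LinearMap.funLeft Cq Cq Fin.rev

theorem sigmaV_can (n : ℕ) (k : Fin (n + 1)) : sigmaV n (can n k) = can n k.rev := by
  funext j
  simp only [sigmaV, can, LinearMap.funLeft_apply, Pi.basisFun_apply, Pi.single_apply]
  congr 1
  rw [eq_iff_iff, Fin.rev_eq_iff]

/-- The antilinear involution `ψ_n` of `V_n` with `ψ_n v_k = v_k`. -/
def psiV (n : ℕ) : V n →ₗ[ℂ] V n := LinearMap.compLeft bar.toLinearMap (Fin (n + 1))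

theorem psiV_smul_can (n : ℕ) (f : Cq) (k : Fin (n + 1)) :
    psiV n (f • can n k) = bar f • can n k := by
  funext j
  simp only [psiV, can, LinearMap.compLeft_apply, Function.comp_apply, Pi.smul_apply,
    smul_eq_mul, AlgHom.toLinearMap_apply, map_mul, Pi.basisFun_apply, Pi.single_apply]
  split_ifs <;> simp

/-- The coefficient of `q ^ i` in the expansion of a rational function at `q = ∞`, that is, as
a Laurent series in `q⁻¹`. -/
def coeffAtInfty (f : Cq) (i : ℤ) : ℂ := HahnSeries.coeff ((bar f : RatFunc ℂ) : LaurentSeries ℂ) (-i)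

/-! ## Gradings on vector spaces -/

section Grading

variable {M : Type} [AddCommGroup M] [Module ℂ M] {ℳ : ℤ → Submodule ℂ M}

theorem isInternal_of_proj (p : ℤ → M →ₗ[ℂ] M) (hsame : ∀ i, ∀ x ∈ ℳ i, p i x = x)
    (hne : ∀ i j, i ≠ j → ∀ x ∈ ℳ i, p j x = 0) (hspan : ∀ x, x ∈ ⨆ i, ℳ i) :
    DirectSum.IsInternal ℳ := by
  refine DirectSum.isInternal_submodule_of_iSupIndep_of_iSup_eq_top ?_ (eq_top_iff.2 fun x _ => hspan x)
  rw [iSupIndep_def]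
  intro i
  rw [Submodule.disjoint_def]
  intro x hx hx'
  rw [← hsame i x hx]
  have : (⨆ j, ⨆ (_ : j ≠ i), ℳ j) ≤ LinearMap.ker (p i) :=
    iSup₂_le fun j hj y hy => hne j i hj y hy
  exact this hx'

/-- The projection to the component of degree `i`. -/
def gproj (h : DirectSum.IsInternal ℳ) (i : ℤ) : M →ₗ[ℂ] M :=
  (ℳ i).subtype ∘ₗ DirectSum.component ℂ ℤ (fun i => ℳ i) i ∘ₗ
    (LinearEquiv.ofBijective (DirectSum.coeLinearMap ℳ) h).symm.toLinearMap

variable (h : DirectSum.IsInternal ℳ)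

theorem gproj_mem (i : ℤ) (x : M) : gproj h i x ∈ ℳ i := by
  simp [gproj]

theorem gproj_same {i : ℤ} {x : M} (hx : x ∈ ℳ i) : gproj h i x = x := by
  have := h.ofBijective_coeLinearMap_of_mem hx
  simp only [gproj, LinearMap.comp_apply, DirectSum.component,
    LinearEquiv.coe_coe, Submodule.subtype_apply]
  exact congrArg Subtype.val this

theorem gproj_ne {i j : ℤ} (hij : i ≠ j) {x : M} (hx : x ∈ ℳ i) : gproj h j x = 0 := by
  have := h.ofBijective_coeLinearMap_of_mem_ne hij hx
  simp only [gproj, LinearMap.comp_apply, DirectSum.component,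
    LinearEquiv.coe_coe, Submodule.subtype_apply]
  exact congrArg Subtype.val this

theorem mem_of_gproj_mem (N : Submodule ℂ M) (x : M) (hx : ∀ i, gproj h i x ∈ N) : x ∈ N := by
  classical
  obtain ⟨d, rfl⟩ := h.surjective x
  have hd : ∀ i, gproj h i (DirectSum.coeLinearMap ℳ d) = d i := fun i => by
    have := (LinearEquiv.ofBijective (DirectSum.coeLinearMap ℳ) h).symm_apply_apply d
    simp only [gproj, LinearMap.comp_apply, DirectSum.component,
      LinearEquiv.coe_coe, Submodule.subtype_apply]
    exact congrArg (fun e : DirectSum ℤ (fun i => ℳ i) => ((e i : ℳ i) : M)) this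
  change DirectSum.coeLinearMap ℳ d ∈ N
  rw [DirectSum.coeLinearMap_eq_dfinsuppSum]
  exact Submodule.dfinsuppSum_mem N d _ fun i _ => by
    rw [← hd i]; exact hx i

theorem grading_induction (h : DirectSum.IsInternal ℳ) {P : M → Prop} (zero : P 0)
    (add : ∀ x y, P x → P y → P (x + y)) (hom : ∀ i, ∀ x ∈ ℳ i, P x) (x : M) : P x := by
  have hx : x ∈ ⨆ i, ℳ i := by rw [h.submodule_iSup_eq_top]; trivial
  exact Submodule.iSup_induction ℳ (motive := P) hx hom zero add

theorem hom_ext_of_grading {N : Type} [AddCommGroup N] [Module ℂ N]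
    (h : DirectSum.IsInternal ℳ) {f g : M →ₗ[ℂ] N} (hfg : ∀ i, ∀ x ∈ ℳ i, f x = g x) : f = g :=
  LinearMap.ext fun x => grading_induction h (by simp)
    (fun x y hx hy => by simp [hx, hy]) hfg x

end Grading

/-! ## The category of finitely generated graded modules -/

section GradedModules

variable {A : Type} [CommRing A] [Algebra ℂ A]

/-- A finitely generated `ℤ`-graded module over the commutative algebra `A` with grading `𝒜`. -/
structure GrMod (𝒜 : ℤ → Submodule ℂ A) : Type 1 where
  /-- The underlying module. -/
  carrier : Type
  [addCommGroup : AddCommGroup carrier]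
  [moduleC : Module ℂ carrier]
  [module : Module A carrier]
  [tower : IsScalarTower ℂ A carrier]
  /-- The homogeneous components. -/
  deg : ℤ → Submodule ℂ carrier
  internal : DirectSum.IsInternal deg
  smul_mem : ∀ (i j : ℤ) (a : A) (m : carrier), a ∈ 𝒜 i → m ∈ deg j → a • m ∈ deg (i + j)
  finite : Module.Finite A carrier

namespace GrMod

variable {𝒜 : ℤ → Submodule ℂ A}

attribute [instance] addCommGroup moduleC module tower finite

theorem gproj_smul (M : GrMod 𝒜) {i : ℤ} {a : A} (ha : a ∈ 𝒜 i) (j : ℤ) (m : M.carrier) :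
    gproj M.internal (i + j) (a • m) = a • gproj M.internal j m := by
  have key : gproj M.internal (i + j) ∘ₗ (LinearMap.lsmul A M.carrier a).restrictScalars ℂ =
      (LinearMap.lsmul A M.carrier a).restrictScalars ℂ ∘ₗ gproj M.internal j := by
    refine hom_ext_of_grading M.internal fun k x hx => ?_
    simp only [LinearMap.comp_apply, LinearMap.restrictScalars_apply, LinearMap.lsmul_apply]
    by_cases hk : k = j
    · subst hk
      rw [gproj_same M.internal hx, gproj_same M.internal (M.smul_mem _ _ _ _ ha hx)]
    · rw [gproj_ne M.internal hk hx,
        gproj_ne M.internal (by omega) (M.smul_mem _ _ _ _ ha hx), smul_zero]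
  exact LinearMap.congr_fun key m

/-- The homomorphisms of graded modules: module homomorphisms preserving degrees. -/
def homs (M N : GrMod 𝒜) : Submodule ℂ (M.carrier →ₗ[A] N.carrier) where
  carrier := {f | ∀ (i : ℤ) (m : M.carrier), m ∈ M.deg i → f m ∈ N.deg i}
  add_mem' hf hg i m h := (N.deg i).add_mem (hf i m h) (hg i m h)
  zero_mem' i _ _ := (N.deg i).zero_mem
  smul_mem' c _ hf i m h := (N.deg i).smul_mem c (hf i m h)

instance : Category (GrMod 𝒜) where
  Hom M N := homs M N
  id M := ⟨LinearMap.id, fun _ _ h => h⟩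
  comp f g := ⟨g.1 ∘ₗ f.1, fun i m h => g.2 i _ (f.2 i m h)⟩

/-- The module homomorphism underlying a morphism of graded modules. -/
def lin {M N : GrMod 𝒜} (f : M ⟶ N) : M.carrier →ₗ[A] N.carrier := f.1

/-- Constructor for morphisms of graded modules. -/
def mkHom {M N : GrMod 𝒜} (f : M.carrier →ₗ[A] N.carrier)
    (hf : ∀ (i : ℤ) (m : M.carrier), m ∈ M.deg i → f m ∈ N.deg i) : M ⟶ N := ⟨f, hf⟩

@[simp] theorem lin_mkHom {M N : GrMod 𝒜} (f : M.carrier →ₗ[A] N.carrier) (hf) :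
    lin (mkHom (M := M) (N := N) f hf) = f := rfl

@[simp] theorem lin_id (M : GrMod 𝒜) : lin (𝟙 M) = LinearMap.id := rfl

@[simp] theorem lin_comp {M N P : GrMod 𝒜} (f : M ⟶ N) (g : N ⟶ P) :
    lin (f ≫ g) = lin g ∘ₗ lin f := rfl

theorem lin_mem {M N : GrMod 𝒜} (f : M ⟶ N) {i : ℤ} {m : M.carrier} (hm : m ∈ M.deg i) :
    lin f m ∈ N.deg i := f.2 i m hm

theorem lin_injective {M N : GrMod 𝒜} : Function.Injective (lin (M := M) (N := N)) :=
  fun _ _ h => Subtype.ext h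

theorem hom_ext {M N : GrMod 𝒜} {f g : M ⟶ N} (h : ∀ m, lin f m = lin g m) : f = g :=
  lin_injective (LinearMap.ext h)

theorem lin_gproj {M N : GrMod 𝒜} (f : M ⟶ N) (i : ℤ) (m : M.carrier) :
    lin f (gproj M.internal i m) = gproj N.internal i (lin f m) := by
  have key : (lin f).restrictScalars ℂ ∘ₗ gproj M.internal i =
      gproj N.internal i ∘ₗ (lin f).restrictScalars ℂ := by
    refine hom_ext_of_grading M.internal fun k x hx => ?_
    simp only [LinearMap.comp_apply, LinearMap.restrictScalars_apply]
    by_cases hk : k = i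
    · subst hk
      rw [gproj_same M.internal hx, gproj_same N.internal (lin_mem f hx)]
    · rw [gproj_ne M.internal hk hx, gproj_ne N.internal hk (lin_mem f hx), map_zero]
  exact LinearMap.congr_fun key m

/-! ### The linear structure -/

instance (M N : GrMod 𝒜) : AddCommGroup (M ⟶ N) := inferInstanceAs (AddCommGroup (homs M N))

instance (M N : GrMod 𝒜) : Module ℂ (M ⟶ N) := inferInstanceAs (Module ℂ (homs M N))

@[simp] theorem lin_add {M N : GrMod 𝒜} (f g : M ⟶ N) : lin (f + g) = lin f + lin g := rfl

@[simp] theorem lin_zero {M N : GrMod 𝒜} : lin (0 : M ⟶ N) = 0 := rfl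

@[simp] theorem lin_smul {M N : GrMod 𝒜} (c : ℂ) (f : M ⟶ N) : lin (c • f) = c • lin f := rfl

instance : Preadditive (GrMod 𝒜) where
  add_comp _ _ _ f f' g := hom_ext fun m => by simp
  comp_add _ _ _ f g g' := hom_ext fun m => by simp

theorem map_smulC {M N : GrMod 𝒜} (f : M ⟶ N) (c : ℂ) (m : M.carrier) :
    lin f (c • m) = c • lin f m := ((lin f).restrictScalars ℂ).map_smul c m

instance : Linear ℂ (GrMod 𝒜) where
  smul_comp _ _ _ c f g := hom_ext fun m => by simp
  comp_smul _ _ _ f c g := hom_ext fun m => by simp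

/-! ### The abelian structure -/

/-- The zero module. -/
def zeroObj (𝒜 : ℤ → Submodule ℂ A) : GrMod 𝒜 where
  carrier := PUnit
  deg _ := ⊤
  internal := isInternal_of_proj (fun _ => 0) (fun _ _ _ => Subsingleton.elim _ _)
    (fun _ _ _ _ _ => Subsingleton.elim _ _) (fun x => by
      rw [Subsingleton.elim x 0]; exact Submodule.zero_mem _)
  smul_mem _ _ _ _ _ _ := Submodule.mem_top
  finite := inferInstance

theorem isZero_zeroObj : IsZero (zeroObj 𝒜) :=
  (IsZero.iff_id_eq_zero _).2 (hom_ext fun _ => rfl)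

instance : HasZeroObject (GrMod 𝒜) := isZero_zeroObj.hasZeroObject

/-- The direct sum of two graded modules. -/
def prodObj (M N : GrMod 𝒜) : GrMod 𝒜 where
  carrier := M.carrier × N.carrier
  deg i := (M.deg i).prod (N.deg i)
  internal := isInternal_of_proj (fun i => (gproj M.internal i).prodMap (gproj N.internal i))
    (fun i x hx => Prod.ext (gproj_same _ hx.1) (gproj_same _ hx.2))
    (fun i j hij x hx => Prod.ext (gproj_ne _ hij hx.1) (gproj_ne _ hij hx.2))
    (fun x => by
      have h1 : (x.1, (0 : N.carrier)) ∈ ⨆ i, (M.deg i).prod (N.deg i) :=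
        mem_of_gproj_mem M.internal
          ((⨆ i, (M.deg i).prod (N.deg i)).comap (LinearMap.inl ℂ M.carrier N.carrier)) x.1
          fun i => Submodule.mem_iSup_of_mem i
            ⟨gproj_mem M.internal i x.1, (N.deg i).zero_mem⟩
      have h2 : ((0 : M.carrier), x.2) ∈ ⨆ i, (M.deg i).prod (N.deg i) :=
        mem_of_gproj_mem N.internal
          ((⨆ i, (M.deg i).prod (N.deg i)).comap (LinearMap.inr ℂ M.carrier N.carrier)) x.2
          fun i => Submodule.mem_iSup_of_mem i
            ⟨(M.deg i).zero_mem, gproj_mem N.internal i x.2⟩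
      have := Submodule.add_mem _ h1 h2
      simpa using this)
  smul_mem i j a m ha hm := ⟨M.smul_mem i j a _ ha hm.1, N.smul_mem i j a _ ha hm.2⟩
  finite := inferInstance

instance : HasBinaryBiproducts (GrMod 𝒜) where
  has_binary_biproduct M N :=
    let b : BinaryBicone M N :=
      { pt := prodObj M N
        fst := mkHom (N := M) (LinearMap.fst A M.carrier N.carrier) fun _ _ h => h.1
        snd := mkHom (N := N) (LinearMap.snd A M.carrier N.carrier) fun _ _ h => h.2
        inl := mkHom (M := M) (LinearMap.inl A M.carrier N.carrier)
          fun i _ h => ⟨h, (N.deg i).zero_mem⟩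
        inr := mkHom (M := N) (LinearMap.inr A M.carrier N.carrier)
          fun i _ h => ⟨(M.deg i).zero_mem, h⟩
        inl_fst := hom_ext fun _ => rfl
        inl_snd := hom_ext fun _ => rfl
        inr_fst := hom_ext fun _ => rfl
        inr_snd := hom_ext fun _ => rfl }
    HasBinaryBiproduct.mk ⟨b, isBinaryBilimitOfTotal b (hom_ext fun m => by
      change (m.1, (0 : N.carrier)) + ((0 : M.carrier), m.2) = (m.1, m.2)
      simp)⟩

instance : HasFiniteProducts (GrMod 𝒜) :=
  hasFiniteProducts_of_has_binary_and_terminal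

/-- A homogeneous submodule of a graded module, as a graded module. -/
def subObj [Module.Finite ℂ A] (M : GrMod 𝒜) (N : Submodule A M.carrier)
    (hN : ∀ i, ∀ m ∈ N, gproj M.internal i m ∈ N) : GrMod 𝒜 where
  carrier := N
  deg i := (M.deg i).comap (N.subtype.restrictScalars ℂ)
  internal := isInternal_of_proj
    (fun i => (gproj M.internal i).restrict (p := N.restrictScalars ℂ)
      (q := N.restrictScalars ℂ) (hN i))
    (fun i x hx => Subtype.ext (gproj_same M.internal hx))
    (fun i j hij x hx => Subtype.ext (gproj_ne M.internal hij hx))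
    (fun x => by
      obtain ⟨y, hy, hyx⟩ := mem_of_gproj_mem M.internal
          ((⨆ i, (M.deg i).comap (N.subtype.restrictScalars ℂ)).map
            (N.subtype.restrictScalars ℂ)) x.1
          fun i => ⟨⟨_, hN i x.1 x.2⟩, Submodule.mem_iSup_of_mem i
            (gproj_mem M.internal i x.1), rfl⟩
      rwa [← Subtype.ext hyx])
  smul_mem i j a m ha hm := M.smul_mem i j a m.1 ha hm
  finite := by
    have : Module.Finite ℂ M.carrier := Module.Finite.trans A M.carrier
    have : Module.Finite ℂ N := inferInstanceAs (Module.Finite ℂ (N.restrictScalars ℂ))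
    exact Module.Finite.of_restrictScalars_finite ℂ A N

/-- The quotient of a graded module by a homogeneous submodule. -/
def quotObj (M : GrMod 𝒜) (N : Submodule A M.carrier)
    (hN : ∀ i, ∀ m ∈ N, gproj M.internal i m ∈ N) : GrMod 𝒜 where
  carrier := M.carrier ⧸ N
  deg i := (M.deg i).map (N.mkQ.restrictScalars ℂ)
  internal := isInternal_of_proj
    (fun i => (N.restrictScalars ℂ).mapQ (N.restrictScalars ℂ) (gproj M.internal i) (hN i))
    (by
      rintro i _ ⟨x, hx, rfl⟩
      exact congrArg N.mkQ (gproj_same M.internal hx))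
    (by
      rintro i j hij _ ⟨x, hx, rfl⟩
      exact (congrArg N.mkQ (gproj_ne M.internal hij hx)).trans (map_zero _))
    (fun x => by
      obtain ⟨x, rfl⟩ := N.mkQ_surjective x
      exact mem_of_gproj_mem M.internal
          ((⨆ i, (M.deg i).map (N.mkQ.restrictScalars ℂ)).comap (N.mkQ.restrictScalars ℂ)) x
          fun i => Submodule.mem_iSup_of_mem i ⟨_, gproj_mem M.internal i x, rfl⟩)
  smul_mem := by
    rintro i j a _ ha ⟨x, hx, rfl⟩
    exact ⟨a • x, M.smul_mem i j a x ha hx, rfl⟩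
  finite := inferInstance

theorem apply_eq_zero {M N P : GrMod 𝒜} {f : M ⟶ N} {g : N ⟶ P} (h : f ≫ g = 0)
    (m : M.carrier) : lin g (lin f m) = 0 :=
  LinearMap.congr_fun (congrArg lin h) m

section
variable [Module.Finite ℂ A]

/-- The kernel of a morphism. -/
def kerObj {M N : GrMod 𝒜} (f : M ⟶ N) : GrMod 𝒜 :=
  subObj M (LinearMap.ker (lin f)) fun i m hm => by
    rw [LinearMap.mem_ker] at hm ⊢
    rw [lin_gproj, hm, map_zero]

/-- The inclusion of the kernel. -/
def kerι {M N : GrMod 𝒜} (f : M ⟶ N) : kerObj f ⟶ M :=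
  mkHom (M := kerObj f) (LinearMap.ker (lin f)).subtype fun _ _ h => h

theorem kerι_comp {M N : GrMod 𝒜} (f : M ⟶ N) : kerι f ≫ f = 0 :=
  hom_ext fun m => m.2

/-- The universal property of the kernel. -/
def kerIsLimit {M N : GrMod 𝒜} (f : M ⟶ N) :
    IsLimit (KernelFork.ofι (kerι f) (kerι_comp f)) :=
  KernelFork.IsLimit.ofι _ _
    (fun {W} g hg => mkHom (M := W) (N := kerObj f)
      ((lin g).codRestrict (LinearMap.ker (lin f)) fun m => apply_eq_zero hg m)
      fun i m hm => lin_mem g hm)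
    (fun _ _ => rfl)
    (fun g hg m hm => hom_ext fun x => Subtype.ext (by subst hm; rfl))

instance : HasKernels (GrMod 𝒜) := ⟨fun f => ⟨_, kerIsLimit f⟩⟩

end

/-- The cokernel of a morphism. -/
def cokerObj {M N : GrMod 𝒜} (f : M ⟶ N) : GrMod 𝒜 :=
  quotObj N (LinearMap.range (lin f)) fun i m hm => by
    obtain ⟨x, rfl⟩ := hm
    exact ⟨gproj M.internal i x, lin_gproj f i x⟩

/-- The projection to the cokernel. -/
def cokerπ {M N : GrMod 𝒜} (f : M ⟶ N) : N ⟶ cokerObj f :=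
  mkHom (N := cokerObj f) (LinearMap.range (lin f)).mkQ fun _ m h => ⟨m, h, rfl⟩

theorem comp_cokerπ {M N : GrMod 𝒜} (f : M ⟶ N) : f ≫ cokerπ f = 0 :=
  hom_ext fun m => (Submodule.Quotient.mk_eq_zero _).2 ⟨m, rfl⟩

/-- The universal property of the cokernel. -/
def cokerIsColimit {M N : GrMod 𝒜} (f : M ⟶ N) :
    IsColimit (CokernelCofork.ofπ (cokerπ f) (comp_cokerπ f)) :=
  CokernelCofork.IsColimit.ofπ _ _
    (fun {W} g hg => mkHom (M := cokerObj f) (N := W)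
      ((LinearMap.range (lin f)).liftQ (lin g) (by
        rintro _ ⟨x, rfl⟩
        exact LinearMap.congr_fun (congrArg lin hg) x))
      (by
        rintro i _ ⟨x, hx, rfl⟩
        exact lin_mem g hx))
    (fun _ _ => hom_ext fun _ => rfl)
    (fun g hg m hm => hom_ext fun x => by
      obtain ⟨x, rfl⟩ := (LinearMap.range (lin f)).mkQ_surjective x
      subst hm
      rfl)

instance : HasCokernels (GrMod 𝒜) := ⟨fun f => ⟨_, cokerIsColimit f⟩⟩

theorem surjective_of_epi {M N : GrMod 𝒜} (f : M ⟶ N) [Epi f] :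
    Function.Surjective (lin f) := by
  have h : cokerπ f = 0 := by
    rw [← cancel_epi f, comp_cokerπ, comp_zero]
  intro y
  exact (Submodule.Quotient.mk_eq_zero _).1 (LinearMap.congr_fun (congrArg lin h) y)

section
variable [Module.Finite ℂ A]

theorem injective_of_mono {M N : GrMod 𝒜} (f : M ⟶ N) [Mono f] :
    Function.Injective (lin f) := by
  have h : kerι f = 0 := by
    rw [← cancel_mono f, kerι_comp, zero_comp]
  rw [← LinearMap.ker_eq_bot, LinearMap.ker_eq_bot']
  intro m hm
  exact LinearMap.congr_fun (congrArg lin h) ⟨m, hm⟩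

/-- A bijective morphism has an inverse. -/
def invOfBijective {M N : GrMod 𝒜} (f : M ⟶ N) (hf : Function.Bijective (lin f)) : N ⟶ M :=
  mkHom (LinearEquiv.ofBijective (lin f) hf).symm.toLinearMap fun i n hn => by
    obtain ⟨m, rfl⟩ := hf.2 n
    have h1 : (LinearEquiv.ofBijective (lin f) hf).symm (lin f m) = m :=
      (LinearEquiv.ofBijective (lin f) hf).symm_apply_apply m
    have h2 : gproj M.internal i m = m := hf.1 (by
      rw [lin_gproj, gproj_same N.internal hn])
    rw [LinearEquiv.coe_coe, h1, ← h2]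
    exact gproj_mem M.internal i m

instance : IsNormalMonoCategory (GrMod 𝒜) where
  normalMonoOfMono {M N} f _ := by
    have hinj := injective_of_mono f
    let e := LinearEquiv.ofInjective (lin f) hinj
    refine ⟨⟨cokerObj f, cokerπ f, comp_cokerπ f, KernelFork.IsLimit.ofι _ _
      (fun {W} g hg => mkHom (M := W) (N := M)
        (e.symm.toLinearMap ∘ₗ (lin g).codRestrict (LinearMap.range (lin f)) fun w =>
          (Submodule.Quotient.mk_eq_zero _).1 (apply_eq_zero hg w)) ?_) ?_ ?_⟩⟩
    · intro i w hw
      set m := (e.symm.toLinearMap ∘ₗ (lin g).codRestrict (LinearMap.range (lin f)) fun w =>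
          (Submodule.Quotient.mk_eq_zero _).1 (apply_eq_zero hg w)) w with hm
      have h1 : lin f m = lin g w := congrArg Subtype.val (e.apply_symm_apply _)
      have h2 : gproj M.internal i m = m := hinj (by
        rw [lin_gproj, h1, gproj_same N.internal (lin_mem g hw)])
      rw [← h2]
      exact gproj_mem M.internal i m
    · intro W g hg
      exact hom_ext fun w => congrArg Subtype.val (e.apply_symm_apply _)
    · intro W g hg m hm
      rw [← cancel_mono f, hm]
      exact hom_ext fun w => (congrArg Subtype.val (e.apply_symm_apply
        ((lin g).codRestrict (LinearMap.range (lin f)) (fun w =>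
          (Submodule.Quotient.mk_eq_zero _).1 (apply_eq_zero hg w)) w))).symm

instance : IsNormalEpiCategory (GrMod 𝒜) where
  normalEpiOfEpi {M N} f _ := by
    have hsurj := surjective_of_epi f
    let e := (lin f).quotKerEquivOfSurjective hsurj
    have he : ∀ m, e.symm (lin f m) = (LinearMap.ker (lin f)).mkQ m := fun m =>
      e.symm_apply_eq.2 rfl
    refine ⟨⟨kerObj f, kerι f, kerι_comp f, CokernelCofork.IsColimit.ofπ _ _
      (fun {W} g hg => mkHom (M := N) (N := W)
        ((LinearMap.ker (lin f)).liftQ (lin g) (fun x hx =>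
          apply_eq_zero hg ⟨x, hx⟩) ∘ₗ e.symm.toLinearMap) ?_) ?_ ?_⟩⟩
    · intro i y hy
      obtain ⟨x, rfl⟩ := hsurj y
      rw [← gproj_same N.internal hy, ← lin_gproj]
      simp only [LinearMap.comp_apply, LinearEquiv.coe_coe, he, Submodule.mkQ_apply]
      exact lin_mem g (gproj_mem M.internal i x)
    · intro W g hg
      refine hom_ext fun m => ?_
      simp only [lin_comp, lin_mkHom, LinearMap.comp_apply, LinearEquiv.coe_coe, he,
        Submodule.mkQ_apply]
      rfl
    · intro W g hg m hm
      rw [← cancel_epi f, hm]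
      refine hom_ext fun m => ?_
      simp only [lin_comp, lin_mkHom, LinearMap.comp_apply, LinearEquiv.coe_coe, he,
        Submodule.mkQ_apply]
      rfl

instance : Abelian (GrMod 𝒜) where

end

/-! ### Grading shifts -/

/-- The module `M⟨k⟩` with `M⟨k⟩_i = M_{i-k}`. -/
def shiftObj (k : ℤ) (M : GrMod 𝒜) : GrMod 𝒜 where
  carrier := M.carrier
  deg i := M.deg (i - k)
  internal := isInternal_of_proj (fun i => gproj M.internal (i - k))
    (fun i x hx => gproj_same M.internal hx)
    (fun i j hij x hx => gproj_ne M.internal (by omega) hx)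
    (fun x => mem_of_gproj_mem M.internal _ x fun i =>
      Submodule.mem_iSup_of_mem (i + k) (by
        rw [add_sub_cancel_right]; exact gproj_mem M.internal i x))
  smul_mem i j a m ha hm := by
    have := M.smul_mem i (j - k) a m ha hm
    rwa [← add_sub_assoc] at this
  finite := M.finite

/-- The grading shift functor `⟨k⟩`. -/
def shift (𝒜 : ℤ → Submodule ℂ A) (k : ℤ) : GrMod 𝒜 ⥤ GrMod 𝒜 where
  obj M := shiftObj k M
  map {M N} f := mkHom (M := shiftObj k M) (N := shiftObj k N) 
      (lin (M := M) (N := N) f) fun _ _ h => lin_mem (M := M) (N := N) f h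
  map_id _ := rfl
  map_comp _ _ := rfl

/-- Graded modules are finite dimensional when the algebra is. -/
theorem finiteC [Module.Finite ℂ A] (M : GrMod 𝒜) : Module.Finite ℂ M.carrier :=
  Module.Finite.trans A M.carrier

/-! ### Induction, restriction, duality and the trivial module -/

section IndRes

variable {B : Type} [CommRing B] [Algebra ℂ B] [Algebra A B] [IsScalarTower ℂ A B]

/-- The bilinear map `(b, m) ↦ b ⊗ m`. -/
def tmulBil (M : GrMod 𝒜) : B →ₗ[ℂ] M.carrier →ₗ[ℂ] (B ⊗[A] M.carrier) :=
  LinearMap.mk₂ ℂ (fun b m => b ⊗ₜ[A] m) (fun _ _ _ => TensorProduct.add_tmul _ _ _)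
    (fun _ _ _ => rfl) (fun _ _ _ => TensorProduct.tmul_add _ _ _)
    (fun c b m => TensorProduct.tmul_smul c b m)

/-- The bilinear map `(b, m) ↦ ∑ b_i ⊗ m_j`, the sum being over `i + j = d`. -/
def indBil {ℬ : ℤ → Submodule ℂ B} (hℬ : DirectSum.IsInternal ℬ) (M : GrMod 𝒜) (d : ℤ) :
    B →ₗ[ℂ] M.carrier →ₗ[ℂ] (B ⊗[A] M.carrier) :=
  DirectSum.toModule ℂ ℤ (M.carrier →ₗ[ℂ] (B ⊗[A] M.carrier))
      (fun k => ((tmulBil M).compl₂ (gproj M.internal (d - k))) ∘ₗ (ℬ k).subtype) ∘ₗ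
    (LinearEquiv.ofBijective (DirectSum.coeLinearMap ℬ) hℬ).symm.toLinearMap

theorem indBil_apply {ℬ : ℤ → Submodule ℂ B} (hℬ : DirectSum.IsInternal ℬ) (M : GrMod 𝒜)
    (d k : ℤ) {b : B} (hb : b ∈ ℬ k) (m : M.carrier) :
    indBil hℬ M d b m = b ⊗ₜ[A] gproj M.internal (d - k) m := by
  have : (LinearEquiv.ofBijective (DirectSum.coeLinearMap ℬ) hℬ).symm b =
      DirectSum.lof ℂ ℤ (fun k => ℬ k) k ⟨b, hb⟩ := by
    rw [LinearEquiv.symm_apply_eq]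
    exact (DirectSum.coeLinearMap_lof ℬ k ⟨b, hb⟩).symm
  simp only [indBil, LinearMap.comp_apply, LinearEquiv.coe_coe, this, DirectSum.toModule_lof]
  rfl

theorem indBil_balanced (h𝒜 : DirectSum.IsInternal 𝒜) {ℬ : ℤ → Submodule ℂ B}
    (hℬ : DirectSum.IsInternal ℬ)
    (hmul : ∀ (i j : ℤ) (a : A) (b : B), a ∈ 𝒜 i → b ∈ ℬ j → a • b ∈ ℬ (i + j))
    (M : GrMod 𝒜) (d : ℤ) (a : A) (b : B) (m : M.carrier) :
    indBil hℬ M d (a • b) m = indBil hℬ M d b (a • m) := by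
  refine grading_induction h𝒜 (P := fun a => indBil hℬ M d (a • b) m =
    indBil hℬ M d b (a • m)) (by simp) (fun x y hx hy => ?_) (fun i a ha => ?_) a
  · simp only [add_smul, map_add, LinearMap.add_apply, hx, hy]
  · refine grading_induction hℬ (P := fun b => indBil hℬ M d (a • b) m =
      indBil hℬ M d b (a • m)) (by simp) (fun x y hx hy => ?_) (fun j b hb => ?_) b
    · simp only [smul_add, map_add, LinearMap.add_apply, hx, hy]
    · rw [indBil_apply hℬ M d j hb, indBil_apply hℬ M d (i + j) (hmul i j a b ha hb),
        show d - j = i + (d - (i + j)) by ring, gproj_smul M ha, TensorProduct.tmul_smul,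
        TensorProduct.smul_tmul']

/-- The projection of `B ⊗ M` to the component of degree `d`. -/
def indProj (h𝒜 : DirectSum.IsInternal 𝒜) {ℬ : ℤ → Submodule ℂ B}
    (hℬ : DirectSum.IsInternal ℬ)
    (hmul : ∀ (i j : ℤ) (a : A) (b : B), a ∈ 𝒜 i → b ∈ ℬ j → a • b ∈ ℬ (i + j))
    (M : GrMod 𝒜) (d : ℤ) : (B ⊗[A] M.carrier) →ₗ[ℂ] (B ⊗[A] M.carrier) :=
  let F : (B ⊗[A] M.carrier) →+ (B ⊗[A] M.carrier) := TensorProduct.liftAddHom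
    (AddMonoidHom.mk' (fun b => (indBil hℬ M d b).toAddMonoidHom) fun b b' => by
      ext m; simp)
    fun a b m => indBil_balanced h𝒜 hℬ hmul M d a b m
  { F with
    map_smul' := fun c t => by
      change F (c • t) = c • F t
      induction t with
      | zero => simp
      | tmul b m =>
        change indBil hℬ M d (c • b) m = c • indBil hℬ M d b m
        simp
      | add x y hx hy => rw [smul_add, map_add, hx, hy, map_add, smul_add] }

/-- The component of degree `d` of `B ⊗ M`, spanned by the `b ⊗ m` with
`deg b + deg m = d`. -/
def indDeg (ℬ : ℤ → Submodule ℂ B) (M : GrMod 𝒜) (d : ℤ) : Submodule ℂ (B ⊗[A] M.carrier) :=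
  Submodule.span ℂ
    {t | ∃ (i j : ℤ) (b : B) (m : M.carrier), i + j = d ∧ b ∈ ℬ i ∧ m ∈ M.deg j ∧
      t = b ⊗ₜ[A] m}

theorem baseChange_mem {ℬ : ℤ → Submodule ℂ B} {M N : GrMod 𝒜} (f : M ⟶ N) (d : ℤ)
    (t : B ⊗[A] M.carrier) (ht : t ∈ indDeg ℬ M d) :
    (lin f).baseChange B t ∈ indDeg ℬ N d := by
  induction ht using Submodule.span_induction with
  | zero => rw [map_zero]; exact Submodule.zero_mem _
  | add x y _ _ hx hy => rw [map_add]; exact Submodule.add_mem _ hx hy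
  | smul c x _ hx =>
    rw [LinearMap.map_smul_of_tower]; exact Submodule.smul_mem _ c hx
  | mem t ht =>
    obtain ⟨i, j, b, m, rfl, hb, hm, rfl⟩ := ht
    exact Submodule.subset_span ⟨i, j, b, lin f m, rfl, hb, lin_mem f hm, rfl⟩

/-- The induced module `B ⊗_A M` with `deg (b ⊗ m) = deg b + deg m`. -/
def indObj [GradedAlgebra 𝒜] (ℬ : ℤ → Submodule ℂ B) [GradedAlgebra ℬ]
    (hAB : ∀ (i : ℤ) (a : A), a ∈ 𝒜 i → algebraMap A B a ∈ ℬ i) (M : GrMod 𝒜) : GrMod ℬ where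
  carrier := B ⊗[A] M.carrier
  deg d := indDeg ℬ M d
  internal := by
    have hmul : ∀ (i j : ℤ) (a : A) (b : B), a ∈ 𝒜 i → b ∈ ℬ j → a • b ∈ ℬ (i + j) := by
      intro i j a b ha hb
      rw [Algebra.smul_def]
      exact SetLike.mul_mem_graded (hAB i a ha) hb
    have h𝒜 := DirectSum.Decomposition.isInternal 𝒜
    have hℬ := DirectSum.Decomposition.isInternal ℬ
    refine isInternal_of_proj (indProj h𝒜 hℬ hmul M) ?_ ?_ ?_
    · intro d t ht
      induction ht using Submodule.span_induction with
      | zero => simp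
      | add x y _ _ hx hy => rw [map_add, hx, hy]
      | smul c x _ hx => rw [map_smul, hx]
      | mem t ht =>
        obtain ⟨i, j, b, m, rfl, hb, hm, rfl⟩ := ht
        change indBil hℬ M (i + j) b m = _
        rw [indBil_apply hℬ M _ i hb, add_sub_cancel_left, gproj_same M.internal hm]
    · intro d e hde t ht
      induction ht using Submodule.span_induction with
      | zero => simp
      | add x y _ _ hx hy => rw [map_add, hx, hy, add_zero]
      | smul c x _ hx => rw [map_smul, hx, smul_zero]
      | mem t ht =>
        obtain ⟨i, j, b, m, rfl, hb, hm, rfl⟩ := ht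
        change indBil hℬ M e b m = _
        rw [indBil_apply hℬ M _ i hb, gproj_ne M.internal (by omega) hm,
          TensorProduct.tmul_zero]
    · intro t
      induction t with
      | zero => exact Submodule.zero_mem _
      | add x y hx hy => exact Submodule.add_mem _ hx hy
      | tmul b m =>
        refine grading_induction hℬ (P := fun b => b ⊗ₜ[A] m ∈ _)
          (by simp) (fun x y hx hy => ?_) (fun i b hb => ?_) b
        · rw [TensorProduct.add_tmul]
          exact Submodule.add_mem _ hx hy
        refine grading_induction M.internal (P := fun m => b ⊗ₜ[A] m ∈ _)
          (by simp) (fun x y hx hy => ?_) (fun j m hm => ?_) m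
        · rw [TensorProduct.tmul_add]
          exact Submodule.add_mem _ hx hy
        exact Submodule.mem_iSup_of_mem (i + j)
          (Submodule.subset_span ⟨i, j, b, m, rfl, hb, hm, rfl⟩)
  smul_mem := by
    intro k d b t hb ht
    induction ht using Submodule.span_induction with
    | zero => simp
    | add x y _ _ hx hy => rw [smul_add]; exact Submodule.add_mem _ hx hy
    | smul c x _ hx => rw [smul_comm]; exact Submodule.smul_mem _ c hx
    | mem t ht =>
      obtain ⟨i, j, b', m, rfl, hb', hm, rfl⟩ := ht
      exact Submodule.subset_span ⟨k + i, j, b * b', m, by ring,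
        SetLike.mul_mem_graded hb hb', hm, rfl⟩
  finite := inferInstance

/-- The induction functor `B ⊗_A -`. -/
def ind [GradedAlgebra 𝒜] (ℬ : ℤ → Submodule ℂ B) [GradedAlgebra ℬ]
    (hAB : ∀ (i : ℤ) (a : A), a ∈ 𝒜 i → algebraMap A B a ∈ ℬ i) : GrMod 𝒜 ⥤ GrMod ℬ where
  obj M := indObj ℬ hAB M
  map {M N} f := mkHom (M := indObj ℬ hAB M) (N := indObj ℬ hAB N)
    ((lin (M := M) (N := N) f).baseChange B)
    fun d t ht => baseChange_mem f d t ht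
  map_id _ := lin_injective LinearMap.baseChange_id
  map_comp f g := lin_injective (LinearMap.baseChange_comp (lin f) (lin g))

/-- The restriction of a graded `B`-module along `A → B`. -/
def resObj [Module.Finite ℂ B] {ℬ : ℤ → Submodule ℂ B} (𝒜 : ℤ → Submodule ℂ A)
    (hAB : ∀ (i : ℤ) (a : A), a ∈ 𝒜 i → algebraMap A B a ∈ ℬ i) (M : GrMod ℬ) : GrMod 𝒜 :=
  letI : Module A M.carrier := Module.compHom M.carrier (algebraMap A B)
  haveI : IsScalarTower ℂ A M.carrier := ⟨fun c a m => by
    change algebraMap A B (c • a) • m = c • (algebraMap A B a • m)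
    rw [← smul_assoc]
    exact congrArg (· • m) (map_smul (IsScalarTower.toAlgHom ℂ A B) c a)⟩
  { carrier := M.carrier
    deg := M.deg
    internal := M.internal
    smul_mem := fun i j a m ha hm => M.smul_mem i j _ m (hAB i a ha) hm
    finite := by
      have : Module.Finite ℂ M.carrier := Module.Finite.trans B M.carrier
      exact Module.Finite.of_restrictScalars_finite ℂ A M.carrier }

/-- The restriction functor along `A → B`. -/
def res [Module.Finite ℂ B] {ℬ : ℤ → Submodule ℂ B} (𝒜 : ℤ → Submodule ℂ A)
    (hAB : ∀ (i : ℤ) (a : A), a ∈ 𝒜 i → algebraMap A B a ∈ ℬ i) : GrMod ℬ ⥤ GrMod 𝒜 where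
  obj M := resObj 𝒜 hAB M
  map {M N} f := mkHom (M := resObj 𝒜 hAB M) (N := resObj 𝒜 hAB N)
    { toFun := lin (M := M) (N := N) f
      map_add' := (lin (M := M) (N := N) f).map_add
      map_smul' := fun a m => (lin (M := M) (N := N) f).map_smul (algebraMap A B a) m }
    fun _ _ h => lin_mem (M := M) (N := N) f h
  map_id _ := rfl
  map_comp _ _ := rfl

end IndRes

/-- The graded dual `dM` with `(dM)_j = Hom_ℂ(M_{-j}, ℂ)`, and `(a f)(m) = f (a m)`. -/
def dualObj [Module.Finite ℂ A] (M : GrMod 𝒜) : GrMod 𝒜 :=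
  letI : Module A (Module.Dual ℂ M.carrier) :=
    { smul := fun a f => f ∘ₗ (LinearMap.lsmul A M.carrier a).restrictScalars ℂ
      one_smul := fun f => LinearMap.ext fun m => congrArg f (one_smul A m)
      mul_smul := fun a b f => LinearMap.ext fun m => congrArg f (by
        rw [mul_comm]; exact mul_smul b a m)
      smul_zero := fun a => rfl
      smul_add := fun a f g => rfl
      add_smul := fun a b f => LinearMap.ext fun m =>
        (congrArg f (add_smul a b m)).trans (map_add f _ _)
      zero_smul := fun f => LinearMap.ext fun m =>
        (congrArg f (zero_smul A m)).trans (map_zero f) }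
  haveI : IsScalarTower ℂ A (Module.Dual ℂ M.carrier) := ⟨fun c a f => LinearMap.ext fun m =>
    (congrArg f (smul_assoc c a m)).trans (map_smul f c _)⟩
  haveI : Module.Finite ℂ M.carrier := Module.Finite.trans A M.carrier
  { carrier := Module.Dual ℂ M.carrier
    deg := fun j =>
      { carrier := {f | ∀ k, k ≠ -j → ∀ m ∈ M.deg k, f m = 0}
        add_mem' := fun hf hg k hk m hm => by
          rw [LinearMap.add_apply, hf k hk m hm, hg k hk m hm, add_zero]
        zero_mem' := fun _ _ _ _ => rfl
        smul_mem' := fun c f hf k hk m hm => by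
          rw [LinearMap.smul_apply, hf k hk m hm, smul_zero] }
    internal := by
      refine isInternal_of_proj (fun j => (gproj M.internal (-j)).dualMap) ?_ ?_ ?_
      · intro j f hf
        refine hom_ext_of_grading M.internal fun k m hm => ?_
        rw [LinearMap.dualMap_apply]
        by_cases hk : k = -j
        · subst hk
          rw [gproj_same M.internal hm]
        · rw [gproj_ne M.internal hk hm, map_zero, hf k hk m hm]
      · intro i j hij f hf
        refine LinearMap.ext fun m => ?_
        rw [LinearMap.dualMap_apply]
        exact hf _ (by omega) _ (gproj_mem M.internal _ m)
      · set W : Submodule ℂ (Module.Dual ℂ M.carrier) := ⨆ i, _ with hW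
        suffices h : W = ⊤ by
          intro x
          rw [h]
          trivial
        suffices h : W.dualCoannihilator = ⊥ by
          rw [← Subspace.dualCoannihilator_dualAnnihilator_eq (W := W), h,
            Submodule.dualAnnihilator_bot]
        rw [eq_bot_iff]
        intro x hx
        refine mem_of_gproj_mem M.internal ⊥ x fun i => ?_
        rw [Submodule.mem_bot, ← Module.forall_dual_apply_eq_zero_iff ℂ]
        intro f
        rw [Submodule.mem_dualCoannihilator] at hx
        refine hx (f ∘ₗ gproj M.internal i) (Submodule.mem_iSup_of_mem (-i) ?_)
        intro k hk m hm
        rw [LinearMap.comp_apply, gproj_ne M.internal (by omega) hm, map_zero]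
    smul_mem := fun i j a f ha hf k hk m hm =>
      hf (i + k) (by omega) (a • m) (M.smul_mem i k a m ha hm)
    finite := Module.Finite.of_restrictScalars_finite ℂ A (Module.Dual ℂ M.carrier) }

/-- The graded duality, a contravariant functor. -/
def dual (𝒜 : ℤ → Submodule ℂ A) [Module.Finite ℂ A] : (GrMod 𝒜)ᵒᵖ ⥤ GrMod 𝒜 where
  obj M := dualObj M.unop
  map {M N} f := mkHom (M := dualObj M.unop) (N := dualObj N.unop)
    { toFun := ((lin f.unop).restrictScalars ℂ).dualMap
      map_add' := map_add _
      map_smul' := fun a g => LinearMap.ext fun m =>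
        congrArg (DFunLike.coe (F := Module.Dual ℂ M.unop.carrier) g)
          ((lin f.unop).map_smul a m).symm }
    fun _ _ hg k hk _ hm => hg k hk _ (lin_mem f.unop hm)
  map_id _ := rfl
  map_comp _ _ := rfl

/-- The trivial module `ℂ`, concentrated in degree `0`, on which `A` acts through an
augmentation which vanishes in nonzero degrees. -/
def trivObj (𝒜 : ℤ → Submodule ℂ A) (ε : A →ₐ[ℂ] ℂ)
    (hε : ∀ (i : ℤ) (a : A), i ≠ 0 → a ∈ 𝒜 i → ε a = 0) : GrMod 𝒜 :=
  letI : Module A ℂ := Module.compHom ℂ ε.toRingHom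
  haveI : IsScalarTower ℂ A ℂ := ⟨fun c a m => by
    change ε (c • a) * m = c * (ε a * m)
    rw [map_smul, smul_eq_mul, mul_assoc]⟩
  { carrier := ℂ
    deg := fun i => if i = 0 then ⊤ else ⊥
    internal := by
      refine isInternal_of_proj (fun i => if i = 0 then LinearMap.id else 0) ?_ ?_ ?_
      · intro i x hx
        by_cases hi : i = 0
        · simp [hi]
        · simp only [hi, if_false] at hx ⊢
          exact ((Submodule.mem_bot ℂ).1 hx).symm
      · intro i j hij x hx
        by_cases hj : j = 0
        · have hi : i ≠ 0 := by omega
          simp only [hi, if_false] at hx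
          rw [(Submodule.mem_bot ℂ).1 hx, map_zero]
        · simp [hj]
      · intro x
        exact Submodule.mem_iSup_of_mem 0 (by simp)
    smul_mem := by
      intro i j a m ha hm
      by_cases hj : j = 0
      · by_cases hi : i = 0
        · simp [hi, hj]
        · change ε a * m ∈ _
          rw [hε i a hi ha, zero_mul]
          exact Submodule.zero_mem _
      · simp only [hj, if_false] at hm
        rw [(Submodule.mem_bot ℂ).1 hm, smul_zero]
        exact Submodule.zero_mem _
    finite := Module.Finite.of_restrictScalars_finite ℂ A ℂ }

end GrMod

end GradedModules

/-! ## Cohomology rings of partial flag varieties -/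

/-- The ideal generated by the symmetric polynomials without constant term. -/
def symIdeal (n : ℕ) : Ideal (MvPolynomial (Fin n) ℂ) :=
  Ideal.span {p | p.IsSymmetric ∧ MvPolynomial.constantCoeff p = 0}

/-- The coinvariant algebra of the symmetric group `S_n`. -/
abbrev Coinv (n : ℕ) : Type := MvPolynomial (Fin n) ℂ ⧸ symIdeal n

/-- Every variable has degree two. -/
def wt (n : ℕ) : Fin n → ℤ := fun _ => 2

/-- Polynomials of degree `d`, every variable having degree two. -/
abbrev polyDeg (n : ℕ) (d : ℤ) : Submodule ℂ (MvPolynomial (Fin n) ℂ) :=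
  MvPolynomial.weightedHomogeneousSubmodule ℂ (wt n) d

/-- The component of degree `d` of the coinvariant algebra, every variable having degree two. -/
def coinvDeg (n : ℕ) (d : ℤ) : Submodule ℂ (Coinv n) :=
  (polyDeg n d).map (Ideal.Quotient.mkₐ ℂ (symIdeal n)).toLinearMap

theorem rename_mem_symIdeal (n : ℕ) (e : Equiv.Perm (Fin n)) :
    symIdeal n ≤ (symIdeal n).comap (MvPolynomial.rename (R := ℂ) e) := by
  refine Ideal.span_le.2 fun p hp => ?_
  change MvPolynomial.rename (R := ℂ) e p ∈ symIdeal n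
  rw [hp.1 e]
  exact Ideal.subset_span hp

/-- The action of a permutation of the variables on the coinvariant algebra. -/
def permAct (n : ℕ) (e : Equiv.Perm (Fin n)) : Coinv n →ₐ[ℂ] Coinv n :=
  Ideal.quotientMapₐ (symIdeal n) (MvPolynomial.rename e) (rename_mem_symIdeal n e)

/-- The Young subgroup `W_I` of `S_n`: the permutations preserving `{1, …, i}`
for each `i ∈ I`. -/
def young (n : ℕ) (I : Set ℕ) : Set (Equiv.Perm (Fin n)) :=
  {e | ∀ i ∈ I, ∀ k : Fin n, (e k : ℕ) < i ↔ (k : ℕ) < i}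

/-- The ring `C^I`: the cohomology ring with complex coefficients of the variety of partial flags
in `ℂ^n` with dimensions in `I`, as the ring of `W_I`-invariants in the coinvariant algebra. -/
def C (n : ℕ) (I : Set ℕ) : Subalgebra ℂ (Coinv n) where
  carrier := {x | ∀ e ∈ young n I, permAct n e x = x}
  mul_mem' hx hy e he := by rw [map_mul, hx e he, hy e he]
  add_mem' hx hy e he := by rw [map_add, hx e he, hy e he]
  algebraMap_mem' c e _ := (permAct n e).commutes c

/-- The cohomological grading of `C^I`. -/
def deg (n : ℕ) (I : Set ℕ) (d : ℤ) : Submodule ℂ (C n I) :=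
  (coinvDeg n d).comap (C n I).val.toLinearMap

/-- The inclusion `C^J ⊆ C^I` for `J ⊆ I`. -/
theorem C_mono (n : ℕ) {J I : Set ℕ} (h : J ⊆ I) : C n J ≤ C n I :=
  fun _ hx e he => hx e fun i hi => he i (h hi)

theorem poly_internal (n : ℕ) : DirectSum.IsInternal (polyDeg n) :=
  letI := MvPolynomial.weightedGradedAlgebra ℂ (wt n)
  DirectSum.Decomposition.isInternal (polyDeg n)

theorem gproj_mul (n : ℕ) {i : ℤ} {a : MvPolynomial (Fin n) ℂ} (ha : a ∈ polyDeg n i) (j : ℤ)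
    (p : MvPolynomial (Fin n) ℂ) :
    gproj (poly_internal n) j (a * p) = a * gproj (poly_internal n) (j - i) p := by
  have key : gproj (poly_internal n) j ∘ₗ LinearMap.mulLeft ℂ a =
      LinearMap.mulLeft ℂ a ∘ₗ gproj (poly_internal n) (j - i) := by
    refine hom_ext_of_grading (poly_internal n) fun k x hx => ?_
    have hax : a * x ∈ polyDeg n (i + k) := MvPolynomial.IsWeightedHomogeneous.mul ha hx
    simp only [LinearMap.comp_apply, LinearMap.mulLeft_apply]
    by_cases hk : k = j - i
    · subst hk
      rw [add_sub_cancel] at hax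
      rw [gproj_same _ hx, gproj_same _ hax]
    · rw [gproj_ne _ hk hx, gproj_ne _ (by omega) hax, mul_zero]
  exact LinearMap.congr_fun key p

theorem rename_mem (n : ℕ) (e : Equiv.Perm (Fin n)) {d : ℤ} {p : MvPolynomial (Fin n) ℂ}
    (hp : p ∈ polyDeg n d) : MvPolynomial.rename e p ∈ polyDeg n d := by
  intro c hc
  obtain ⟨u, rfl, hu⟩ := MvPolynomial.coeff_rename_ne_zero _ _ _ hc
  rw [← hp hu, Finsupp.weight_apply, Finsupp.weight_apply,
    Finsupp.sum_mapDomain_index (by simp) (by intros; rw [add_smul])]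
  rfl

theorem rename_gproj (n : ℕ) (e : Equiv.Perm (Fin n)) (d : ℤ) (p : MvPolynomial (Fin n) ℂ) :
    MvPolynomial.rename e (gproj (poly_internal n) d p) =
      gproj (poly_internal n) d (MvPolynomial.rename e p) := by
  have key : (MvPolynomial.rename (R := ℂ) e).toLinearMap ∘ₗ gproj (poly_internal n) d =
      gproj (poly_internal n) d ∘ₗ (MvPolynomial.rename e).toLinearMap := by
    refine hom_ext_of_grading (poly_internal n) fun k x hx => ?_
    simp only [LinearMap.comp_apply, AlgHom.toLinearMap_apply]
    by_cases hk : k = d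
    · subst hk
      rw [gproj_same _ hx, gproj_same _ (rename_mem n e hx)]
    · rw [gproj_ne _ hk hx, gproj_ne _ hk (rename_mem n e hx), map_zero]
  exact LinearMap.congr_fun key p

theorem constantCoeff_of_mem (n : ℕ) {d : ℤ} (hd : d ≠ 0) {p : MvPolynomial (Fin n) ℂ}
    (hp : p ∈ polyDeg n d) : MvPolynomial.constantCoeff p = 0 := by
  by_contra h
  have := hp (d := 0) h
  rw [map_zero] at this
  exact hd this.symm

theorem constantCoeff_gproj (n : ℕ) (d : ℤ) (p : MvPolynomial (Fin n) ℂ)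
    (hp : MvPolynomial.constantCoeff p = 0) :
    MvPolynomial.constantCoeff (gproj (poly_internal n) d p) = 0 := by
  by_cases hd : d = 0
  · have key : (MvPolynomial.lcoeff ℂ (0 : Fin n →₀ ℕ)) ∘ₗ gproj (poly_internal n) d =
        MvPolynomial.lcoeff ℂ (0 : Fin n →₀ ℕ) := by
      refine hom_ext_of_grading (poly_internal n) fun k x hx => ?_
      simp only [LinearMap.comp_apply]
      by_cases hk : k = d
      · subst hk
        rw [gproj_same _ hx]
      · rw [gproj_ne _ hk hx, map_zero]
        exact (constantCoeff_of_mem n (by omega) hx).symm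
    exact (LinearMap.congr_fun key p).trans hp
  · exact constantCoeff_of_mem n hd (gproj_mem _ d p)

theorem gproj_mem_symIdeal (n : ℕ) (p : MvPolynomial (Fin n) ℂ) (hp : p ∈ symIdeal n) (d : ℤ) :
    gproj (poly_internal n) d p ∈ symIdeal n := by
  induction hp using Submodule.span_induction generalizing d with
  | zero => rw [map_zero]; exact Submodule.zero_mem _
  | add x y _ _ hx hy => rw [map_add]; exact Submodule.add_mem _ (hx d) (hy d)
  | mem p hp =>
    exact Ideal.subset_span ⟨fun e => by rw [rename_gproj, hp.1 e],
      constantCoeff_gproj n d p hp.2⟩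
  | smul a x _ hx =>
    refine grading_induction (poly_internal n)
      (P := fun a => gproj (poly_internal n) d (a • x) ∈ symIdeal n)
      (by simp) (fun a b ha hb => ?_) (fun i a ha => ?_) a
    · rw [add_smul, map_add]; exact Submodule.add_mem _ ha hb
    · rw [smul_eq_mul, gproj_mul n ha]
      exact Ideal.mul_mem_left _ _ (hx _)

theorem coinv_internal (n : ℕ) : DirectSum.IsInternal (coinvDeg n) := by
  refine isInternal_of_proj (fun d => ((symIdeal n).restrictScalars ℂ).mapQ
    ((symIdeal n).restrictScalars ℂ) (gproj (poly_internal n) d)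
    fun p hp => gproj_mem_symIdeal n p hp d) ?_ ?_ ?_
  · rintro d _ ⟨x, hx, rfl⟩
    exact congrArg (Ideal.Quotient.mk (symIdeal n)) (gproj_same _ hx)
  · rintro i j hij _ ⟨x, hx, rfl⟩
    exact (congrArg (Ideal.Quotient.mk (symIdeal n)) (gproj_ne _ hij hx)).trans (map_zero _)
  · intro x
    obtain ⟨x, rfl⟩ := Ideal.Quotient.mk_surjective x
    exact mem_of_gproj_mem (poly_internal n) ((⨆ i, coinvDeg n i).comap
        (Ideal.Quotient.mkₐ ℂ (symIdeal n)).toLinearMap) x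
      fun i => Submodule.mem_iSup_of_mem i ⟨_, gproj_mem _ i x, rfl⟩

theorem permAct_mem (n : ℕ) (e : Equiv.Perm (Fin n)) {d : ℤ} {x : Coinv n}
    (hx : x ∈ coinvDeg n d) : permAct n e x ∈ coinvDeg n d := by
  obtain ⟨p, hp, rfl⟩ := hx
  exact ⟨_, rename_mem n e hp, rfl⟩

theorem permAct_gproj (n : ℕ) (e : Equiv.Perm (Fin n)) (d : ℤ) (x : Coinv n) :
    permAct n e (gproj (coinv_internal n) d x) = gproj (coinv_internal n) d (permAct n e x) := by
  have key : (permAct n e).toLinearMap ∘ₗ gproj (coinv_internal n) d =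
      gproj (coinv_internal n) d ∘ₗ (permAct n e).toLinearMap := by
    refine hom_ext_of_grading (coinv_internal n) fun k x hx => ?_
    simp only [LinearMap.comp_apply, AlgHom.toLinearMap_apply]
    by_cases hk : k = d
    · subst hk
      rw [gproj_same _ hx, gproj_same _ (permAct_mem n e hx)]
    · rw [gproj_ne _ hk hx, gproj_ne _ hk (permAct_mem n e hx), map_zero]
  exact LinearMap.congr_fun key x

theorem C_internal (n : ℕ) (I : Set ℕ) : DirectSum.IsInternal (deg n I) := by
  have hC : ∀ d, ∀ x ∈ C n I, gproj (coinv_internal n) d x ∈ C n I := fun d x hx e he => by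
    rw [permAct_gproj, hx e he]
  refine isInternal_of_proj (fun d => (gproj (coinv_internal n) d).restrict
      (p := Subalgebra.toSubmodule (C n I)) (q := Subalgebra.toSubmodule (C n I)) (hC d)) ?_ ?_ ?_
  · exact fun d x hx => Subtype.ext (gproj_same (coinv_internal n) hx)
  · exact fun i j hij x hx => Subtype.ext (gproj_ne (coinv_internal n) hij hx)
  · intro x
    obtain ⟨y, hy, hyx⟩ := mem_of_gproj_mem (coinv_internal n)
      ((⨆ i, deg n I i).map (C n I).val.toLinearMap) x.1
      fun i => ⟨⟨_, hC i x.1 x.2⟩, Submodule.mem_iSup_of_mem (p := deg n I) i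
        (gproj_mem (coinv_internal n) i x.1 : _ ∈ coinvDeg n i), rfl⟩
    rwa [← Subtype.ext hyx]

instance (n : ℕ) (I : Set ℕ) : GradedAlgebra (deg n I) :=
  { (C_internal n I).chooseDecomposition with
    one_mem := ⟨1, MvPolynomial.isWeightedHomogeneous_one ℂ (wt n), rfl⟩
    mul_mem := by
      rintro i j x y ⟨a, ha, hax⟩ ⟨b, hb, hby⟩
      refine ⟨a * b, MvPolynomial.IsWeightedHomogeneous.mul ha hb, ?_⟩
      change Ideal.Quotient.mk (symIdeal n) (a * b) = x.1 * y.1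
      rw [map_mul]
      exact congrArg₂ (· * ·) hax hby }

theorem X_pow_mem (n : ℕ) (i : Fin n) : (MvPolynomial.X i : MvPolynomial (Fin n) ℂ) ^ n ∈
    symIdeal n := by
  let P : Polynomial (MvPolynomial (Fin n) ℂ) :=
    ∏ j : Fin n, (Polynomial.X - Polynomial.C (MvPolynomial.X j))
  have hP : ∀ e : Equiv.Perm (Fin n),
      P.map (MvPolynomial.rename (R := ℂ) e).toRingHom = P := fun e => by
    simp only [P, Polynomial.map_prod, Polynomial.map_sub, Polynomial.map_X, Polynomial.map_C]
    simp only [AlgHom.toRingHom_eq_coe, RingHom.coe_coe, MvPolynomial.rename_X]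
    exact Equiv.prod_comp e fun j => (Polynomial.X - Polynomial.C (MvPolynomial.X j))
  have hP0 : P.map (MvPolynomial.constantCoeff (σ := Fin n) (R := ℂ)) = Polynomial.X ^ n := by
    simp [P, Polynomial.map_prod]
  have key : P.map (Ideal.Quotient.mk (symIdeal n)) = Polynomial.X ^ n := by
    have : P.map (Ideal.Quotient.mk (symIdeal n)) =
        (P.map MvPolynomial.constantCoeff).map (algebraMap ℂ (Coinv n)) := by
      ext k
      rw [Polynomial.coeff_map, Polynomial.coeff_map, Polynomial.coeff_map]
      refine Ideal.Quotient.eq.2 (Ideal.subset_span ⟨fun e => ?_, by simp⟩)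
      rw [map_sub]
      congr 1
      · conv_rhs => rw [← hP e, Polynomial.coeff_map]
        rfl
      · exact (MvPolynomial.rename e).commutes _
    rw [this, hP0, Polynomial.map_pow, Polynomial.map_X]
  rw [← Ideal.Quotient.eq_zero_iff_mem, map_pow]
  have h1 := congrArg (Polynomial.eval (Ideal.Quotient.mk (symIdeal n) (MvPolynomial.X i))) key
  rw [Polynomial.eval_pow, Polynomial.eval_X, Polynomial.eval_map_apply] at h1
  rw [← h1, Polynomial.eval_prod, Finset.prod_eq_zero (Finset.mem_univ i) (by simp), map_zero]

instance (n : ℕ) : Module.Finite ℂ (Coinv n) := by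
  have hint : Algebra.IsIntegral ℂ (Coinv n) := by
    refine ⟨fun x => ?_⟩
    obtain ⟨p, rfl⟩ := Ideal.Quotient.mk_surjective x
    induction p using MvPolynomial.induction_on with
    | C c => exact isIntegral_algebraMap (A := Coinv n) (x := c)
    | add p q hp hq => rw [map_add]; exact hp.add hq
    | mul_X p i hp =>
      rw [map_mul]
      refine hp.mul ⟨Polynomial.X ^ n, Polynomial.monic_X_pow n, ?_⟩
      rw [Polynomial.eval₂_pow, Polynomial.eval₂_X, ← map_pow]
      exact Ideal.Quotient.eq_zero_iff_mem.2 (X_pow_mem n i)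
  exact Algebra.IsIntegral.finite

instance (n : ℕ) (I : Set ℕ) : Module.Finite ℂ (C n I) :=
  inferInstanceAs (Module.Finite ℂ (Subalgebra.toSubmodule (C n I)))

/-- The augmentation of the coinvariant algebra. -/
def coinvAug (n : ℕ) : Coinv n →ₐ[ℂ] ℂ :=
  Ideal.Quotient.liftₐ (symIdeal n) (MvPolynomial.aeval fun _ => (0 : ℂ)) fun p hp => by
    have : symIdeal n ≤ RingHom.ker (MvPolynomial.aeval (R := ℂ) fun _ : Fin n => (0 : ℂ)) :=
      Ideal.span_le.2 fun p hp => by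
        change MvPolynomial.aeval (R := ℂ) (fun _ : Fin n => (0 : ℂ)) p = 0
        rw [MvPolynomial.aeval_zero', hp.2, map_zero]
    exact this hp

/-- The augmentation `C^I → ℂ`, with kernel the elements of positive degree. -/
def aug (n : ℕ) (I : Set ℕ) : C n I →ₐ[ℂ] ℂ := (coinvAug n).comp (C n I).val

theorem aug_eq_zero (n : ℕ) (I : Set ℕ) (d : ℤ) (a : C n I) (hd : d ≠ 0) (ha : a ∈ deg n I d) :
    aug n I a = 0 := by
  obtain ⟨p, hp, hpa⟩ := ha
  change coinvAug n a.1 = 0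
  rw [show a.1 = Ideal.Quotient.mk (symIdeal n) p from hpa.symm]
  change MvPolynomial.aeval (R := ℂ) (fun _ : Fin n => (0 : ℂ)) p = 0
  rw [MvPolynomial.aeval_zero', constantCoeff_of_mem n hd hp, map_zero]

/-! ## Finite direct sums of categories -/

section PiCat

variable {ι : Type} {D : ι → Type 1} [∀ i, Category.{0} (D i)]

instance piPreadditive [∀ i, Preadditive (D i)] : Preadditive (∀ i, D i) where
  homGroup X Y := inferInstanceAs (AddCommGroup (∀ i, X i ⟶ Y i))
  add_comp _ _ _ _ _ _ := funext fun _ => Preadditive.add_comp _ _ _ _ _ _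
  comp_add _ _ _ _ _ _ := funext fun _ => Preadditive.comp_add _ _ _ _ _ _

instance piLinear [∀ i, Preadditive (D i)] [∀ i, Linear ℂ (D i)] : Linear ℂ (∀ i, D i) where
  homModule X Y := inferInstanceAs (Module ℂ (∀ i, X i ⟶ Y i))
  smul_comp _ _ _ _ _ _ := funext fun _ => Linear.smul_comp _ _ _ _ _ _
  comp_smul _ _ _ _ _ _ := funext fun _ => Linear.comp_smul _ _ _ _ _ _

variable [∀ i, Abelian (D i)]

instance : HasFiniteProducts (∀ i, D i) where
  out _ := ⟨fun _ => pi.hasLimit_of_hasLimit_comp_eval⟩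

instance : HasKernels (∀ i, D i) where
  has_limit _ := pi.hasLimit_of_hasLimit_comp_eval

instance : HasCokernels (∀ i, D i) where
  has_colimit _ := pi.hasColimit_of_hasColimit_comp_eval

theorem pi_mono {X Y : ∀ i, D i} (f : X ⟶ Y) [Mono f] (i : ι) : Mono (f i) := by
  classical
  refine Preadditive.mono_of_cancel_zero _ fun {P} g hg => ?_
  have hk : kernel.ι (f i) = 0 := by
    let Z : ∀ i, D i := fun j => kernel (f j)
    let k : Z ⟶ X := fun j => kernel.ι (f j)
    have hkf : k ≫ f = 0 ≫ f := funext fun j => by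
      rw [zero_comp]
      exact kernel.condition (f j)
    exact congrFun ((cancel_mono f).1 hkf) i
  rw [← kernel.lift_ι (f i) g hg, hk, comp_zero]

theorem pi_epi {X Y : ∀ i, D i} (f : X ⟶ Y) [Epi f] (i : ι) : Epi (f i) := by
  refine Preadditive.epi_of_cancel_zero _ fun {P} g hg => ?_
  have hk : cokernel.π (f i) = 0 := by
    let Z : ∀ i, D i := fun j => cokernel (f j)
    let k : Y ⟶ Z := fun j => cokernel.π (f j)
    have hkf : f ≫ k = f ≫ 0 := funext fun j => by
      rw [comp_zero]
      exact cokernel.condition (f j)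
    exact congrFun ((cancel_epi f).1 hkf) i
  rw [← cokernel.π_desc (f i) g hg, hk, zero_comp]

instance : IsNormalMonoCategory (∀ i, D i) where
  normalMonoOfMono {X Y} f _ := by
    have := pi_mono f
    let N : ∀ i, NormalMono (f i) := fun i => normalMonoOfMono (f i)
    exact ⟨⟨fun i => (N i).Z, fun i => (N i).g, funext fun i => (N i).w,
      KernelFork.IsLimit.ofι _ _
        (fun g hg i => (N i).isLimit.lift (KernelFork.ofι (g i) (congrFun hg i)))
        (fun g hg => funext fun i => (N i).isLimit.fac _ WalkingParallelPair.zero)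
        (fun g hg m hm => (cancel_mono f).1 (hm.trans (funext fun i =>
          ((N i).isLimit.fac (KernelFork.ofι (g i) (congrFun hg i))
            WalkingParallelPair.zero).symm)))⟩⟩

instance : IsNormalEpiCategory (∀ i, D i) where
  normalEpiOfEpi {X Y} f _ := by
    have := pi_epi f
    let N : ∀ i, NormalEpi (f i) := fun i => normalEpiOfEpi (f i)
    exact ⟨⟨fun i => (N i).W, fun i => (N i).g, funext fun i => (N i).w,
      CokernelCofork.IsColimit.ofπ _ _
        (fun g hg i => (N i).isColimit.desc (CokernelCofork.ofπ (g i) (congrFun hg i)))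
        (fun g hg => funext fun i => (N i).isColimit.fac _ WalkingParallelPair.one)
        (fun g hg m hm => (cancel_epi f).1 (hm.trans (funext fun i =>
          ((N i).isColimit.fac (CokernelCofork.ofπ (g i) (congrFun hg i))
            WalkingParallelPair.one).symm)))⟩⟩

instance piAbelian : Abelian (∀ i, D i) where

end PiCat

/-! ## The category `⨁ C^i-gmod` and its functors -/

/-- The category `C^i-gmod` of finitely generated graded modules over the cohomology ring `C^i`
of the Grassmannian of `i`-dimensional subspaces of `ℂ^n`. -/
abbrev Block (n i : ℕ) : Type 1 := GrMod (deg n {i})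

/-- The category `⨁_{i=0}^n C^i-gmod`. -/
abbrev GCat (n : ℕ) : Type 1 := ∀ i : Fin (n + 1), Block n i

/-- The projection of `⨁_{i=0}^n C^i-gmod` to its `i`-th summand. -/
abbrev proj (n : ℕ) (i : Fin (n + 1)) : GCat n ⥤ Block n i := Pi.eval _ i

/-- The functor `Res_j^{i,j} C^{i,j} ⊗_{C^i} -` from `C^i-gmod` to `C^j-gmod`. -/
def indRes (n i j : ℕ) : Block n i ⥤ Block n j :=
  letI : Algebra (C n {i}) (C n {i, j}) :=
    (Subalgebra.inclusion (C_mono n (J := {i}) (I := {i, j}) (by simp))).toAlgebra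
  letI : Algebra (C n {j}) (C n {i, j}) :=
    (Subalgebra.inclusion (C_mono n (J := {j}) (I := {i, j}) (by simp))).toAlgebra
  haveI : IsScalarTower ℂ (C n {i}) (C n {i, j}) := IsScalarTower.of_algebraMap_eq fun _ => rfl
  haveI : IsScalarTower ℂ (C n {j}) (C n {i, j}) := IsScalarTower.of_algebraMap_eq fun _ => rfl
  GrMod.ind (𝒜 := deg n {i}) (deg n {i, j}) (fun _ _ h => h) ⋙
    GrMod.res (ℬ := deg n {i, j}) (deg n {j}) (fun _ _ h => h)

/-- `E_i = Res_{i+1}^{i,i+1} C^{i,i+1} ⊗_{C^i} ⟨-n+i+1⟩`, for `0 ≤ i < n`. -/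
def Eblk (n i : ℕ) : Block n i ⥤ Block n (i + 1) :=
  indRes n i (i + 1) ⋙ GrMod.shift _ (-n + i + 1)

/-- `F_{i+1} = Res_i^{i,i+1} C^{i,i+1} ⊗_{C^{i+1}} ⟨-(i+1)+1⟩`, for `0 ≤ i < n`. -/
def Fblk (n i : ℕ) : Block n (i + 1) ⥤ Block n i :=
  indRes n (i + 1) i ⋙ GrMod.shift _ (-((i : ℤ) + 1) + 1)

/-- The functor `E = ⨁ E_i`, where `E_i` maps the `i`-th to the `(i+1)`-st summand
and `E_n = 0`. -/
def E (n : ℕ) : GCat n ⥤ GCat n :=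
  Functor.pi' fun j => match j with
    | ⟨0, _⟩ => (Functor.const _).obj (GrMod.zeroObj _)
    | ⟨i + 1, h⟩ => proj n ⟨i, Nat.lt_of_succ_lt h⟩ ⋙ Eblk n i

/-- The functor `F = ⨁ F_i`, where `F_i` maps the `i`-th to the `(i-1)`-st summand
and `F_0 = 0`. -/
def F (n : ℕ) : GCat n ⥤ GCat n :=
  Functor.pi' fun j =>
    if h : (j : ℕ) + 1 < n + 1 then proj n ⟨j + 1, h⟩ ⋙ Fblk n j
    else (Functor.const _).obj (GrMod.zeroObj _)

/-- The functor `K = ⨁ K_i` with `K_i = ⟨2i-n⟩`. -/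
def K (n : ℕ) : GCat n ⥤ GCat n := Functor.pi fun i => GrMod.shift _ (2 * (i : ℤ) - n)

/-- The functor `K⁻¹ = ⨁ K_i⁻¹` with `K_i⁻¹ = ⟨-(2i-n)⟩`. -/
def Kinv (n : ℕ) : GCat n ⥤ GCat n := Functor.pi fun i => GrMod.shift _ (-(2 * (i : ℤ) - n))

/-- The grading shift `⟨k⟩` on `⨁ C^i-gmod`. -/
def shiftC (n : ℕ) (k : ℤ) : GCat n ⥤ GCat n := Functor.pi fun _ => GrMod.shift _ k

instance (n i : ℕ) : HasFiniteBiproducts (Block n i ⥤ Block n i) :=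
  HasFiniteBiproducts.of_hasFiniteProducts

/-- The functor `⨁_{k=0}^{m-1} ID⟨m-1-2k⟩` on `C^i-gmod`. For `m = 2i-n ≥ 0` this is
`(K_i - K_i⁻¹) / (q - q⁻¹)`, and for `m = n-2i ≥ 0` it is `-(K_i - K_i⁻¹) / (q - q⁻¹)`. -/
def quantumSum (n i m : ℕ) : Block n i ⥤ Block n i :=
  ⨁ fun k : Fin m => GrMod.shift (deg n {i}) ((m : ℤ) - 1 - 2 * (k : ℤ))

/-- The simple trivial module `S_i = ℂ` of `C^i` concentrated in degree `0`. -/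
def S (n : ℕ) (i : Fin (n + 1)) : GCat n := fun j =>
  if j = i then GrMod.trivObj _ (aug n {(j : ℕ)}) (aug_eq_zero n _) else GrMod.zeroObj _

/-- The graded duality `d = Hom_ℂ(-, ℂ)` on `⨁ C^i-gmod`, a contravariant functor. -/
def dualC (n : ℕ) : (GCat n)ᵒᵖ ⥤ GCat n :=
  Functor.pi' fun i => (proj n i).op ⋙ GrMod.dual (deg n {(i : ℕ)})

/-- `P` is a projective cover of `X`: it is projective and has an essential epimorphism
to `X`. -/
def IsProjectiveCover {D : Type 1} [Category.{0} D] (P X : D) : Prop :=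
  Projective P ∧ ∃ f : P ⟶ X, Epi f ∧ ∀ (Z : D) (g : Z ⟶ P), Epi (g ≫ f) → Epi g

/-! ## The Grothendieck group -/

section Shift

variable {A : Type} [CommRing A] [Algebra ℂ A]

namespace GrMod

/-- Shifting by `0`. -/
def shiftZero (𝒜 : ℤ → Submodule ℂ A) {k : ℤ} (hk : k = 0) : shift 𝒜 k ≅ 𝟭 (GrMod 𝒜) where
  hom := { app := fun M => mkHom (M := shiftObj k M) (N := M) (LinearMap.id (M := M.carrier))
            fun i m h => by subst hk; exact (sub_zero i ▸ (h : m ∈ M.deg (i - 0))) }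
  inv := { app := fun M => mkHom (M := M) (N := shiftObj k M) (LinearMap.id (M := M.carrier))
            fun i m h => by subst hk; exact ((sub_zero i).symm ▸ h : m ∈ M.deg (i - 0)) }

/-- Composition of shifts. -/
def shiftAdd (𝒜 : ℤ → Submodule ℂ A) (k l : ℤ) : shift 𝒜 k ⋙ shift 𝒜 l ≅ shift 𝒜 (k + l) where
  hom := { app := fun M => mkHom (M := shiftObj l (shiftObj k M)) (N := shiftObj (k + l) M)
            (LinearMap.id (M := M.carrier)) fun i m h => by
              have h' : m ∈ M.deg (i - l - k) := h
              change m ∈ M.deg (i - (k + l))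
              rwa [show i - (k + l) = i - l - k by ring] }
  inv := { app := fun M => mkHom (M := shiftObj (k + l) M) (N := shiftObj l (shiftObj k M))
            (LinearMap.id (M := M.carrier)) fun i m h => by
              have h' : m ∈ M.deg (i - (k + l)) := h
              change m ∈ M.deg (i - l - k)
              rwa [show i - l - k = i - (k + l) by ring] }

end GrMod

end Shift

/-- Shifting by `0`. -/
def shiftCZero (n : ℕ) {k : ℤ} (hk : k = 0) : shiftC n k ≅ 𝟭 (GCat n) :=
  NatIso.ofComponents (fun M => Pi.isoMk fun i => (GrMod.shiftZero _ hk).app (M i))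
    fun f => funext fun i => (GrMod.shiftZero _ hk).hom.naturality (f i)

/-- Composition of shifts. -/
def shiftCAdd (n : ℕ) (k l : ℤ) : shiftC n k ⋙ shiftC n l ≅ shiftC n (k + l) :=
  NatIso.ofComponents (fun M => Pi.isoMk fun i => (GrMod.shiftAdd _ k l).app (M i))
    fun f => funext fun i => (GrMod.shiftAdd _ k l).hom.naturality (f i)

instance (n : ℕ) (k : ℤ) : (shiftC n k).IsEquivalence :=
  (CategoryTheory.Equivalence.mk (shiftC n k) (shiftC n (-k))
    (shiftCAdd n k (-k) ≪≫ shiftCZero n (add_neg_cancel k)).symm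
    (shiftCAdd n (-k) k ≪≫ shiftCZero n (neg_add_cancel k))).isEquivalence_functor

instance (n : ℕ) (k : ℤ) : (shiftC n k).Additive where
  map_add := rfl

/-- The relations `[M_2] = [M_1] + [M_3]` for all short exact sequences
`0 → M_1 → M_2 → M_3 → 0`. -/
def K0Rel (n : ℕ) : AddSubgroup (FreeAbelianGroup (GCat n)) :=
  AddSubgroup.closure {x | ∃ s : ShortComplex (GCat n), s.ShortExact ∧
    x = FreeAbelianGroup.of s.X₂ - (FreeAbelianGroup.of s.X₁ + FreeAbelianGroup.of s.X₃)}

/-- The Grothendieck group `[⨁ C^i-gmod]`. -/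
def K0 (n : ℕ) : Type 1 := FreeAbelianGroup (GCat n) ⧸ K0Rel n

instance (n : ℕ) : AddCommGroup (K0 n) := inferInstanceAs (AddCommGroup (_ ⧸ K0Rel n))

/-- The class `[M]` of an object in the Grothendieck group. -/
def K0.mk (n : ℕ) (M : GCat n) : K0 n := QuotientAddGroup.mk' (K0Rel n) (FreeAbelianGroup.of M)

theorem K0.hom_ext {n : ℕ} {P : Type*} [AddCommGroup P] {f g : K0 n →+ P}
    (h : ∀ M, f (K0.mk n M) = g (K0.mk n M)) : f = g :=
  QuotientAddGroup.addMonoidHom_ext _ (FreeAbelianGroup.lift_ext _ _ h)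

theorem K0.exact {n : ℕ} {s : ShortComplex (GCat n)} (hs : s.ShortExact) :
    K0.mk n s.X₂ = K0.mk n s.X₁ + K0.mk n s.X₃ := by
  have h : FreeAbelianGroup.of s.X₂ - (FreeAbelianGroup.of s.X₁ + FreeAbelianGroup.of s.X₃) ∈
      K0Rel n := AddSubgroup.subset_closure ⟨s, hs, rfl⟩
  have := (QuotientAddGroup.eq_zero_iff _).2 h
  exact sub_eq_zero.1 this

theorem K0.iso {n : ℕ} {M N : GCat n} (e : M ≅ N) : K0.mk n M = K0.mk n N := by
  obtain ⟨Z, hz⟩ := (inferInstance : HasZeroObject (GCat n)).zero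
  have h0 : K0.mk n Z = 0 := by
    have hs : (ShortComplex.mk (0 : Z ⟶ Z) (0 : Z ⟶ Z) (by simp)).ShortExact :=
      { exact := ShortComplex.exact_of_isZero_X₂ _ hz
        mono_f := hz.mono _
        epi_g := hz.epi _ }
    have := K0.exact hs
    simpa using this
  have hs : (ShortComplex.mk e.hom (0 : N ⟶ Z) (by simp)).ShortExact :=
    { exact := by
        rw [ShortComplex.exact_iff_epi _ rfl]
        exact inferInstanceAs (Epi e.hom)
      mono_f := inferInstanceAs (Mono e.hom)
      epi_g := hz.epi _ }
  have := K0.exact hs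
  simpa [h0] using this.symm

/-- The endomorphism `[M] ↦ [M⟨k⟩]` of the Grothendieck group. -/
def K0.shift (n : ℕ) (k : ℤ) : K0 n →+ K0 n :=
  QuotientAddGroup.lift (K0Rel n)
    (FreeAbelianGroup.lift fun M => K0.mk n ((shiftC n k).obj M)) (by
    refine (AddSubgroup.closure_le _).2 ?_
    rintro _ ⟨s, hs, rfl⟩
    have := K0.exact (hs.map_of_exact (shiftC n k))
    simp only [SetLike.mem_coe, AddMonoidHom.mem_ker, map_sub, map_add,
      FreeAbelianGroup.lift_apply_of]
    exact sub_eq_zero.2 this)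

theorem K0.shift_mk (n : ℕ) (k : ℤ) (M : GCat n) :
    K0.shift n k (K0.mk n M) = K0.mk n ((shiftC n k).obj M) :=
  FreeAbelianGroup.lift_apply_of _ _

/-- The action of `q ^ k` on the Grothendieck group. -/
def K0.shiftHom (n : ℕ) : Multiplicative ℤ →* Module.End ℤ (K0 n) where
  toFun k := (K0.shift n k.toAdd).toIntLinearMap
  map_one' := LinearMap.toAddMonoidHom_injective (K0.hom_ext fun M =>
    (K0.shift_mk n 0 M).trans (K0.iso ((shiftCZero n rfl).app M)))
  map_mul' k l := LinearMap.toAddMonoidHom_injective (K0.hom_ext fun M => by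
    change K0.shift n (k.toAdd + l.toAdd) (K0.mk n M) =
      K0.shift n k.toAdd (K0.shift n l.toAdd (K0.mk n M))
    rw [K0.shift_mk, K0.shift_mk, K0.shift_mk, add_comm k.toAdd l.toAdd]
    exact (K0.iso ((shiftCAdd n l.toAdd k.toAdd).app M)).symm)

/-- The action of `ℤ[q, q⁻¹]` on the Grothendieck group, where `q ^ k` acts as the shift
`⟨k⟩`. -/
instance (n : ℕ) : Module ℤ[T;T⁻¹] (K0 n) :=
  Module.compHom (K0 n) (AddMonoidAlgebra.lift ℤ (Module.End ℤ (K0 n)) ℤ (K0.shiftHom n)).toRingHom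

theorem K0.T_smul (n : ℕ) (k : ℤ) (M : GCat n) :
    (LaurentPolynomial.T k : ℤ[T;T⁻¹]) • K0.mk n M = K0.mk n ((shiftC n k).obj M) := by
  rw [← K0.shift_mk]
  change (AddMonoidAlgebra.lift ℤ (Module.End ℤ (K0 n)) ℤ (K0.shiftHom n)
    (AddMonoidAlgebra.single k 1)) _ = _
  rw [AddMonoidAlgebra.lift_single, one_smul]
  rfl

/-- The inclusion of `ℤ[q, q⁻¹]` in `ℂ(q)`. -/
instance laurentAlgebra : Algebra ℤ[T;T⁻¹] Cq :=
  (LaurentPolynomial.eval₂ (Int.castRingHom Cq) (Units.mk0 q q_ne_zero)).toAlgebra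

theorem algebraMap_T (k : ℤ) : algebraMap ℤ[T;T⁻¹] Cq (LaurentPolynomial.T k) = q ^ k := by
  change LaurentPolynomial.eval₂ (Int.castRingHom Cq) (Units.mk0 q q_ne_zero) _ = _
  rw [LaurentPolynomial.eval₂_T]
  simp

/-- The Grothendieck group `G = ℂ(q) ⊗_{ℤ[q, q⁻¹]} [⨁ C^i-gmod]`. -/
abbrev G (n : ℕ) : Type 1 := Cq ⊗[ℤ[T;T⁻¹]] K0 n

/-- The element `1 ⊗ [M]`. -/
def cls (n : ℕ) (M : GCat n) : G n := 1 ⊗ₜ K0.mk n M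

theorem cls_shift (n : ℕ) (k : ℤ) (M : GCat n) :
    cls n ((shiftC n k).obj M) = q ^ k • cls n M := by
  rw [cls, cls, ← K0.T_smul, ← TensorProduct.smul_tmul, TensorProduct.smul_tmul',
    Algebra.smul_def, algebraMap_T, smul_eq_mul]

/-! ## Graded extension groups -/

instance (n : ℕ) : HasExt.{1} (GCat n) := HasExt.standard _

/-- The group `Ext^j(M, N⟨-i⟩)` in the category `⨁ C^i-gmod`. -/
abbrev GrExt (n : ℕ) (M N : GCat n) (i : ℤ) (j : ℕ) : Type 1 :=
  Abelian.Ext M ((shiftC n (-i)).obj N) j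

instance (n : ℕ) (M N : GCat n) (i : ℤ) (j : ℕ) : Module ℂ (GrExt n M N i j) :=
  inferInstance

/-- The Euler characteristic `∑_j (-1)^j dim Ext^j(M, N⟨-i⟩)`. -/
def extEuler (n : ℕ) (M N : GCat n) (i : ℤ) : ℤ :=
  ∑ᶠ j : ℕ, (-1) ^ j * (Module.finrank ℂ (GrExt n M N i j) : ℤ)

end

end SlTwoCat

open SlTwoCat

open CategoryTheory CategoryTheory.Limits
open scoped TensorProduct LaurentPolynomial

namespace SlTwoCat

noncomputable section

/-! ## Invariant polynomials under Young subgroups -/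

section Invariants

variable (n : ℕ) (I : Set ℕ)

/-! Everything rests on one algebraic fact. The ring C^{k,k+1} is free over C^k and over C^{k+1},
with basis 1, x, …, x^(m-1), where x is the class of the variable with zero-based index k and m =
n-k, respectively m = k+1 (`AddsVar.exists_basis`, `powUp`, `powDown`). The invariants of a Young
subgroup are generated by the power sums over its orbits, and splitting one variable off an orbit
changes a power sum by a power of that variable; this gives spanning. Independence holds because a
polynomial of degree less than m cannot vanish at the m distinct variables of an orbit.

An extension with such a basis is a Frobenius extension, the trace being the coefficient of x^(m-1).
Hence induction is left adjoint to restriction and, up to the shift by -2(m-1), also right adjoint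
to it (`GrMod.indResAdj`, `GrMod.frobAdj`), and induction commutes with the graded duality up to the
same shift (`GrMod.dualIndIso`). The shifts in the definitions of E and F are half of these. This
yields the adjunctions of (f), the exactness of E and F and the commutation with duality in (d).
Reversing the order of the variables identifies C^i with C^{n-i} and exchanges E and F, which is
(c).

For the relation between EF and FE put A = C^{k+1}, B = C^{k,k+1}, D = C^k, B' = C^{k+1,k+2}, D' =
C^{k+2}. The two composites are tensor products with the bimodules B ⊗_D B and B' ⊗_{D'} B'. Let a
and b be the monic polynomials over A whose roots are the variables before and after the cut at k+1.
Then B ⊗_D B is the quotient of A[X,Y] by a(X) and (Y-X)b(Y), while b(Y) and (Y-X)a(X) vanish in B'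
⊗_{D'} B'. This symmetry produces a bimodule map between them (`CrossData.cross`). If B has the
larger rank over A, the map together with the upper coordinates of the product B ⊗_D B → B is
surjective, and a count of dimensions makes it bijective (`CrossData.cross_bijective`). The t-th
coordinate is homogeneous of degree -2t, whence the shifts in Q_m. In the two end blocks one of the
composites is zero and the coordinates alone suffice.

The rings C^i are nonnegatively graded with degree zero part ℂ. So every object is an iterated
extension of shifted simple objects, and the graded dimensions of the components identify the
Grothendieck group with ℤ[q,q⁻¹]^(n+1), with basis the classes of the S_i (`devissage`, `K0.equiv`).
By freeness, E and F act on characters through quantum integers. Comparing the two descriptions of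
C^{k,k+1} gives the Hilbert series q^(i(n-i)) [n,i] of C^i (`hilb`), so that the class of the
shifted free module is [n,i] times that of S_i. The induced actions of (b), (c) and (d) are then
identities between characters.

For (e), both sides are additive in M. They agree on free modules, and both vanish when M lives in
sufficiently high degrees. A shifted simple object is the quotient of a free module by a kernel
which lives in higher degrees, so a downward induction on the degree compares them on all M
(`free_devissage`, `coeffAtInfty_form`). The same covers give the finiteness and the vanishing of
the extension groups (`finite_ext`, `subsingleton_ext`). -/

/-- Polynomials invariant under the Young subgroup `W_I`. -/
def polyInv : Subalgebra ℂ (MvPolynomial (Fin n) ℂ) where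
  carrier := {p | ∀ e ∈ young n I, MvPolynomial.rename e p = p}
  mul_mem' hx hy e he := by rw [map_mul, hx e he, hy e he]
  add_mem' hx hy e he := by rw [map_add, hx e he, hy e he]
  algebraMap_mem' c e _ := (MvPolynomial.rename e).commutes c

/-- The elements of `I` which are larger than `k`; these determine the orbit of `k`. -/
def col (k : Fin n) : Set ℕ := {i | i ∈ I ∧ (k : ℕ) < i}

variable {n I}

/-- Replaces preservation of all the initial segments by preservation of a colouring; transpositions
of two indices of the same colour are then visibly in W_I. -/
theorem mem_young_iff {e : Equiv.Perm (Fin n)} :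
    e ∈ young n I ↔ ∀ k, col n I (e k) = col n I k := by
  constructor
  · intro h k
    ext i
    exact and_congr_right fun hi => h i hi k
  · intro h i hi k
    have := Set.ext_iff.1 (h k) i
    exact ⟨fun h' => (this.1 ⟨hi, h'⟩).2, fun h' => (this.2 ⟨hi, h'⟩).2⟩

theorem swap_mem_young {j k : Fin n} (h : col n I j = col n I k) :
    Equiv.swap j k ∈ young n I := by
  rw [mem_young_iff]
  intro l
  rcases Equiv.swap_apply_eq_iff.1 (rfl : Equiv.swap j k l = _) with _
  by_cases h1 : l = j
  · subst h1; rw [Equiv.swap_apply_left, h]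
  · by_cases h2 : l = k
    · subst h2; rw [Equiv.swap_apply_right, h]
    · rw [Equiv.swap_apply_of_ne_of_ne h1 h2]

theorem young_mul {e f : Equiv.Perm (Fin n)} (he : e ∈ young n I) (hf : f ∈ young n I) :
    e * f ∈ young n I := by
  rw [mem_young_iff] at *
  intro k
  rw [Equiv.Perm.mul_apply, he, hf]

theorem young_inv {e : Equiv.Perm (Fin n)} (he : e ∈ young n I) : e⁻¹ ∈ young n I := by
  rw [mem_young_iff] at *
  intro k
  have := he (e⁻¹ k)
  rw [← this]
  exact congrArg _ (e.apply_symm_apply k)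

theorem young_one : (1 : Equiv.Perm (Fin n)) ∈ young n I := mem_young_iff.2 fun _ => rfl

theorem polyInv_mono {J I : Set ℕ} (h : J ⊆ I) : polyInv n J ≤ polyInv n I :=
  fun _ hx e he => hx e fun i hi => he i (h hi)

theorem rename_mul_perm (e f : Equiv.Perm (Fin n)) (p : MvPolynomial (Fin n) ℂ) :
    MvPolynomial.rename (e * f) p = MvPolynomial.rename e (MvPolynomial.rename f p) := by
  rw [MvPolynomial.rename_rename]; rfl

variable (n I)

open Classical in
/-- The Young subgroup as a finite set. -/
def youngFinset : Finset (Equiv.Perm (Fin n)) := Finset.univ.filter fun e => e ∈ young n I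

variable {n I}

theorem mem_youngFinset {e : Equiv.Perm (Fin n)} : e ∈ youngFinset n I ↔ e ∈ young n I := by
  simp [youngFinset]

theorem card_youngFinset_ne : ((youngFinset n I).card : ℂ) ≠ 0 :=
  Nat.cast_ne_zero.2 (Finset.card_ne_zero_of_mem (mem_youngFinset.2 young_one))

variable (n I)

/-- Averaging over the Young subgroup. -/
def avg : MvPolynomial (Fin n) ℂ →ₗ[ℂ] MvPolynomial (Fin n) ℂ :=
  ((youngFinset n I).card : ℂ)⁻¹ •
    ∑ e ∈ youngFinset n I, (MvPolynomial.rename (R := ℂ) e).toLinearMap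

variable {n I}

theorem avg_apply (p : MvPolynomial (Fin n) ℂ) : avg n I p =
    ((youngFinset n I).card : ℂ)⁻¹ • ∑ e ∈ youngFinset n I, MvPolynomial.rename e p := by
  simp [avg, LinearMap.sum_apply]

theorem avg_rename {f : Equiv.Perm (Fin n)} (hf : f ∈ young n I)
    (p : MvPolynomial (Fin n) ℂ) : avg n I (MvPolynomial.rename f p) = avg n I p := by
  rw [avg_apply, avg_apply]
  congr 1
  refine Finset.sum_bij (fun e _ => e * f)
    (fun e he => mem_youngFinset.2 (young_mul (mem_youngFinset.1 he) hf))
    (fun _ _ _ _ h => mul_right_cancel h)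
    (fun e he => ⟨e * f⁻¹, mem_youngFinset.2 (young_mul (mem_youngFinset.1 he) (young_inv hf)),
      by simp⟩) (fun e _ => (rename_mul_perm e f p).symm)

theorem avg_mem (p : MvPolynomial (Fin n) ℂ) : avg n I p ∈ polyInv n I := by
  intro f hf
  rw [avg_apply, map_smul, map_sum]
  congr 1
  refine Finset.sum_bij (fun e _ => f * e)
    (fun e he => mem_youngFinset.2 (young_mul hf (mem_youngFinset.1 he)))
    (fun _ _ _ _ h => mul_left_cancel h)
    (fun e he => ⟨f⁻¹ * e, mem_youngFinset.2 (young_mul (young_inv hf) (mem_youngFinset.1 he)),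
      by simp⟩) (fun e _ => (rename_mul_perm f e p).symm)

theorem avg_mul (p : MvPolynomial (Fin n) ℂ) {g : MvPolynomial (Fin n) ℂ}
    (hg : g ∈ polyInv n I) : avg n I (g * p) = g * avg n I p := by
  rw [avg_apply, avg_apply, mul_smul_comm, Finset.mul_sum]
  congr 1
  refine Finset.sum_congr rfl fun e he => ?_
  rw [map_mul, hg e (mem_youngFinset.1 he)]

theorem avg_of_mem {g : MvPolynomial (Fin n) ℂ} (hg : g ∈ polyInv n I) : avg n I g = g := by
  rw [avg_apply, Finset.sum_congr rfl fun e he => hg e (mem_youngFinset.1 he),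
    Finset.sum_const, ← Nat.cast_smul_eq_nsmul ℂ, smul_smul, inv_mul_cancel₀ card_youngFinset_ne,
    one_smul]

variable (n I)

open Classical in
/-- The variables in the orbit of `j`. -/
def orbit (j : Fin n) : Finset (Fin n) := Finset.univ.filter fun k => col n I k = col n I j

/-- The power sum of the variables in the orbit of `j`. -/
def orbitPsum (j : Fin n) (a : ℕ) : MvPolynomial (Fin n) ℂ :=
  ∑ k ∈ orbit n I j, MvPolynomial.X k ^ a

variable {n I}

theorem mem_orbit {j k : Fin n} : k ∈ orbit n I j ↔ col n I k = col n I j := by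
  simp [orbit]

theorem young_orbit {e : Equiv.Perm (Fin n)} (he : e ∈ young n I) {j k : Fin n} :
    e k ∈ orbit n I j ↔ k ∈ orbit n I j := by
  rw [mem_orbit, mem_orbit, mem_young_iff.1 he]

theorem orbitPsum_mem (j : Fin n) (a : ℕ) : orbitPsum n I j a ∈ polyInv n I := by
  intro e he
  rw [orbitPsum, map_sum]
  simp only [map_pow, MvPolynomial.rename_X]
  exact Finset.sum_bij (fun k _ => e k) (fun k hk => (young_orbit he).2 hk)
    (fun _ _ _ _ h => e.injective h)
    (fun k hk => ⟨e⁻¹ k, (young_orbit (young_inv he)).2 hk, by simp⟩) (fun _ _ => rfl)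

variable (n I)

/-- The algebra generated by the power sums over the orbits of `W_I`. -/
def psumAlg : Subalgebra ℂ (MvPolynomial (Fin n) ℂ) :=
  Algebra.adjoin ℂ {p | ∃ j a, p = orbitPsum n I j a}

variable {n I}

/-- Induction on the number of variables in the monomial. Write it as x_j^a m' with x_j not in m'.
The product of the power sum over the orbit of j with the average of m' is the sum of the averages
of x_k^a m'. The terms with x_k not in m' are all equal to the wanted one, and the others involve
fewer variables. Dividing by the number of equal terms uses characteristic zero. -/
theorem avg_monomial_mem (r : ℕ) : ∀ m : Fin n →₀ ℕ, m.support.card ≤ r →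
    avg n I (MvPolynomial.monomial m 1) ∈ psumAlg n I := by
  classical
  induction r with
  | zero =>
    intro m hm
    have : m = 0 := by simpa using hm
    subst this
    have h1 : (MvPolynomial.monomial (0 : Fin n →₀ ℕ) (1 : ℂ)) = 1 := rfl
    rw [h1, avg_of_mem (one_mem _)]
    exact one_mem _
  | succ r ih =>
    intro m hm
    by_cases h0 : m = 0
    · exact ih m (by simp [h0])
    obtain ⟨j, hj⟩ := Finsupp.support_nonempty_iff.2 h0
    set a := m j with ha
    set m' := m.erase j with hm'
    have hmm : m = m' + Finsupp.single j a := (Finsupp.erase_add_single j m).symm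
    have hs : m'.support.card + 1 = m.support.card := by
      rw [hm', Finsupp.support_erase, Finset.card_erase_add_one hj]
    have hmon : ∀ k, MvPolynomial.monomial (m' + Finsupp.single k a) (1 : ℂ) =
        MvPolynomial.X k ^ a * MvPolynomial.monomial m' 1 := fun k => by
      rw [MvPolynomial.X_pow_eq_monomial, MvPolynomial.monomial_mul, mul_one, add_comm]
    have hj' : j ∉ m'.support := by simp [hm']
    have key : orbitPsum n I j a * avg n I (MvPolynomial.monomial m' 1) =
        ∑ k ∈ orbit n I j, avg n I (MvPolynomial.monomial (m' + Finsupp.single k a) 1) := by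
      rw [← avg_mul _ (orbitPsum_mem j a), orbitPsum, Finset.sum_mul, map_sum]
      exact Finset.sum_congr rfl fun k _ => by rw [hmon]
    have hsame : ∀ k ∈ (orbit n I j).filter (fun k => k ∉ m'.support),
        avg n I (MvPolynomial.monomial (m' + Finsupp.single k a) 1) =
          avg n I (MvPolynomial.monomial m 1) := fun k hk => by
      obtain ⟨hk1, hk2⟩ := Finset.mem_filter.1 hk
      have hsw : Equiv.swap j k ∈ young n I := swap_mem_young (mem_orbit.1 hk1).symm
      rw [← avg_rename hsw]
      congr 1
      rw [hmon, hmm, hmon, map_mul, map_pow, MvPolynomial.rename_X, Equiv.swap_apply_right,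
        MvPolynomial.rename_monomial]
      -- Neither x_j nor x_k occurs in m', so the transposition fixes it.
      suffices hm'' : Finsupp.mapDomain (Equiv.swap j k) m' = m' by rw [hm'']
      refine Finsupp.ext fun l => ?_
      rw [Finsupp.mapDomain_equiv_apply, Equiv.symm_swap]
      by_cases h1 : l = j
      · subst h1
        rw [Equiv.swap_apply_left, Finsupp.notMem_support_iff.1 hk2,
          Finsupp.notMem_support_iff.1 hj']
      · by_cases h2 : l = k
        · subst h2
          rw [Equiv.swap_apply_right, Finsupp.notMem_support_iff.1 hk2,
            Finsupp.notMem_support_iff.1 hj']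
        · rw [Equiv.swap_apply_of_ne_of_ne h1 h2]
    rw [← Finset.sum_filter_add_sum_filter_not _ (fun k => k ∉ m'.support),
      Finset.sum_congr rfl hsame, Finset.sum_const] at key
    -- The index j itself is counted, so the multiplicity is positive and can be divided out.
    have hcard : (((orbit n I j).filter (fun k => k ∉ m'.support)).card : ℂ) ≠ 0 :=
      Nat.cast_ne_zero.2 (Finset.card_ne_zero_of_mem
        (Finset.mem_filter.2 ⟨mem_orbit.2 rfl, hj'⟩))
    have h1 : orbitPsum n I j a * avg n I (MvPolynomial.monomial m' 1) ∈ psumAlg n I :=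
      mul_mem (Algebra.subset_adjoin ⟨j, a, rfl⟩) (ih m' (by omega))
    have h2 : ∑ k ∈ (orbit n I j).filter (fun k => ¬ k ∉ m'.support),
        avg n I (MvPolynomial.monomial (m' + Finsupp.single k a) 1) ∈ psumAlg n I := by
      refine sum_mem fun k hk => ih _ ?_
      have hk2 := (Finset.mem_filter.1 hk).2
      rw [not_not] at hk2
      have : (m' + Finsupp.single k a).support ⊆ m'.support := by
        refine Finsupp.support_add.trans (Finset.union_subset (Finset.Subset.refl _) ?_)
        exact Finsupp.support_single_subset.trans (Finset.singleton_subset_iff.2 hk2)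
      have := Finset.card_le_card this
      omega
    have h3 := sub_mem h1 h2
    rw [key, add_sub_cancel_right, ← Nat.cast_smul_eq_nsmul ℂ] at h3
    have h4 := (psumAlg n I).smul_mem h3
      (((orbit n I j).filter (fun k => k ∉ m'.support)).card : ℂ)⁻¹
    rwa [smul_smul, inv_mul_cancel₀ hcard, one_smul] at h4

/-- The power sums over the orbits generate the invariants of a Young subgroup. -/
theorem polyInv_le_psumAlg : polyInv n I ≤ psumAlg n I := by
  intro p hp
  rw [← avg_of_mem hp]
  clear hp
  induction p using MvPolynomial.induction_on' with
  | monomial m c =>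
    have : MvPolynomial.monomial m c = c • MvPolynomial.monomial m (1 : ℂ) := by
      rw [MvPolynomial.smul_monomial, smul_eq_mul, mul_one]
    rw [this, map_smul]
    exact Subalgebra.smul_mem _ (avg_monomial_mem _ m le_rfl) c
  | add p q hp hq => rw [map_add]; exact add_mem hp hq

/-- Averaging a lift over W_I does not change its class when the class is invariant. So invariants
of the quotient are classes of invariants. -/
theorem exists_lift (y : C n I) : ∃ p ∈ polyInv n I, Ideal.Quotient.mk (symIdeal n) p = y.1 := by
  obtain ⟨p, hp⟩ := Ideal.Quotient.mk_surjective y.1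
  refine ⟨avg n I p, avg_mem p, ?_⟩
  have h : ∀ e ∈ youngFinset n I, Ideal.Quotient.mkₐ ℂ (symIdeal n) (MvPolynomial.rename e p) =
      y.1 := fun e he => by
    have := y.2 e (mem_youngFinset.1 he)
    rw [← hp] at this ⊢
    exact this
  have h' : Ideal.Quotient.mkₐ ℂ (symIdeal n) (avg n I p) = y.1 := by
    rw [avg_apply, map_smul, map_sum, Finset.sum_congr rfl h,
      Finset.sum_const, ← Nat.cast_smul_eq_nsmul ℂ, smul_smul,
      inv_mul_cancel₀ card_youngFinset_ne, one_smul]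
  exact h'

/-- The class of an invariant polynomial. -/
def invMk : polyInv n I →ₐ[ℂ] C n I :=
  ((Ideal.Quotient.mkₐ ℂ (symIdeal n)).comp (polyInv n I).val).codRestrict (C n I)
    fun p e he => congrArg (Ideal.Quotient.mk (symIdeal n)) (p.2 e he)

theorem invMk_surjective : Function.Surjective (invMk (n := n) (I := I)) := fun y => by
  obtain ⟨p, hp, h⟩ := exists_lift y
  exact ⟨⟨p, hp⟩, Subtype.ext h⟩

end Invariants

/-! ## Adjoining one variable -/

section PowerBasis

variable {n : ℕ} {J I : Set ℕ} {j₀ : Fin n}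

open MvPolynomial in
/-- The condition that the invariants of `W_I` are generated by the invariants of `W_J`
and one variable. -/
structure AddsVar (n : ℕ) (J I : Set ℕ) (j₀ : Fin n) : Prop where
  sub : J ⊆ I
  mem : X j₀ ∈ polyInv n I
  -- The three cases occurring below: an orbit common to W_I and W_J, the orbit consisting of j₀
  -- alone, and the W_J-orbit of j₀ with j₀ removed.
  psum : ∀ j, (∀ a, orbitPsum n I j a ∈ polyInv n J) ∨ (∀ a, orbitPsum n I j a = X j₀ ^ a) ∨
    (∀ a, orbitPsum n I j a + X j₀ ^ a = orbitPsum n J j₀ a)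

/-- The product of the X - x_j over an orbit of W_J has W_J-invariant coefficients. This is the
equation of x_{j₀} over the invariants, and its degree will be the rank of the extension. -/
theorem exists_monic (n : ℕ) (J : Set ℕ) (j₀ : Fin n) :
    ∃ g : Polynomial (polyInv n J), g.Monic ∧ g.natDegree = (orbit n J j₀).card ∧
      g.map (algebraMap _ (MvPolynomial (Fin n) ℂ)) =
        ∏ j ∈ orbit n J j₀, (Polynomial.X - Polynomial.C (MvPolynomial.X j)) := by
  classical
  set P : Polynomial (MvPolynomial (Fin n) ℂ) :=
    ∏ j ∈ orbit n J j₀, (Polynomial.X - Polynomial.C (MvPolynomial.X j)) with hP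
  have hmon : P.Monic := Polynomial.monic_prod_of_monic _ _ fun j _ => Polynomial.monic_X_sub_C _
  have hlift : P ∈ Polynomial.lifts (algebraMap (polyInv n J) (MvPolynomial (Fin n) ℂ)) := by
    rw [Polynomial.lifts_iff_coeff_lifts]
    intro k
    refine ⟨⟨P.coeff k, fun e he => ?_⟩, rfl⟩
    have : P.map (MvPolynomial.rename (R := ℂ) e).toRingHom = P := by
      simp only [hP, Polynomial.map_prod, Polynomial.map_sub, Polynomial.map_X, Polynomial.map_C]
      simp only [AlgHom.toRingHom_eq_coe, RingHom.coe_coe, MvPolynomial.rename_X]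
      exact Finset.prod_bij (fun k _ => e k) (fun k hk => (young_orbit he).2 hk)
        (fun _ _ _ _ h => e.injective h)
        (fun k hk => ⟨e⁻¹ k, (young_orbit (young_inv he)).2 hk, by simp⟩) (fun _ _ => rfl)
    conv_rhs => rw [← this, Polynomial.coeff_map]
    rfl
  obtain ⟨g, hg, hdeg, hgm⟩ := Polynomial.lifts_and_natDegree_eq_and_monic hlift hmon
  refine ⟨g, hgm, ?_, hg⟩
  rw [hdeg, hP, Polynomial.natDegree_prod_of_monic _ _ fun j _ => Polynomial.monic_X_sub_C _]
  simp

/-- It suffices to treat the power sums over the orbits of W_I, and each of the three cases of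
`AddsVar.psum` only involves invariants of W_J and powers of x_{j₀}. -/
theorem AddsVar.mem_adjoin (h : AddsVar n J I j₀) {f : MvPolynomial (Fin n) ℂ}
    (hf : f ∈ polyInv n I) :
    f ∈ Algebra.adjoin (polyInv n J) {(MvPolynomial.X j₀ : MvPolynomial (Fin n) ℂ)} := by
  have hle : psumAlg n I ≤ (Algebra.adjoin (polyInv n J)
      {(MvPolynomial.X j₀ : MvPolynomial (Fin n) ℂ)}).restrictScalars ℂ := by
    refine Algebra.adjoin_le ?_
    rintro _ ⟨j, a, rfl⟩
    have hX : ∀ a : ℕ, (MvPolynomial.X j₀ : MvPolynomial (Fin n) ℂ) ^ a ∈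
        Algebra.adjoin (polyInv n J) {(MvPolynomial.X j₀ : MvPolynomial (Fin n) ℂ)} :=
      fun a => pow_mem (Algebra.subset_adjoin (Set.mem_singleton _)) a
    have hA : ∀ p ∈ polyInv n J, p ∈
        Algebra.adjoin (polyInv n J) {(MvPolynomial.X j₀ : MvPolynomial (Fin n) ℂ)} :=
      fun p hp => Subalgebra.algebraMap_mem _ (⟨p, hp⟩ : polyInv n J)
    rcases h.psum j with h1 | h1 | h1
    · exact hA _ (h1 a)
    · rw [h1]; exact hX a
    · rw [← add_sub_cancel_right (orbitPsum n I j a) (MvPolynomial.X j₀ ^ a), h1]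
      exact sub_mem (hA _ (orbitPsum_mem j₀ a)) (hX a)
  exact hle (polyInv_le_psumAlg hf)

/-- Division with remainder by the monic polynomial of `exists_monic`, of which x_{j₀} is a root. -/
theorem AddsVar.exists_coeffs (h : AddsVar n J I j₀) {f : MvPolynomial (Fin n) ℂ}
    (hf : f ∈ polyInv n I) :
    ∃ c : Fin (orbit n J j₀).card → polyInv n J, f = ∑ k, (c k).1 * MvPolynomial.X j₀ ^ (k : ℕ) := by
  obtain ⟨g, hgm, hdeg, hg⟩ := exists_monic n J j₀
  have hroot : Polynomial.aeval (MvPolynomial.X j₀ : MvPolynomial (Fin n) ℂ) g = 0 := by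
    rw [Polynomial.aeval_def, ← Polynomial.eval_map, hg, Polynomial.eval_prod]
    exact Finset.prod_eq_zero (mem_orbit.2 rfl) (by simp)
  have hf' := h.mem_adjoin hf
  rw [Algebra.adjoin_singleton_eq_range_aeval] at hf'
  obtain ⟨p, rfl⟩ := hf'
  refine ⟨fun k => (p %ₘ g).coeff k, ?_⟩
  have hlt : (p %ₘ g).degree < ((orbit n J j₀).card : ℕ) := by
    have := Polynomial.degree_modByMonic_lt p hgm
    rwa [Polynomial.degree_eq_natDegree hgm.ne_zero, hdeg] at this
  change Polynomial.aeval (MvPolynomial.X j₀ : MvPolynomial (Fin n) ℂ) p = _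
  rw [← Polynomial.aeval_modByMonic_eq_self_of_root hroot, Polynomial.aeval_def,
    Polynomial.eval₂_eq_sum_range' _ (n := (orbit n J j₀).card) (by
      by_cases h0 : p %ₘ g = 0
      · rw [h0, Polynomial.natDegree_zero]
        exact Finset.card_pos.2 ⟨j₀, mem_orbit.2 rfl⟩
      · exact (Polynomial.natDegree_lt_iff_degree_lt h0).2 hlt), Finset.sum_range]
  rfl

/-- A transposition of j₀ with another index of its orbit fixes the coefficients and moves x_{j₀}.
So a polynomial of degree less than the size of the orbit vanishes at all of its variables. -/
theorem coeffs_unique (c : Fin (orbit n J j₀).card → polyInv n J)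
    (h : ∑ k, (c k).1 * (MvPolynomial.X j₀ : MvPolynomial (Fin n) ℂ) ^ (k : ℕ) = 0) : c = 0 := by
  classical
  let p : Polynomial (MvPolynomial (Fin n) ℂ) :=
    ∑ k, Polynomial.C (c k).1 * Polynomial.X ^ (k : ℕ)
  have hcoeff : ∀ k : Fin (orbit n J j₀).card, p.coeff k = (c k).1 := fun k => by
    simp only [p, Polynomial.finsetSum_coeff, Polynomial.coeff_C_mul, Polynomial.coeff_X_pow]
    rw [Finset.sum_eq_single k]
    · simp
    · intro b _ hb
      rw [if_neg (fun h => hb (Fin.ext h.symm)), mul_zero]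
    · simp
  have hp : p = 0 := by
    refine Polynomial.eq_zero_of_degree_lt_of_eval_finset_eq_zero
      ((orbit n J j₀).map ⟨_, MvPolynomial.X_injective⟩) ?_ ?_
    · rw [Finset.card_map]
      refine lt_of_le_of_lt (Polynomial.degree_sum_le _ _) ?_
      refine (Finset.sup_lt_iff (WithBot.bot_lt_coe _)).2 fun k _ => ?_
      refine lt_of_le_of_lt (Polynomial.degree_C_mul_X_pow_le _ _) ?_
      exact_mod_cast k.2
    · intro y hy
      obtain ⟨j, hj, rfl⟩ := Finset.mem_map.1 hy
      have hsw : Equiv.swap j₀ j ∈ young n J := swap_mem_young (mem_orbit.1 hj).symm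
      have := congrArg (MvPolynomial.rename (R := ℂ) (Equiv.swap j₀ j)) h
      rw [map_zero, map_sum] at this
      simp only [map_mul, map_pow, MvPolynomial.rename_X, Equiv.swap_apply_left,
        (c _).2 _ hsw] at this
      simpa [p, Polynomial.eval_finsetSum] using this
  funext k
  refine Subtype.ext ?_
  rw [← hcoeff, hp]; rfl

theorem sym_mem_polyInv {p : MvPolynomial (Fin n) ℂ} (hp : p.IsSymmetric) : p ∈ polyInv n J :=
  fun e _ => hp e

/-- Makes the basis descend to the quotients by the symmetric polynomials. For a symmetric s, the
average of a s is s times the average of a, so the coefficients are multiplied by s, which is an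
invariant of W_J lying in the ideal. -/
theorem AddsVar.coeffs_symIdeal (h : AddsVar n J I j₀) {f : MvPolynomial (Fin n) ℂ}
    (hf : f ∈ symIdeal n) :
    ∃ c : Fin (orbit n J j₀).card → polyInv n J, (∀ k, (c k).1 ∈ symIdeal n) ∧
      avg n I f = ∑ k, (c k).1 * MvPolynomial.X j₀ ^ (k : ℕ) := by
  -- The multiplier `a` is carried along so that the induction on the span survives multiplication
  -- by ring elements.
  suffices H : ∀ a, ∃ c : Fin (orbit n J j₀).card → polyInv n J, (∀ k, (c k).1 ∈ symIdeal n) ∧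
      avg n I (a * f) = ∑ k, (c k).1 * MvPolynomial.X j₀ ^ (k : ℕ) by
    simpa using H 1
  induction hf using Submodule.span_induction with
  | zero => exact fun a => ⟨0, fun k => Ideal.zero_mem _, by simp⟩
  | add x y _ _ hx hy =>
    intro a
    obtain ⟨c, hc, hc'⟩ := hx a
    obtain ⟨d, hd, hd'⟩ := hy a
    refine ⟨c + d, fun k => Ideal.add_mem _ (hc k) (hd k), ?_⟩
    rw [mul_add, map_add, hc', hd', ← Finset.sum_add_distrib]
    exact Finset.sum_congr rfl fun k _ => (add_mul _ _ _).symm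
  | smul b x _ hx =>
    intro a
    obtain ⟨c, hc, hc'⟩ := hx (a * b)
    exact ⟨c, hc, by rw [← hc', smul_eq_mul, mul_assoc]⟩
  | mem s hs =>
    intro a
    obtain ⟨c, hc⟩ := h.exists_coeffs (avg_mem (I := I) a)
    refine ⟨fun k => ⟨s, sym_mem_polyInv hs.1⟩ * c k,
      fun k => Ideal.mul_mem_right _ _ (Ideal.subset_span hs), ?_⟩
    rw [mul_comm, avg_mul _ (sym_mem_polyInv hs.1), hc, Finset.mul_sum]
    exact Finset.sum_congr rfl fun k _ => by
      rw [← mul_assoc]; rfl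

/-- The algebra structure given by the inclusion `C^J ⊆ C^I`. -/
abbrev inclAlg (n : ℕ) {J I : Set ℕ} (h : J ⊆ I) : Algebra (C n J) (C n I) :=
  (Subalgebra.inclusion (C_mono n h)).toAlgebra

/-- The class of the variable `X j₀`. -/
def AddsVar.var (h : AddsVar n J I j₀) : C n I := invMk ⟨MvPolynomial.X j₀, h.mem⟩

/-- Spanning is inherited from the invariant polynomials. For independence, a relation lifts to a
combination of powers lying in the ideal. This combination also has coefficients in the ideal by
`AddsVar.coeffs_symIdeal`, and coefficients are unique by `coeffs_unique`, so the given ones vanish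
in C^J. -/
theorem AddsVar.exists_basis (h : AddsVar n J I j₀) : let _ := inclAlg n h.sub
    ∃ b : Module.Basis (Fin (orbit n J j₀).card) (C n J) (C n I), ∀ k, b k = h.var ^ (k : ℕ) := by
  let := inclAlg n h.sub
  have hval : ∀ c : Fin (orbit n J j₀).card → polyInv n J,
      (∑ k, invMk (c k) • h.var ^ (k : ℕ) : C n I).1 =
      Ideal.Quotient.mk (symIdeal n) (∑ k, (c k).1 * MvPolynomial.X j₀ ^ (k : ℕ)) := fun c => by
    rw [map_sum, AddSubmonoidClass.coe_finsetSum]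
    exact Finset.sum_congr rfl fun k _ => by rw [map_mul, map_pow]; rfl
  have hli : LinearIndependent (C n J) fun k : Fin (orbit n J j₀).card => h.var ^ (k : ℕ) := by
    rw [Fintype.linearIndependent_iff]
    intro g hg
    choose c hc using fun k => invMk_surjective (g k)
    have h1 : (∑ k, (c k).1 * MvPolynomial.X j₀ ^ (k : ℕ)) ∈ symIdeal n := by
      rw [← Ideal.Quotient.eq_zero_iff_mem, ← hval]
      simp only [hc, hg]; rfl
    have h2 : (∑ k, (c k).1 * MvPolynomial.X j₀ ^ (k : ℕ)) ∈ polyInv n I :=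
      sum_mem fun k _ => mul_mem (polyInv_mono h.sub (c k).2) (pow_mem h.mem _)
    obtain ⟨d, hd, hd'⟩ := h.coeffs_symIdeal h1
    rw [avg_of_mem h2] at hd'
    have h3 := coeffs_unique (c - d) (by
      rw [← sub_eq_zero.2 hd', ← Finset.sum_sub_distrib]
      exact Finset.sum_congr rfl fun k _ => sub_mul _ _ _)
    intro k
    rw [← hc, sub_eq_zero.1 h3]
    exact Subtype.ext (Ideal.Quotient.eq_zero_iff_mem.2 (hd k))
  have hsp : ⊤ ≤ Submodule.span (C n J)
      (Set.range fun k : Fin (orbit n J j₀).card => h.var ^ (k : ℕ)) := by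
    intro y _
    obtain ⟨f, hf, hfy⟩ := exists_lift y
    obtain ⟨c, hc⟩ := h.exists_coeffs hf
    have : y = ∑ k, invMk (c k) • h.var ^ (k : ℕ) := Subtype.ext (by rw [hval, ← hc, hfy])
    rw [this]
    exact Submodule.sum_mem _ fun k _ => Submodule.smul_mem _ _ (Submodule.subset_span ⟨k, rfl⟩)
  exact ⟨Module.Basis.mk hli hsp, fun k => Module.Basis.mk_apply hli hsp k⟩

end PowerBasis

end

end SlTwoCat

open CategoryTheory CategoryTheory.Limits
open scoped TensorProduct LaurentPolynomial

namespace SlTwoCat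

noncomputable section

set_option linter.unusedSectionVars false

/-! ## Isomorphisms of graded modules -/

namespace GrMod

section Basic

variable {A : Type} [CommRing A] [Algebra ℂ A] {𝒜 : ℤ → Submodule ℂ A} [Module.Finite ℂ A]

/-- A bijective morphism of graded modules is an isomorphism. -/
def isoOfBijective {M N : GrMod 𝒜} (f : M ⟶ N) (hf : Function.Bijective (lin f)) : M ≅ N where
  hom := f
  inv := invOfBijective f hf
  hom_inv_id := hom_ext fun m => (LinearEquiv.ofBijective (lin f) hf).symm_apply_apply m
  inv_hom_id := hom_ext fun m => (LinearEquiv.ofBijective (lin f) hf).apply_symm_apply m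

theorem isIso_of_bijective {M N : GrMod 𝒜} (f : M ⟶ N) (hf : Function.Bijective (lin f)) :
    IsIso f := (isoOfBijective f hf).isIso_hom

/-- A natural transformation with bijective components is an isomorphism. -/
def natIsoOfBijective {D : Type*} [Category* D] {F G : D ⥤ GrMod 𝒜} (α : F ⟶ G)
    (h : ∀ M, Function.Bijective (lin (α.app M))) : F ≅ G :=
  haveI : ∀ M, IsIso (α.app M) := fun M => isIso_of_bijective _ (h M)
  haveI := NatIso.isIso_of_isIso_app α
  asIso α

end Basic

/-! ### Induction and restriction as adjoint functors -/

section IndRes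

variable {A B : Type} [CommRing A] [Algebra ℂ A] [CommRing B] [Algebra ℂ B] [Algebra A B]
  [IsScalarTower ℂ A B] {𝒜 : ℤ → Submodule ℂ A} {ℬ : ℤ → Submodule ℂ B}

theorem indDeg_shift (M : GrMod 𝒜) (k d : ℤ) :
    indDeg ℬ (shiftObj k M) d = indDeg (B := B) ℬ M (d - k) := by
  refine congrArg (Submodule.span ℂ) (Set.ext fun t => ?_)
  constructor
  · rintro ⟨i, j, b, m, h, hb, hm, rfl⟩
    exact ⟨i, j - k, b, m, by omega, hb, hm, rfl⟩
  · rintro ⟨i, j, b, m, h, hb, hm, rfl⟩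
    refine ⟨i, j + k, b, m, by omega, hb, ?_, rfl⟩
    change m ∈ M.deg (j + k - k)
    rwa [add_sub_cancel_right]

theorem tmul_mem_indDeg {M : GrMod 𝒜} {i j d : ℤ} {b : B} {m : M.carrier} (hb : b ∈ ℬ i)
    (hm : m ∈ M.deg j) (h : i + j = d) : b ⊗ₜ[A] m ∈ indDeg ℬ M d :=
  Submodule.subset_span ⟨i, j, b, m, h, hb, hm, rfl⟩

/-- To check that an additive map on an induced module respects degrees, it suffices to consider
pure tensors. -/
theorem mem_of_indDeg {M : GrMod 𝒜} {N : Type} [AddCommGroup N] [Module ℂ N]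
    (W : Submodule ℂ N) (f : (B ⊗[A] M.carrier) →+ N)
    (hf : ∀ (c : ℂ) (t : B ⊗[A] M.carrier), f (c • t) = c • f t) {d : ℤ}
    (h : ∀ (i j : ℤ) (b : B) (m : M.carrier), i + j = d → b ∈ ℬ i → m ∈ M.deg j →
      f (b ⊗ₜ[A] m) ∈ W) {t : B ⊗[A] M.carrier} (ht : t ∈ indDeg ℬ M d) : f t ∈ W := by
  induction ht using Submodule.span_induction with
  | zero => rw [map_zero]; exact W.zero_mem
  | add x y _ _ hx hy => rw [map_add]; exact W.add_mem hx hy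
  | smul c x _ hx => rw [hf]; exact W.smul_mem c hx
  | mem t ht =>
    obtain ⟨i, j, b, m, hd, hb, hm, rfl⟩ := ht
    exact h i j b m hd hb hm

variable [GradedAlgebra 𝒜] [GradedAlgebra ℬ]
  (hAB : ∀ (i : ℤ) (a : A), a ∈ 𝒜 i → algebraMap A B a ∈ ℬ i)

/-- Induction commutes with grading shifts. -/
def shiftInd (k : ℤ) : shift 𝒜 k ⋙ ind ℬ hAB ≅ ind ℬ hAB ⋙ shift ℬ k where
  hom := { app := fun M => mkHom (M := indObj ℬ hAB (shiftObj k M))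
            (N := shiftObj k (indObj ℬ hAB M)) (LinearMap.id (M := B ⊗[A] M.carrier))
            fun i m h => (indDeg_shift (ℬ := ℬ) M k i).le h }
  inv := { app := fun M => mkHom (M := shiftObj k (indObj ℬ hAB M))
            (N := indObj ℬ hAB (shiftObj k M)) (LinearMap.id (M := B ⊗[A] M.carrier))
            fun i m h => (indDeg_shift (ℬ := ℬ) M k i).ge h }

/-- Restriction commutes with grading shifts. -/
def shiftRes [Module.Finite ℂ B] (k : ℤ) :
    shift ℬ k ⋙ res 𝒜 hAB ≅ res 𝒜 hAB ⋙ shift 𝒜 k where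
  hom := { app := fun M => 𝟙 (shiftObj k (resObj 𝒜 hAB M)) }
  inv := { app := fun M => 𝟙 (shiftObj k (resObj 𝒜 hAB M)) }

/-- The induced module, as a module over the larger algebra, acts by multiplication. -/
def resAct [Module.Finite ℂ B] (N : GrMod ℬ) :
    (B ⊗[A] (resObj 𝒜 hAB N).carrier) →ₗ[B] N.carrier :=
  letI : Module A N.carrier := (resObj 𝒜 hAB N).module
  haveI : IsScalarTower A B N.carrier := ⟨fun a b m => by
    rw [Algebra.smul_def, mul_smul]; rfl⟩
  TensorProduct.AlgebraTensorModule.lift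
    { toFun := fun b => ({
        toFun := fun m => b • m
        map_add' := smul_add b
        map_smul' := fun a m => smul_comm b (algebraMap A B a) m } : N.carrier →ₗ[A] N.carrier)
      map_add' := fun b c => LinearMap.ext fun m => add_smul b c m
      map_smul' := fun b c => LinearMap.ext fun m => mul_smul b c m }

/-- The unit of the adjunction between induction and restriction. -/
def indResUnit [Module.Finite ℂ B] (M : GrMod 𝒜) : M ⟶ resObj 𝒜 hAB (indObj ℬ hAB M) :=
  mkHom (M := M) (N := resObj 𝒜 hAB (indObj ℬ hAB M))
    { toFun := fun m => (1 : B) ⊗ₜ[A] m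
      map_add' := fun _ _ => TensorProduct.tmul_add _ _ _
      map_smul' := fun a m => by
        rw [TensorProduct.tmul_smul, ← algebraMap_smul B a]; rfl }
    fun i m hm => tmul_mem_indDeg SetLike.GradedOne.one_mem hm (zero_add i)

/-- Induction is left adjoint to restriction. -/
def indResAdj [Module.Finite ℂ B] : ind ℬ hAB ⊣ res 𝒜 hAB where
  unit := { app := fun M => indResUnit hAB M
            naturality := fun M N f => hom_ext fun m => rfl }
  counit :=
    { app := fun N => mkHom (M := indObj ℬ hAB (resObj 𝒜 hAB N)) (N := N) (resAct hAB N)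
        fun d t ht => mem_of_indDeg (M := resObj 𝒜 hAB N) (N.deg d) (resAct hAB N).toAddMonoidHom
          (fun c t => (resAct hAB N).map_smul_of_tower c t)
          (fun i j b m h hb hm => by
            rw [← h]; exact N.smul_mem i j b m hb hm) ht
      naturality := fun M N f => hom_ext fun t => by
        induction t using TensorProduct.induction_on with
        | zero => exact (map_zero _).trans (map_zero _).symm
        | add x y hx hy => exact (map_add _ x y).trans ((congrArg₂ _ hx hy).trans (map_add _ x y).symm)
        | tmul b m => exact (LinearMap.map_smul (lin f) b m).symm }
  left_triangle_components M := hom_ext fun t => by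
    induction t using TensorProduct.induction_on with
    | zero => exact (map_zero _).trans (map_zero _).symm
    | add x y hx hy => exact (map_add _ x y).trans ((congrArg₂ _ hx hy).trans (map_add _ x y).symm)
    | tmul b m => exact congrArg (· ⊗ₜ[A] m) (mul_one b)
  right_triangle_components N := hom_ext fun m => @one_smul B N.carrier _ _ m

end IndRes

end GrMod

end

end SlTwoCat

open CategoryTheory CategoryTheory.Limits
open scoped TensorProduct LaurentPolynomial

namespace SlTwoCat

noncomputable section

set_option linter.unusedSectionVars false

/-! ## Graded extensions with a basis of powers -/

section PowExt

variable {A B : Type} [CommRing A] [Algebra ℂ A] [CommRing B] [Algebra ℂ B] [Algebra A B]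
  [IsScalarTower ℂ A B]

/-- A graded extension with a basis `1, x, …, x^(m-1)`, where `x` has degree two. -/
structure PowExt (𝒜 : ℤ → Submodule ℂ A) (ℬ : ℤ → Submodule ℂ B) where
  /-- The generator. -/
  x : B
  /-- The rank. -/
  m : ℕ
  m_pos : 0 < m
  x_mem : x ∈ ℬ 2
  /-- The basis of powers. -/
  basis : Module.Basis (Fin m) A B
  basis_apply : ∀ k, basis k = x ^ (k : ℕ)

namespace PowExt

variable {𝒜 : ℤ → Submodule ℂ A} {ℬ : ℤ → Submodule ℂ B} [GradedAlgebra 𝒜] [GradedAlgebra ℬ]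
  (P : PowExt 𝒜 ℬ)

theorem pow_mem (k : ℕ) : P.x ^ k ∈ ℬ (2 * k) := by
  have := SetLike.pow_mem_graded k P.x_mem
  rwa [nsmul_eq_mul, mul_comm] at this

theorem algebraMap_mul_mem (hAB : ∀ (i : ℤ) (a : A), a ∈ 𝒜 i → algebraMap A B a ∈ ℬ i) {i j : ℤ}
    {a : A} {b : B} (ha : a ∈ 𝒜 i) (hb : b ∈ ℬ j) : a • b ∈ ℬ (i + j) := by
  rw [Algebra.smul_def]
  exact SetLike.mul_mem_graded (hAB i a ha) hb

/-- Since x^k is homogeneous of degree 2k, projecting b to degree d means projecting its k-th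
coordinate to degree d-2k; coordinates being unique, those of a homogeneous b are homogeneous. -/
theorem repr_mem (hAB : ∀ (i : ℤ) (a : A), a ∈ 𝒜 i → algebraMap A B a ∈ ℬ i) {d : ℤ} {b : B}
    (hb : b ∈ ℬ d) (k : Fin P.m) : P.basis.repr b k ∈ 𝒜 (d - 2 * (k : ℤ)) := by
  have h𝒜 := DirectSum.Decomposition.isInternal 𝒜
  have hℬ := DirectSum.Decomposition.isInternal ℬ
  have key : ∀ (k : ℕ) (a : A), gproj hℬ d (a • P.x ^ k) = gproj h𝒜 (d - 2 * k) a • P.x ^ k := by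
    intro k a
    refine grading_induction h𝒜 (P := fun a => gproj hℬ d (a • P.x ^ k) =
      gproj h𝒜 (d - 2 * k) a • P.x ^ k) (by simp) (fun a b ha hb => ?_) (fun i a ha => ?_) a
    · simp only [add_smul, map_add, ha, hb]
    · have h1 := algebraMap_mul_mem hAB ha (P.pow_mem k)
      by_cases hi : i = d - 2 * k
      · subst hi
        rw [sub_add_cancel] at h1
        rw [gproj_same hℬ h1, gproj_same h𝒜 ha]
      · rw [gproj_ne hℬ (by omega) h1, gproj_ne h𝒜 hi ha, zero_smul]
  have h1 : b = ∑ k : Fin P.m, gproj h𝒜 (d - 2 * (k : ℕ)) (P.basis.repr b k) • P.basis k := by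
    conv_lhs => rw [← gproj_same hℬ hb, ← P.basis.sum_repr b, map_sum]
    exact Finset.sum_congr rfl fun k _ => by rw [P.basis_apply, key]
  have h2 := congrFun (congrArg DFunLike.coe (congrArg P.basis.repr h1)) k
  rw [P.basis.repr_sum_self] at h2
  rw [h2]
  exact gproj_mem h𝒜 _ _

/-- The trace: the coefficient of the top power. -/
def tr : B →ₗ[A] A := P.basis.coord ⟨P.m - 1, Nat.sub_lt P.m_pos one_pos⟩

theorem tr_mem (hAB : ∀ (i : ℤ) (a : A), a ∈ 𝒜 i → algebraMap A B a ∈ ℬ i) {d : ℤ} {b : B}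
    (hb : b ∈ ℬ d) : P.tr b ∈ 𝒜 (d - 2 * ((P.m : ℤ) - 1)) := by
  have := P.repr_mem hAB hb ⟨P.m - 1, Nat.sub_lt P.m_pos one_pos⟩
  have hm := P.m_pos
  rwa [show (((⟨P.m - 1, Nat.sub_lt P.m_pos one_pos⟩ : Fin P.m) : ℕ) : ℤ) = (P.m : ℤ) - 1 by
    simp only []; omega] at this

theorem tr_pow {k : ℕ} (hk : k < P.m) : P.tr (P.x ^ k) = if k = P.m - 1 then 1 else 0 := by
  have := P.basis_apply ⟨k, hk⟩
  simp only at this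
  rw [tr, ← this, Module.Basis.coord_apply, Module.Basis.repr_self, Finsupp.single_apply]
  simp only [Fin.mk.injEq]

/-- The lower coefficients of the minimal polynomial of `x`, in descending order. -/
def coef (r : ℕ) : A :=
  if h : r < P.m then -(P.basis.repr (P.x ^ P.m) ⟨P.m - 1 - r, by omega⟩) else 0

/-- The sequence of the Horner quotients of the minimal polynomial of `x`. -/
def horner : ℕ → B
  | 0 => 1
  | r + 1 => P.x * horner r + algebraMap A B (P.coef r)

theorem coef_mem (hAB : ∀ (i : ℤ) (a : A), a ∈ 𝒜 i → algebraMap A B a ∈ ℬ i) (r : ℕ) :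
    P.coef r ∈ 𝒜 (2 * (r + 1)) := by
  unfold coef
  split_ifs with h
  · have h1 := P.repr_mem hAB (P.pow_mem P.m) ⟨P.m - 1 - r, by omega⟩
    rw [show (2 * (P.m : ℤ) - 2 * (((⟨P.m - 1 - r, by omega⟩ : Fin P.m) : ℕ) : ℤ)) =
      2 * (r + 1) by simp only []; omega] at h1
    exact Submodule.neg_mem _ h1
  · exact Submodule.zero_mem _

theorem horner_mem (hAB : ∀ (i : ℤ) (a : A), a ∈ 𝒜 i → algebraMap A B a ∈ ℬ i) (r : ℕ) :
    P.horner r ∈ ℬ (2 * r) := by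
  induction r with
  | zero => exact SetLike.one_mem_graded ℬ
  | succ r ih =>
    refine Submodule.add_mem _ ?_ ?_
    · have := SetLike.mul_mem_graded P.x_mem ih
      rwa [show (2 : ℤ) + 2 * r = 2 * ((r + 1 : ℕ) : ℤ) by push_cast; ring] at this
    · have := hAB _ _ (P.coef_mem hAB r)
      rwa [show (2 : ℤ) * (r + 1) = 2 * ((r + 1 : ℕ) : ℤ) by push_cast; ring] at this

theorem horner_eq (r : ℕ) :
    P.horner r = P.x ^ r + ∑ s ∈ Finset.range r, P.coef s • P.x ^ (r - 1 - s) := by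
  induction r with
  | zero => simp [horner]
  | succ r ih =>
    rw [horner, ih, Finset.sum_range_succ, mul_add, ← pow_succ', Finset.mul_sum, add_assoc]
    congr 2
    · refine Finset.sum_congr rfl fun s hs => ?_
      have := Finset.mem_range.1 hs
      rw [mul_smul_comm, ← pow_succ']
      congr 2
      omega
    · simp [Algebra.algebraMap_eq_smul_one]

/-- The last Horner quotient is the minimal polynomial itself, evaluated at its root x. -/
theorem horner_m : P.horner P.m = 0 := by
  rw [horner_eq, Finset.sum_range]
  have h1 := P.basis.sum_repr (P.x ^ P.m)
  have h2 : ∑ s : Fin P.m, P.coef s • P.x ^ (P.m - 1 - (s : ℕ)) =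
      -∑ s : Fin P.m, P.basis.repr (P.x ^ P.m) s • P.basis s := by
    rw [← Finset.sum_neg_distrib]
    refine Fintype.sum_equiv Fin.revPerm _ _ fun s => ?_
    rw [P.basis_apply, coef, dif_pos s.2, neg_smul]
    have : (Fin.revPerm s) = ⟨P.m - 1 - s, by omega⟩ := Fin.ext (by simp; omega)
    rw [this]
  rw [h2, h1, add_neg_cancel]

/-- The coefficients are zero by convention from index m on, so the sequence stays zero. This allows
indices beyond the rank in `tr_pow_mul_horner`. -/
theorem horner_of_le {r : ℕ} (h : P.m ≤ r) : P.horner r = 0 := by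
  induction r, h using Nat.le_induction with
  | base => exact P.horner_m
  | succ r h ih => rw [horner, ih, mul_zero, coef, dif_neg (by omega), map_zero, add_zero]

/-- For r below the rank the quotient is monic of degree r in x, so the top coordinate only sees r =
m-1. -/
theorem tr_horner (r : ℕ) : P.tr (P.horner r) = if r = P.m - 1 then 1 else 0 := by
  have hm := P.m_pos
  by_cases hr : P.m ≤ r
  · rw [P.horner_of_le hr, map_zero, if_neg (by omega)]
  · rw [horner_eq, map_add, map_sum, P.tr_pow (by omega), Finset.sum_eq_zero, add_zero]
    intro s hs
    have := Finset.mem_range.1 hs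
    rw [map_smul, P.tr_pow (by omega), if_neg (by omega), smul_zero]

/-- Multiplying a quotient by x gives the next one minus an element of A, and the trace kills the
powers below the top one. So powers of x move into the index, and the quotients in reverse order are
dual to the powers. -/
theorem tr_pow_mul_horner (k r : ℕ) (hk : k < P.m) :
    P.tr (P.x ^ k * P.horner r) = P.tr (P.horner (r + k)) := by
  induction k generalizing r with
  | zero => simp
  | succ k ih =>
    have h1 : P.x ^ (k + 1) * P.horner r = P.x ^ k * P.horner (r + 1) - P.coef r • P.x ^ k := by
      rw [horner, Algebra.smul_def]; ring
    rw [h1, map_sub, map_smul, P.tr_pow (by omega), if_neg (by omega), smul_zero, sub_zero,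
      ih _ (by omega)]
    congr 2
    omega

/-- The basis which is dual to the powers of `x` with respect to the trace. -/
def dual (k : Fin P.m) : B := P.horner (P.m - 1 - k)

theorem dual_mem (hAB : ∀ (i : ℤ) (a : A), a ∈ 𝒜 i → algebraMap A B a ∈ ℬ i) (k : Fin P.m) :
    P.dual k ∈ ℬ (2 * ((P.m : ℤ) - 1) - 2 * (k : ℤ)) := by
  have := P.horner_mem hAB (P.m - 1 - k)
  rwa [show (2 * ((P.m - 1 - (k : ℕ) : ℕ) : ℤ)) = 2 * ((P.m : ℤ) - 1) - 2 * (k : ℤ) by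
    have := k.2; omega] at this

theorem tr_basis_dual (k l : Fin P.m) :
    P.tr (P.basis k * P.dual l) = if k = l then 1 else 0 := by
  rw [P.basis_apply, dual, P.tr_pow_mul_horner _ _ k.2, tr_horner]
  have := k.2
  have := l.2
  congr 1
  rw [eq_iff_iff, Fin.ext_iff]
  omega

theorem sum_tr_dual (b : B) : ∑ k, P.tr (b * P.dual k) • P.basis k = b := by
  have h : (∑ k, (LinearMap.toSpanSingleton A B (P.basis k)) ∘ₗ P.tr ∘ₗ
      (LinearMap.mulRight A (P.dual k))) = LinearMap.id := by
    refine P.basis.ext fun l => ?_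
    simp [LinearMap.sum_apply, tr_basis_dual]
  have := LinearMap.congr_fun h b
  simpa [LinearMap.sum_apply] using this

/-- Nondegeneracy of the trace form: all coefficients in the expansion `sum_tr_dual` are traces of
multiples of b. -/
theorem eq_zero_of_tr (b : B) (h : ∀ k, P.tr (b * P.basis k) = 0) : b = 0 := by
  have h' : ∀ y, P.tr (b * y) = 0 := fun y => by
    have : P.tr ∘ₗ LinearMap.mulLeft A b = 0 := P.basis.ext fun k => h k
    exact LinearMap.congr_fun this y
  rw [← P.sum_tr_dual b]
  exact Finset.sum_eq_zero fun k _ => by rw [h', zero_smul]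

/-- The expansion in the dual basis; the difference of both sides is orthogonal to all powers of x,
hence zero by nondegeneracy. -/
theorem sum_tr_basis (b : B) : ∑ k, P.tr (b * P.basis k) • P.dual k = b := by
  rw [← sub_eq_zero]
  refine P.eq_zero_of_tr _ fun l => ?_
  have : ∀ k, P.tr (P.tr (b * P.basis k) • P.dual k * P.basis l) =
      if l = k then P.tr (b * P.basis k) else 0 := fun k => by
    rw [smul_mul_assoc, map_smul, mul_comm (P.dual k), tr_basis_dual]
    split_ifs <;> simp
  rw [sub_mul, Finset.sum_mul, map_sub, map_sum, Finset.sum_congr rfl fun k _ => this k]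
  simp

/-- The Casimir element of the dual bases commutes with B: expand b x_k in the powers of x, move the
coefficients through the tensor sign, and collect them by the expansion in the dual basis. This is
the B-linearity of `coev`. -/
theorem casimir {N : Type} [AddCommGroup N] [Module A N] [Module B N] [IsScalarTower A B N]
    (b : B) (n : N) : ∑ k, (b * P.basis k) ⊗ₜ[A] (P.dual k • n) =
      ∑ k, P.basis k ⊗ₜ[A] (P.dual k • (b • n)) := by
  have h1 : ∀ k, (b * P.basis k) ⊗ₜ[A] (P.dual k • n) =
      ∑ l, P.basis l ⊗ₜ[A] ((P.tr (b * P.basis k * P.dual l) • P.dual k) • n) := fun k => by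
    conv_lhs => rw [← P.sum_tr_dual (b * P.basis k), TensorProduct.sum_tmul]
    exact Finset.sum_congr rfl fun l _ => by
      rw [TensorProduct.smul_tmul, smul_assoc]
  rw [Finset.sum_congr rfl fun k _ => h1 k, Finset.sum_comm]
  refine Finset.sum_congr rfl fun l _ => ?_
  rw [← TensorProduct.tmul_sum, ← Finset.sum_smul]
  congr 1
  rw [← mul_smul]
  congr 1
  conv_rhs => rw [← P.sum_tr_basis (P.dual l * b)]
  exact Finset.sum_congr rfl fun k _ => by
    congr 2
    ring

/-- The map `n ↦ ∑ x_k ⊗ x_k' n` for dual bases `x_k` and `x_k'`. -/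
def coev (N : Type) [AddCommGroup N] [Module A N] [Module B N] [IsScalarTower A B N] :
    N →ₗ[B] B ⊗[A] N where
  toFun n := ∑ k, P.basis k ⊗ₜ[A] (P.dual k • n)
  map_add' n n' := by simp only [smul_add, TensorProduct.tmul_add, Finset.sum_add_distrib]
  map_smul' b n := by
    refine (P.casimir b n).symm.trans ?_
    rw [RingHom.id_apply, Finset.smul_sum]
    rfl

/-- The map `b ⊗ m ↦ tr b • m`. -/
def trAct (M : Type) [AddCommGroup M] [Module A M] : B ⊗[A] M →ₗ[A] M :=
  TensorProduct.lift ((LinearMap.lsmul A M) ∘ₗ P.tr)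

theorem coev_apply (N : Type) [AddCommGroup N] [Module A N] [Module B N] [IsScalarTower A B N]
    (n : N) : P.coev N n = ∑ k, P.basis k ⊗ₜ[A] (P.dual k • n) := rfl

/-- One triangle identity of the Frobenius adjunction. It reduces to expanding 1 in the dual basis.
-/
theorem trAct_coev (N : Type) [AddCommGroup N] [Module A N] [Module B N] [IsScalarTower A B N]
    (n : N) : P.trAct N (P.coev N n) = n := by
  have h := congrArg (· • n) (P.sum_tr_basis 1)
  simp only [one_mul, one_smul, Finset.sum_smul, smul_assoc] at h
  exact (map_sum (P.trAct N) (fun k => P.basis k ⊗ₜ[A] (P.dual k • n)) Finset.univ).trans h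

theorem baseChange_coev (N M : Type) [AddCommGroup N] [Module A N] [Module B N]
    [IsScalarTower A B N] [AddCommGroup M] [Module A M] (g : N →ₗ[A] M) (n : N) :
    g.baseChange B (P.coev N n) = ∑ k, P.basis k ⊗ₜ[A] g (P.dual k • n) :=
  map_sum (g.baseChange B) (fun k => P.basis k ⊗ₜ[A] (P.dual k • n)) Finset.univ

/-- The other triangle identity, which is the expansion of b in the powers of x. -/
theorem sum_basis_tr {M : Type} [AddCommGroup M] [Module A M] (b : B) (m : M) :
    ∑ k, P.basis k ⊗ₜ[A] (P.tr (P.dual k * b) • m) = b ⊗ₜ[A] m := by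
  conv_rhs => rw [← P.sum_tr_dual b, TensorProduct.sum_tmul]
  exact Finset.sum_congr rfl fun k _ => by rw [TensorProduct.smul_tmul, mul_comm]

/-- Every element of an induced module has coordinates. -/
theorem exists_coords {M : Type} [AddCommGroup M] [Module A M] (t : B ⊗[A] M) :
    ∃ c : Fin P.m → M, t = ∑ k, P.basis k ⊗ₜ[A] c k := by
  induction t using TensorProduct.induction_on with
  | zero => exact ⟨0, by simp⟩
  | add x y hx hy =>
    obtain ⟨c, rfl⟩ := hx
    obtain ⟨d, rfl⟩ := hy
    exact ⟨c + d, by simp [TensorProduct.tmul_add, Finset.sum_add_distrib]⟩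
  | tmul b m =>
    refine ⟨fun k => P.basis.repr b k • m, ?_⟩
    conv_lhs => rw [← P.basis.sum_repr b, TensorProduct.sum_tmul]
    exact Finset.sum_congr rfl fun k _ => TensorProduct.smul_tmul _ _ _

/-- The coordinate functions on an induced module. -/
def coordM (M : Type) [AddCommGroup M] [Module A M] (k : Fin P.m) : (B ⊗[A] M) →ₗ[A] M :=
  TensorProduct.lift ((LinearMap.lsmul A M) ∘ₗ P.basis.coord k)

theorem coordM_tmul {M : Type} [AddCommGroup M] [Module A M] (k : Fin P.m) (b : B) (m : M) :
    P.coordM M k (b ⊗ₜ m) = P.basis.repr b k • m := rfl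

theorem coordM_sum {M : Type} [AddCommGroup M] [Module A M] (c : Fin P.m → M) (l : Fin P.m) :
    P.coordM M l (∑ k, P.basis k ⊗ₜ[A] c k) = c l := by
  classical
  rw [map_sum, Finset.sum_eq_single l]
  · rw [coordM_tmul, P.basis.repr_self, Finsupp.single_eq_same, one_smul]
  · intro k _ hk
    rw [coordM_tmul, P.basis.repr_self, Finsupp.single_eq_of_ne hk.symm, zero_smul]
  · simp

/-- The induced module is a direct sum of copies of the given one. -/
def coordsEquiv (M : Type) [AddCommGroup M] [Module A M] : (B ⊗[A] M) ≃ₗ[A] (Fin P.m → M) where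
  toLinearMap := LinearMap.pi fun k => P.coordM M k
  invFun c := ∑ k, P.basis k ⊗ₜ[A] c k
  left_inv t := by
    obtain ⟨c, rfl⟩ := P.exists_coords t
    refine Finset.sum_congr rfl fun k _ => ?_
    congr 1
    exact P.coordM_sum c k
  right_inv c := funext fun k => P.coordM_sum c k

end PowExt

end PowExt

/-! ## Frobenius extensions -/

namespace GrMod

section Frobenius

variable {A B : Type} [CommRing A] [Algebra ℂ A] [CommRing B] [Algebra ℂ B] [Algebra A B]
  [IsScalarTower ℂ A B] {𝒜 : ℤ → Submodule ℂ A} {ℬ : ℤ → Submodule ℂ B}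
  [GradedAlgebra 𝒜] [GradedAlgebra ℬ] [Module.Finite ℂ B]
  (hAB : ∀ (i : ℤ) (a : A), a ∈ 𝒜 i → algebraMap A B a ∈ ℬ i) (P : PowExt 𝒜 ℬ)

/-- The unit of the Frobenius adjunction. -/
def frobUnit (N : GrMod ℬ) :
    N ⟶ shiftObj (-2 * ((P.m : ℤ) - 1)) (indObj ℬ hAB (resObj 𝒜 hAB N)) :=
  letI : Module A N.carrier := (resObj 𝒜 hAB N).module
  haveI : IsScalarTower A B N.carrier := ⟨fun a b m => by
    rw [Algebra.smul_def, mul_smul]; rfl⟩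
  mkHom (M := N) (N := shiftObj (-2 * ((P.m : ℤ) - 1)) (indObj ℬ hAB (resObj 𝒜 hAB N)))
    (P.coev N.carrier)
    fun i n hn => by
      have h : ∀ k, (P.basis k ⊗ₜ[A] (P.dual k • n) : B ⊗[A] N.carrier) ∈
          indDeg (B := B) ℬ (resObj 𝒜 hAB N) (i - (-2 * ((P.m : ℤ) - 1))) := fun k => by
        rw [P.basis_apply]
        exact tmul_mem_indDeg (M := resObj 𝒜 hAB N) (P.pow_mem k)
          (N.smul_mem _ _ _ _ (P.dual_mem hAB k) hn) (by ring)
      have h' : P.coev N.carrier n ∈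
          indDeg (B := B) ℬ (resObj 𝒜 hAB N) (i - (-2 * ((P.m : ℤ) - 1))) := by
        rw [P.coev_apply]
        exact Submodule.sum_mem _ fun k _ => h k
      exact h'

/-- The counit of the Frobenius adjunction. -/
def frobCounit (M : GrMod 𝒜) :
    resObj 𝒜 hAB (shiftObj (-2 * ((P.m : ℤ) - 1)) (indObj ℬ hAB M)) ⟶ M :=
  mkHom (M := resObj 𝒜 hAB (shiftObj (-2 * ((P.m : ℤ) - 1)) (indObj ℬ hAB M))) (N := M)
    { toFun := P.trAct M.carrier
      map_add' := map_add (P.trAct M.carrier)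
      map_smul' := fun a (t : B ⊗[A] M.carrier) =>
        (congrArg (P.trAct M.carrier) (algebraMap_smul B a t)).trans
          (map_smul (P.trAct M.carrier) a t) }
    fun d t ht => mem_of_indDeg (M := M) (M.deg d) (P.trAct M.carrier).toAddMonoidHom
      (fun c t => (P.trAct M.carrier).map_smul_of_tower c t)
      (fun i j b m h hb hm => by
        have := M.smul_mem _ _ _ _ (P.tr_mem hAB hb) hm
        rwa [show i - 2 * ((P.m : ℤ) - 1) + j = d by omega] at this) ht

/-- Induction along a Frobenius extension is also right adjoint to restriction, up to a shift. -/
def frobAdj : res 𝒜 hAB ⊣ ind ℬ hAB ⋙ shift ℬ (-2 * ((P.m : ℤ) - 1)) where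
  unit :=
    { app := fun N => frobUnit hAB P N
      naturality := fun M N f => hom_ext fun (n : M.carrier) => by
        let _ : Module A M.carrier := (resObj 𝒜 hAB M).module
        have _ : IsScalarTower A B M.carrier := ⟨fun a b m => by
          rw [Algebra.smul_def, mul_smul]; rfl⟩
        let g : M.carrier →ₗ[A] (resObj 𝒜 hAB N).carrier :=
          lin (M := resObj 𝒜 hAB M) (N := resObj 𝒜 hAB N) ((res 𝒜 hAB).map f)
        refine Eq.symm ((P.baseChange_coev M.carrier (resObj 𝒜 hAB N).carrier g n).trans ?_)
        refine Finset.sum_congr rfl fun k _ => ?_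
        exact congrArg (fun z : (resObj 𝒜 hAB N).carrier => P.basis k ⊗ₜ[A] z)
          (LinearMap.map_smul (lin f) (P.dual k) n) }
  counit :=
    { app := fun M => frobCounit hAB P M
      naturality := fun M N f => hom_ext fun t => by
        induction t using TensorProduct.induction_on with
        | zero => exact (map_zero _).trans (map_zero _).symm
        | add x y hx hy =>
          exact (map_add _ x y).trans ((congrArg₂ _ hx hy).trans (map_add _ x y).symm)
        | tmul b m => exact (LinearMap.map_smul (lin f) (P.tr b) m).symm }
  left_triangle_components N := hom_ext fun n => by
    let _ : Module A N.carrier := (resObj 𝒜 hAB N).module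
    have _ : IsScalarTower A B N.carrier := ⟨fun a b m => by
      rw [Algebra.smul_def, mul_smul]; rfl⟩
    exact P.trAct_coev N.carrier n
  right_triangle_components M := hom_ext fun t => by
    induction t using TensorProduct.induction_on with
    | zero => exact (map_zero _).trans (map_zero _).symm
    | add x y hx hy =>
      exact (map_add _ x y).trans ((congrArg₂ _ hx hy).trans (map_add _ x y).symm)
    | tmul b m =>
      let N := shiftObj (-2 * ((P.m : ℤ) - 1)) (indObj ℬ hAB M)
      let _ : Module A N.carrier := (resObj 𝒜 hAB N).module
      have _ : IsScalarTower A B N.carrier := ⟨fun a b m => by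
        rw [Algebra.smul_def, mul_smul]; rfl⟩
      refine (P.baseChange_coev N.carrier M.carrier (lin (frobCounit hAB P M)) (b ⊗ₜ[A] m)).trans ?_
      exact P.sum_basis_tr b m

end Frobenius

end GrMod

end

end SlTwoCat

open CategoryTheory CategoryTheory.Limits
open scoped TensorProduct LaurentPolynomial

namespace SlTwoCat

noncomputable section

set_option linter.unusedSectionVars false

/-! ## Duality and induction along Frobenius extensions -/

namespace GrMod

section DualInd

variable {A B A' : Type} [CommRing A] [Algebra ℂ A] [CommRing B] [Algebra ℂ B] [CommRing A']
  [Algebra ℂ A'] [Algebra A B] [IsScalarTower ℂ A B] [Algebra A' B] [IsScalarTower ℂ A' B]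
  {𝒜 : ℤ → Submodule ℂ A} {ℬ : ℤ → Submodule ℂ B} {𝒜' : ℤ → Submodule ℂ A'}
  [GradedAlgebra 𝒜] [GradedAlgebra ℬ] [Module.Finite ℂ A] [Module.Finite ℂ B]
  [Module.Finite ℂ A']
  (hAB : ∀ (i : ℤ) (a : A), a ∈ 𝒜 i → algebraMap A B a ∈ ℬ i)
  (hAB' : ∀ (i : ℤ) (a : A'), a ∈ 𝒜' i → algebraMap A' B a ∈ ℬ i) (P : PowExt 𝒜 ℬ)

/-- Evaluation of a functional. -/
def dualEval (M : GrMod 𝒜) (m : M.carrier) : (dualObj M).carrier →ₗ[ℂ] ℂ :=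
  (LinearMap.applyₗ m : (M.carrier →ₗ[ℂ] ℂ) →ₗ[ℂ] ℂ)

/-- The map `b' ⊗ φ ↦ tr (b b') φ`. -/
def mulTr (M : GrMod 𝒜) (b : B) : B ⊗[A] (dualObj M).carrier →ₗ[A] (dualObj M).carrier :=
  P.trAct _ ∘ₗ (LinearMap.mulLeft A b).rTensor _

theorem mulTr_tmul (M : GrMod 𝒜) (b b' : B) (φ : (dualObj M).carrier) :
    mulTr P M b (b' ⊗ₜ φ) = P.tr (b * b') • φ := rfl

theorem mulTr_add (M : GrMod 𝒜) (b c : B) (z : B ⊗[A] (dualObj M).carrier) :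
    mulTr P M (b + c) z = mulTr P M b z + mulTr P M c z := by
  induction z using TensorProduct.induction_on with
  | zero => simp
  | add x y hx hy => rw [map_add, hx, hy, map_add, map_add]; abel
  | tmul b' φ => rw [mulTr_tmul, mulTr_tmul, mulTr_tmul, add_mul, map_add, add_smul]

theorem mulTr_mul (M : GrMod 𝒜) (b c : B) (z : B ⊗[A] (dualObj M).carrier) :
    mulTr P M (c * b) z = mulTr P M b (c • z) := by
  induction z using TensorProduct.induction_on with
  | zero => simp
  | add x y hx hy => rw [map_add, hx, hy, smul_add, map_add]
  | tmul b' φ =>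
    rw [TensorProduct.smul_tmul', mulTr_tmul, mulTr_tmul, smul_eq_mul]
    congr 2
    ring

/-- The pairing of `B ⊗ M` with `B ⊗ dM`. -/
def dualPair (M : GrMod 𝒜) : (B ⊗[A] M.carrier) →+ Module.Dual ℂ (B ⊗[A] (dualObj M).carrier) :=
  TensorProduct.liftAddHom
    (AddMonoidHom.mk' (fun b => AddMonoidHom.mk'
        (fun m => dualEval M m ∘ₗ (mulTr P M b).restrictScalars ℂ)
        fun m m' => LinearMap.ext fun z => LinearMap.map_add (show Module.Dual ℂ M.carrier from mulTr P M b z) m m')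
      fun b c => AddMonoidHom.ext fun m => LinearMap.ext fun z =>
        (congrArg (dualEval M m) (mulTr_add P M b c z)).trans (map_add (dualEval M m) _ _))
    fun a b m => LinearMap.ext fun z => by
      change dualEval M m (mulTr P M (a • b) z) = dualEval M (a • m) (mulTr P M b z)
      rw [Algebra.smul_def, mulTr_mul, algebraMap_smul, map_smul]
      rfl

theorem dualPair_tmul (M : GrMod 𝒜) (b b' : B) (m : M.carrier) (φ : Module.Dual ℂ M.carrier) :
    dualPair P M (b ⊗ₜ m) (b' ⊗ₜ[A] (φ : (dualObj M).carrier)) = φ (P.tr (b * b') • m) := rfl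

theorem dualPair_smul (M : GrMod 𝒜) (c : B) (t : B ⊗[A] M.carrier)
    (z : B ⊗[A] (dualObj M).carrier) : dualPair P M (c • t) z = dualPair P M t (c • z) := by
  induction t using TensorProduct.induction_on with
  | zero => simp
  | add x y hx hy => rw [smul_add, map_add, map_add, LinearMap.add_apply, LinearMap.add_apply,
      hx, hy]
  | tmul b m => exact congrArg (dualEval M m) (mulTr_mul P M b c z)

theorem dualPair_smulC (M : GrMod 𝒜) (c : ℂ) (t : B ⊗[A] M.carrier) :
    dualPair P M (c • t) = c • dualPair P M t := by
  refine LinearMap.ext fun z => ?_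
  have h := dualPair_smul P M (algebraMap ℂ B c) t z
  rw [algebraMap_smul, algebraMap_smul, LinearMap.map_smul] at h
  exact h

/-- Pairing with the l-th dual basis element tensored with a functional φ extracts φ of the l-th
coordinate. -/
theorem dualPair_injective (M : GrMod 𝒜) : Function.Injective (dualPair P M) := by
  rw [injective_iff_map_eq_zero]
  intro t ht
  obtain ⟨c, rfl⟩ := P.exists_coords t
  refine Finset.sum_eq_zero fun l _ => ?_
  suffices h : c l = 0 by rw [h, TensorProduct.tmul_zero]
  rw [← Module.forall_dual_apply_eq_zero_iff ℂ]
  intro φ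
  have h1 := LinearMap.congr_fun ht (P.dual l ⊗ₜ[A] (φ : (dualObj M).carrier))
  rw [map_sum, LinearMap.sum_apply] at h1
  rw [Finset.sum_eq_single l] at h1
  · rw [dualPair_tmul, P.tr_basis_dual, if_pos rfl, one_smul] at h1
    exact h1
  · intro k _ hk
    rw [dualPair_tmul, P.tr_basis_dual, if_neg hk, zero_smul, map_zero]
  · simp

theorem finrank_ind (M : GrMod 𝒜) :
    Module.finrank ℂ (B ⊗[A] M.carrier) = P.m * Module.finrank ℂ M.carrier := by
  have := finiteC M
  rw [LinearEquiv.finrank_eq ((P.coordsEquiv M.carrier).restrictScalars ℂ),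
    Module.finrank_pi_fintype]
  simp

/-- Both sides have dimension m · dim M, so injectivity is enough. -/
theorem dualPair_bijective (hAB : ∀ (i : ℤ) (a : A), a ∈ 𝒜 i → algebraMap A B a ∈ ℬ i)
    (M : GrMod 𝒜) : Function.Bijective (dualPair P M) := by
  let f : (B ⊗[A] M.carrier) →ₗ[ℂ] Module.Dual ℂ (B ⊗[A] (dualObj M).carrier) :=
    { dualPair P M with map_smul' := dualPair_smulC P M }
  have h1 := finiteC M
  have h2 : Module.Finite ℂ (B ⊗[A] M.carrier) := finiteC (indObj ℬ hAB M)
  have h3 : Module.Finite ℂ (B ⊗[A] (dualObj M).carrier) := finiteC (indObj ℬ hAB (dualObj M))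
  have hinj : Function.Injective f := dualPair_injective P M
  refine ⟨hinj, (LinearMap.injective_iff_surjective_of_finrank_eq_finrank (f := f) ?_).1 hinj⟩
  rw [Subspace.dual_finrank_eq, finrank_ind P M, finrank_ind P (dualObj M)]
  congr 1
  exact (Subspace.dual_finrank_eq (K := ℂ) (V := M.carrier)).symm

/-- The trace lowers degrees by 2(m-1); this is the source of the shift in `dualIndTrans`. -/
theorem dualPair_mem (hAB : ∀ (i : ℤ) (a : A), a ∈ 𝒜 i → algebraMap A B a ∈ ℬ i)
    (M : GrMod 𝒜) (d : ℤ) (t : B ⊗[A] M.carrier)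
    (ht : t ∈ indDeg (B := B) ℬ M (d - (-2 * ((P.m : ℤ) - 1)))) (k : ℤ) (hk : k ≠ -d)
    (z : B ⊗[A] (dualObj M).carrier) (hz : z ∈ indDeg (B := B) ℬ (dualObj M) k) :
    dualPair P M t z = 0 := by
  induction ht using Submodule.span_induction with
  | zero => rw [map_zero]; rfl
  | add x y _ _ hx hy => rw [map_add, LinearMap.add_apply, hx, hy, add_zero]
  | smul c x _ hx => rw [dualPair_smulC, LinearMap.smul_apply, hx, smul_zero]
  | mem t ht =>
    obtain ⟨i, j, b, m, hd, hb, hm, rfl⟩ := ht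
    induction hz using Submodule.span_induction with
    | zero => rw [map_zero]
    | add x y _ _ hx hy => rw [map_add, hx, hy, add_zero]
    | smul c x _ hx => rw [map_smul, hx, smul_zero]
    | mem z hz =>
      obtain ⟨p, q, b', φ, hpq, hb', hφ, rfl⟩ := hz
      refine (dualPair_tmul P M b b' m φ).trans ?_
      exact hφ (i + p - 2 * ((P.m : ℤ) - 1) + j) (by omega) _
        (M.smul_mem _ _ _ _ (P.tr_mem hAB (SetLike.mul_mem_graded hb hb')) hm)

/-- The map `g` may be any adjoint of the morphism with respect to evaluation; it is used with the
dual morphism. -/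
theorem dualPair_naturality {M N : GrMod 𝒜} (f : M ⟶ N)
    (g : (dualObj N).carrier →ₗ[A] (dualObj M).carrier)
    (hg : ∀ φ m, dualEval M m (g φ) = dualEval N (lin f m) φ) (t : B ⊗[A] M.carrier)
    (z : B ⊗[A] (dualObj N).carrier) :
    dualPair P N ((lin f).baseChange B t) z = dualPair P M t (g.baseChange B z) := by
  induction t using TensorProduct.induction_on with
  | zero => rw [map_zero, map_zero, map_zero, LinearMap.zero_apply, LinearMap.zero_apply]
  | add x y hx hy =>
    rw [map_add, map_add, map_add, LinearMap.add_apply, LinearMap.add_apply, hx, hy]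
  | tmul b m =>
    induction z using TensorProduct.induction_on with
    | zero => rw [map_zero, map_zero, map_zero]
    | add x y hx hy => rw [map_add, map_add, map_add, hx, hy]
    | tmul b' φ =>
      change dualEval N (P.tr (b * b') • lin f m) φ = dualEval M (P.tr (b * b') • m) (g φ)
      rw [hg, map_smul]

/-- Conjugating an induction functor by the duality changes it by a shift. -/
def dualIndTrans : (ind ℬ hAB ⋙ res 𝒜' hAB') ⋙ shift 𝒜' (-2 * ((P.m : ℤ) - 1)) ⟶
    (GrMod.dual 𝒜).rightOp ⋙ (ind ℬ hAB ⋙ res 𝒜' hAB').op ⋙ GrMod.dual 𝒜' where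
  app M := mkHom (M := shiftObj (-2 * ((P.m : ℤ) - 1)) (resObj 𝒜' hAB' (indObj ℬ hAB M)))
    (N := dualObj (resObj 𝒜' hAB' (indObj ℬ hAB (dualObj M))))
    { toFun := dualPair P M
      map_add' := map_add (dualPair P M)
      map_smul' := fun a t => LinearMap.ext fun z =>
        dualPair_smul P M (algebraMap A' B a) t z }
    fun d t ht k hk z hz => dualPair_mem P hAB M d t ht k hk z hz
  naturality _ _ f := hom_ext fun t => LinearMap.ext fun z =>
    dualPair_naturality P f (lin ((GrMod.dual 𝒜).map f.op)) (fun _ _ => rfl) t z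

/-- Conjugating an induction functor by the duality changes it by a shift. -/
def dualIndIso : (ind ℬ hAB ⋙ res 𝒜' hAB') ⋙ shift 𝒜' (-2 * ((P.m : ℤ) - 1)) ≅
    (GrMod.dual 𝒜).rightOp ⋙ (ind ℬ hAB ⋙ res 𝒜' hAB').op ⋙ GrMod.dual 𝒜' :=
  natIsoOfBijective (dualIndTrans hAB hAB' P) fun M => dualPair_bijective P hAB M

end DualInd

/-! ## Transport along isomorphisms of algebras -/

section Twist

/-- Restriction along a graded algebra homomorphism. -/
def twist {A₁ A₂ : Type} [CommRing A₁] [Algebra ℂ A₁] [CommRing A₂] [Algebra ℂ A₂]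
    [Module.Finite ℂ A₂] {𝒜₁ : ℤ → Submodule ℂ A₁} {𝒜₂ : ℤ → Submodule ℂ A₂}
    (α : A₁ →ₐ[ℂ] A₂) (hα : ∀ i, ∀ a ∈ 𝒜₁ i, α a ∈ 𝒜₂ i) : GrMod 𝒜₂ ⥤ GrMod 𝒜₁ :=
  letI : Algebra A₁ A₂ := α.toRingHom.toAlgebra
  haveI : IsScalarTower ℂ A₁ A₂ := IsScalarTower.of_algebraMap_eq fun c => (α.commutes c).symm
  res (ℬ := 𝒜₂) 𝒜₁ hα

variable {A₁ A₂ B₁ B₂ A₁' A₂' : Type} [CommRing A₁] [Algebra ℂ A₁] [CommRing A₂] [Algebra ℂ A₂]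
  [CommRing B₁] [Algebra ℂ B₁] [CommRing B₂] [Algebra ℂ B₂] [CommRing A₁'] [Algebra ℂ A₁']
  [CommRing A₂'] [Algebra ℂ A₂'] [Module.Finite ℂ A₂] [Module.Finite ℂ A₁'] [Module.Finite ℂ A₂']
  [Module.Finite ℂ B₁] [Module.Finite ℂ B₂]
  [Algebra A₁ B₁] [IsScalarTower ℂ A₁ B₁] [Algebra A₁' B₁] [IsScalarTower ℂ A₁' B₁]
  [Algebra A₂ B₂] [IsScalarTower ℂ A₂ B₂] [Algebra A₂' B₂] [IsScalarTower ℂ A₂' B₂]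
  {𝒜₁ : ℤ → Submodule ℂ A₁} {𝒜₂ : ℤ → Submodule ℂ A₂} {ℬ₁ : ℤ → Submodule ℂ B₁}
  {ℬ₂ : ℤ → Submodule ℂ B₂} {𝒜₁' : ℤ → Submodule ℂ A₁'} {𝒜₂' : ℤ → Submodule ℂ A₂'}
  [GradedAlgebra 𝒜₁] [GradedAlgebra 𝒜₂] [GradedAlgebra ℬ₁] [GradedAlgebra ℬ₂]
  (h₁ : ∀ (i : ℤ) (a : A₁), a ∈ 𝒜₁ i → algebraMap A₁ B₁ a ∈ ℬ₁ i)
  (h₁' : ∀ (i : ℤ) (a : A₁'), a ∈ 𝒜₁' i → algebraMap A₁' B₁ a ∈ ℬ₁ i)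
  (h₂ : ∀ (i : ℤ) (a : A₂), a ∈ 𝒜₂ i → algebraMap A₂ B₂ a ∈ ℬ₂ i)
  (h₂' : ∀ (i : ℤ) (a : A₂'), a ∈ 𝒜₂' i → algebraMap A₂' B₂ a ∈ ℬ₂ i)
  (α : A₁ →ₐ[ℂ] A₂) (hα : ∀ i, ∀ a ∈ 𝒜₁ i, α a ∈ 𝒜₂ i) (hαs : Function.Surjective α)
  (β : B₁ ≃ₐ[ℂ] B₂) (hβ : ∀ i, ∀ b ∈ ℬ₁ i, β b ∈ ℬ₂ i)
  (α' : A₁' →ₐ[ℂ] A₂') (hα' : ∀ i, ∀ a ∈ 𝒜₁' i, α' a ∈ 𝒜₂' i)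
  (hc : ∀ a, β (algebraMap A₁ B₁ a) = algebraMap A₂ B₂ (α a))
  (hc' : ∀ a, β (algebraMap A₁' B₁ a) = algebraMap A₂' B₂ (α' a))

/-- The comparison map `B₁ ⊗ M → B₂ ⊗ M`. -/
def twistFun (M : GrMod 𝒜₂) :
    (B₁ ⊗[A₁] ((twist α hα).obj M).carrier) →+ (B₂ ⊗[A₂] M.carrier) :=
  TensorProduct.liftAddHom
    (AddMonoidHom.mk' (fun b => AddMonoidHom.mk' (fun m : M.carrier => β b ⊗ₜ[A₂] m)
        fun m m' => TensorProduct.tmul_add _ _ _)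
      fun b c => AddMonoidHom.ext fun m =>
        (congrArg (· ⊗ₜ[A₂] m) (map_add β b c)).trans (TensorProduct.add_tmul _ _ _))
    fun a b m => by
      change β (a • b) ⊗ₜ[A₂] (show M.carrier from m) = β b ⊗ₜ[A₂] (α a • (show M.carrier from m))
      rw [Algebra.smul_def, map_mul, hc, ← Algebra.smul_def, TensorProduct.smul_tmul]

/-- The inverse of the comparison map. -/
def twistInv (M : GrMod 𝒜₂) :
    (B₂ ⊗[A₂] M.carrier) →+ (B₁ ⊗[A₁] ((twist α hα).obj M).carrier) :=
  TensorProduct.liftAddHom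
    (AddMonoidHom.mk' (fun b => AddMonoidHom.mk'
        (fun m : M.carrier => β.symm b ⊗ₜ[A₁] (show ((twist α hα).obj M).carrier from m))
        fun m m' => TensorProduct.tmul_add _ _ _)
      fun b c => AddMonoidHom.ext fun m =>
        (congrArg (· ⊗ₜ[A₁] (show ((twist α hα).obj M).carrier from m))
          (map_add β.symm b c)).trans (TensorProduct.add_tmul _ _ _))
    fun a b m => by
      obtain ⟨a, rfl⟩ := hαs a
      change β.symm (α a • b) ⊗ₜ[A₁] (show ((twist α hα).obj M).carrier from m) =
        β.symm b ⊗ₜ[A₁] (a • (show ((twist α hα).obj M).carrier from m))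
      rw [Algebra.smul_def, map_mul, ← hc, AlgEquiv.symm_apply_apply, ← Algebra.smul_def,
        TensorProduct.smul_tmul]

theorem twistFun_bijective (hαs : Function.Surjective α) (M : GrMod 𝒜₂) : Function.Bijective (twistFun α hα β hc M) := by
  refine Function.bijective_iff_has_inverse.2 ⟨twistInv α hα hαs β hc M, fun t => ?_, fun t => ?_⟩
  · induction t using TensorProduct.induction_on with
    | zero => exact (congrArg _ (map_zero _)).trans (map_zero _)
    | add x y hx hy =>
      exact (congrArg _ (map_add _ x y)).trans ((map_add _ _ _).trans (congrArg₂ _ hx hy))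
    | tmul b m => exact congrArg (· ⊗ₜ[A₁] m) (β.symm_apply_apply b)
  · induction t using TensorProduct.induction_on with
    | zero => exact (congrArg _ (map_zero _)).trans (map_zero _)
    | add x y hx hy =>
      exact (congrArg _ (map_add _ x y)).trans ((map_add _ _ _).trans (congrArg₂ _ hx hy))
    | tmul b m => exact congrArg (· ⊗ₜ[A₂] m) (β.apply_symm_apply b)

theorem twistFun_smulB (M : GrMod 𝒜₂) (c : B₁)
    (t : B₁ ⊗[A₁] ((twist α hα).obj M).carrier) :
    twistFun α hα β hc M (c • t) = β c • twistFun α hα β hc M t := by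
  induction t using TensorProduct.induction_on with
  | zero => rw [smul_zero, map_zero, smul_zero]
  | add x y hx hy => rw [smul_add, map_add, map_add, hx, hy, smul_add]
  | tmul b m => exact congrArg (· ⊗ₜ[A₂] (show M.carrier from m)) (map_mul β c b)

theorem twistFun_mem (hβ : ∀ i, ∀ b ∈ ℬ₁ i, β b ∈ ℬ₂ i) (M : GrMod 𝒜₂) {d : ℤ} {t : B₁ ⊗[A₁] ((twist α hα).obj M).carrier}
    (ht : t ∈ indDeg (B := B₁) ℬ₁ ((twist α hα).obj M) d) :
    twistFun α hα β hc M t ∈ indDeg (B := B₂) ℬ₂ M d := by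
  refine mem_of_indDeg (M := (twist α hα).obj M) _ (twistFun α hα β hc M) (fun c t => ?_)
    (fun i j b m h hb hm => ?_) ht
  · have := twistFun_smulB α hα β hc M (algebraMap ℂ B₁ c) t
    rwa [algebraMap_smul, AlgEquiv.commutes, algebraMap_smul] at this
  · exact tmul_mem_indDeg (M := M) (hβ i b hb) hm h

/-- Transport of an induction functor along compatible isomorphisms of algebras. -/
def twistIndIso : twist α hα ⋙ ind ℬ₁ h₁ ⋙ res 𝒜₁' h₁' ≅
    (ind ℬ₂ h₂ ⋙ res 𝒜₂' h₂') ⋙ twist α' hα' :=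
  natIsoOfBijective
    { app := fun M => mkHom (M := resObj 𝒜₁' h₁' (indObj ℬ₁ h₁ ((twist α hα).obj M)))
        (N := (twist α' hα').obj (resObj 𝒜₂' h₂' (indObj ℬ₂ h₂ M)))
        { toFun := twistFun α hα β hc M
          map_add' := map_add (twistFun α hα β hc M)
          map_smul' := fun a t => by
            refine (twistFun_smulB α hα β hc M (algebraMap A₁' B₁ a) t).trans ?_
            rw [hc']
            rfl }
        fun d t ht => twistFun_mem α hα β hc hβ M ht
      naturality := fun M N f => hom_ext fun t => by
        induction t using TensorProduct.induction_on with
        | zero => exact (map_zero _).trans (map_zero _).symm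
        | add x y hx hy =>
          exact (map_add _ x y).trans ((congrArg₂ _ hx hy).trans (map_add _ x y).symm)
        | tmul b m => rfl }
    fun M => twistFun_bijective α hα β hc hαs M

end Twist

end GrMod

end

end SlTwoCat

open CategoryTheory CategoryTheory.Limits
open scoped TensorProduct LaurentPolynomial

namespace SlTwoCat

noncomputable section

set_option linter.unusedSectionVars false

/-! ## Bivariate polynomials and evaluations -/

section BiEval

open Polynomial

variable {A W : Type} [CommRing A] [CommRing W] (ι : A →+* W) (u v : W)

/-- Evaluation of the inner variable at `u` and of the outer variable at `v`. -/
def biEval : A[X][X] →+* W := eval₂RingHom (eval₂RingHom ι u) v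

theorem biEval_C (g : A[X]) : biEval ι u v (Polynomial.C g) = eval₂ ι u g := by simp [biEval]

theorem biEval_X : biEval ι u v X = v := by simp [biEval]

theorem biEval_map (g : A[X]) : biEval ι u v (g.map Polynomial.C) = eval₂ ι v g := by
  rw [biEval, coe_eval₂RingHom, eval₂_map]
  congr 1
  ext a
  simp

/-- The outer variable may be replaced by the inner one next to an element annihilated by the
difference of their values. -/
theorem mul_biEval {c : W} (hc : c * (v - u) = 0) (f : A[X][X]) :
    c * biEval ι u v f = c * eval₂ ι u (f.eval X) := by
  obtain ⟨g, hg⟩ := X_sub_C_dvd_sub_C_eval (a := (X : A[X])) (p := f)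
  have h := congrArg (biEval ι u v) hg
  rw [map_sub, map_mul, map_sub, biEval_X, biEval_C, biEval_C, eval₂_X] at h
  rw [← sub_eq_zero, ← mul_sub, h, ← mul_assoc, hc, zero_mul]

end BiEval

/-! ### Polynomials over the base of an extension with a basis of powers -/

section PowExtPoly

open Polynomial

variable {A B : Type} [CommRing A] [Algebra ℂ A] [CommRing B] [Algebra ℂ B] [Algebra A B]
  [IsScalarTower ℂ A B] {𝒜 : ℤ → Submodule ℂ A} {ℬ : ℤ → Submodule ℂ B} [GradedAlgebra 𝒜]
  [GradedAlgebra ℬ] (P : PowExt 𝒜 ℬ)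

namespace PowExt

theorem repr_aeval {g : A[X]} (hg : g.degree < P.m) (t : Fin P.m) :
    P.basis.repr (aeval P.x g) t = g.coeff t := by
  have hn : g.natDegree < P.m := by
    by_cases h0 : g = 0
    · rw [h0, natDegree_zero]; exact P.m_pos
    · exact (natDegree_lt_iff_degree_lt h0).2 hg
  rw [aeval_eq_sum_range' hn, Finset.sum_range]
  simp only [← P.basis_apply]
  rw [P.basis.repr_sum_self (fun i : Fin P.m => g.coeff i)]

/-- The remainder modulo `a` has degree less than the rank, so its coefficients are the coordinates
of zero in the basis of powers. -/
theorem dvd_of_aeval {a : A[X]} (ha : a.Monic) (hd : a.natDegree = P.m) (h0 : aeval P.x a = 0)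
    {g : A[X]} (hg : aeval P.x g = 0) : a ∣ g := by
  rw [← modByMonic_eq_zero_iff_dvd ha]
  have h1 : aeval P.x (g %ₘ a) = 0 := by rw [aeval_modByMonic_eq_self_of_root h0, hg]
  rcases subsingleton_or_nontrivial A with hA | hA
  · exact Subsingleton.elim _ _
  have hlt : (g %ₘ a).degree < P.m := by
    have := degree_modByMonic_lt g ha
    rwa [degree_eq_natDegree ha.ne_zero, hd] at this
  ext t
  by_cases ht : t < P.m
  · have := P.repr_aeval hlt ⟨t, ht⟩
    rw [h1, map_zero] at this
    exact this.symm
  · rw [coeff_zero]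
    exact coeff_eq_zero_of_degree_lt (hlt.trans_le (by exact_mod_cast not_lt.1 ht))

end PowExt

end PowExtPoly

/-! ## Two ways around a square of extensions -/

open Polynomial

/-- Two extensions `B` and `B'` of `A`, generated by roots of polynomials `a` and `b`, and rings
`D ⊆ B` and `D' ⊆ B'` which contain the coefficients of `(X - x) b` and `(X - x') a`. -/
structure CrossData {A B B' D D' : Type} [CommRing A] [Algebra ℂ A] [CommRing B] [Algebra ℂ B]
    [CommRing B'] [Algebra ℂ B'] [CommRing D] [Algebra ℂ D] [CommRing D'] [Algebra ℂ D']
    [Algebra A B] [Algebra A B'] [Algebra D B] [Algebra D' B']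
    (𝒜 : ℤ → Submodule ℂ A) (ℬ : ℤ → Submodule ℂ B) (ℬ' : ℤ → Submodule ℂ B')
    (𝒟 : ℤ → Submodule ℂ D) (𝒟' : ℤ → Submodule ℂ D') where
  /-- The extension `B` of `A`. -/
  P : PowExt 𝒜 ℬ
  /-- The extension `B'` of `A`. -/
  P' : PowExt 𝒜 ℬ'
  /-- The extension `B` of `D`. -/
  R : PowExt 𝒟 ℬ
  /-- The extension `B'` of `D'`. -/
  R' : PowExt 𝒟' ℬ'
  x_eq : R.x = P.x
  x_eq' : R'.x = P'.x
  m_eq : R.m = P'.m + 1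
  m_eq' : R'.m = P.m + 1
  /-- The minimal polynomial of `x` over `A`. -/
  a : A[X]
  /-- The minimal polynomial of `x'` over `A`. -/
  b : A[X]
  a_monic : a.Monic
  b_monic : b.Monic
  a_deg : a.natDegree = P.m
  b_deg : b.natDegree = P'.m
  a_root : aeval P.x a = 0
  b_root : aeval P'.x b = 0
  -- In the application x and the roots of b form a single group of variables over D, and likewise
  -- x' and the roots of a over D'. This also explains the additional 1 in the ranks `m_eq` and
  -- `m_eq'`.
  lift : ∃ c : D[X], c.map (algebraMap D B) = (X - Polynomial.C P.x) * b.map (algebraMap A B)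
  lift' : ∃ c : D'[X], c.map (algebraMap D' B') = (X - Polynomial.C P'.x) * a.map (algebraMap A B')
  -- The generators are power sums over the variables on one side of a cut. Moving the cut one place
  -- in either direction changes them by a power of x or of x', with opposite signs. This controls
  -- the second action of A on the tensor products.
  gens : ∃ S : Set A, Algebra.adjoin ℂ S = ⊤ ∧ ∀ s ∈ S, ∃ (N : ℕ) (z : ℂ),
    (∃ d : D, algebraMap D B d = algebraMap A B s - z • P.x ^ N) ∧
    ∃ d : D', algebraMap D' B' d = algebraMap A B' s + z • P'.x ^ N

namespace CrossData

variable {A B B' D D' : Type} [CommRing A] [Algebra ℂ A] [CommRing B] [Algebra ℂ B]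
    [CommRing B'] [Algebra ℂ B'] [CommRing D] [Algebra ℂ D] [CommRing D'] [Algebra ℂ D']
    [Algebra A B] [Algebra A B'] [Algebra D B] [Algebra D' B']
    {𝒜 : ℤ → Submodule ℂ A} {ℬ : ℤ → Submodule ℂ B} {ℬ' : ℤ → Submodule ℂ B'}
    {𝒟 : ℤ → Submodule ℂ D} {𝒟' : ℤ → Submodule ℂ D'}

/-- Exchanging the roles of the two extensions. -/
def symm (Z : CrossData 𝒜 ℬ ℬ' 𝒟 𝒟') : CrossData 𝒜 ℬ' ℬ 𝒟' 𝒟 where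
  P := Z.P'
  P' := Z.P
  R := Z.R'
  R' := Z.R
  x_eq := Z.x_eq'
  x_eq' := Z.x_eq
  m_eq := Z.m_eq'
  m_eq' := Z.m_eq
  a := Z.b
  b := Z.a
  a_monic := Z.b_monic
  b_monic := Z.a_monic
  a_deg := Z.b_deg
  b_deg := Z.a_deg
  a_root := Z.b_root
  b_root := Z.a_root
  lift := Z.lift'
  lift' := Z.lift
  gens := by
    obtain ⟨S, hS, h⟩ := Z.gens
    refine ⟨S, hS, fun s hs => ?_⟩
    obtain ⟨N, z, ⟨d, hd⟩, d', hd'⟩ := h s hs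
    exact ⟨N, -z, ⟨d', by rw [hd', neg_smul, sub_neg_eq_add]⟩,
      d, by rw [hd, neg_smul, sub_eq_add_neg]⟩

variable [IsScalarTower ℂ A B] [IsScalarTower ℂ A B'] [IsScalarTower ℂ D B]
  [IsScalarTower ℂ D' B'] [GradedAlgebra 𝒜] [GradedAlgebra ℬ] [GradedAlgebra ℬ']
  [GradedAlgebra 𝒟] [GradedAlgebra 𝒟'] (Z : CrossData 𝒜 ℬ ℬ' 𝒟 𝒟')

/-- The action of `A` on the first factor. -/
def inA : A →+* (B ⊗[D] B) := (algebraMap B (B ⊗[D] B)).comp (algebraMap A B)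

/-- The action of `A` on the second factor. -/
def outA : A →+* (B ⊗[D] B) :=
  (Algebra.TensorProduct.includeRight : B →ₐ[D] (B ⊗[D] B)).toRingHom.comp (algebraMap A B)

theorem inA_apply (a : A) : inA (B := B) (D := D) a = algebraMap A B a ⊗ₜ[D] 1 := rfl

theorem outA_apply (a : A) : outA (B := B) (D := D) a = 1 ⊗ₜ[D] algebraMap A B a := rfl

/-- Evaluation at the generators of the first and of the second factor of `B ⊗ B`. -/
def ev : A[X][X] →+* (B ⊗[D] B) := biEval inA (Z.P.x ⊗ₜ[D] 1) (1 ⊗ₜ[D] Z.P.x)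

/-- Evaluation at the generators of the second and of the first factor of `B' ⊗ B'`. -/
def ev' : A[X][X] →+* (B' ⊗[D'] B') := biEval inA (1 ⊗ₜ[D'] Z.P'.x) (Z.P'.x ⊗ₜ[D'] 1)

theorem ev_C (g : A[X]) : Z.ev (Polynomial.C g) = aeval Z.P.x g ⊗ₜ[D] 1 := by
  rw [ev, biEval_C, aeval_def]
  exact (hom_eval₂ g (algebraMap A B) (algebraMap B (B ⊗[D] B)) Z.P.x).symm

theorem eval₂_in (g : A[X]) : eval₂ inA (Z.P.x ⊗ₜ[D] 1) g = aeval Z.P.x g ⊗ₜ[D] 1 := by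
  rw [aeval_def]
  exact (hom_eval₂ g (algebraMap A B) (algebraMap B (B ⊗[D] B)) Z.P.x).symm

theorem ev_X : Z.ev X = 1 ⊗ₜ[D] Z.P.x := biEval_X _ _ _

theorem ev'_X : Z.ev' X = Z.P'.x ⊗ₜ[D'] 1 := biEval_X _ _ _

theorem ev'_b : eval₂ inA (Z.P'.x ⊗ₜ[D'] (1 : B')) Z.b = 0 := by
  have h := (hom_eval₂ Z.b (algebraMap A B') (algebraMap B' (B' ⊗[D'] B')) Z.P'.x).symm
  rw [← aeval_def, Z.b_root, map_zero] at h
  exact h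

/-- The polynomial (Y-x)b(Y) has coefficients in D and x as a root. Such coefficients pass through
the tensor sign, so 1 ⊗ x is a root of it with coefficients acting on the first factor. -/
theorem ev_cross : (1 ⊗ₜ[D] Z.P.x - Z.P.x ⊗ₜ[D] 1) * eval₂ inA (1 ⊗ₜ[D] Z.P.x) Z.b = 0 := by
  obtain ⟨c, hc⟩ := Z.lift
  have h1 : eval₂ (algebraMap D (B ⊗[D] B)) (1 ⊗ₜ[D] Z.P.x) c = 0 := by
    have h2 := hom_eval₂ c (algebraMap D B)
      (Algebra.TensorProduct.includeRight : B →ₐ[D] (B ⊗[D] B)).toRingHom Z.P.x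
    rw [← Polynomial.eval_map, hc, eval_mul, eval_sub, eval_X, eval_C, sub_self, zero_mul, map_zero] at h2
    have h3 : (Algebra.TensorProduct.includeRight : B →ₐ[D] (B ⊗[D] B)).toRingHom.comp
        (algebraMap D B) = algebraMap D (B ⊗[D] B) := RingHom.ext fun d =>
      (Algebra.TensorProduct.includeRight : B →ₐ[D] (B ⊗[D] B)).commutes d
    rw [h3] at h2
    exact h2.symm
  have h4 : algebraMap D (B ⊗[D] B) = (algebraMap B (B ⊗[D] B)).comp (algebraMap D B) := rfl
  rw [h4, ← eval₂_map, hc, eval₂_mul, eval₂_sub, eval₂_X, eval₂_C, eval₂_map] at h1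
  exact h1

theorem ev'_cross : (Z.P'.x ⊗ₜ[D'] 1 - 1 ⊗ₜ[D'] Z.P'.x) *
    eval₂ inA (1 ⊗ₜ[D'] Z.P'.x) Z.a = 0 := by
  have := Z.symm.ev_cross
  rw [← neg_eq_zero, ← neg_mul, neg_sub] at this
  exact this

/-- Computes the kernel of the evaluation. Dividing by the monic polynomial (Y-X)b(Y), whose degree
in Y is the rank of B over D, leaves a remainder of smaller degree. The elements 1 ⊗ x^l form a
basis over the first factor, so all coefficients of the remainder vanish at x and are divisible by
a. -/
theorem ev_eq_zero {f : A[X][X]} (hf : Z.ev f = 0) :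
    ∃ g h, f = Polynomial.C Z.a * g + (X - Polynomial.C X) * Z.b.map Polynomial.C * h := by
  -- Degrees of remainders are compared over a nontrivial ring only.
  rcases subsingleton_or_nontrivial A with hA | hA
  · exact ⟨0, 0, Subsingleton.elim _ _⟩
  have hm : ((X - Polynomial.C X) * Z.b.map Polynomial.C : A[X][X]).Monic := (monic_X_sub_C _).mul (Z.b_monic.map Polynomial.C)
  have hd : ((X - Polynomial.C X) * Z.b.map Polynomial.C : A[X][X]).natDegree = Z.R.m := by
    rw [(monic_X_sub_C _).natDegree_mul (Z.b_monic.map Polynomial.C), natDegree_X_sub_C,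
      Z.b_monic.natDegree_map, Z.b_deg, Z.m_eq, add_comm]
  have h0 : Z.ev ((X - Polynomial.C X) * Z.b.map Polynomial.C) = 0 := by
    rw [map_mul, map_sub, ev_X, ev_C, ev, biEval_map, aeval_X, Z.ev_cross]
  set g := f %ₘ ((X - Polynomial.C X) * Z.b.map Polynomial.C) with hg
  have hfg : f = g + (X - Polynomial.C X) * Z.b.map Polynomial.C * (f /ₘ ((X - Polynomial.C X) * Z.b.map Polynomial.C)) :=
    (modByMonic_add_div f _).symm
  have hg0 : Z.ev g = 0 := by
    rw [hfg, map_add, map_mul, h0, zero_mul, add_zero] at hf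
    exact hf
  have hlt : g.natDegree < Z.R.m := by
    by_cases h1 : g = 0
    · rw [h1, natDegree_zero]; exact Z.R.m_pos
    · refine (natDegree_lt_iff_degree_lt h1).2 ?_
      have := degree_modByMonic_lt f hm
      rwa [degree_eq_natDegree hm.ne_zero, hd] at this
  have key : ∀ l, aeval Z.P.x (g.coeff l) = 0 := by
    intro l
    by_cases hl : l < Z.R.m
    · have h1 : Z.ev g = ∑ k : Fin Z.R.m, aeval Z.P.x (g.coeff k) •
          Algebra.TensorProduct.basis B Z.R.basis k := by
        rw [ev, biEval, coe_eval₂RingHom, eval₂_eq_sum_range' _ hlt, Finset.sum_range]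
        refine Finset.sum_congr rfl fun k _ => ?_
        rw [coe_eval₂RingHom, eval₂_in, Algebra.TensorProduct.basis_apply, Z.R.basis_apply, Z.x_eq,
          Algebra.TensorProduct.tmul_pow, one_pow, Algebra.TensorProduct.tmul_mul_tmul,
          TensorProduct.smul_tmul', smul_eq_mul, one_mul]
      have h2 := (Algebra.TensorProduct.basis B Z.R.basis).repr_sum_self
        fun k : Fin Z.R.m => aeval Z.P.x (g.coeff k)
      rw [← h1, hg0, map_zero] at h2
      exact (congrFun h2 ⟨l, hl⟩).symm
    · rw [coeff_eq_zero_of_natDegree_lt (hlt.trans_le (not_lt.1 hl)), map_zero]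
  obtain ⟨s, hs⟩ := (C_dvd_iff_dvd_coeff _ _).2 fun l =>
    Z.P.dvd_of_aeval Z.a_monic Z.a_deg Z.a_root (key l)
  exact ⟨s, f /ₘ ((X - Polynomial.C X) * Z.b.map Polynomial.C), by rw [← hs]; exact hfg⟩

end CrossData

end

end SlTwoCat

open CategoryTheory CategoryTheory.Limits
open scoped TensorProduct LaurentPolynomial

namespace SlTwoCat

noncomputable section

set_option linter.unusedSectionVars false

open Polynomial

/-! ### The comparison map between the two bimodules -/

namespace CrossData

variable {A B B' D D' : Type} [CommRing A] [Algebra ℂ A] [CommRing B] [Algebra ℂ B]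
    [CommRing B'] [Algebra ℂ B'] [CommRing D] [Algebra ℂ D] [CommRing D'] [Algebra ℂ D']
    [Algebra A B] [Algebra A B'] [Algebra D B] [Algebra D' B']
    {𝒜 : ℤ → Submodule ℂ A} {ℬ : ℤ → Submodule ℂ B} {ℬ' : ℤ → Submodule ℂ B'}
    {𝒟 : ℤ → Submodule ℂ D} {𝒟' : ℤ → Submodule ℂ D'}
    [IsScalarTower ℂ A B] [IsScalarTower ℂ A B'] [IsScalarTower ℂ D B]
    [IsScalarTower ℂ D' B'] [GradedAlgebra 𝒜] [GradedAlgebra ℬ] [GradedAlgebra ℬ']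
    [GradedAlgebra 𝒟] [GradedAlgebra 𝒟'] (Z : CrossData 𝒜 ℬ ℬ' 𝒟 𝒟')

theorem _root_.SlTwoCat.PowExt.exists_aeval (P : PowExt 𝒜 ℬ) (b : B) :
    ∃ g : A[X], aeval P.x g = b := by
  refine ⟨∑ k, Polynomial.C (P.basis.repr b k) * X ^ (k : ℕ), ?_⟩
  conv_rhs => rw [← P.basis.sum_repr b]
  rw [map_sum]
  refine Finset.sum_congr rfl fun k _ => ?_
  rw [map_mul, aeval_C, map_pow, aeval_X, P.basis_apply, Algebra.smul_def]

theorem tmul_eq_sum (p s : B) : p ⊗ₜ[D] s =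
    ∑ l : Fin Z.R.m, (Z.R.basis.repr s l • p) ⊗ₜ[D] (Z.P.x ^ (l : ℕ)) := by
  conv_lhs => rw [← Z.R.basis.sum_repr s]
  rw [TensorProduct.tmul_sum]
  refine Finset.sum_congr rfl fun l _ => ?_
  rw [Z.R.basis_apply, Z.x_eq, TensorProduct.smul_tmul]

theorem ev_C_mul_pow (g : A[X]) (l : ℕ) :
    Z.ev (Polynomial.C g * X ^ l) = aeval Z.P.x g ⊗ₜ[D] (Z.P.x ^ l) := by
  rw [map_mul, ev_C, map_pow, ev_X, Algebra.TensorProduct.tmul_pow, one_pow,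
    Algebra.TensorProduct.tmul_mul_tmul, one_mul, mul_one]

theorem ev_surjective : Function.Surjective Z.ev := by
  intro w
  change w ∈ Z.ev.range
  induction w using TensorProduct.induction_on with
  | zero => exact zero_mem _
  | add x y hx hy => exact add_mem hx hy
  | tmul p s =>
    rw [Z.tmul_eq_sum]
    refine sum_mem fun l _ => ?_
    obtain ⟨g, hg⟩ := Z.P.exists_aeval (Z.R.basis.repr s l • p)
    exact ⟨Polynomial.C g * X ^ (l : ℕ), by rw [ev_C_mul_pow, hg]⟩

theorem ev'_C (g : A[X]) : Z.ev' (Polynomial.C g) = eval₂ inA (1 ⊗ₜ[D'] Z.P'.x) g :=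
  biEval_C _ _ _ _

/-- Up to the exchange of the two variables this is the evaluation for the exchanged data, whose
surjectivity is known. -/
theorem ev'_surjective : Function.Surjective Z.ev' := by
  intro w
  obtain ⟨f, rfl⟩ := Z.symm.ev_surjective w
  have h : Z.symm.ev.range ≤ Z.ev'.range := by
    rintro _ ⟨f, rfl⟩
    induction f using Polynomial.induction_on' with
    | add p q hp hq => rw [map_add]; exact add_mem hp hq
    | monomial l g =>
      rw [← C_mul_X_pow_eq_monomial, map_mul, map_pow, ev_X, ev_C]
      refine mul_mem (RingHom.mem_range.2 ⟨g.map Polynomial.C, ?_⟩)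
        (pow_mem (RingHom.mem_range.2 ⟨Polynomial.C X, ?_⟩) l)
      · rw [ev', biEval_map]
        exact Z.symm.eval₂_in g
      · rw [ev'_C, eval₂_X]
        rfl
  exact h ⟨f, rfl⟩

/-- The map `x ^ t ↦ 1 ⊗ x' ^ t`, for `t` less than the rank, extended linearly. -/
def red : B →+ (B' ⊗[D'] B') :=
  AddMonoidHom.mk' (fun c => ∑ t : Fin Z.P.m, inA (Z.P.basis.repr c t) * (1 ⊗ₜ[D'] Z.P'.x) ^ (t : ℕ))
    fun c d => by
      rw [← Finset.sum_add_distrib]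
      exact Finset.sum_congr rfl fun t _ => by rw [map_add, Finsupp.add_apply, map_add, add_mul]

theorem red_apply (c : B) :
    Z.red c = ∑ t : Fin Z.P.m, inA (Z.P.basis.repr c t) * (1 ⊗ₜ[D'] Z.P'.x) ^ (t : ℕ) := rfl

theorem red_smul (a : A) (c : B) : Z.red (a • c) = inA a * Z.red c := by
  rw [red_apply, red_apply, Finset.mul_sum]
  exact Finset.sum_congr rfl fun t _ => by
    rw [map_smul, Finsupp.smul_apply, smul_eq_mul, map_mul, mul_assoc]

theorem red_aeval {g : A[X]} (hg : g.degree < Z.P.m) :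
    Z.red (aeval Z.P.x g) = eval₂ inA (1 ⊗ₜ[D'] Z.P'.x) g := by
  have hn : g.natDegree < Z.P.m := by
    by_cases h0 : g = 0
    · rw [h0, natDegree_zero]; exact Z.P.m_pos
    · exact (natDegree_lt_iff_degree_lt h0).2 hg
  rw [red_apply, eval₂_eq_sum_range' _ hn, Finset.sum_range]
  exact Finset.sum_congr rfl fun t _ => by rw [Z.P.repr_aeval hg]

/-- The map `red` reduces modulo a before inserting 1 ⊗ x', so the error is the quotient by a times
the value of a. -/
theorem eval_sub_red (g : A[X]) :
    eval₂ inA (1 ⊗ₜ[D'] Z.P'.x) g - Z.red (aeval Z.P.x g) =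
      eval₂ inA (1 ⊗ₜ[D'] Z.P'.x) Z.a * eval₂ inA (1 ⊗ₜ[D'] Z.P'.x) (g /ₘ Z.a) := by
  rcases subsingleton_or_nontrivial A with hA | hA
  · have h0 : ∀ g : A[X], g = 0 := fun g => Subsingleton.elim _ _
    rw [h0 g, h0 Z.a, map_zero, map_zero, eval₂_zero, sub_zero, zero_mul]
  have h1 : (g %ₘ Z.a).degree < Z.P.m := by
    have := degree_modByMonic_lt g Z.a_monic
    rwa [degree_eq_natDegree Z.a_monic.ne_zero, Z.a_deg] at this
  rw [← aeval_modByMonic_eq_self_of_root Z.a_root, Z.red_aeval h1, ← eval₂_mul]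
  rw [sub_eq_iff_eq_add, add_comm, ← eval₂_add, modByMonic_add_div]

/-- The map which induces the comparison map. -/
def crossAux : A[X][X] →+ (B' ⊗[D'] B') :=
  AddMonoidHom.mk' (fun f => Z.ev' f - eval₂ inA (1 ⊗ₜ[D'] Z.P'.x) (f.eval X) +
      Z.red (aeval Z.P.x (f.eval X)))
    fun f g => by
      rw [map_add, eval_add, eval₂_add, map_add, map_add]
      abel

/-- The evaluation `ev'` alone does not respect the relation a(X) = 0. Its value on the diagonal Y =
X is therefore replaced by the value reduced modulo a. -/
theorem crossAux_apply (f : A[X][X]) : Z.crossAux f =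
    Z.ev' f - eval₂ inA (1 ⊗ₜ[D'] Z.P'.x) (f.eval X) + Z.red (aeval Z.P.x (f.eval X)) := rfl

/-- On multiples of a(X) the reduced diagonal value is zero, and the other two terms cancel because
(Y-X)a(X) is sent to zero. On multiples of (Y-X)b(Y) the diagonal value vanishes, and b(Y) is sent
to zero. -/
theorem crossAux_eq_zero {f : A[X][X]} (hf : Z.ev f = 0) : Z.crossAux f = 0 := by
  obtain ⟨g, h, rfl⟩ := Z.ev_eq_zero hf
  rw [map_add, crossAux_apply, crossAux_apply]
  have h1 : ((X - Polynomial.C X) * Z.b.map Polynomial.C * h : A[X][X]).eval X = 0 := by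
    rw [eval_mul, eval_mul, eval_sub, eval_X, eval_C, sub_self, zero_mul, zero_mul]
  have h2 : Z.ev' (Z.b.map Polynomial.C) = 0 := by
    rw [ev', biEval_map, Z.ev'_b]
  rw [h1, map_mul Z.ev', map_mul Z.ev', map_mul Z.ev', h2, mul_zero, zero_mul, eval₂_zero, map_zero, map_zero, sub_zero,
    add_zero, add_zero, eval_mul, eval_C, map_mul (aeval Z.P.x), Z.a_root, zero_mul, map_zero, add_zero,
    ev'_C, eval₂_mul, ev', mul_biEval, sub_self]
  rw [mul_comm, Z.ev'_cross]

/-- The comparison map from `B ⊗ B` to `B' ⊗ B'`. -/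
def cross : (B ⊗[D] B) →+ (B' ⊗[D'] B') :=
  Z.ev.toAddMonoidHom.liftOfSurjective Z.ev_surjective
    ⟨Z.crossAux, fun _ hf => Z.crossAux_eq_zero hf⟩

theorem cross_ev (f : A[X][X]) : Z.cross (Z.ev f) = Z.crossAux f :=
  AddMonoidHom.liftOfRightInverse_comp_apply _ _ _ _ f

/-- Multiplication identifies the two tensor factors, hence the two variables. Only the diagonal
value of a polynomial matters for the coordinates of the product. -/
theorem mul_ev (f : A[X][X]) :
    Algebra.TensorProduct.lmul' D (S := B) (Z.ev f) = aeval Z.P.x (f.eval X) := by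
  have h : ((Algebra.TensorProduct.lmul' D (S := B)).toRingHom.comp Z.ev) =
      (aeval Z.P.x : A[X] →ₐ[A] B).toRingHom.comp (evalRingHom X) := by
    refine Polynomial.ringHom_ext' (Polynomial.ringHom_ext' (RingHom.ext fun a => ?_) ?_) ?_
    · simp [ev, biEval, inA]
    · simp [ev, biEval]
    · simp [ev, biEval]
  exact RingHom.congr_fun h f

theorem cross_inA (a : A) (w : B ⊗[D] B) : Z.cross (inA a * w) = inA a * Z.cross w := by
  obtain ⟨f, rfl⟩ := Z.ev_surjective w
  have h1 : inA a = Z.ev (Polynomial.C (Polynomial.C a)) := by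
    rw [ev_C, aeval_C]; rfl
  have h2 : inA a = Z.ev' (Polynomial.C (Polynomial.C a)) := by
    rw [ev'_C, eval₂_C]
  rw [h1, ← map_mul, cross_ev, cross_ev, crossAux_apply, crossAux_apply, map_mul, ← h2, eval_mul,
    eval_C, eval₂_mul, eval₂_C, map_mul, aeval_C, ← Algebra.smul_def, red_smul]
  ring

/-- The second action of A is the first one corrected by a multiple of Y-X, with the same polynomial
for both bimodules. For a generator s, an element of D or D' is moved across the tensor sign, which
leaves ±z(Y^N - X^N). The opposite signs of the two sides are compensated by the exchange of the two
factors in `ev'`. Elements of this form are closed under sums and products. -/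
theorem exists_outA (a : A) : ∃ h : A[X][X],
    outA a = Z.ev (Polynomial.C (Polynomial.C a) + (X - Polynomial.C X) * h) ∧
    outA a = Z.ev' (Polynomial.C (Polynomial.C a) + (X - Polynomial.C X) * h) := by
  obtain ⟨S, hS, hgen⟩ := Z.gens
  have ha : a ∈ Algebra.adjoin ℂ S := by rw [hS]; trivial
  induction ha using Algebra.adjoin_induction with
  | algebraMap c =>
    have h1 : ∀ (E F : Type) [CommRing E] [Algebra ℂ E] [CommRing F] [Algebra ℂ F] [Algebra A F]
        [IsScalarTower ℂ A F] [Algebra E F] [IsScalarTower ℂ E F],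
        outA (algebraMap ℂ A c) = inA (B := F) (D := E) (algebraMap ℂ A c) := by
      intro E F _ _ _ _ _ _ _ _
      rw [outA_apply, inA_apply, ← IsScalarTower.algebraMap_apply,
        IsScalarTower.algebraMap_apply ℂ E F, Algebra.algebraMap_eq_smul_one,
        TensorProduct.smul_tmul]
    refine ⟨0, ?_, ?_⟩
    · rw [mul_zero, add_zero, ev_C, aeval_C, h1]; rfl
    · rw [mul_zero, add_zero, ev'_C, eval₂_C, h1]
  | mem s hs =>
    obtain ⟨N, z, ⟨d, hd⟩, d', hd'⟩ := hgen s hs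
    obtain ⟨h, hh⟩ := sub_dvd_pow_sub_pow (X : A[X][X]) (Polynomial.C X) N
    refine ⟨z • h, ?_, ?_⟩
    · have h1 : algebraMap A B s = algebraMap D B d + z • Z.P.x ^ N := by rw [hd]; ring
      rw [mul_smul_comm, ← hh, map_add, ev_C, aeval_C, ← algebraMap_smul A[X][X] z, smul_eq_mul,
        map_mul, map_sub, map_pow, map_pow, ev_C, ev_X, aeval_X, outA_apply, h1,
        IsScalarTower.algebraMap_apply ℂ A A[X][X]]
      change _ = _ + Z.ev (Polynomial.C (Polynomial.C _)) * _
      rw [ev_C, aeval_C, ← IsScalarTower.algebraMap_apply, TensorProduct.tmul_add,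
        TensorProduct.add_tmul, Algebra.algebraMap_eq_smul_one, ← TensorProduct.smul_tmul,
        mul_sub]
      simp only [Algebra.TensorProduct.tmul_pow, one_pow, Algebra.TensorProduct.tmul_mul_tmul,
        Algebra.algebraMap_eq_smul_one, one_mul, mul_one, smul_mul_assoc,
        TensorProduct.tmul_smul, TensorProduct.smul_tmul']
      abel
    · have h1 : algebraMap A B' s = algebraMap D' B' d' - z • Z.P'.x ^ N := by rw [hd']; ring
      rw [mul_smul_comm, ← hh, map_add, ev'_C, eval₂_C, ← algebraMap_smul A[X][X] z, smul_eq_mul,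
        map_mul, map_sub, map_pow, map_pow, ev'_C, ev'_X, eval₂_X, outA_apply, inA_apply, h1,
        IsScalarTower.algebraMap_apply ℂ A A[X][X]]
      change _ = _ + Z.ev' (Polynomial.C (Polynomial.C _)) * _
      rw [ev'_C, eval₂_C, inA_apply, ← IsScalarTower.algebraMap_apply, TensorProduct.tmul_sub,
        TensorProduct.sub_tmul, Algebra.algebraMap_eq_smul_one, ← TensorProduct.smul_tmul,
        mul_sub]
      simp only [Algebra.TensorProduct.tmul_pow, one_pow, Algebra.TensorProduct.tmul_mul_tmul,
        Algebra.algebraMap_eq_smul_one, one_mul, mul_one, smul_mul_assoc,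
        TensorProduct.tmul_smul, TensorProduct.smul_tmul']
      abel
  | add x y _ _ hx hy =>
    obtain ⟨h, h1, h2⟩ := hx
    obtain ⟨k, k1, k2⟩ := hy
    refine ⟨h + k, ?_, ?_⟩
    · rw [map_add, h1, k1, ← map_add]; congr 1; rw [map_add, map_add]; ring
    · rw [map_add, h2, k2, ← map_add]; congr 1; rw [map_add, map_add]; ring
  | mul x y _ _ hx hy =>
    obtain ⟨h, h1, h2⟩ := hx
    obtain ⟨k, k1, k2⟩ := hy
    refine ⟨Polynomial.C (Polynomial.C x) * k + h * Polynomial.C (Polynomial.C y) +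
      h * ((X - Polynomial.C X) * k), ?_, ?_⟩
    · rw [map_mul, h1, k1, ← map_mul]; congr 1; rw [map_mul, map_mul]; ring
    · rw [map_mul, h2, k2, ← map_mul]; congr 1; rw [map_mul, map_mul]; ring

/-- The two sides differ by a multiple of Y-X times the difference between the diagonal value and
its reduction. The latter is a multiple of a(1 ⊗ x') by `eval_sub_red`, so `ev'_cross` applies. -/
theorem cross_outA (a : A) (w : B ⊗[D] B) : Z.cross (outA a * w) = outA a * Z.cross w := by
  obtain ⟨f, rfl⟩ := Z.ev_surjective w
  obtain ⟨h, h1, h2⟩ := Z.exists_outA a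
  have h3 : ((Polynomial.C (Polynomial.C a) + (X - Polynomial.C X) * h) * f : A[X][X]).eval X =
      Polynomial.C a * f.eval X := by
    rw [eval_mul, eval_add, eval_mul, eval_sub, eval_X, eval_C, eval_C, sub_self, zero_mul,
      add_zero]
  have h4 : Z.ev' (X - Polynomial.C X) *
      (eval₂ inA (1 ⊗ₜ[D'] Z.P'.x) (f.eval X) - Z.red (aeval Z.P.x (f.eval X))) = 0 := by
    rw [eval_sub_red, ← mul_assoc, map_sub, ev'_X, ev'_C, eval₂_X, Z.ev'_cross, zero_mul]
  rw [h1, ← map_mul, cross_ev, cross_ev, crossAux_apply, crossAux_apply, h3, h2, map_mul Z.ev',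
    eval₂_mul, eval₂_C, map_mul, aeval_C, ← Algebra.smul_def, red_smul, map_add Z.ev',
    map_mul Z.ev', ev'_C, eval₂_C]
  linear_combination Z.ev' h * h4

/-- The comparison map and the upper coordinates of the product are jointly surjective. -/
theorem cross_surjective (hle : Z.P'.m ≤ Z.P.m) (w : B' ⊗[D'] B') (e : Fin Z.P.m → A) :
    ∃ w₁, Z.cross w₁ = w ∧ ∀ k : Fin Z.P.m, Z.P'.m ≤ k →
      Z.P.basis.repr (Algebra.TensorProduct.lmul' D (S := B) w₁) k = e k := by
  rcases subsingleton_or_nontrivial A with hA | hA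
  · have h1 : (1 : B' ⊗[D'] B') = 0 := by
      rw [← map_one (inA (A := A)), Subsingleton.elim (1 : A) 0, map_zero]
    exact ⟨0, by rw [← mul_one (Z.cross 0), ← mul_one w, h1, mul_zero, mul_zero],
      fun k _ => Subsingleton.elim _ _⟩
  -- Prescribes the coordinates of the product. The image of `E` under the comparison map is
  -- subtracted from the target in advance.
  let E : A[X] := ∑ k : Fin Z.P.m, Polynomial.C (e k) * X ^ (k : ℕ)
  have hE : E.degree < Z.P.m := by
    refine lt_of_le_of_lt (degree_sum_le _ _) ?_
    refine (Finset.sup_lt_iff (WithBot.bot_lt_coe _)).2 fun k _ => ?_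
    refine lt_of_le_of_lt (degree_C_mul_X_pow_le _ _) ?_
    exact_mod_cast k.2
  have hEc : ∀ k : Fin Z.P.m, E.coeff k = e k := fun k => by
    simp only [E, finsetSum_coeff, coeff_C_mul, coeff_X_pow]
    rw [Finset.sum_eq_single k]
    · simp
    · intro j _ hj
      rw [if_neg (fun h => hj (Fin.ext h.symm)), mul_zero]
    · simp
  obtain ⟨f, hf⟩ := Z.ev'_surjective (w - Z.cross (Z.ev (Polynomial.C E)))
  have hb : Z.ev' (Z.b.map Polynomial.C) = 0 := by rw [ev', biEval_map, Z.ev'_b]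
  -- Subtracting a multiple of b(Y) does not change the value of `ev'` and reduces the diagonal
  -- value modulo b. Its degree is then below m' ≤ m: `red` cancels the diagonal term, and the
  -- coordinates from m' on are not affected.
  let f' : A[X][X] := f - Z.b.map Polynomial.C * (f.eval X /ₘ Z.b).map Polynomial.C
  have hmap : ∀ g : A[X], (g.map Polynomial.C).eval X = g := fun g => by
    rw [Polynomial.eval_map, eval₂_C_X]
  have hf' : f'.eval X = f.eval X %ₘ Z.b := by
    rw [eval_sub, eval_mul, hmap, hmap, modByMonic_eq_sub_mul_div]
  have hdeg : (f.eval X %ₘ Z.b).degree < Z.P'.m := by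
    have := degree_modByMonic_lt (f.eval X) Z.b_monic
    rwa [degree_eq_natDegree Z.b_monic.ne_zero, Z.b_deg] at this
  have hdeg' : (f.eval X %ₘ Z.b).degree < Z.P.m := hdeg.trans_le (by exact_mod_cast hle)
  refine ⟨Z.ev (f' + Polynomial.C E), ?_, fun k hk => ?_⟩
  · rw [map_add, map_add, cross_ev, crossAux_apply, hf', red_aeval _ hdeg', sub_add_cancel, map_sub,
      map_mul, hb, zero_mul, sub_zero, hf, sub_add_cancel]
  · rw [mul_ev, eval_add, hf', eval_C, map_add, map_add, Finsupp.add_apply, Z.P.repr_aeval hdeg',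
      Z.P.repr_aeval hE, hEc, coeff_eq_zero_of_degree_lt (hdeg.trans_le (by exact_mod_cast hk)),
      zero_add]

/-- The component of degree `d` of `B ⊗ B`. -/
def tdeg (D : Type) [CommRing D] [Algebra ℂ D] [Algebra D B] [IsScalarTower ℂ D B]
    (ℬ : ℤ → Submodule ℂ B) (d : ℤ) : Submodule ℂ (B ⊗[D] B) :=
  Submodule.span ℂ {t | ∃ (i j : ℤ) (p s : B), i + j = d ∧ p ∈ ℬ i ∧ s ∈ ℬ j ∧ t = p ⊗ₜ[D] s}

/-- Expanding in the elements a x^k ⊗ x^l, each of the three terms of `crossAux` is homogeneous of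
the same degree as such an element, since both generators have degree two. -/
theorem cross_mem (hAB : ∀ (i : ℤ) (a : A), a ∈ 𝒜 i → algebraMap A B a ∈ ℬ i)
    (hAB' : ∀ (i : ℤ) (a : A), a ∈ 𝒜 i → algebraMap A B' a ∈ ℬ' i)
    (hDB : ∀ (i : ℤ) (a : D), a ∈ 𝒟 i → algebraMap D B a ∈ ℬ i)
    {i j : ℤ} {p s : B} (hp : p ∈ ℬ i) (hs : s ∈ ℬ j) :
    Z.cross (p ⊗ₜ[D] s) ∈ tdeg D' ℬ' (i + j) := by
  have hpure : ∀ {k l d : ℤ} {p s : B'}, p ∈ ℬ' k → s ∈ ℬ' l → k + l = d →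
      p ⊗ₜ[D'] s ∈ tdeg D' ℬ' d := fun hp hs h =>
    Submodule.subset_span ⟨_, _, _, _, h, hp, hs, rfl⟩
  rw [Z.tmul_eq_sum, map_sum]
  refine Submodule.sum_mem _ fun l _ => ?_
  have hc := PowExt.algebraMap_mul_mem hDB (Z.R.repr_mem hDB hs l) hp
  set c := Z.R.basis.repr s l • p with hcdef
  have h1 : c ⊗ₜ[D] (Z.P.x ^ (l : ℕ)) = ∑ k : Fin Z.P.m,
      Z.ev (Polynomial.C (Polynomial.C (Z.P.basis.repr c k) * X ^ (k : ℕ)) * X ^ (l : ℕ)) := by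
    simp only [ev_C_mul_pow]
    rw [← TensorProduct.sum_tmul]
    congr 1
    conv_lhs => rw [← Z.P.basis.sum_repr c]
    refine Finset.sum_congr rfl fun k _ => ?_
    rw [map_mul, aeval_C, map_pow, aeval_X, Z.P.basis_apply, Algebra.smul_def]
  rw [h1, map_sum]
  refine Submodule.sum_mem _ fun k _ => ?_
  have ha := Z.P.repr_mem hAB hc k
  set a := Z.P.basis.repr c k with hadef
  have hev : (Polynomial.C (Polynomial.C a * X ^ (k : ℕ)) * X ^ (l : ℕ) : A[X][X]).eval X =
      Polynomial.C a * X ^ ((k : ℕ) + l) := by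
    rw [eval_mul, eval_C, eval_pow, eval_X, pow_add, mul_assoc]
  have hin : ∀ (a : A) (N : ℕ), inA a * (1 ⊗ₜ[D'] Z.P'.x) ^ N =
      algebraMap A B' a ⊗ₜ[D'] (Z.P'.x ^ N) := fun a N => by
    rw [inA_apply, Algebra.TensorProduct.tmul_pow, one_pow, Algebra.TensorProduct.tmul_mul_tmul,
      one_mul, mul_one]
  rw [cross_ev, crossAux_apply, hev]
  refine Submodule.add_mem _ (Submodule.sub_mem _ ?_ ?_) ?_
  · rw [map_mul, map_pow, ev'_C, ev'_X, eval₂_mul, eval₂_C, eval₂_pow, eval₂_X, hin,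
      Algebra.TensorProduct.tmul_pow, one_pow, Algebra.TensorProduct.tmul_mul_tmul, mul_one]
    exact hpure (SetLike.mul_mem_graded (hAB' _ _ ha) (Z.P'.pow_mem l)) (Z.P'.pow_mem k) (by ring)
  · rw [eval₂_mul, eval₂_C, eval₂_pow, eval₂_X, hin]
    exact hpure (hAB' _ _ ha) (Z.P'.pow_mem _) (by push_cast; ring)
  · rw [map_mul, aeval_C, ← Algebra.smul_def, red_smul, red_apply, Finset.mul_sum]
    refine Submodule.sum_mem _ fun t _ => ?_
    rw [← mul_assoc, ← map_mul, hin, map_pow, aeval_X]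
    exact hpure (hAB' _ _ (SetLike.mul_mem_graded ha (Z.P.repr_mem hAB (Z.P.pow_mem _) t)))
      (Z.P'.pow_mem _) (by push_cast; ring)

end CrossData

end

end SlTwoCat

open CategoryTheory CategoryTheory.Limits
open scoped TensorProduct LaurentPolynomial

namespace SlTwoCat

noncomputable section

set_option linter.unusedSectionVars false

/-! ### Composite functors described by bimodules -/

namespace CrossData

variable {A B B' D D' : Type} [CommRing A] [Algebra ℂ A] [CommRing B] [Algebra ℂ B]
    [CommRing B'] [Algebra ℂ B'] [CommRing D] [Algebra ℂ D] [CommRing D'] [Algebra ℂ D']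
    [Algebra A B] [Algebra A B'] [Algebra D B] [Algebra D' B']
    {𝒜 : ℤ → Submodule ℂ A} {ℬ : ℤ → Submodule ℂ B} {ℬ' : ℤ → Submodule ℂ B'}
    {𝒟 : ℤ → Submodule ℂ D} {𝒟' : ℤ → Submodule ℂ D'}
    [IsScalarTower ℂ A B] [IsScalarTower ℂ A B'] [IsScalarTower ℂ D B]
    [IsScalarTower ℂ D' B'] [GradedAlgebra 𝒜] [GradedAlgebra ℬ] [GradedAlgebra ℬ']
    [GradedAlgebra 𝒟] [GradedAlgebra 𝒟'] [Module.Finite ℂ A] [Module.Finite ℂ B]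
    [Module.Finite ℂ B'] [Module.Finite ℂ D] [Module.Finite ℂ D']

section Loop

open GrMod

variable (hAB : ∀ (i : ℤ) (a : A), a ∈ 𝒜 i → algebraMap A B a ∈ ℬ i)
  (hDB : ∀ (i : ℤ) (a : D), a ∈ 𝒟 i → algebraMap D B a ∈ ℬ i)

/-- The composite of the functor from `A`-modules to `D`-modules given by the bimodule `B` with
the functor in the other direction. -/
abbrev loop : GrMod 𝒜 ⥤ GrMod 𝒜 :=
  (ind ℬ hAB ⋙ res 𝒟 hDB) ⋙ ind ℬ hDB ⋙ res 𝒜 hAB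

/-- The element `p ⊗ m`, in the restricted module. -/
def inner (M : GrMod 𝒜) (p : B) (m : M.carrier) : (resObj 𝒟 hDB (indObj ℬ hAB M)).carrier :=
  p ⊗ₜ[A] m

theorem inner_add (M : GrMod 𝒜) (p : B) (m m' : M.carrier) :
    inner hAB hDB M p (m + m') = inner hAB hDB M p m + inner hAB hDB M p m' :=
  TensorProduct.tmul_add p m m'

theorem add_inner (M : GrMod 𝒜) (p p' : B) (m : M.carrier) :
    inner hAB hDB M (p + p') m = inner hAB hDB M p m + inner hAB hDB M p' m :=
  TensorProduct.add_tmul p p' m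

theorem smul_inner (M : GrMod 𝒜) (d : D) (p : B) (m : M.carrier) :
    inner hAB hDB M (d • p) m = d • inner hAB hDB M p m :=
  congrArg (· ⊗ₜ[A] m) (Algebra.smul_def d p)

/-- The element `s ⊗ (p ⊗ m)` attached to `p ⊗ s` and `m`. -/
def place (M : GrMod 𝒜) : (B ⊗[D] B) →+ (M.carrier →+ ((loop hAB hDB).obj M).carrier) :=
  TensorProduct.liftAddHom
    (AddMonoidHom.mk' (fun p => AddMonoidHom.mk' (fun s => AddMonoidHom.mk'
        (fun m => (s ⊗ₜ[D] inner hAB hDB M p m :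
          B ⊗[D] (resObj 𝒟 hDB (indObj ℬ hAB M)).carrier))
        fun m m' => (congrArg (s ⊗ₜ[D] ·) (inner_add hAB hDB M p m m')).trans
          (TensorProduct.tmul_add _ _ _))
        fun s s' => AddMonoidHom.ext fun m => TensorProduct.add_tmul _ _ _)
      fun p p' => AddMonoidHom.ext fun s => AddMonoidHom.ext fun m =>
        (congrArg (s ⊗ₜ[D] ·) (add_inner hAB hDB M p p' m)).trans (TensorProduct.tmul_add _ _ _))
    fun d p s => AddMonoidHom.ext fun m => by
      change s ⊗ₜ[D] inner hAB hDB M (d • p) m = (d • s) ⊗ₜ[D] inner hAB hDB M p m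
      rw [smul_inner, TensorProduct.smul_tmul]

theorem place_tmul (M : GrMod 𝒜) (p s : B) (m : M.carrier) :
    place hAB hDB M (p ⊗ₜ[D] s) m = s ⊗ₜ[D] inner hAB hDB M p m := rfl

theorem place_inA (M : GrMod 𝒜) (a : A) (w : B ⊗[D] B) (m : M.carrier) :
    place hAB hDB M (inA a * w) m = place hAB hDB M w (a • m) := by
  induction w using TensorProduct.induction_on with
  | zero => rw [mul_zero, map_zero]; rfl
  | add x y hx hy =>
    rw [mul_add, map_add, AddMonoidHom.add_apply, hx, hy, map_add, AddMonoidHom.add_apply]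
  | tmul p s =>
    rw [inA_apply, Algebra.TensorProduct.tmul_mul_tmul, one_mul, place_tmul, place_tmul,
      ← Algebra.smul_def]
    exact congrArg (fun x : (resObj 𝒟 hDB (indObj ℬ hAB M)).carrier => s ⊗ₜ[D] x)
      (TensorProduct.smul_tmul (R := A) a p m)

theorem place_outA (M : GrMod 𝒜) (a : A) (w : B ⊗[D] B) (m : M.carrier) :
    place hAB hDB M (outA a * w) m = a • place hAB hDB M w m := by
  induction w using TensorProduct.induction_on with
  | zero => rw [mul_zero, map_zero]; exact (smul_zero (A := ((loop hAB hDB).obj M).carrier) a).symm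
  | add x y hx hy =>
    rw [mul_add, map_add, AddMonoidHom.add_apply, hx, hy, map_add, AddMonoidHom.add_apply,
      smul_add]
  | tmul p s =>
    rw [outA_apply, Algebra.TensorProduct.tmul_mul_tmul, one_mul]
    rfl

theorem place_mem (M : GrMod 𝒜) {d k e : ℤ} {w : B ⊗[D] B} {m : M.carrier} (hw : w ∈ tdeg D ℬ d)
    (hm : m ∈ M.deg k) (h : d + k = e) :
    place hAB hDB M w m ∈ ((loop hAB hDB).obj M).deg e := by
  induction hw using Submodule.span_induction with
  | zero => rw [map_zero]; exact Submodule.zero_mem _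
  | add x y _ _ hx hy => rw [map_add]; exact Submodule.add_mem _ hx hy
  | smul c x _ hx =>
    -- The complex scalar is written as an element of A acting on the second factor, so that
    -- `place_outA` can move it outside.
    have h1 : c • x = outA (algebraMap ℂ A c) * x := by
      rw [outA_apply, ← IsScalarTower.algebraMap_apply, IsScalarTower.algebraMap_apply ℂ D B,
        Algebra.algebraMap_eq_smul_one (A := B), ← TensorProduct.smul_tmul,
        ← Algebra.algebraMap_eq_smul_one, ← IsScalarTower.algebraMap_apply]
      exact Algebra.smul_def c x
    rw [h1, place_outA, algebraMap_smul]
    exact Submodule.smul_mem _ c hx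
  | mem t ht =>
    obtain ⟨i, j, p, s, hd, hp, hs, rfl⟩ := ht
    exact tmul_mem_indDeg (M := resObj 𝒟 hDB (indObj ℬ hAB M)) hs
      (tmul_mem_indDeg (M := M) hp hm (d := i + k) rfl) (by omega)

/-- The elements coming from the bimodule and M generate the composite additively. Morphisms out of
the composite are determined on them, and `glueHom` constructs morphisms from their values there. -/
theorem place_induction {M : GrMod 𝒜} {S : AddSubgroup ((loop hAB hDB).obj M).carrier}
    (h : ∀ w m, place hAB hDB M w m ∈ S) (t : ((loop hAB hDB).obj M).carrier) : t ∈ S := by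
  induction t using TensorProduct.induction_on with
  | zero => exact S.zero_mem
  | add x y hx hy => exact S.add_mem hx hy
  | tmul s n =>
    refine TensorProduct.induction_on
      (motive := fun n : (resObj 𝒟 hDB (indObj ℬ hAB M)).carrier => s ⊗ₜ[D] n ∈ S) n ?_
      (fun p m => h (p ⊗ₜ s) m) fun x y hx hy => ?_
    · exact (congrArg (· ∈ S) (TensorProduct.tmul_zero _ _)).mpr S.zero_mem
    · exact (congrArg (· ∈ S) (TensorProduct.tmul_add
        (N := (resObj 𝒟 hDB (indObj ℬ hAB M)).carrier) s x y)).mpr (S.add_mem hx hy)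

section Glue

variable {M N : GrMod 𝒜} (ψ : (B ⊗[D] B) →+ (M.carrier →+ N.carrier))
  (hin : ∀ (a : A) (w : B ⊗[D] B) (m : M.carrier), ψ (inA a * w) m = ψ w (a • m))
  (hout : ∀ (a : A) (w : B ⊗[D] B) (m : M.carrier), ψ (outA a * w) m = a • ψ w m)

/-- Extension of a balanced map. -/
def glueAux (s : B) : (resObj 𝒟 hDB (indObj ℬ hAB M)).carrier →+ N.carrier :=
  TensorProduct.liftAddHom (M := B) (N := M.carrier)
    (AddMonoidHom.mk' (fun p => ψ (p ⊗ₜ[D] s)) fun p p' => by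
      rw [TensorProduct.add_tmul, map_add])
    fun a p m => by
      have h := hin a (p ⊗ₜ[D] s) m
      rw [inA_apply, Algebra.TensorProduct.tmul_mul_tmul, one_mul, ← Algebra.smul_def] at h
      exact h

theorem glueAux_inner (s p : B) (m : M.carrier) :
    glueAux hAB hDB ψ hin s (inner hAB hDB M p m) = ψ (p ⊗ₜ[D] s) m := rfl

theorem inner_induction {P : (resObj 𝒟 hDB (indObj ℬ hAB M)).carrier → Prop} (h0 : P 0)
    (hadd : ∀ x y, P x → P y → P (x + y)) (h : ∀ p m, P (inner hAB hDB M p m))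
    (n : (resObj 𝒟 hDB (indObj ℬ hAB M)).carrier) : P n :=
  TensorProduct.induction_on (motive := P) n h0 h hadd

/-- Extension of a balanced map. -/
def glue : ((loop hAB hDB).obj M).carrier →+ N.carrier :=
  TensorProduct.liftAddHom (M := B) (N := (resObj 𝒟 hDB (indObj ℬ hAB M)).carrier)
    (AddMonoidHom.mk' (fun s => glueAux hAB hDB ψ hin s) fun s s' => AddMonoidHom.ext fun n => by
      induction n using inner_induction hAB hDB with
      | h0 => rw [map_zero, map_zero]
      | hadd x y hx hy => rw [map_add, map_add, hx, hy]
      | h p m =>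
        rw [AddMonoidHom.add_apply, glueAux_inner, glueAux_inner, glueAux_inner,
          TensorProduct.tmul_add, map_add, AddMonoidHom.add_apply])
    fun d s n => by
      change glueAux hAB hDB ψ hin (d • s) n = glueAux hAB hDB ψ hin s (d • n)
      induction n using inner_induction hAB hDB with
      | h0 => rw [smul_zero, map_zero, map_zero]
      | hadd x y hx hy => rw [smul_add, map_add, map_add, hx, hy]
      | h p m =>
        rw [← smul_inner, glueAux_inner, glueAux_inner, TensorProduct.smul_tmul]

theorem glue_place (w : B ⊗[D] B) (m : M.carrier) :
    glue hAB hDB ψ hin (place hAB hDB M w m) = ψ w m := by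
  induction w using TensorProduct.induction_on with
  | zero => rw [map_zero, map_zero, AddMonoidHom.zero_apply, AddMonoidHom.zero_apply, map_zero]
  | add x y hx hy =>
    rw [map_add, AddMonoidHom.add_apply, map_add, hx, hy, map_add, AddMonoidHom.add_apply]
  | tmul p s => rfl

theorem glue_smul (hout : ∀ (a : A) (w : B ⊗[D] B) (m : M.carrier), ψ (outA a * w) m = a • ψ w m)
    (a : A) (t : ((loop hAB hDB).obj M).carrier) :
    glue hAB hDB ψ hin (a • t) = a • glue hAB hDB ψ hin t := by
  let S : AddSubgroup ((loop hAB hDB).obj M).carrier :=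
    { carrier := {t | glue hAB hDB ψ hin (a • t) = a • glue hAB hDB ψ hin t}
      add_mem' := fun {x y} hx hy => by
        simp only [Set.mem_ofPred_eq] at hx hy ⊢
        rw [smul_add, map_add, map_add, hx, hy, smul_add]
      zero_mem' := by
        simp only [Set.mem_ofPred_eq]
        rw [smul_zero, map_zero, smul_zero]
      neg_mem' := fun {x} hx => by
        simp only [Set.mem_ofPred_eq] at hx ⊢
        rw [smul_neg, map_neg, map_neg, hx, smul_neg] }
  exact place_induction hAB hDB (S := S) (fun w m => by
    change glue hAB hDB ψ hin (a • _) = _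
    rw [← place_outA, glue_place, glue_place, hout]) t

/-- Extension of a balanced map of bimodules to a morphism of graded modules. -/
def glueHom (hdeg : ∀ (i j k : ℤ) (p s : B) (m : M.carrier), p ∈ ℬ i → s ∈ ℬ j → m ∈ M.deg k →
    ψ (p ⊗ₜ[D] s) m ∈ N.deg (i + j + k)) : (loop hAB hDB).obj M ⟶ N :=
  mkHom (M := (loop hAB hDB).obj M) (N := N)
    { toFun := glue hAB hDB ψ hin
      map_add' := map_add _
      map_smul' := glue_smul hAB hDB ψ hin hout }
    fun d t ht => by
      have hC : ∀ (c : ℂ) (t : ((loop hAB hDB).obj M).carrier),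
          glue hAB hDB ψ hin (c • t) = c • glue hAB hDB ψ hin t := fun c t => by
        rw [← algebraMap_smul A c t, glue_smul hAB hDB ψ hin hout, algebraMap_smul]
      refine mem_of_indDeg (M := resObj 𝒟 hDB (indObj ℬ hAB M)) (N.deg d) (glue hAB hDB ψ hin) hC
        (fun j l s n hjl hs hn => ?_) ht
      refine mem_of_indDeg (M := M) (N.deg d) (glueAux hAB hDB ψ hin s) (fun c n => ?_)
        (fun i k p m hik hp hm => ?_) hn
      · have h1 := hC c (s ⊗ₜ[D] (show (resObj 𝒟 hDB (indObj ℬ hAB M)).carrier from n))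
        refine Eq.trans ?_ h1
        refine congrArg (glue hAB hDB ψ hin) (?_ : s ⊗ₜ[D] (c •
          (show (resObj 𝒟 hDB (indObj ℬ hAB M)).carrier from n)) = _)
        exact TensorProduct.tmul_smul c s _
      · have := hdeg i j k p s m hp hs hm
        rwa [show i + j + k = d by omega] at this

theorem lin_glueHom (hdeg) (t : ((loop hAB hDB).obj M).carrier) :
    lin (glueHom hAB hDB ψ hin hout hdeg) t = glue hAB hDB ψ hin t := rfl

end Glue

theorem loop_map_place {M N : GrMod 𝒜} (f : M ⟶ N) (w : B ⊗[D] B) (m : M.carrier) :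
    lin ((loop hAB hDB).map f) (place hAB hDB M w m) = place hAB hDB N w (lin f m) := by
  induction w using TensorProduct.induction_on with
  | zero => rw [map_zero, map_zero, AddMonoidHom.zero_apply, AddMonoidHom.zero_apply, map_zero]
  | add x y hx hy =>
    rw [map_add, map_add, AddMonoidHom.add_apply, map_add, hx, hy, AddMonoidHom.add_apply]
  | tmul p s => rfl

theorem loop_hom_ext {M N : GrMod 𝒜} {f g : (loop hAB hDB).obj M ⟶ N}
    (h : ∀ w m, lin f (place hAB hDB M w m) = lin g (place hAB hDB M w m)) : f = g :=
  hom_ext fun t => place_induction hAB hDB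
    (S := (lin f - lin g).toAddMonoidHom.ker) (fun w m => sub_eq_zero.2 (h w m)) t |> sub_eq_zero.1

end Loop

/-! ### Comparison and coordinate transformations -/

section Trans

open GrMod

variable (Z : CrossData 𝒜 ℬ ℬ' 𝒟 𝒟')
  (hAB : ∀ (i : ℤ) (a : A), a ∈ 𝒜 i → algebraMap A B a ∈ ℬ i)
  (hDB : ∀ (i : ℤ) (a : D), a ∈ 𝒟 i → algebraMap D B a ∈ ℬ i)
  (hAB' : ∀ (i : ℤ) (a : A), a ∈ 𝒜 i → algebraMap A B' a ∈ ℬ' i)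
  (hDB' : ∀ (i : ℤ) (a : D'), a ∈ 𝒟' i → algebraMap D' B' a ∈ ℬ' i)

/-- The comparison of the two loops. -/
def crossTrans : loop hAB hDB ⟶ loop hAB' hDB' where
  app M := glueHom hAB hDB (N := (loop hAB' hDB').obj M) ((place hAB' hDB' M).comp Z.cross)
    (fun a w m => by
      rw [AddMonoidHom.comp_apply, cross_inA, place_inA]; rfl)
    (fun a w m => by
      rw [AddMonoidHom.comp_apply, cross_outA, place_outA]; rfl)
    fun i j k p s m hp hs hm => place_mem hAB' hDB' M (Z.cross_mem hAB hAB' hDB hp hs) hm rfl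
  naturality M N f := loop_hom_ext hAB hDB fun w m => by
    rw [lin_comp, lin_comp, LinearMap.comp_apply, LinearMap.comp_apply, loop_map_place,
      lin_glueHom, lin_glueHom, glue_place, glue_place]
    exact (loop_map_place hAB' hDB' f _ m).symm

theorem crossTrans_place (M : GrMod 𝒜) (w : B ⊗[D] B) (m : M.carrier) :
    lin ((Z.crossTrans hAB hDB hAB' hDB').app M) (place hAB hDB M w m) =
      place hAB' hDB' M (Z.cross w) m := glue_place _ _ _ _ _ _

/-- The coordinates of the product, as maps of bimodules. -/
def coordAux (P : PowExt 𝒜 ℬ) (M : GrMod 𝒜) (k : Fin P.m) :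
    (B ⊗[D] B) →+ (M.carrier →+ M.carrier) :=
  AddMonoidHom.mk' (fun w => DistribSMul.toAddMonoidHom M.carrier
      (P.basis.repr (Algebra.TensorProduct.lmul' D (S := B) w) k))
    fun w w' => AddMonoidHom.ext fun m => by
      rw [map_add, map_add, Finsupp.add_apply]
      exact add_smul _ _ m

theorem coordAux_apply (P : PowExt 𝒜 ℬ) (M : GrMod 𝒜) (k : Fin P.m) (w : B ⊗[D] B) (m : M.carrier) :
    coordAux P M k w m = P.basis.repr (Algebra.TensorProduct.lmul' D (S := B) w) k • m := rfl

/-- Treats both actions of A at once: multiplication B ⊗ B → B takes `inA a` and `outA a` to the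
same element. -/
theorem coordAux_mul (P : PowExt 𝒜 ℬ) (M : GrMod 𝒜) (k : Fin P.m) (w v : B ⊗[D] B) (a : A)
    (hv : Algebra.TensorProduct.lmul' D (S := B) v = algebraMap A B a) (m : M.carrier) :
    coordAux P M k (v * w) m = a • coordAux P M k w m := by
  rw [coordAux_apply, coordAux_apply, map_mul, hv, ← Algebra.smul_def, map_smul,
    Finsupp.smul_apply, smul_eq_mul, mul_smul]

/-- The coordinates of the product, as natural transformations. -/
def coordTrans (P : PowExt 𝒜 ℬ) (k : Fin P.m) :
    loop hAB hDB ⟶ shift 𝒜 (2 * ((k : ℕ) : ℤ)) where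
  app M := glueHom hAB hDB (M := M) (N := shiftObj (2 * ((k : ℕ) : ℤ)) M) (coordAux P M k)
    (fun a w m => by
      refine (coordAux_mul P M k w _ a ?_ m).trans ?_
      · rw [inA_apply, Algebra.TensorProduct.lmul'_apply_tmul, mul_one]
      · rw [coordAux_apply, smul_comm]; rfl)
    (fun a w m => coordAux_mul P M k w _ a (by
      rw [outA_apply, Algebra.TensorProduct.lmul'_apply_tmul, one_mul]) m)
    fun i j l p s m hp hs hm => by
      have h1 := P.repr_mem hAB (SetLike.mul_mem_graded hp hs) k
      have h2 := M.smul_mem _ _ _ _ h1 hm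
      change _ ∈ M.deg (i + j + l - 2 * ((k : ℕ) : ℤ))
      rw [show i + j + l - 2 * ((k : ℕ) : ℤ) = i + j - 2 * ((k : ℕ) : ℤ) + l by ring]
      exact h2
  naturality M N f := loop_hom_ext hAB hDB fun w m => by
    refine (congrArg (glue hAB hDB (N := shiftObj (2 * ((k : ℕ) : ℤ)) N) (coordAux P N k) _)
      (loop_map_place hAB hDB f w m)).trans ?_
    refine (glue_place hAB hDB (N := shiftObj (2 * ((k : ℕ) : ℤ)) N) (coordAux P N k) _ w (lin f m)).trans ?_
    exact ((lin f).map_smul _ m).symm.trans (congrArg (lin f)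
      (glue_place hAB hDB (N := shiftObj (2 * ((k : ℕ) : ℤ)) M) (coordAux P M k) _ w m).symm)

theorem coordTrans_place (P : PowExt 𝒜 ℬ) (k : Fin P.m) (M : GrMod 𝒜) (w : B ⊗[D] B)
    (m : M.carrier) : lin ((coordTrans hAB hDB P k).app M) (place hAB hDB M w m) =
      P.basis.repr (Algebra.TensorProduct.lmul' D (S := B) w) k • m := glue_place _ _ _ _ _ _

theorem finrank_loop (P : PowExt 𝒜 ℬ) (R : PowExt 𝒟 ℬ) (M : GrMod 𝒜) :
    Module.finrank ℂ ((loop hAB hDB).obj M).carrier =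
      R.m * (P.m * Module.finrank ℂ M.carrier) :=
  (finrank_ind R (resObj 𝒟 hDB (indObj ℬ hAB M))).trans
    (congrArg (R.m * ·) (finrank_ind P M))

/-- The comparison map and the upper coordinates identify the larger loop with the sum of
the smaller one and of shifts. -/
theorem cross_bijective (hle : Z.P'.m ≤ Z.P.m) (M : GrMod 𝒜) : Function.Bijective
    (fun t : ((loop hAB hDB).obj M).carrier =>
      ((lin ((Z.crossTrans hAB hDB hAB' hDB').app M) t : ((loop hAB' hDB').obj M).carrier),
        fun k : Fin (Z.P.m - Z.P'.m) => (lin ((coordTrans hAB hDB Z.P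
          ⟨Z.P.m - 1 - k, by omega⟩).app M) t : M.carrier))) := by
  let J : ((loop hAB hDB).obj M).carrier →ₗ[ℂ]
      ((loop hAB' hDB').obj M).carrier × (Fin (Z.P.m - Z.P'.m) → M.carrier) :=
    ((lin ((Z.crossTrans hAB hDB hAB' hDB').app M)).restrictScalars ℂ).prod
      (LinearMap.pi fun k : Fin (Z.P.m - Z.P'.m) =>
        ((lin ((coordTrans hAB hDB Z.P ⟨Z.P.m - 1 - k, by omega⟩).app M)).restrictScalars ℂ :
          _ →ₗ[ℂ] M.carrier))
  change Function.Bijective J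
  have hf1 := finiteC ((loop hAB hDB).obj M)
  have hf2 := finiteC ((loop hAB' hDB').obj M)
  have hf3 := finiteC M
  have hsurj : Function.Surjective J := by
    have h1 : ∀ w (e : Fin (Z.P.m - Z.P'.m) → A) m, (place hAB' hDB' M w m, fun k => e k • m) ∈ LinearMap.range J := by
      intro w e m
      -- The m-m' upper coordinates are numbered downwards from m-1; the values prescribed for the
      -- lower coordinates play no role and are set to zero.
      obtain ⟨w₁, hw, he⟩ := Z.cross_surjective hle w fun k : Fin Z.P.m =>
        if h : Z.P.m - 1 - k < Z.P.m - Z.P'.m then e ⟨Z.P.m - 1 - k, h⟩ else 0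
      refine ⟨place hAB hDB M w₁ m, Prod.ext ?_ (funext fun k => ?_)⟩
      · exact (Z.crossTrans_place hAB hDB hAB' hDB' M w₁ m).trans (by rw [hw])
      · refine (coordTrans_place hAB hDB Z.P _ M w₁ m).trans ?_
        have hk := k.2
        rw [he ⟨Z.P.m - 1 - k, by omega⟩ (by simp only []; omega), dif_pos (by simp only []; omega)]
        have : (⟨Z.P.m - 1 - (⟨Z.P.m - 1 - (k : ℕ), by omega⟩ : Fin Z.P.m), by
          simp only []; omega⟩ : Fin (Z.P.m - Z.P'.m)) = k := Fin.ext (by simp only []; omega)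
        rw [this]
    rintro ⟨n, e⟩
    have h2 : ∀ n, (n, (0 : Fin (Z.P.m - Z.P'.m) → M.carrier)) ∈ LinearMap.range J := fun n =>
      place_induction hAB' hDB'
        (S := ((LinearMap.range J).comap (LinearMap.inl ℂ _ _)).toAddSubgroup) (fun w m => by
          have := h1 w 0 m
          simp only [Pi.zero_apply, zero_smul] at this
          exact this) n
    have h3 : ∀ k m, ((0 : ((loop hAB' hDB').obj M).carrier), Pi.single k m) ∈
        LinearMap.range J := fun k m => by
      have := h1 0 (Pi.single k 1) m
      have h5 : (fun l => Pi.single (M := fun _ => A) k 1 l • m) =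
          Pi.single (M := fun _ => M.carrier) k m := by
        funext l
        by_cases hl : l = k
        · subst hl; simp
        · simp [hl]
      rw [map_zero, h5] at this
      exact this
    have h4 : ((n, e) : ((loop hAB' hDB').obj M).carrier × (Fin (Z.P.m - Z.P'.m) → M.carrier)) =
        (n, 0) + ∑ k, ((0 : ((loop hAB' hDB').obj M).carrier), Pi.single k (e k)) := by
      refine Prod.ext ?_ ?_
      · rw [Prod.fst_add, Prod.fst_sum, Finset.sum_const_zero, add_zero]
      · rw [Prod.snd_add, Prod.snd_sum, zero_add, Finset.univ_sum_single]
    rw [h4]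
    exact Submodule.add_mem _ (h2 n) (Submodule.sum_mem _ fun k _ => h3 k _)
  -- The dimensions agree because (m'+1)m = (m+1)m' + (m-m').
  refine ⟨(LinearMap.injective_iff_surjective_of_finrank_eq_finrank ?_).2 hsurj, hsurj⟩
  rw [Module.finrank_prod, finrank_loop hAB hDB Z.P Z.R, finrank_loop hAB' hDB' Z.P' Z.R',
    Module.finrank_pi_fintype, Finset.sum_const, Finset.card_univ, Fintype.card_fin, Z.m_eq,
    Z.m_eq', smul_eq_mul, ← mul_assoc, ← mul_assoc, ← add_mul]
  congr 1
  obtain ⟨c, hc⟩ := Nat.exists_eq_add_of_le hle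
  rw [hc, Nat.add_sub_cancel_left]
  ring

end Trans

end CrossData

end

end SlTwoCat

open CategoryTheory CategoryTheory.Limits
open scoped TensorProduct LaurentPolynomial

namespace SlTwoCat

noncomputable section

set_option linter.unusedSectionVars false

/-! ## The rings of the two-step flag varieties -/

section FlagRings

variable (n : ℕ)

/-- The first `t` indices. -/
def lowSet (t : ℕ) : Finset (Fin n) := Finset.univ.filter fun j => (j : ℕ) < t

/-- The indices from `t` on. -/
def highSet (t : ℕ) : Finset (Fin n) := Finset.univ.filter fun j => t ≤ (j : ℕ)

/-- A power sum. -/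
def psumOn (s : Finset (Fin n)) (N : ℕ) : MvPolynomial (Fin n) ℂ := ∑ j ∈ s, MvPolynomial.X j ^ N

variable {n}

theorem mem_lowSet {t : ℕ} {j : Fin n} : j ∈ lowSet n t ↔ (j : ℕ) < t := by simp [lowSet]

theorem mem_highSet {t : ℕ} {j : Fin n} : j ∈ highSet n t ↔ t ≤ (j : ℕ) := by simp [highSet]

theorem psumOn_mem {I : Set ℕ} {s : Finset (Fin n)}
    (h : ∀ e ∈ young n I, ∀ j, e j ∈ s ↔ j ∈ s) (N : ℕ) : psumOn n s N ∈ polyInv n I := by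
  intro e he
  rw [psumOn, map_sum]
  simp only [map_pow, MvPolynomial.rename_X]
  exact Finset.sum_bij (fun k _ => e k) (fun k hk => (h e he k).2 hk)
    (fun _ _ _ _ h => e.injective h)
    (fun k hk => ⟨e⁻¹ k, (h e he _).1 (by simpa using hk), by simp⟩) (fun _ _ => rfl)

theorem psumOn_low_mem {I : Set ℕ} {t : ℕ} (ht : t ∈ I) (N : ℕ) :
    psumOn n (lowSet n t) N ∈ polyInv n I :=
  psumOn_mem (fun e he j => by rw [mem_lowSet, mem_lowSet]; exact he t ht j) N

theorem psumOn_high_mem {I : Set ℕ} {t : ℕ} (ht : t ∈ I) (N : ℕ) :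
    psumOn n (highSet n t) N ∈ polyInv n I :=
  psumOn_mem (fun e he j => by
    rw [mem_highSet, mem_highSet, ← not_lt, ← not_lt]; exact not_congr (he t ht j)) N

theorem lowSet_succ {k : ℕ} (hk : k < n) : lowSet n (k + 1) = insert ⟨k, hk⟩ (lowSet n k) := by
  ext j
  rw [Finset.mem_insert, mem_lowSet, mem_lowSet, Fin.ext_iff]
  simp only
  omega

theorem notMem_lowSet {k : ℕ} (hk : k < n) : (⟨k, hk⟩ : Fin n) ∉ lowSet n k := by
  rw [mem_lowSet]; simp

theorem highSet_eq {k : ℕ} (hk : k < n) : highSet n k = insert ⟨k, hk⟩ (highSet n (k + 1)) := by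
  ext j
  rw [Finset.mem_insert, mem_highSet, mem_highSet, Fin.ext_iff]
  simp only
  omega

theorem notMem_highSet {k : ℕ} (hk : k < n) : (⟨k, hk⟩ : Fin n) ∉ highSet n (k + 1) := by
  rw [mem_highSet]; simp

theorem psumOn_low_succ {k : ℕ} (hk : k < n) (N : ℕ) : psumOn n (lowSet n (k + 1)) N =
    MvPolynomial.X ⟨k, hk⟩ ^ N + psumOn n (lowSet n k) N := by
  rw [psumOn, lowSet_succ hk, Finset.sum_insert (notMem_lowSet hk), psumOn]

theorem psumOn_high_eq {k : ℕ} (hk : k < n) (N : ℕ) : psumOn n (highSet n k) N =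
    MvPolynomial.X ⟨k, hk⟩ ^ N + psumOn n (highSet n (k + 1)) N := by
  rw [psumOn, highSet_eq hk, Finset.sum_insert (notMem_highSet hk), psumOn]

theorem card_lowSet {t : ℕ} (ht : t ≤ n) : (lowSet n t).card = t := by
  induction t with
  | zero => rw [Finset.card_eq_zero, Finset.eq_empty_iff_forall_notMem]; simp [mem_lowSet]
  | succ t ih => rw [lowSet_succ ht, Finset.card_insert_of_notMem (notMem_lowSet ht), ih (by omega)]

theorem card_highSet {t : ℕ} (ht : t ≤ n) : (highSet n t).card = n - t := by
  have h : highSet n t = (lowSet n t)ᶜ := by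
    ext j; rw [Finset.mem_compl, mem_highSet, mem_lowSet, not_lt]
  rw [h, Finset.card_compl, card_lowSet ht, Fintype.card_fin]

theorem col_singleton_eq {t : ℕ} {j l : Fin n} :
    col n {t} l = col n {t} j ↔ ((l : ℕ) < t ↔ (j : ℕ) < t) := by
  simp only [col, Set.ext_iff, Set.mem_singleton_iff, Set.mem_ofPred_eq]
  constructor
  · intro h; simpa using h t
  · rintro h i
    constructor
    · rintro ⟨rfl, h'⟩; exact ⟨rfl, h.1 h'⟩
    · rintro ⟨rfl, h'⟩; exact ⟨rfl, h.2 h'⟩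

theorem col_pair_eq {s t : ℕ} {j l : Fin n} : col n {s, t} l = col n {s, t} j ↔
    ((l : ℕ) < s ↔ (j : ℕ) < s) ∧ ((l : ℕ) < t ↔ (j : ℕ) < t) := by
  simp only [col, Set.ext_iff, Set.mem_insert_iff, Set.mem_singleton_iff, Set.mem_ofPred_eq]
  constructor
  · intro h; exact ⟨by simpa using h s, by simpa using h t⟩
  · rintro ⟨h, h2⟩ i
    constructor
    · rintro ⟨rfl | rfl, h'⟩
      · exact ⟨Or.inl rfl, h.1 h'⟩
      · exact ⟨Or.inr rfl, h2.1 h'⟩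
    · rintro ⟨rfl | rfl, h'⟩
      · exact ⟨Or.inl rfl, h.2 h'⟩
      · exact ⟨Or.inr rfl, h2.2 h'⟩

theorem orbit_low {t : ℕ} {j : Fin n} (h : (j : ℕ) < t) : orbit n {t} j = lowSet n t := by
  ext l
  rw [mem_orbit, col_singleton_eq, mem_lowSet]
  tauto

theorem orbit_high {t : ℕ} {j : Fin n} (h : t ≤ (j : ℕ)) : orbit n {t} j = highSet n t := by
  ext l
  rw [mem_orbit, col_singleton_eq, mem_highSet]
  omega

theorem orbit_pair_low {k : ℕ} {j : Fin n} (h : (j : ℕ) < k) :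
    orbit n {k, k + 1} j = lowSet n k := by
  ext l
  rw [mem_orbit, col_pair_eq, mem_lowSet]
  omega

theorem orbit_pair_high {k : ℕ} {j : Fin n} (h : k < (j : ℕ)) :
    orbit n {k, k + 1} j = highSet n (k + 1) := by
  ext l
  rw [mem_orbit, col_pair_eq, mem_highSet]
  omega

theorem orbit_pair_mid {k : ℕ} (hk : k < n) : orbit n {k, k + 1} ⟨k, hk⟩ = {⟨k, hk⟩} := by
  ext l
  rw [mem_orbit, col_pair_eq, Finset.mem_singleton, Fin.ext_iff]
  simp only
  omega

theorem orbitPsum_pair_mid {k : ℕ} (hk : k < n) (a : ℕ) :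
    orbitPsum n {k, k + 1} ⟨k, hk⟩ a = MvPolynomial.X ⟨k, hk⟩ ^ a := by
  rw [orbitPsum, orbit_pair_mid, Finset.sum_singleton]

theorem X_mem_pair {k : ℕ} (hk : k < n) : MvPolynomial.X ⟨k, hk⟩ ∈ polyInv n {k, k + 1} := by
  have := orbitPsum_mem (n := n) (I := {k, k + 1}) ⟨k, hk⟩ 1
  rwa [orbitPsum_pair_mid, pow_one] at this

/-- With indices from zero, the orbits of W_{k,k+1} are the indices below k, the index k and the
indices above k. Over W_k the last two are merged, and over W_{k+1} the first two. -/
theorem addsVar_up {k : ℕ} (hk : k < n) : AddsVar n {k} {k, k + 1} ⟨k, hk⟩ where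
  sub := by simp
  mem := X_mem_pair hk
  psum j := by
    rcases lt_trichotomy (j : ℕ) k with h | h | h
    · refine Or.inl fun a => ?_
      rw [orbitPsum, orbit_pair_low h]
      exact psumOn_low_mem (Set.mem_singleton k) a
    · refine Or.inr (Or.inl fun a => ?_)
      rw [show j = ⟨k, hk⟩ from Fin.ext h, orbitPsum_pair_mid]
    · refine Or.inr (Or.inr fun a => ?_)
      rw [orbitPsum, orbit_pair_high h, orbitPsum, orbit_high (le_refl k)]
      exact (add_comm _ _).trans (psumOn_high_eq hk a).symm

theorem addsVar_down {k : ℕ} (hk : k < n) : AddsVar n {k + 1} {k, k + 1} ⟨k, hk⟩ where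
  sub := by simp
  mem := X_mem_pair hk
  psum j := by
    rcases lt_trichotomy (j : ℕ) k with h | h | h
    · refine Or.inr (Or.inr fun a => ?_)
      rw [orbitPsum, orbit_pair_low h, orbitPsum, orbit_low (Nat.lt_succ_self k)]
      exact (add_comm _ _).trans (psumOn_low_succ hk a).symm
    · refine Or.inr (Or.inl fun a => ?_)
      rw [show j = ⟨k, hk⟩ from Fin.ext h, orbitPsum_pair_mid]
    · refine Or.inl fun a => ?_
      rw [orbitPsum, orbit_pair_high h]
      exact psumOn_high_mem (Set.mem_singleton (k + 1)) a

instance algebraUp (n k : ℕ) : Algebra (C n {k}) (C n {k, k + 1}) := inclAlg n (by simp)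

instance algebraDown (n k : ℕ) : Algebra (C n {k + 1}) (C n {k, k + 1}) := inclAlg n (by simp)

instance (n k : ℕ) : SMul (C n {k}) (C n {k, k + 1}) := (algebraUp n k).toSMul

instance (n k : ℕ) : SMul (C n {k + 1}) (C n {k, k + 1}) := (algebraDown n k).toSMul

instance (n k : ℕ) : IsScalarTower ℂ (C n {k}) (C n {k, k + 1}) :=
  IsScalarTower.of_algebraMap_eq fun _ => rfl

instance (n k : ℕ) : IsScalarTower ℂ (C n {k + 1}) (C n {k, k + 1}) :=
  IsScalarTower.of_algebraMap_eq fun _ => rfl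

theorem degUp (n k : ℕ) : ∀ (i : ℤ) (a : C n {k}), a ∈ deg n {k} i →
    algebraMap (C n {k}) (C n {k, k + 1}) a ∈ deg n {k, k + 1} i := fun _ _ h => h

theorem degDown (n k : ℕ) : ∀ (i : ℤ) (a : C n {k + 1}), a ∈ deg n {k + 1} i →
    algebraMap (C n {k + 1}) (C n {k, k + 1}) a ∈ deg n {k, k + 1} i := fun _ _ h => h

/-- The class of the variable which is added. -/
def midVar {k : ℕ} (hk : k < n) : C n {k, k + 1} := (addsVar_up hk).var

theorem midVar_mem {k : ℕ} (hk : k < n) : midVar hk ∈ deg n {k, k + 1} 2 :=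
  ⟨MvPolynomial.X ⟨k, hk⟩, MvPolynomial.isWeightedHomogeneous_X ℂ (wt n) _, rfl⟩

/-- The extension of `C^k` given by `C^{k,k+1}`. -/
def powUp {k : ℕ} (hk : k < n) : PowExt (deg n {k}) (deg n {k, k + 1}) where
  x := midVar hk
  m := n - k
  m_pos := by omega
  x_mem := midVar_mem hk
  basis := (addsVar_up hk).exists_basis.choose.reindex (finCongr (by
    rw [orbit_high (le_refl k), card_highSet hk.le]))
  basis_apply l := by
    rw [Module.Basis.reindex_apply]
    exact (addsVar_up hk).exists_basis.choose_spec _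

/-- The extension of `C^{k+1}` given by `C^{k,k+1}`. -/
def powDown {k : ℕ} (hk : k < n) : PowExt (deg n {k + 1}) (deg n {k, k + 1}) where
  x := midVar hk
  m := k + 1
  m_pos := by omega
  x_mem := midVar_mem hk
  basis := (addsVar_down hk).exists_basis.choose.reindex (finCongr (by
    rw [orbit_low (Nat.lt_succ_self k), card_lowSet hk]))
  basis_apply l := by
    rw [Module.Basis.reindex_apply]
    exact (addsVar_down hk).exists_basis.choose_spec _

instance (n : ℕ) (I : Set ℕ) : Nontrivial (C n I) := (aug n I).toRingHom.domain_nontrivial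

instance (n : ℕ) : Nontrivial (Coinv n) := (coinvAug n).toRingHom.domain_nontrivial

/-- The class of a variable in the coinvariant algebra. -/
def cx (j : Fin n) : Coinv n := Ideal.Quotient.mk (symIdeal n) (MvPolynomial.X j)

/-- The monic polynomial over `C^J` whose roots are the variables in an orbit. -/
def orbPoly (n : ℕ) (J : Set ℕ) (j : Fin n) : Polynomial (C n J) :=
  (exists_monic n J j).choose.map (invMk (n := n) (I := J)).toRingHom

theorem orbPoly_monic (J : Set ℕ) (j : Fin n) : (orbPoly n J j).Monic :=
  (exists_monic n J j).choose_spec.1.map _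

theorem orbPoly_natDegree (J : Set ℕ) (j : Fin n) :
    (orbPoly n J j).natDegree = (orbit n J j).card := by
  rw [orbPoly, (exists_monic n J j).choose_spec.1.natDegree_map,
    (exists_monic n J j).choose_spec.2.1]

theorem orbPoly_map (J : Set ℕ) (j : Fin n) : (orbPoly n J j).map (C n J).val.toRingHom =
    ∏ l ∈ orbit n J j, (Polynomial.X - Polynomial.C (cx l)) := by
  have h := congrArg (Polynomial.map (Ideal.Quotient.mk (symIdeal n)))
    (exists_monic n J j).choose_spec.2.2
  rw [orbPoly, Polynomial.map_map]
  rw [Polynomial.map_map, Polynomial.map_prod] at h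
  refine Eq.trans ?_ (h.trans ?_)
  · rfl
  · exact Finset.prod_congr rfl fun l _ => by simp [cx]

theorem map_val_injective (I : Set ℕ) : Function.Injective
    (Polynomial.map (C n I).val.toRingHom) := Polynomial.map_injective _ Subtype.val_injective

theorem adjoin_psum (I : Set ℕ) : Algebra.adjoin ℂ {s : C n I | ∃ j N,
    s = invMk ⟨orbitPsum n I j N, orbitPsum_mem j N⟩} = ⊤ := by
  rw [eq_top_iff]
  rintro y -
  obtain ⟨⟨p, hp⟩, rfl⟩ := invMk_surjective y
  have hp' := polyInv_le_psumAlg hp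
  -- The invariance of p is part of the statement proved by induction, since the class of p is only
  -- defined for invariant p.
  suffices h : ∃ hp : p ∈ polyInv n I, invMk ⟨p, hp⟩ ∈ Algebra.adjoin ℂ {s : C n I | ∃ j N,
      s = invMk ⟨orbitPsum n I j N, orbitPsum_mem j N⟩} from h.2
  clear hp
  induction hp' using Algebra.adjoin_induction with
  | mem p hp =>
    obtain ⟨j, N, rfl⟩ := hp
    exact ⟨orbitPsum_mem j N, Algebra.subset_adjoin ⟨j, N, rfl⟩⟩
  | algebraMap c =>
    refine ⟨Subalgebra.algebraMap_mem _ c, ?_⟩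
    have := Subalgebra.algebraMap_mem (Algebra.adjoin ℂ {s : C n I | ∃ j N,
      s = invMk ⟨orbitPsum n I j N, orbitPsum_mem j N⟩}) c
    rwa [← (invMk (n := n) (I := I)).commutes c] at this
  | add x y _ _ hx hy =>
    obtain ⟨h1, h2⟩ := hx
    obtain ⟨h3, h4⟩ := hy
    refine ⟨add_mem h1 h3, ?_⟩
    have := add_mem h2 h4
    rwa [← map_add] at this
  | mul x y _ _ hx hy =>
    obtain ⟨h1, h2⟩ := hx
    obtain ⟨h3, h4⟩ := hy
    refine ⟨mul_mem h1 h3, ?_⟩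
    have := mul_mem h2 h4
    rwa [← map_mul] at this

/-- Moving the cut from k to k+1 transfers the variable of index k from the upper group to the lower
one. -/
theorem psum_low_up {k : ℕ} (hk : k < n) (N : ℕ) :
    algebraMap (C n {k}) (C n {k, k + 1})
        (invMk ⟨psumOn n (lowSet n k) N, psumOn_low_mem (Set.mem_singleton _) N⟩) =
      algebraMap (C n {k + 1}) (C n {k, k + 1})
        (invMk ⟨psumOn n (lowSet n (k + 1)) N, psumOn_low_mem (Set.mem_singleton _) N⟩) -
        midVar hk ^ N := by
  refine Subtype.ext ?_
  change Ideal.Quotient.mk (symIdeal n) (psumOn n (lowSet n k) N) =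
    Ideal.Quotient.mk (symIdeal n) (psumOn n (lowSet n (k + 1)) N) -
    Ideal.Quotient.mk (symIdeal n) (MvPolynomial.X ⟨k, hk⟩) ^ N
  rw [← map_pow, ← map_sub, psumOn_low_succ hk, add_sub_cancel_left]

theorem psum_high_up {k : ℕ} (hk : k < n) (N : ℕ) :
    algebraMap (C n {k}) (C n {k, k + 1})
        (invMk ⟨psumOn n (highSet n k) N, psumOn_high_mem (Set.mem_singleton _) N⟩) =
      algebraMap (C n {k + 1}) (C n {k, k + 1})
        (invMk ⟨psumOn n (highSet n (k + 1)) N, psumOn_high_mem (Set.mem_singleton _) N⟩) +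
        midVar hk ^ N := by
  refine Subtype.ext ?_
  change Ideal.Quotient.mk (symIdeal n) (psumOn n (highSet n k) N) =
    Ideal.Quotient.mk (symIdeal n) (psumOn n (highSet n (k + 1)) N) +
    Ideal.Quotient.mk (symIdeal n) (MvPolynomial.X ⟨k, hk⟩) ^ N
  rw [← map_pow, ← map_add, psumOn_high_eq hk, add_comm]

/-- The sign z is 1 for power sums of the variables before the cut k+1 and -1 for those after it.
Moving the cut down removes a power of x from the former and adds it to the latter; moving it up
does the opposite with x'. -/
theorem gens_psum {k : ℕ} (hk : k + 1 < n) (s : C n {k + 1})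
    (hs : ∃ j N, s = invMk ⟨orbitPsum n {k + 1} j N, orbitPsum_mem j N⟩) : ∃ (N : ℕ) (z : ℂ),
    (∃ d : C n {k}, algebraMap (C n {k}) (C n {k, k + 1}) d =
      algebraMap (C n {k + 1}) (C n {k, k + 1}) s - z • midVar (Nat.lt_of_succ_lt hk) ^ N) ∧
    ∃ d : C n {k + 1 + 1}, algebraMap (C n {k + 1 + 1}) (C n {k + 1, k + 1 + 1}) d =
      algebraMap (C n {k + 1}) (C n {k + 1, k + 1 + 1}) s + z • midVar hk ^ N := by
  obtain ⟨j, N, rfl⟩ := hs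
  by_cases hj : (j : ℕ) < k + 1
  · have h : (⟨orbitPsum n {k + 1} j N, orbitPsum_mem j N⟩ : polyInv n {k + 1}) =
        ⟨psumOn n (lowSet n (k + 1)) N, psumOn_low_mem (Set.mem_singleton _) N⟩ :=
      Subtype.ext (congrArg (fun t => psumOn n t N) (orbit_low hj))
    rw [h]
    refine ⟨N, 1, ⟨_, (psum_low_up (Nat.lt_of_succ_lt hk) N).trans ?_⟩, _,
      (eq_add_of_sub_eq (psum_low_up hk N).symm).trans ?_⟩
    · rw [one_smul]
    · rw [one_smul]
  · rw [not_lt] at hj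
    have h : (⟨orbitPsum n {k + 1} j N, orbitPsum_mem j N⟩ : polyInv n {k + 1}) =
        ⟨psumOn n (highSet n (k + 1)) N, psumOn_high_mem (Set.mem_singleton _) N⟩ :=
      Subtype.ext (congrArg (fun t => psumOn n t N) (orbit_high hj))
    rw [h]
    refine ⟨N, -1, ⟨_, (psum_high_up (Nat.lt_of_succ_lt hk) N).trans ?_⟩, _,
      (eq_sub_of_add_eq (psum_high_up hk N).symm).trans ?_⟩
    · rw [neg_smul, one_smul, sub_neg_eq_add]
    · rw [neg_smul, one_smul, ← sub_eq_add_neg]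

open Polynomial in
/-- The extensions of `C^{k+1}` given by the neighbouring two-step flag varieties. -/
def crossData {k : ℕ} (hk : k + 1 < n) : CrossData (deg n {k + 1}) (deg n {k, k + 1})
    (deg n {k + 1, k + 1 + 1}) (deg n {k}) (deg n {k + 1 + 1}) where
  P := powDown (Nat.lt_of_succ_lt hk)
  P' := powUp hk
  R := powUp (Nat.lt_of_succ_lt hk)
  R' := powDown hk
  x_eq := rfl
  x_eq' := rfl
  m_eq := show n - k = n - (k + 1) + 1 by omega
  m_eq' := rfl
  a := orbPoly n {k + 1} ⟨k, by omega⟩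
  b := orbPoly n {k + 1} ⟨k + 1, hk⟩
  a_monic := orbPoly_monic _ _
  b_monic := orbPoly_monic _ _
  a_deg := by
    rw [orbPoly_natDegree, orbit_low (Nat.lt_succ_self k), card_lowSet hk.le]; rfl
  b_deg := by
    rw [orbPoly_natDegree, orbit_high (le_refl (k + 1)), card_highSet hk.le]; rfl
  a_root := Subtype.val_injective (by
    have h1 : (C n {k, k + 1}).val.toRingHom (aeval (midVar (Nat.lt_of_succ_lt hk))
        (orbPoly n {k + 1} ⟨k, by omega⟩)) = 0 := by
      rw [aeval_def, hom_eval₂]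
      change eval₂ (C n {k + 1}).val.toRingHom (cx ⟨k, by omega⟩) _ = 0
      rw [← Polynomial.eval_map, orbPoly_map, eval_prod]
      exact Finset.prod_eq_zero (mem_orbit.2 rfl) (by simp)
    exact h1)
  b_root := Subtype.val_injective (by
    have h1 : (C n {k + 1, k + 1 + 1}).val.toRingHom (aeval (midVar hk)
        (orbPoly n {k + 1} ⟨k + 1, hk⟩)) = 0 := by
      rw [aeval_def, hom_eval₂]
      change eval₂ (C n {k + 1}).val.toRingHom (cx ⟨k + 1, hk⟩) _ = 0
      rw [← Polynomial.eval_map, orbPoly_map, eval_prod]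
      exact Finset.prod_eq_zero (mem_orbit.2 rfl) (by simp)
    exact h1)
  -- The variables of index at least k are the one of index k and the roots of b. Both sides are
  -- compared in the coinvariant algebra, where they become products of linear factors.
  lift := by
    refine ⟨orbPoly n {k} ⟨k, by omega⟩, map_val_injective _ ?_⟩
    rw [Polynomial.map_mul, Polynomial.map_sub, map_X, map_C, Polynomial.map_map,
      Polynomial.map_map]
    change (orbPoly n {k} ⟨k, by omega⟩).map (C n {k}).val.toRingHom =
      (X - Polynomial.C (cx ⟨k, by omega⟩)) *
        (orbPoly n {k + 1} ⟨k + 1, hk⟩).map (C n {k + 1}).val.toRingHom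
    rw [orbPoly_map, orbPoly_map, orbit_high (le_refl k), orbit_high (le_refl (k + 1)),
      highSet_eq (by omega : k < n), Finset.prod_insert (notMem_highSet _)]
  lift' := by
    refine ⟨orbPoly n {k + 1 + 1} ⟨k + 1, hk⟩, map_val_injective _ ?_⟩
    rw [Polynomial.map_mul, Polynomial.map_sub, map_X, map_C, Polynomial.map_map,
      Polynomial.map_map]
    change (orbPoly n {k + 1 + 1} ⟨k + 1, hk⟩).map (C n {k + 1 + 1}).val.toRingHom =
      (X - Polynomial.C (cx ⟨k + 1, hk⟩)) *
        (orbPoly n {k + 1} ⟨k, by omega⟩).map (C n {k + 1}).val.toRingHom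
    rw [orbPoly_map, orbPoly_map, orbit_low (Nat.lt_succ_self (k + 1)),
      orbit_low (Nat.lt_succ_self k), lowSet_succ hk, Finset.prod_insert (notMem_lowSet _)]
  gens := ⟨_, adjoin_psum {k + 1}, gens_psum hk⟩

end FlagRings

/-! ## The functors between neighbouring blocks -/

section Functors

/-- Induction to the two-step flag variety followed by restriction, upwards. -/
def upF (n k : ℕ) : Block n k ⥤ Block n (k + 1) :=
  GrMod.ind (deg n {k, k + 1}) (degUp n k) ⋙ GrMod.res (deg n {k + 1}) (degDown n k)

/-- Induction to the two-step flag variety followed by restriction, downwards. -/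
def downF (n k : ℕ) : Block n (k + 1) ⥤ Block n k :=
  GrMod.ind (deg n {k, k + 1}) (degDown n k) ⋙ GrMod.res (deg n {k}) (degUp n k)

/-- The functor of induction and restriction through `C^I`. -/
def indResOf (n : ℕ) {i j : ℕ} {I : Set ℕ} (hi : {i} ⊆ I) (hj : {j} ⊆ I) : Block n i ⥤ Block n j :=
  letI := inclAlg n hi
  letI := inclAlg n hj
  haveI : IsScalarTower ℂ (C n {i}) (C n I) := IsScalarTower.of_algebraMap_eq fun _ => rfl
  haveI : IsScalarTower ℂ (C n {j}) (C n I) := IsScalarTower.of_algebraMap_eq fun _ => rfl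
  GrMod.ind (𝒜 := deg n {i}) (deg n I) (fun _ _ h => h) ⋙
    GrMod.res (ℬ := deg n I) (deg n {j}) (fun _ _ h => h)

/-- The sets {k+1, k} and {k, k+1} are equal, but not by definition. Allowing an arbitrary I makes
it possible to substitute the equality, since all data depend on I. -/
theorem indResOf_congr (n : ℕ) {i j : ℕ} {I I' : Set ℕ} (h : I = I') (hi : {i} ⊆ I) (hj : {j} ⊆ I)
    (hi' : {i} ⊆ I') (hj' : {j} ⊆ I') : indResOf n hi hj = indResOf n hi' hj' := by
  subst h; rfl

theorem indRes_down (n k : ℕ) : indRes n (k + 1) k = downF n k :=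
  indResOf_congr n (Set.pair_comm (k + 1) k) (by simp) (by simp) (by simp) (by simp)

end Functors

end

end SlTwoCat

open CategoryTheory CategoryTheory.Limits
open scoped TensorProduct LaurentPolynomial

namespace SlTwoCat

noncomputable section

set_option linter.unusedSectionVars false

/-! ## Decomposition of functors from pointwise data -/

namespace GrMod

section Decompose

variable {A : Type} [CommRing A] [Algebra ℂ A] [Module.Finite ℂ A] {𝒜 : ℤ → Submodule ℂ A}

/-- The identification of shifts. -/
def shiftAddEq (𝒜 : ℤ → Submodule ℂ A) {k l s : ℤ} (h : k + l = s) :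
    shift 𝒜 k ⋙ shift 𝒜 l ≅ shift 𝒜 s :=
  shiftAdd 𝒜 k l ≪≫ eqToIso (congrArg (shift 𝒜) h)

theorem lin_shiftAddEq {k l s : ℤ} (h : k + l = s) (M : GrMod 𝒜) (m : M.carrier) :
    lin ((shiftAddEq 𝒜 h).hom.app M) m = m := by
  subst h; rfl

/-- A family of natural transformations which is pointwise an isomorphism onto a direct sum yields
a decomposition of functors. -/
theorem nonempty_iso_biprod {D : Type 1} [Category.{0} D] {H G : D ⥤ GrMod 𝒜} {R : D ⥤ GrMod 𝒜}
    {m : ℕ} (f : Fin m → (GrMod 𝒜 ⥤ GrMod 𝒜)) [HasBiproduct f]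
    [HasBinaryBiproduct G (R ⋙ ⨁ f)] (φ : H ⟶ G)
    (ρ : ∀ k, H ⟶ R ⋙ f k)
    (h : ∀ M, Function.Bijective (fun t : (H.obj M).carrier =>
      (lin (φ.app M) t, fun k => lin ((ρ k).app M) t))) :
    Nonempty (H ≅ G ⊞ (R ⋙ ⨁ f)) := by
  let π : ∀ k, R ⋙ ⨁ f ⟶ R ⋙ f k := fun k => Functor.whiskerLeft R (biproduct.π f k)
  let ι : ∀ k, R ⋙ f k ⟶ R ⋙ ⨁ f := fun k => Functor.whiskerLeft R (biproduct.ι f k)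
  have hι : ∀ k l, ι k ≫ π l = if h : k = l then eqToHom (by rw [h]) else 0 := by
    intro k l
    have := biproduct.ι_π f k l
    change Functor.whiskerLeft R (biproduct.ι f k) ≫ Functor.whiskerLeft R (biproduct.π f l) = _
    rw [← Functor.whiskerLeft_comp, this]
    split_ifs with h
    · subst h; simp
    · rfl
  have htot : ∑ k, π k ≫ ι k = 𝟙 (R ⋙ ⨁ f) := by
    have := congrArg (Functor.whiskerLeft R) (biproduct.total (f := f))
    rw [Functor.whiskerLeft_id'] at this
    rw [← this]
    ext M : 2
    rw [NatTrans.app_sum, Functor.whiskerLeft_app, NatTrans.app_sum]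
    rfl
  let Ψ : H ⟶ G ⊞ (R ⋙ ⨁ f) := biprod.lift φ (∑ k, ρ k ≫ ι k)
  have h1 : Ψ ≫ biprod.fst = φ := biprod.lift_fst _ _
  have h2 : ∀ l, (Ψ ≫ biprod.snd) ≫ π l = ρ l := fun l => by
    rw [biprod.lift_snd, Preadditive.sum_comp, Finset.sum_eq_single l]
    · rw [Category.assoc, hι, dif_pos rfl, eqToHom_refl, Category.comp_id]
    · intro k _ hk
      rw [Category.assoc, hι, dif_neg hk, comp_zero]
    · simp
  refine ⟨natIsoOfBijective Ψ fun M => ?_⟩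
  -- Collects the projections of the biproduct functor, evaluated at M. It is injective because the
  -- projections and inclusions satisfy the completeness relations. As its composite with Ψ is
  -- bijective by assumption, so is Ψ.
  let L : ((G ⊞ (R ⋙ ⨁ f)).obj M).carrier → (G.obj M).carrier ×
      (∀ k, ((R ⋙ f k).obj M).carrier) := fun t =>
    (lin ((biprod.fst : G ⊞ (R ⋙ ⨁ f) ⟶ G).app M) t,
      fun k => lin ((π k).app M) (lin ((biprod.snd : G ⊞ (R ⋙ ⨁ f) ⟶ _).app M) t))
  have hL : ∀ t, L (lin (Ψ.app M) t) = (lin (φ.app M) t, fun k => lin ((ρ k).app M) t) := by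
    intro t
    refine Prod.ext ?_ (funext fun k => ?_)
    · exact LinearMap.congr_fun (congrArg (fun α : H ⟶ G => lin (α.app M)) h1) t
    · exact LinearMap.congr_fun (congrArg (fun α : H ⟶ R ⋙ f k => lin (α.app M)) (h2 k)) t
  have hLinj : Function.Injective L := by
    intro t t' htt
    have hs : lin ((biprod.snd : G ⊞ (R ⋙ ⨁ f) ⟶ _).app M) t =
        lin ((biprod.snd : G ⊞ (R ⋙ ⨁ f) ⟶ _).app M) t' := by
      have key : ∀ s : ((R ⋙ ⨁ f).obj M).carrier,
          s = ∑ k, lin ((ι k).app M) (lin ((π k).app M) s) := fun s => by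
        have := congrArg (fun α : R ⋙ ⨁ f ⟶ R ⋙ ⨁ f => lin (α.app M) s) htot
        simp only [NatTrans.app_sum] at this
        refine this.symm.trans ?_
        have hsum : ∀ (T : Finset (Fin m)) (g : Fin m → ((R ⋙ ⨁ f).obj M ⟶ (R ⋙ ⨁ f).obj M)),
            lin (∑ k ∈ T, g k) s = ∑ k ∈ T, lin (g k) s := by
          intro T g
          classical
          induction T using Finset.induction_on with
          | empty => rfl
          | insert a T ha ih =>
            rw [Finset.sum_insert ha, Finset.sum_insert ha, lin_add, LinearMap.add_apply, ih]
        rw [hsum]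
        rfl
      rw [key (lin _ t), key (lin _ t')]
      exact Finset.sum_congr rfl fun k _ =>
        congrArg _ (congrFun (congrArg Prod.snd htt) k)
    have key : ∀ s : ((G ⊞ (R ⋙ ⨁ f)).obj M).carrier,
        s = lin ((biprod.inl : G ⟶ G ⊞ (R ⋙ ⨁ f)).app M)
            (lin ((biprod.fst : G ⊞ (R ⋙ ⨁ f) ⟶ G).app M) s) +
          lin ((biprod.inr : (R ⋙ ⨁ f) ⟶ G ⊞ (R ⋙ ⨁ f)).app M)
            (lin ((biprod.snd : G ⊞ (R ⋙ ⨁ f) ⟶ _).app M) s) := fun s =>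
      (congrArg (fun α : G ⊞ (R ⋙ ⨁ f) ⟶ G ⊞ (R ⋙ ⨁ f) => lin (α.app M) s)
        (biprod.total (X := G) (Y := R ⋙ ⨁ f))).symm
    have hf : lin ((biprod.fst : G ⊞ (R ⋙ ⨁ f) ⟶ G).app M) t =
        lin ((biprod.fst : G ⊞ (R ⋙ ⨁ f) ⟶ G).app M) t' := congrArg Prod.fst htt
    rw [key t, key t', hs, hf]
  have hcomp : Function.Bijective (L ∘ lin (Ψ.app M)) := by
    have : (L ∘ lin (Ψ.app M)) = fun t => (lin (φ.app M) t, fun k => lin ((ρ k).app M) t) :=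
      funext hL
    rw [this]; exact h M
  refine ⟨Function.Injective.of_comp hcomp.1, fun t => ?_⟩
  obtain ⟨s, hs⟩ := hcomp.2 (L t)
  exact ⟨s, hLinj hs⟩

end Decompose

end GrMod

namespace CrossData

/-! ### The case in which one of the composites vanishes -/

section Single

open GrMod

variable {A B D : Type} [CommRing A] [Algebra ℂ A] [CommRing B] [Algebra ℂ B]
    [CommRing D] [Algebra ℂ D] [Algebra A B] [Algebra D B]
    {𝒜 : ℤ → Submodule ℂ A} {ℬ : ℤ → Submodule ℂ B} {𝒟 : ℤ → Submodule ℂ D}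
    [IsScalarTower ℂ A B] [IsScalarTower ℂ D B] [GradedAlgebra 𝒜] [GradedAlgebra ℬ]
    [GradedAlgebra 𝒟] [Module.Finite ℂ A] [Module.Finite ℂ B] [Module.Finite ℂ D]
    (hAB : ∀ (i : ℤ) (a : A), a ∈ 𝒜 i → algebraMap A B a ∈ ℬ i)
    (hDB : ∀ (i : ℤ) (a : D), a ∈ 𝒟 i → algebraMap D B a ∈ ℬ i)

/-- When `B` has rank one over `D`, the coordinates identify the loop with a sum of shifts. -/
theorem coord_bijective (P : PowExt 𝒜 ℬ) (R : PowExt 𝒟 ℬ) (hR : R.m = 1) (M : GrMod 𝒜) :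
    Function.Bijective (fun t : ((loop hAB hDB).obj M).carrier => fun k : Fin P.m =>
      (lin ((coordTrans hAB hDB P ⟨P.m - 1 - k, by omega⟩).app M) t : M.carrier)) := by
  let J : ((loop hAB hDB).obj M).carrier →ₗ[ℂ] (Fin P.m → M.carrier) :=
    LinearMap.pi fun k : Fin P.m =>
      ((lin ((coordTrans hAB hDB P ⟨P.m - 1 - k, by omega⟩).app M)).restrictScalars ℂ :
          _ →ₗ[ℂ] M.carrier)
  change Function.Bijective J
  have hf1 := finiteC ((loop hAB hDB).obj M)
  have hf3 := finiteC M
  have hsurj : Function.Surjective J := by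
    intro e
    refine ⟨∑ l : Fin P.m, place hAB hDB M (P.basis l ⊗ₜ[D] 1) (e ⟨P.m - 1 - l, by omega⟩), ?_⟩
    rw [map_sum]
    funext k
    rw [Finset.sum_apply]
    have h1 : ∀ l : Fin P.m, J (place hAB hDB M (P.basis l ⊗ₜ[D] 1) (e ⟨P.m - 1 - l, by omega⟩)) k =
        (if l = ⟨P.m - 1 - k, by omega⟩ then (1 : A) else 0) • e ⟨P.m - 1 - l, by omega⟩ := by
      intro l
      refine (coordTrans_place hAB hDB P ⟨P.m - 1 - k, by omega⟩ M (P.basis l ⊗ₜ[D] 1)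
        (e ⟨P.m - 1 - l, by omega⟩)).trans ?_
      rw [Algebra.TensorProduct.lmul'_apply_tmul, mul_one, P.basis.repr_self,
        Finsupp.single_apply]
    rw [Finset.sum_congr rfl fun l _ => h1 l, Finset.sum_eq_single ⟨P.m - 1 - k, by omega⟩]
    · rw [if_pos rfl, one_smul]
      congr 1
      exact Fin.ext (by simp only []; omega)
    · intro l _ hl
      rw [if_neg hl, zero_smul]
    · simp
  refine ⟨(LinearMap.injective_iff_surjective_of_finrank_eq_finrank ?_).2 hsurj, hsurj⟩
  rw [finrank_loop hAB hDB P R, Module.finrank_pi_fintype, Finset.sum_const, Finset.card_univ,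
    Fintype.card_fin, hR, smul_eq_mul, one_mul]

end Single

end CrossData

/-! ## The functors `E` and `F` in terms of blocks -/

section BlockFunctors

variable {n : ℕ}

/-- Shifts commute with the upward functor. -/
def shiftUp (n k : ℕ) (s : ℤ) :
    GrMod.shift (deg n {k}) s ⋙ upF n k ≅ upF n k ⋙ GrMod.shift (deg n {k + 1}) s :=
  Functor.isoWhiskerRight (GrMod.shiftInd (degUp n k) s) (GrMod.res _ (degDown n k)) ≪≫
    Functor.isoWhiskerLeft (GrMod.ind _ (degUp n k)) (GrMod.shiftRes (degDown n k) s)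

/-- Shifts commute with the downward functor. -/
def shiftDown (n k : ℕ) (s : ℤ) :
    GrMod.shift (deg n {k + 1}) s ⋙ downF n k ≅ downF n k ⋙ GrMod.shift (deg n {k}) s :=
  Functor.isoWhiskerRight (GrMod.shiftInd (degDown n k) s) (GrMod.res _ (degUp n k)) ≪≫
    Functor.isoWhiskerLeft (GrMod.ind _ (degDown n k)) (GrMod.shiftRes (degUp n k) s)

/-- The components of `E`. -/
def EProj {k : ℕ} (hk : k < n) : E n ⋙ proj n ⟨k + 1, by omega⟩ ≅
    proj n ⟨k, by omega⟩ ⋙ upF n k ⋙ GrMod.shift _ (-n + k + 1) := Iso.refl _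

/-- The lowest component of `E`. -/
def EProjZero (n : ℕ) : E n ⋙ proj n ⟨0, by omega⟩ ≅
    (Functor.const _).obj (GrMod.zeroObj _) := Iso.refl _

theorem Fblk_eq (n k : ℕ) :
    Fblk n k = downF n k ⋙ GrMod.shift (deg n {k}) (-((k : ℤ) + 1) + 1) :=
  congrArg (fun T : Block n (k + 1) ⥤ Block n k =>
    T ⋙ GrMod.shift (deg n {k}) (-((k : ℤ) + 1) + 1)) (indRes_down n k)

theorem F_proj_eq {k : ℕ} (hk : k < n) : F n ⋙ proj n ⟨k, by omega⟩ =
    proj n ⟨k + 1, by omega⟩ ⋙ downF n k ⋙ GrMod.shift (deg n {k}) (-((k : ℤ) + 1) + 1) := by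
  refine (Functor.pi'_eval _ _).trans ((dif_pos (show k + 1 < n + 1 by omega)).trans ?_)
  exact congrArg (fun T : Block n (k + 1) ⥤ Block n k => proj n ⟨k + 1, by omega⟩ ⋙ T)
    (Fblk_eq n k)

/-- The components of `F`. -/
def FProj {k : ℕ} (hk : k < n) : F n ⋙ proj n ⟨k, by omega⟩ ≅
    proj n ⟨k + 1, by omega⟩ ⋙ downF n k ⋙ GrMod.shift (deg n {k}) (-((k : ℤ) + 1) + 1) :=
  eqToIso (F_proj_eq hk)

/-- The highest component of `F`. -/
def FProjTop (n : ℕ) : F n ⋙ proj n ⟨n, by omega⟩ ≅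
    (Functor.const _).obj (GrMod.zeroObj _) :=
  eqToIso ((Functor.pi'_eval _ _).trans (dif_neg (by simp)))

/-- Moving a functor past another one and merging it with a third one. -/
def collect {X Y Z : Type 1} [Category.{0} X] [Category.{0} Y] [Category.{0} Z] {U : X ⥤ Y}
    {S : Y ⥤ Y} {D : Y ⥤ Z} {S' T T' : Z ⥤ Z} (c : S ⋙ D ≅ D ⋙ S') (t : S' ⋙ T ≅ T') :
    (U ⋙ S) ⋙ D ⋙ T ≅ (U ⋙ D) ⋙ T' :=
  Functor.isoWhiskerLeft U (Functor.isoWhiskerRight c T) ≪≫ Functor.isoWhiskerLeft (U ⋙ D) t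

/-- Composition of components. -/
def projComp {X Y Z W : Type 1} [Category.{0} X] [Category.{0} Y] [Category.{0} Z]
    [Category.{0} W] {F : X ⥤ X}
    {E : X ⥤ Y} {p : X ⥤ Z} {p' : X ⥤ W} {f : W ⥤ Z} {e : Z ⥤ Y} {r : W ⥤ Y}
    (hE : E ≅ p ⋙ e) (hF : F ⋙ p ≅ p' ⋙ f) (h : f ⋙ e ≅ r) : F ⋙ E ≅ p' ⋙ r :=
  Functor.isoWhiskerLeft F hE ≪≫ Functor.isoWhiskerRight hF e ≪≫ Functor.isoWhiskerLeft p' h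

/-- Collecting the shifts in `EF`. -/
def upDown (n k : ℕ) : (downF n k ⋙ GrMod.shift (deg n {k}) (-((k : ℤ) + 1) + 1)) ⋙
    upF n k ⋙ GrMod.shift (deg n {k + 1}) (-n + k + 1) ≅
      (downF n k ⋙ upF n k) ⋙ GrMod.shift (deg n {k + 1}) (1 - n) :=
  collect (shiftUp n k (-((k : ℤ) + 1) + 1))
      (GrMod.shiftAddEq (deg n {k + 1}) (k := -((k : ℤ) + 1) + 1) (l := -n + k + 1)
        (s := 1 - n) (by ring))

/-- Collecting the shifts in `FE`. -/
def downUp (n k : ℕ) : (upF n k ⋙ GrMod.shift (deg n {k + 1}) (-n + k + 1)) ⋙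
    downF n k ⋙ GrMod.shift (deg n {k}) (-((k : ℤ) + 1) + 1) ≅
      (upF n k ⋙ downF n k) ⋙ GrMod.shift (deg n {k}) (1 - n) :=
  collect (shiftDown n k (-n + k + 1))
      (GrMod.shiftAddEq (deg n {k}) (k := -n + k + 1) (l := -((k : ℤ) + 1) + 1)
        (s := 1 - n) (by ring))

/-- The components of `EF`. -/
def EFProj {k : ℕ} (hk : k < n) : F n ⋙ E n ⋙ proj n ⟨k + 1, by omega⟩ ≅
    proj n ⟨k + 1, by omega⟩ ⋙ (downF n k ⋙ upF n k) ⋙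
      GrMod.shift (deg n {k + 1}) (1 - n) :=
  projComp (EProj hk) (FProj hk) (upDown n k)

/-- The components of `FE`. -/
def FEProj {k : ℕ} (hk : k < n) : E n ⋙ F n ⋙ proj n ⟨k, by omega⟩ ≅
    proj n ⟨k, by omega⟩ ⋙ (upF n k ⋙ downF n k) ⋙ GrMod.shift (deg n {k}) (1 - n) :=
  projComp (FProj hk) (EProj hk) (downUp n k)

end BlockFunctors

end

end SlTwoCat

open CategoryTheory CategoryTheory.Limits
open scoped TensorProduct LaurentPolynomial

namespace SlTwoCat

noncomputable section

set_option linter.unusedSectionVars false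

/-! ### Decomposition of the composite functors -/

namespace CrossData

section Decomposition

open GrMod

variable {A B B' D D' : Type} [CommRing A] [Algebra ℂ A] [CommRing B] [Algebra ℂ B]
    [CommRing B'] [Algebra ℂ B'] [CommRing D] [Algebra ℂ D] [CommRing D'] [Algebra ℂ D']
    [Algebra A B] [Algebra A B'] [Algebra D B] [Algebra D' B']
    {𝒜 : ℤ → Submodule ℂ A} {ℬ : ℤ → Submodule ℂ B} {ℬ' : ℤ → Submodule ℂ B'}
    {𝒟 : ℤ → Submodule ℂ D} {𝒟' : ℤ → Submodule ℂ D'}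
    [IsScalarTower ℂ A B] [IsScalarTower ℂ A B'] [IsScalarTower ℂ D B]
    [IsScalarTower ℂ D' B'] [GradedAlgebra 𝒜] [GradedAlgebra ℬ] [GradedAlgebra ℬ']
    [GradedAlgebra 𝒟] [GradedAlgebra 𝒟'] [Module.Finite ℂ A] [Module.Finite ℂ B]
    [Module.Finite ℂ B'] [Module.Finite ℂ D] [Module.Finite ℂ D']
    (hAB : ∀ (i : ℤ) (a : A), a ∈ 𝒜 i → algebraMap A B a ∈ ℬ i)
    (hDB : ∀ (i : ℤ) (a : D), a ∈ 𝒟 i → algebraMap D B a ∈ ℬ i)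
    (hAB' : ∀ (i : ℤ) (a : A), a ∈ 𝒜 i → algebraMap A B' a ∈ ℬ' i)
    (hDB' : ∀ (i : ℤ) (a : D'), a ∈ 𝒟' i → algebraMap D' B' a ∈ ℬ' i)
    {X : Type 1} [Category.{0} X]

/-- The coordinate maps, normalized by a shift. -/
def coordShift (P : PowExt 𝒜 ℬ) {k : ℕ} (hk : k < P.m) {c s : ℤ} (h : 2 * (k : ℤ) + c = s) :
    loop hAB hDB ⋙ shift 𝒜 c ⟶ shift 𝒜 s :=
  Functor.whiskerRight (coordTrans hAB hDB P ⟨k, hk⟩) (shift 𝒜 c) ≫ (shiftAddEq 𝒜 h).hom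

theorem lin_coordShift (P : PowExt 𝒜 ℬ) {k : ℕ} (hk : k < P.m) {c s : ℤ}
    (h : 2 * (k : ℤ) + c = s) (M : GrMod 𝒜) (t : ((loop hAB hDB).obj M).carrier) :
    lin ((coordShift hAB hDB P hk h).app M) t = lin ((coordTrans hAB hDB P ⟨k, hk⟩).app M) t :=
  lin_shiftAddEq h M _

/-- The decomposition of one loop by the other one. -/
theorem decomposition (Z : CrossData 𝒜 ℬ ℬ' 𝒟 𝒟') (R : X ⥤ GrMod 𝒜) {m : ℕ}
    (hm : m + Z.P'.m = Z.P.m) {c : ℤ} (hc : c = 1 - Z.P.m - Z.P'.m)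
    [HasBiproduct fun k : Fin m => shift 𝒜 ((m : ℤ) - 1 - 2 * (k : ℤ))]
    [HasBinaryBiproduct (R ⋙ loop hAB' hDB' ⋙ shift 𝒜 c)
      (R ⋙ ⨁ fun k : Fin m => shift 𝒜 ((m : ℤ) - 1 - 2 * (k : ℤ)))] :
    Nonempty (R ⋙ loop hAB hDB ⋙ shift 𝒜 c ≅ (R ⋙ loop hAB' hDB' ⋙ shift 𝒜 c) ⊞
      (R ⋙ ⨁ fun k : Fin m => shift 𝒜 ((m : ℤ) - 1 - 2 * (k : ℤ)))) := by
  obtain rfl : m = Z.P.m - Z.P'.m := by omega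
  refine nonempty_iso_biprod _
    (Functor.whiskerLeft R (Functor.whiskerRight (Z.crossTrans hAB hDB hAB' hDB') (shift 𝒜 c)))
    -- The coordinate of index t = m_P-1-k contributes the shift 2t. With c = 1-m_P-m_{P'} this
    -- gives m-1-2k, the k-th shift in Q_m.
    (fun k => Functor.whiskerLeft R (coordShift hAB hDB Z.P (k := Z.P.m - 1 - k) (by omega)
      (by have := k.2; omega))) fun M => ?_
  have h1 := Z.cross_bijective hAB hDB hAB' hDB' (by omega) (R.obj M)
  have h2 : ∀ (k : Fin (Z.P.m - Z.P'.m)) t,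
      lin ((coordShift hAB hDB Z.P (k := Z.P.m - 1 - k) (by omega)
        (show 2 * ((Z.P.m - 1 - k : ℕ) : ℤ) + c = ((Z.P.m - Z.P'.m : ℕ) : ℤ) - 1 - 2 * (k : ℤ) by
          have := k.2; omega)).app (R.obj M)) t =
      (lin ((coordTrans hAB hDB Z.P ⟨Z.P.m - 1 - k, by omega⟩).app (R.obj M)) t :
        (R.obj M).carrier) :=
    fun k t => lin_coordShift hAB hDB Z.P _ _ (R.obj M) t
  refine ⟨fun t t' htt => h1.1 (Prod.ext (Prod.ext_iff.1 htt).1 (funext fun k => ?_)),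
    fun ⟨y, g⟩ => ?_⟩
  · exact (h2 k t).symm.trans ((congrFun (congrArg Prod.snd htt) k).trans (h2 k t'))
  · obtain ⟨t, ht⟩ := h1.2 (y, g)
    exact ⟨t, Prod.ext (Prod.ext_iff.1 ht).1 (funext fun k =>
      (h2 k t).trans (congrFun (congrArg Prod.snd ht) k))⟩

/-- The decomposition of a loop when `B` has rank one over `D`. -/
theorem decomposition_of_rank_one (P : PowExt 𝒜 ℬ) (Q : PowExt 𝒟 ℬ) (hQ : Q.m = 1)
    (R : X ⥤ GrMod 𝒜) (Y : X ⥤ GrMod 𝒜) (hY : ∀ M, Subsingleton (Y.obj M).carrier) {m : ℕ}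
    (hm : m = P.m) {c : ℤ} (hc : c = 1 - P.m)
    [HasBiproduct fun k : Fin m => shift 𝒜 ((m : ℤ) - 1 - 2 * (k : ℤ))]
    [HasBinaryBiproduct Y (R ⋙ ⨁ fun k : Fin m => shift 𝒜 ((m : ℤ) - 1 - 2 * (k : ℤ)))] :
    Nonempty (R ⋙ loop hAB hDB ⋙ shift 𝒜 c ≅ Y ⊞
      (R ⋙ ⨁ fun k : Fin m => shift 𝒜 ((m : ℤ) - 1 - 2 * (k : ℤ)))) := by
  subst hm
  refine nonempty_iso_biprod _ 0
    (fun k => Functor.whiskerLeft R (coordShift hAB hDB P (k := P.m - 1 - k) (by omega)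
      (by have := k.2; omega))) fun M => ?_
  have h1 := coord_bijective hAB hDB P Q hQ (R.obj M)
  have h2 : ∀ (k : Fin P.m) t, lin ((coordShift hAB hDB P (k := P.m - 1 - k) (by omega)
      (show 2 * ((P.m - 1 - k : ℕ) : ℤ) + c = (P.m : ℤ) - 1 - 2 * (k : ℤ) by
        have := k.2; omega)).app (R.obj M)) t =
      (lin ((coordTrans hAB hDB P ⟨P.m - 1 - k, by omega⟩).app (R.obj M)) t :
        (R.obj M).carrier) :=
    fun k t => lin_coordShift hAB hDB P _ _ (R.obj M) t
  have := hY M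
  refine ⟨fun t t' htt => h1.1 (funext fun k => ?_), fun ⟨y, g⟩ => ?_⟩
  · exact (h2 k t).symm.trans ((congrFun (congrArg Prod.snd htt) k).trans (h2 k t'))
  · obtain ⟨t, ht⟩ := h1.2 g
    exact ⟨t, Prod.ext (Subsingleton.elim _ _) (funext fun k =>
      (h2 k t).trans (congrFun ht k))⟩

end Decomposition

end CrossData

/-! ### The relation between EF and FE -/

section Commutator

variable {n : ℕ}

/-- Since n > 0, the block is of the form k+1. Here EF passes through C^{k,k+1}, which has rank k+1
over C^{k+1}, against n-k-1 for the other neighbour. These ranks add up to n, so the collected shift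
1-n is the one required. In the top block FE is zero, and C^{n-1,n} has rank one over C^{n-1}. -/
theorem nonempty_EF (i : Fin (n + 1)) (hn : 0 < n) (hi : n ≤ 2 * (i : ℕ)) :
    Nonempty (F n ⋙ E n ⋙ proj n i ≅
      (E n ⋙ F n ⋙ proj n i) ⊞ (proj n i ⋙ quantumSum n i (2 * i - n))) := by
  obtain ⟨i, hin⟩ := i
  obtain ⟨k, rfl⟩ : ∃ k, i = k + 1 := ⟨i - 1, by simp only [] at hi; omega⟩
  simp only [] at hi
  by_cases hk : k + 1 < n
  · obtain ⟨e⟩ := (crossData hk).decomposition (degDown n k) (degUp n k) (degUp n (k + 1))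
      (degDown n (k + 1)) (proj n ⟨k + 1, hin⟩) (m := 2 * (k + 1) - n) (c := 1 - n)
      (by change 2 * (k + 1) - n + (n - (k + 1)) = k + 1; omega)
      (by change (1 - n : ℤ) = 1 - ((k + 1 : ℕ) : ℤ) - ((n - (k + 1) : ℕ) : ℤ); omega)
    exact ⟨EFProj (by omega) ≪≫ e ≪≫ biprod.mapIso (FEProj hk).symm (Iso.refl _)⟩
  · obtain rfl : n = k + 1 := by omega
    obtain ⟨e⟩ := CrossData.decomposition_of_rank_one (degDown (k + 1) k) (degUp (k + 1) k)
      (powDown (Nat.lt_succ_self k)) (powUp (Nat.lt_succ_self k))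
      (by change k + 1 - k = 1; omega) (proj (k + 1) ⟨k + 1, hin⟩)
      (E (k + 1) ⋙ (Functor.const _).obj (GrMod.zeroObj (deg (k + 1) {k + 1})))
      (fun M => inferInstanceAs (Subsingleton PUnit)) (m := 2 * (k + 1) - (k + 1))
      (c := 1 - ((k + 1 : ℕ) : ℤ))
      (by change _ = k + 1; omega) rfl
    exact ⟨EFProj (by omega) ≪≫ e ≪≫
      biprod.mapIso (Functor.isoWhiskerLeft _ (FProjTop (k + 1)).symm) (Iso.refl _)⟩

/-- The same with the two neighbours exchanged. In the bottom block EF is zero, and C^{0,1} has rank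
one over C^1. -/
theorem nonempty_FE (i : Fin (n + 1)) (hi : 2 * (i : ℕ) < n) :
    Nonempty (E n ⋙ F n ⋙ proj n i ≅
      (F n ⋙ E n ⋙ proj n i) ⊞ (proj n i ⋙ quantumSum n i (n - 2 * i))) := by
  obtain ⟨i, hin⟩ := i
  simp only [] at hi
  obtain rfl | ⟨k, rfl⟩ : i = 0 ∨ ∃ k, i = k + 1 := by
    cases i
    · exact Or.inl rfl
    · exact Or.inr ⟨_, rfl⟩
  · obtain ⟨e⟩ := CrossData.decomposition_of_rank_one (degUp n 0) (degDown n 0)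
      (powUp (show 0 < n by omega)) (powDown (show 0 < n by omega)) rfl (proj n ⟨0, hin⟩)
      (F n ⋙ (Functor.const _).obj (GrMod.zeroObj (deg n {0})))
      (fun M => inferInstanceAs (Subsingleton PUnit)) (m := n - 2 * 0) (c := 1 - (n : ℤ))
      (by change _ = n - 0; omega) rfl
    exact ⟨FEProj (by omega) ≪≫ e ≪≫
      biprod.mapIso (Functor.isoWhiskerLeft _ (EProjZero n).symm) (Iso.refl _)⟩
  · have hk : k + 1 < n := by omega
    obtain ⟨e⟩ := (crossData hk).symm.decomposition (degUp n (k + 1)) (degDown n (k + 1))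
      (degDown n k) (degUp n k) (proj n ⟨k + 1, hin⟩) (m := n - 2 * (k + 1)) (c := 1 - n)
      (by change n - 2 * (k + 1) + (k + 1) = n - (k + 1); omega)
      (by change (1 - n : ℤ) = 1 - ((n - (k + 1) : ℕ) : ℤ) - ((k + 1 : ℕ) : ℤ); omega)
    exact ⟨FEProj hk ≪≫ e ≪≫ biprod.mapIso (EFProj (by omega)).symm (Iso.refl _)⟩

end Commutator

end

end SlTwoCat

open CategoryTheory CategoryTheory.Limits
open scoped TensorProduct LaurentPolynomial

namespace SlTwoCat

noncomputable section

set_option linter.unusedSectionVars false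

/-! ## Shifts, twists and duality on graded modules -/

namespace GrMod

section Basic

variable {A : Type} [CommRing A] [Algebra ℂ A] {𝒜 : ℤ → Submodule ℂ A} [Module.Finite ℂ A]

/-- Functors with trivial values are isomorphic. -/
def isoOfSubsingleton {D : Type*} [Category* D] {F G : D ⥤ GrMod 𝒜}
    (hF : ∀ M, Subsingleton (F.obj M).carrier) (hG : ∀ M, Subsingleton (G.obj M).carrier) :
    F ≅ G :=
  natIsoOfBijective
    { app := fun _ => 0
      naturality := fun _ _ _ => hom_ext fun _ => (hG _).elim _ _ }
    fun M => ⟨fun _ _ _ => (hF M).elim _ _, fun _ => ⟨0, (hG M).elim _ _⟩⟩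

/-- Shifts by equal integers. -/
def shiftEq (𝒜 : ℤ → Submodule ℂ A) {k l : ℤ} (h : k = l) : shift 𝒜 k ≅ shift 𝒜 l :=
  eqToIso (congrArg (shift 𝒜) h)

/-- The shift functors are adjoint to each other. -/
def shiftAdj (𝒜 : ℤ → Submodule ℂ A) {k l : ℤ} (h : k + l = 0) : shift 𝒜 k ⊣ shift 𝒜 l :=
  (CategoryTheory.Equivalence.mk (shift 𝒜 k) (shift 𝒜 l)
    (shiftAdd 𝒜 k l ≪≫ shiftZero 𝒜 h).symm
    (shiftAdd 𝒜 l k ≪≫ shiftZero 𝒜 ((add_comm l k).trans h))).toAdjunction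

/-- The evaluation of a module in its double dual. -/
def dualDualHom (M : GrMod 𝒜) : M ⟶ dualObj (dualObj M) :=
  mkHom (M := M) (N := dualObj (dualObj M))
    { toFun := fun m => Module.Dual.eval ℂ M.carrier m
      map_add' := map_add (Module.Dual.eval ℂ M.carrier)
      map_smul' := fun _ _ => rfl }
    fun i m hm k hk (f : Module.Dual ℂ M.carrier) hf => hf i (by omega) m hm

/-- A module is isomorphic to its double dual. -/
def dualDual (𝒜 : ℤ → Submodule ℂ A) : 𝟭 (GrMod 𝒜) ≅ (dual 𝒜).rightOp ⋙ dual 𝒜 :=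
  natIsoOfBijective { app := dualDualHom } fun M =>
    have := finiteC M
    Module.bijective_dual_eval ℂ M.carrier

/-- Duality reverses shifts. -/
def shiftDual (𝒜 : ℤ → Submodule ℂ A) {k l : ℤ} (h : k + l = 0) :
    (shift 𝒜 k).op ⋙ dual 𝒜 ≅ dual 𝒜 ⋙ shift 𝒜 l :=
  natIsoOfBijective
    { app := fun M => mkHom (M := dualObj (shiftObj k M.unop)) (N := shiftObj l (dualObj M.unop))
        { toFun := fun f => f
          map_add' := fun _ _ => rfl
          map_smul' := fun _ _ => rfl }
        fun i f hf j hj m hm => hf (j + k) (by omega) m (by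
          change m ∈ M.unop.deg (j + k - k)
          rwa [add_sub_cancel_right]) }
    fun M => ⟨fun _ _ h => h, fun f => ⟨f, rfl⟩⟩

variable {A' : Type} [CommRing A'] [Algebra ℂ A'] {𝒜' : ℤ → Submodule ℂ A'} [Module.Finite ℂ A']

/-- Twists commute with shifts. -/
def shiftTwist (α : A →ₐ[ℂ] A') (hα : ∀ i, ∀ a ∈ 𝒜 i, α a ∈ 𝒜' i) (k : ℤ) :
    shift 𝒜' k ⋙ twist α hα ≅ twist α hα ⋙ shift 𝒜 k := Iso.refl _

/-- Twists along mutually inverse maps. -/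
def twistTwist (α : A →ₐ[ℂ] A') (hα : ∀ i, ∀ a ∈ 𝒜 i, α a ∈ 𝒜' i) (β : A' →ₐ[ℂ] A)
    (hβ : ∀ i, ∀ a ∈ 𝒜' i, β a ∈ 𝒜 i) (h : ∀ a, α (β a) = a) :
    𝟭 (GrMod 𝒜') ≅ twist α hα ⋙ twist β hβ :=
  natIsoOfBijective
    { app := fun M => mkHom (M := M) (N := (twist β hβ).obj ((twist α hα).obj M))
        { toFun := fun m => m
          map_add' := fun _ _ => rfl
          map_smul' := fun a m => congrArg (fun b : A' => (b • m : M.carrier)) (h a).symm }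
        fun _ _ h => h }
    fun M => ⟨fun _ _ h => h, fun f => ⟨f, rfl⟩⟩

end Basic

end GrMod

/-! ## The components of `K` and of the shifts -/

section Gluing

variable {n : ℕ}

theorem F_top_subsingleton (X : GCat n) (i : Fin (n + 1)) (hi : ¬(i : ℕ) < n) :
    Subsingleton (((F n).obj X) i).carrier := by
  have h : F n ⋙ proj n i = (Functor.const _).obj (GrMod.zeroObj _) :=
    (Functor.pi'_eval _ _).trans (dif_neg (by omega))
  have h' : ((F n).obj X) i = GrMod.zeroObj _ := congrArg (fun T => T.obj X) h
  rw [h']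
  exact inferInstanceAs (Subsingleton PUnit)

/-- Gluing of natural isomorphisms from a lowest component and the others. -/
def glueUp {D : Type*} [Category* D] {F G : D ⥤ GCat n}
    (e0 : F ⋙ proj n ⟨0, by omega⟩ ≅ G ⋙ proj n ⟨0, by omega⟩)
    (e : ∀ k (hk : k < n), F ⋙ proj n ⟨k + 1, by omega⟩ ≅ G ⋙ proj n ⟨k + 1, by omega⟩) :
    F ≅ G :=
  NatIso.pi' fun i => match i with
    | ⟨0, _⟩ => e0
    | ⟨k + 1, h⟩ => e k (Nat.lt_of_succ_lt_succ h)

/-- Gluing of natural isomorphisms from a highest component and the others. -/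
def glueDown {D : Type*} [Category* D] {F G : D ⥤ GCat n}
    (hF : ∀ X (i : Fin (n + 1)), ¬(i : ℕ) < n → Subsingleton ((F.obj X) i).carrier)
    (hG : ∀ X (i : Fin (n + 1)), ¬(i : ℕ) < n → Subsingleton ((G.obj X) i).carrier)
    (e : ∀ k (hk : k < n), F ⋙ proj n ⟨k, by omega⟩ ≅ G ⋙ proj n ⟨k, by omega⟩) :
    F ≅ G :=
  NatIso.pi' fun i => if h : (i : ℕ) < n then e i h else
    GrMod.isoOfSubsingleton (fun X => hF X i h) (fun X => hG X i h)

/-- `K` and `K⁻¹` are inverse to each other. -/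
def KinvK (n : ℕ) : Kinv n ⋙ K n ≅ 𝟭 (GCat n) :=
  NatIso.pi' fun i => Functor.isoWhiskerLeft (proj n i)
    (GrMod.shiftAdd _ _ _ ≪≫ GrMod.shiftZero _ (by ring) :
      GrMod.shift (deg n {(i : ℕ)}) (-(2 * (i : ℤ) - n)) ⋙ GrMod.shift _ (2 * (i : ℤ) - n) ≅ 𝟭 _)

/-- `K` and `K⁻¹` are inverse to each other. -/
def KKinv (n : ℕ) : K n ⋙ Kinv n ≅ 𝟭 (GCat n) :=
  NatIso.pi' fun i => Functor.isoWhiskerLeft (proj n i)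
    (GrMod.shiftAdd _ _ _ ≪≫ GrMod.shiftZero _ (by ring) :
      GrMod.shift (deg n {(i : ℕ)}) (2 * (i : ℤ) - n) ⋙ GrMod.shift _ (-(2 * (i : ℤ) - n)) ≅ 𝟭 _)

/-- `K` as an equivalence. -/
def KEquiv (n : ℕ) : GCat n ≌ GCat n :=
  CategoryTheory.Equivalence.mk (K n) (Kinv n) (KKinv n).symm (KinvK n)

/-- The shifts as equivalences. -/
def shiftEquiv (n : ℕ) (k : ℤ) : GCat n ≌ GCat n :=
  CategoryTheory.Equivalence.mk (shiftC n (-k)) (shiftC n k)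
    (shiftCAdd n (-k) k ≪≫ shiftCZero n (by ring)).symm
    (shiftCAdd n k (-k) ≪≫ shiftCZero n (by ring))

/-- Two shifts before a functor which commutes with shifts. -/
def passShifts {X Y : Type 1} [Category.{0} X] [Category.{0} Y] {a : X ⥤ X} {U : X ⥤ Y}
    {b c d b' : Y ⥤ Y} (h : a ⋙ U ≅ U ⋙ b') (e : b' ⋙ c ≅ b ⋙ d) :
    a ⋙ U ⋙ c ≅ (U ⋙ b) ⋙ d :=
  Functor.isoWhiskerRight h c ≪≫ Functor.isoWhiskerLeft U e

/-- Collecting two shifts. -/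
def shiftTwo {A : Type} [CommRing A] [Algebra ℂ A] (𝒜 : ℤ → Submodule ℂ A) [Module.Finite ℂ A]
    {a b c d : ℤ} (h : a + b = c + d) :
    GrMod.shift 𝒜 a ⋙ GrMod.shift 𝒜 b ≅ GrMod.shift 𝒜 c ⋙ GrMod.shift 𝒜 d :=
  GrMod.shiftAddEq 𝒜 h ≪≫ (GrMod.shiftAdd 𝒜 c d).symm

/-- The relation `KE = q² EK`. -/
def KEIso (n : ℕ) : K n ⋙ E n ⋙ shiftC n 2 ≅ E n ⋙ K n :=
  glueUp (GrMod.isoOfSubsingleton (fun _ => inferInstanceAs (Subsingleton PUnit))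
      (fun _ => inferInstanceAs (Subsingleton PUnit)))
    fun k hk => Functor.isoWhiskerLeft (proj n ⟨k, by omega⟩)
      (passShifts (a := GrMod.shift (deg n {k}) (2 * (k : ℤ) - n)) (U := upF n k)
        (b := GrMod.shift (deg n {k + 1}) (-n + k + 1))
        (c := GrMod.shift (deg n {k + 1}) (-n + k + 1) ⋙ GrMod.shift (deg n {k + 1}) 2)
        (d := GrMod.shift (deg n {k + 1}) (2 * ((k + 1 : ℕ) : ℤ) - n))
        (shiftUp n k (2 * (k : ℤ) - n))
        (Functor.isoWhiskerRight (GrMod.shiftAdd (deg n {k + 1}) _ _) (GrMod.shift _ 2) ≪≫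
          shiftTwo (deg n {k + 1}) (by push_cast; ring)))

/-- The components of a composite of three functors. -/
def projSandwich {X Z W : Type 1} [Category.{0} X] [Category.{0} Z] [Category.{0} W]
    {K F S : X ⥤ X} {p : X ⥤ Z} {p' : X ⥤ W} {f : W ⥤ Z} {s : Z ⥤ Z} {k : W ⥤ W} {r : W ⥤ Z}
    (hK : K ⋙ p' ≅ p' ⋙ k) (hF : F ⋙ p ≅ p' ⋙ f) (hS : S ⋙ p ≅ p ⋙ s)
    (h : k ⋙ f ⋙ s ≅ r) : (K ⋙ F ⋙ S) ⋙ p ≅ p' ⋙ r :=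
  Functor.isoWhiskerLeft (K ⋙ F) hS ≪≫
    Functor.isoWhiskerLeft K (Functor.isoWhiskerRight hF s) ≪≫
    Functor.isoWhiskerRight hK (f ⋙ s) ≪≫ Functor.isoWhiskerLeft p' h

/-- The components of a composite of two functors. -/
def projPair {X Z W : Type 1} [Category.{0} X] [Category.{0} Z] [Category.{0} W]
    {F S : X ⥤ X} {p : X ⥤ Z} {p' : X ⥤ W} {f : W ⥤ Z} {s : Z ⥤ Z}
    (hF : F ⋙ p ≅ p' ⋙ f) (hS : S ⋙ p ≅ p ⋙ s) : (F ⋙ S) ⋙ p ≅ p' ⋙ f ⋙ s :=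
  Functor.isoWhiskerLeft F hS ≪≫ Functor.isoWhiskerRight hF s

/-- The relation `KF = q⁻² FK` between the blocks. -/
def KFBlock (n k : ℕ) : GrMod.shift (deg n {k + 1}) (2 * ((k + 1 : ℕ) : ℤ) - n) ⋙
    (downF n k ⋙ GrMod.shift (deg n {k}) (-((k : ℤ) + 1) + 1)) ⋙ GrMod.shift (deg n {k}) (-2) ≅
      (downF n k ⋙ GrMod.shift (deg n {k}) (-((k : ℤ) + 1) + 1)) ⋙
        GrMod.shift (deg n {k}) (2 * (k : ℤ) - n) :=
  passShifts (a := GrMod.shift (deg n {k + 1}) (2 * ((k + 1 : ℕ) : ℤ) - n))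
    (U := downF n k)
    (b := GrMod.shift (deg n {k}) (-((k : ℤ) + 1) + 1))
    (c := GrMod.shift (deg n {k}) (-((k : ℤ) + 1) + 1) ⋙ GrMod.shift (deg n {k}) (-2))
    (d := GrMod.shift (deg n {k}) (2 * (k : ℤ) - n))
    (shiftDown n k (2 * ((k + 1 : ℕ) : ℤ) - n))
    (Functor.isoWhiskerRight (GrMod.shiftAdd (deg n {k}) _ _) (GrMod.shift _ (-2)) ≪≫
      shiftTwo (deg n {k}) (by push_cast; ring))

/-- The relation `KF = q⁻² FK`. -/
def KFIso (n : ℕ) : K n ⋙ F n ⋙ shiftC n (-2) ≅ F n ⋙ K n :=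
  glueDown (fun X i hi => F_top_subsingleton ((K n).obj X) i hi)
    (fun X i hi => F_top_subsingleton X i hi)
    fun k hk => projSandwich (K := K n) (S := shiftC n (-2)) (s := GrMod.shift (deg n {k}) (-2))
        (k := GrMod.shift (deg n {k + 1}) (2 * ((k + 1 : ℕ) : ℤ) - n))
        (Iso.refl _) (FProj hk) (Iso.refl _) (KFBlock n k) ≪≫
      (projPair (S := K n) (s := GrMod.shift (deg n {k}) (2 * (k : ℤ) - n))
        (FProj hk) (Iso.refl _)).symm

/-! ## Adjunctions -/

section CompEquiv

variable {X Y Z : Type 1} [Category.{0} X] [Category.{0} Y] [Category.{0} Z] {L R : X ⥤ X}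
  {p : X ⥤ Y} {p' : X ⥤ Z} {u : Y ⥤ Z} {d : Z ⥤ Y} (eL : L ⋙ p' ≅ p ⋙ u) (eR : R ⋙ p ≅ p' ⋙ d)
  (adj : u ⊣ d)

/-- The correspondence of the components of morphisms. -/
def compEquiv (x y : X) : (p'.obj (L.obj x) ⟶ p'.obj y) ≃ (p.obj x ⟶ p.obj (R.obj y)) where
  toFun f := adj.homEquiv (p.obj x) (p'.obj y) (eL.inv.app x ≫ f) ≫ eR.inv.app y
  invFun g := eL.hom.app x ≫ (adj.homEquiv (p.obj x) (p'.obj y)).symm (g ≫ eR.hom.app y)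
  left_inv f := by
    change eL.hom.app x ≫ (adj.homEquiv (p.obj x) (p'.obj y)).symm
      ((adj.homEquiv (p.obj x) (p'.obj y) (eL.inv.app x ≫ f) ≫ eR.inv.app y) ≫ eR.hom.app y) = f
    rw [Category.assoc, Iso.inv_hom_id_app]
    erw [Category.comp_id]
    rw [Equiv.symm_apply_apply, Iso.hom_inv_id_app_assoc]
  right_inv g := by
    change adj.homEquiv (p.obj x) (p'.obj y) (eL.inv.app x ≫ eL.hom.app x ≫
      (adj.homEquiv (p.obj x) (p'.obj y)).symm (g ≫ eR.hom.app y)) ≫ eR.inv.app y = g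
    rw [Iso.inv_hom_id_app_assoc, Equiv.apply_symm_apply, Category.assoc, Iso.hom_inv_id_app]
    exact Category.comp_id g

theorem compEquiv_symm_naturality {x x' y : X} (f : x' ⟶ x) (g : p.obj x ⟶ p.obj (R.obj y)) :
    (compEquiv eL eR adj x' y).symm (p.map f ≫ g) =
      p'.map (L.map f) ≫ (compEquiv eL eR adj x y).symm g := by
  change eL.hom.app x' ≫ (adj.homEquiv _ _).symm ((p.map f ≫ g) ≫ eR.hom.app y) =
    p'.map (L.map f) ≫ eL.hom.app x ≫ (adj.homEquiv _ _).symm (g ≫ eR.hom.app y)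
  have := eL.hom.naturality f
  rw [Functor.comp_map, Functor.comp_map] at this
  rw [Category.assoc, Adjunction.homEquiv_naturality_left_symm, reassoc_of% this]

theorem compEquiv_naturality {x y y' : X} (f : p'.obj (L.obj x) ⟶ p'.obj y) (g : y ⟶ y') :
    compEquiv eL eR adj x y' (f ≫ p'.map g) =
      compEquiv eL eR adj x y f ≫ p.map (R.map g) := by
  change adj.homEquiv _ _ (eL.inv.app x ≫ f ≫ p'.map g) ≫ eR.inv.app y' =
    (adj.homEquiv _ _ (eL.inv.app x ≫ f) ≫ eR.inv.app y) ≫ p.map (R.map g)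
  have := eR.inv.naturality g
  rw [Functor.comp_map, Functor.comp_map] at this
  rw [← Category.assoc, Adjunction.homEquiv_naturality_right, Category.assoc, Category.assoc, this]

end CompEquiv

section GlueAdj

variable {L R : GCat n ⥤ GCat n}
  (e : ∀ (k : ℕ) (hk : k < n) (X Y : GCat n), ((L.obj X) ⟨k + 1, by omega⟩ ⟶ Y ⟨k + 1, by omega⟩) ≃
    (X ⟨k, by omega⟩ ⟶ (R.obj Y) ⟨k, by omega⟩))

theorem hom_eq_of_subsingleton {A : Type} [CommRing A] [Algebra ℂ A] {𝒜 : ℤ → Submodule ℂ A}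
    {M N : GrMod 𝒜} (h : Subsingleton M.carrier) (f g : M ⟶ N) : f = g :=
  GrMod.hom_ext fun m => by
    rw [h.elim m 0, map_zero, map_zero]

/-- Gluing of adjunctions between blocks. -/
def glueAdj (hL : ∀ X, Subsingleton ((L.obj X) ⟨0, by omega⟩).carrier)
    (hR : ∀ X (i : Fin (n + 1)), ¬(i : ℕ) < n → Subsingleton ((R.obj X) i).carrier)
    (h₁ : ∀ k (hk : k < n) (X X' Y : GCat n) (f : X' ⟶ X) (g), (e k hk X' Y).symm (f _ ≫ g) =
      (L.map f) _ ≫ (e k hk X Y).symm g)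
    (h₂ : ∀ k (hk : k < n) (X Y Y' : GCat n) (f) (g : Y ⟶ Y'), e k hk X Y' (f ≫ g _) =
      e k hk X Y f ≫ (R.map g) _) :
    L ⊣ R :=
  Adjunction.mkOfHomEquiv
    { homEquiv := fun X Y =>
        -- In the lowest block the source is zero and in the highest block the target is zero, so
        -- the zero morphism is the only one there.
        { toFun := fun f i => if h : (i : ℕ) < n then e i h X Y (f ⟨i + 1, by omega⟩) else 0
          invFun := fun g i => match i with
            | ⟨0, _⟩ => 0
            | ⟨k + 1, h⟩ => (e k (Nat.lt_of_succ_lt_succ h) X Y).symm (g ⟨k, by omega⟩)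
          left_inv := fun f => funext fun i => by
            obtain ⟨_ | k, h⟩ := i
            · exact hom_eq_of_subsingleton (hL X) _ _
            · refine ((e k (Nat.lt_of_succ_lt_succ h) X Y).symm_apply_eq).2 ?_
              exact dif_pos (Nat.lt_of_succ_lt_succ h)
          right_inv := fun g => funext fun i => by
            by_cases h : (i : ℕ) < n
            · refine (dif_pos h).trans ?_
              exact (e i h X Y).apply_symm_apply (g i)
            · exact GrMod.hom_ext fun m => (hR Y i h).elim _ _ }
      homEquiv_naturality_left_symm := fun {X X' Y} f g => funext fun i => by
        obtain ⟨_ | k, h⟩ := i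
        · exact hom_eq_of_subsingleton (hL X) _ _
        · exact h₁ k (Nat.lt_of_succ_lt_succ h) X' X Y f (g _)
      homEquiv_naturality_right := fun {X Y Y'} f g => funext fun i => by
        by_cases h : (i : ℕ) < n
        · refine (dif_pos h).trans (Eq.trans ?_ (congrArg (· ≫ (R.map g) i) (dif_pos h).symm))
          exact h₂ i h X Y Y' (f _) g
        · exact GrMod.hom_ext fun m => (hR Y' i h).elim _ _ }

end GlueAdj

/-- Collecting shifts before and after the downward functor. -/
def downShifts (n k : ℕ) {a s x b : ℤ} (h : a + s = 1 + x + b) :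
    GrMod.shift (deg n {k + 1}) a ⋙ downF n k ⋙ GrMod.shift (deg n {k}) s ≅
      (GrMod.shift (deg n {k + 1}) 1 ⋙ GrMod.shift (deg n {k + 1}) x) ⋙
        downF n k ⋙ GrMod.shift (deg n {k}) b :=
  passShifts (b := GrMod.shift (deg n {k}) (1 + x)) (d := GrMod.shift (deg n {k}) b)
      (shiftDown n k a) (shiftTwo (deg n {k}) h) ≪≫
    Functor.isoWhiskerRight ((shiftDown n k (1 + x)).symm ≪≫
      Functor.isoWhiskerRight (GrMod.shiftAdd (deg n {k + 1}) 1 x).symm (downF n k))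
        (GrMod.shift (deg n {k}) b)

/-- The adjunction between the blocks. -/
def upAdj {k : ℕ} (hk : k < n) : upF n k ⋙ GrMod.shift (deg n {k + 1}) (-n + k + 1) ⊣
    (GrMod.shift (deg n {k + 1}) 1 ⋙ GrMod.shift (deg n {k + 1}) (-(2 * ((k + 1 : ℕ) : ℤ) - n))) ⋙
      downF n k ⋙ GrMod.shift (deg n {k}) (-((k : ℤ) + 1) + 1) :=
  -- Induction from C^k is left adjoint to restriction, and restriction to C^{k+1} is left adjoint
  -- to induction shifted by -2k, the rank being k+1. Together with the inverse of the shift of E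
  -- these shifts add up to those of F, K⁻¹ and ⟨1⟩.
  ((((GrMod.indResAdj (degUp n k)).comp (GrMod.frobAdj (degDown n k) (powDown hk))).comp
    (GrMod.shiftAdj (deg n {k + 1}) (k := -n + k + 1) (l := n - k - 1) (by ring)))).ofNatIsoRight
      (Functor.isoWhiskerLeft (GrMod.shift (deg n {k + 1}) (n - k - 1))
        (Functor.isoWhiskerLeft (GrMod.ind (deg n {k, k + 1}) (degDown n k))
          (GrMod.shiftRes (degUp n k) (-2 * (((powDown hk).m : ℤ) - 1)))) ≪≫
        downShifts n k (by
          change (n : ℤ) - k - 1 + -2 * (((k + 1 : ℕ) : ℤ) - 1) = _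
          push_cast; ring))

/-- The components of the right adjoint of `E`. -/
def adjProj {k : ℕ} (hk : k < n) : (shiftC n 1 ⋙ Kinv n ⋙ F n) ⋙ proj n ⟨k, by omega⟩ ≅
    proj n ⟨k + 1, by omega⟩ ⋙ (GrMod.shift (deg n {k + 1}) 1 ⋙
      GrMod.shift (deg n {k + 1}) (-(2 * ((k + 1 : ℕ) : ℤ) - n))) ⋙
      downF n k ⋙ GrMod.shift (deg n {k}) (-((k : ℤ) + 1) + 1) :=
  Functor.isoWhiskerLeft (shiftC n 1 ⋙ Kinv n) (FProj hk)

/-- The right adjoint of `E`. -/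
def EAdj (n : ℕ) : E n ⊣ shiftC n 1 ⋙ Kinv n ⋙ F n :=
  glueAdj (fun _ hk X Y => compEquiv (EProj hk) (adjProj hk) (upAdj hk) X Y)
    (fun _ => inferInstanceAs (Subsingleton PUnit))
    (fun _ i hi => F_top_subsingleton _ i hi)
    (fun _ hk _ _ _ f g => compEquiv_symm_naturality (EProj hk) (adjProj hk) (upAdj hk) f g)
    (fun _ hk _ _ _ f g => compEquiv_naturality (EProj hk) (adjProj hk) (upAdj hk) f g)

end Gluing

end

end SlTwoCat

open CategoryTheory CategoryTheory.Limits
open scoped TensorProduct LaurentPolynomial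

namespace SlTwoCat

noncomputable section

set_option linter.unusedSectionVars false

/-! ## The flip of the Grassmannians -/

section Flip

variable {n : ℕ}

theorem permAct_permAct (e f : Equiv.Perm (Fin n)) (x : Coinv n) :
    permAct n e (permAct n f x) = permAct n (e * f) x := by
  obtain ⟨p, rfl⟩ := Ideal.Quotient.mk_surjective x
  exact congrArg (Ideal.Quotient.mk (symIdeal n)) (rename_mul_perm e f p).symm

theorem permAct_one (x : Coinv n) : permAct n 1 x = x := by
  obtain ⟨p, rfl⟩ := Ideal.Quotient.mk_surjective x
  exact congrArg (Ideal.Quotient.mk (symIdeal n)) (MvPolynomial.rename_id_apply p)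

theorem revPerm_sq : (Fin.revPerm * Fin.revPerm : Equiv.Perm (Fin n)) = 1 :=
  Equiv.ext fun k => Fin.rev_rev k

/-- Reversal takes the first i indices to the complement of the first n-i, and a permutation
preserves a set if and only if it preserves the complement. -/
theorem young_rev {I J : Set ℕ} (h : ∀ i ∈ I, ∃ j ∈ J, i + j = n) {e : Equiv.Perm (Fin n)}
    (he : e ∈ young n J) : Fin.revPerm * e * Fin.revPerm ∈ young n I := by
  intro i hi k
  obtain ⟨j, hj, hij⟩ := h i hi
  have := he j hj k.rev
  simp only [Equiv.Perm.mul_apply, Fin.revPerm_apply, Fin.val_rev] at this ⊢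
  have h1 := (e k.rev).2
  have h2 := k.2
  omega

/-- The reversal of the variables, as a map between rings of invariants. -/
def revAlg (n : ℕ) {I J : Set ℕ} (h : ∀ i ∈ I, ∃ j ∈ J, i + j = n) : C n I →ₐ[ℂ] C n J :=
  ((permAct n Fin.revPerm).comp (C n I).val).codRestrict (C n J) fun x e he => by
    have h1 := x.2 _ (young_rev h he)
    change permAct n e (permAct n Fin.revPerm x.1) = permAct n Fin.revPerm x.1
    conv_rhs => rw [← h1]
    rw [permAct_permAct, permAct_permAct, ← mul_assoc, ← mul_assoc, revPerm_sq, one_mul]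

theorem revAlg_mem {I J : Set ℕ} (h : ∀ i ∈ I, ∃ j ∈ J, i + j = n) (d : ℤ) (a : C n I)
    (ha : a ∈ deg n I d) : revAlg n h a ∈ deg n J d := permAct_mem n _ ha

theorem revAlg_revAlg {I J : Set ℕ} (h : ∀ i ∈ I, ∃ j ∈ J, i + j = n)
    (h' : ∀ i ∈ J, ∃ j ∈ I, i + j = n) (a : C n I) : revAlg n h' (revAlg n h a) = a :=
  Subtype.ext ((permAct_permAct _ _ a.1).trans (by rw [revPerm_sq, permAct_one]))

theorem revAlg_bijective {I J : Set ℕ} (h : ∀ i ∈ I, ∃ j ∈ J, i + j = n)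
    (h' : ∀ i ∈ J, ∃ j ∈ I, i + j = n) : Function.Bijective (revAlg n h) :=
  Function.bijective_iff_has_inverse.2 ⟨revAlg n h', revAlg_revAlg h h', revAlg_revAlg h' h⟩

theorem aug_revAlg {I J : Set ℕ} (h : ∀ i ∈ I, ∃ j ∈ J, i + j = n) (a : C n I) :
    aug n J (revAlg n h a) = aug n I a := by
  obtain ⟨x, hx⟩ := a
  obtain ⟨p, rfl⟩ := Ideal.Quotient.mk_surjective x
  change MvPolynomial.aeval (R := ℂ) (fun _ : Fin n => (0 : ℂ)) (MvPolynomial.rename _ p) =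
    MvPolynomial.aeval (R := ℂ) (fun _ : Fin n => (0 : ℂ)) p
  rw [MvPolynomial.aeval_rename]
  rfl

theorem single_rev {i j : ℕ} (h : i + j = n) :
    ∀ i' ∈ ({i} : Set ℕ), ∃ j' ∈ ({j} : Set ℕ), i' + j' = n := fun _ hi => ⟨j, rfl, by
  rw [Set.mem_singleton_iff] at hi; omega⟩

theorem pair_rev {j k : ℕ} (h : j + k + 1 = n) :
    ∀ i' ∈ ({j, j + 1} : Set ℕ), ∃ j' ∈ ({k, k + 1} : Set ℕ), i' + j' = n := by
  intro i hi
  rcases hi with hi | hi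
  · exact ⟨k + 1, by simp, by omega⟩
  · rw [Set.mem_singleton_iff] at hi
    exact ⟨k, by simp, by omega⟩

/-- The isomorphism of blocks given by the reversal of the variables. -/
def flip (n : ℕ) {i j : ℕ} (h : i + j = n) : Block n j ⥤ Block n i :=
  GrMod.twist (revAlg n (single_rev h)) (revAlg_mem (single_rev h))

/-- Flipping twice. -/
def flipFlip {i j : ℕ} (h : i + j = n) (h' : j + i = n) : 𝟭 (Block n j) ≅ flip n h ⋙ flip n h' :=
  GrMod.twistTwist _ _ _ _ fun a => revAlg_revAlg (single_rev h') (single_rev h) a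

/-- Flipping exchanges the upward and the downward functor. -/
def flipUp {j k : ℕ} (h : j + (k + 1) = n) (h' : j + 1 + k = n) :
    flip n h ⋙ upF n j ≅ downF n k ⋙ flip n h' :=
  GrMod.twistIndIso (degUp n j) (degDown n j) (degDown n k) (degUp n k)
    (revAlg n (single_rev h)) (revAlg_mem _) (revAlg_bijective _ (single_rev (by omega))).2
    (AlgEquiv.ofBijective (revAlg n (pair_rev (j := j) (k := k) (by omega)))
      (revAlg_bijective _ (pair_rev (by omega)))) (fun d a ha => revAlg_mem (pair_rev (by omega)) d a ha)
    (revAlg n (single_rev h')) (revAlg_mem _) (fun _ => rfl) (fun _ => rfl)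

/-- The equivalence induced by flipping. -/
def Sig (n : ℕ) : GCat n ⥤ GCat n :=
  Functor.pi' fun i => proj n i.rev ⋙ flip n (show (i : ℕ) + (i.rev : ℕ) = n by
    rw [Fin.val_rev]; omega)

/-- The opposite block is indexed by any j with i + j = n. Once j is replaced by the value of
`Fin.rev`, the two sides agree by definition. -/
theorem Sig_proj {i j : ℕ} (h : i + j = n) : Sig n ⋙ proj n ⟨i, by omega⟩ =
    proj n ⟨j, by omega⟩ ⋙ flip n h := by
  obtain rfl : j = n + 1 - (i + 1) := by omega
  rfl

/-- The components of the flip. -/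
def SigProj {i j : ℕ} (h : i + j = n) : Sig n ⋙ proj n ⟨i, by omega⟩ ≅
    proj n ⟨j, by omega⟩ ⋙ flip n h := eqToIso (Sig_proj h)

/-- The flip is an involution. -/
def SigSig (n : ℕ) : Sig n ⋙ Sig n ≅ 𝟭 (GCat n) :=
  NatIso.pi' fun ⟨i, hi⟩ =>
    have h : i + (n - i) = n := by omega
    have h' : (n - i) + i = n := by omega
    (projComp (SigProj h) (SigProj h') (flipFlip h' h).symm :
      Sig n ⋙ Sig n ⋙ proj n ⟨i, by omega⟩ ≅ proj n ⟨i, by omega⟩ ⋙ 𝟭 _)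

/-- The flip as an equivalence. -/
def SigEquiv (n : ℕ) : GCat n ≌ GCat n :=
  CategoryTheory.Equivalence.mk (Sig n) (Sig n) (SigSig n).symm (SigSig n)

theorem Sig_subsingleton {i j : ℕ} (h : i + j = n) (X : GCat n)
    (hX : Subsingleton (X ⟨j, by omega⟩).carrier) :
    Subsingleton (((Sig n).obj X) ⟨i, by omega⟩).carrier := by
  have : ((Sig n).obj X) ⟨i, by omega⟩ = (flip n h).obj (X ⟨j, by omega⟩) :=
    congrArg (fun T => T.obj X) (Sig_proj h)
  rw [this]
  exact hX

/-- Conjugating a functor by the flip exchanges the blocks. -/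
def sigConj {X W W' Z Z' : Type 1} [Category.{0} X] [Category.{0} W] [Category.{0} W']
    [Category.{0} Z] [Category.{0} Z'] {σ T : X ⥤ X} {p : X ⥤ Z} {p' : X ⥤ Z'} {r : X ⥤ W}
    {r' : X ⥤ W'} {f : Z' ⥤ Z} {t : W ⥤ Z'} {f' : W' ⥤ W} {e : W' ⥤ Z}
    (h₁ : σ ⋙ p ≅ p' ⋙ f) (h₂ : T ⋙ p' ≅ r ⋙ t) (h₃ : σ ⋙ r ≅ r' ⋙ f')
    (h : f' ⋙ t ⋙ f ≅ e) : (σ ⋙ T ⋙ σ) ⋙ p ≅ r' ⋙ e :=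
  Functor.isoWhiskerLeft (σ ⋙ T) h₁ ≪≫
    Functor.isoWhiskerLeft σ (Functor.isoWhiskerRight h₂ f) ≪≫
    Functor.isoWhiskerRight h₃ (t ⋙ f) ≪≫ Functor.isoWhiskerLeft r' h

/-- Cancelling flips around a functor. -/
def flipCancel {Z Z' W W' : Type 1} [Category.{0} W] [Category.{0} W']
    [Category.{0} Z] [Category.{0} Z'] {f' : W' ⥤ W} {u : W ⥤ Z'} {s : Z' ⥤ Z'} {f : Z' ⥤ Z}
    {d : W' ⥤ Z} {g : Z ⥤ Z'} {s' : Z ⥤ Z} (h₁ : f' ⋙ u ≅ d ⋙ g) (h₂ : s ⋙ f ≅ f ⋙ s')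
    (h₃ : 𝟭 Z ≅ g ⋙ f) : f' ⋙ (u ⋙ s) ⋙ f ≅ d ⋙ s' :=
  Functor.isoWhiskerRight h₁ (s ⋙ f) ≪≫ Functor.isoWhiskerLeft (d ⋙ g) h₂ ≪≫
    Functor.isoWhiskerRight (Functor.isoWhiskerLeft d h₃.symm) s'

/-- Flipping exchanges `E` and `F`. -/
def SigESig (n : ℕ) : Sig n ⋙ E n ⋙ Sig n ≅ F n :=
  glueDown (fun X ⟨i, hi⟩ hin => Sig_subsingleton (i := i) (j := 0) (by simp only [] at hin; omega)
      ((E n).obj ((Sig n).obj X)) (show Subsingleton PUnit from inferInstance))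
    (fun X i hi => F_top_subsingleton X i hi)
    fun k hk =>
      have h1 : k + (n - k - 1 + 1) = n := by omega
      have h2 : n - k - 1 + (k + 1) = n := by omega
      have h3 : n - k - 1 + 1 + k = n := by omega
      sigConj (SigProj h1) (EProj (k := n - k - 1) (by omega)) (SigProj h2)
          (flipCancel (flipUp h2 h3) (GrMod.shiftTwist _ _ _) (flipFlip h3 h1)) ≪≫
        Functor.isoWhiskerLeft (proj n ⟨k + 1, by omega⟩ ⋙ downF n k)
          (GrMod.shiftEq (deg n {k}) (by omega)) ≪≫ (FProj hk).symm

/-- Flipping exchanges `F` and `E`. -/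
def SigFSig (n : ℕ) : Sig n ⋙ F n ⋙ Sig n ≅ E n :=
  Functor.isoWhiskerLeft (Sig n) (Functor.isoWhiskerRight (SigESig n).symm (Sig n)) ≪≫
    Functor.isoWhiskerRight (SigSig n) (E n ⋙ Sig n ⋙ Sig n) ≪≫
    Functor.isoWhiskerLeft (E n) (SigSig n)

/-- Flipping a shift. -/
def flipShift {i j : ℕ} (h : i + j = n) (h' : j + i = n) {a b : ℤ} (hab : a = b) :
    flip n h' ⋙ GrMod.shift (deg n {j}) a ⋙ flip n h ≅ GrMod.shift (deg n {i}) b :=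
  Functor.isoWhiskerRight (flipFlip h' h).symm (GrMod.shift (deg n {i}) a) ≪≫
    GrMod.shiftEq (deg n {i}) hab

/-- Flipping exchanges `K` and `K⁻¹`. -/
def SigKSig (n : ℕ) : Sig n ⋙ K n ⋙ Sig n ≅ Kinv n :=
  NatIso.pi' fun ⟨i, hi⟩ =>
    have h : i + (n - i) = n := by omega
    have h' : (n - i) + i = n := by omega
    (sigConj (T := K n) (t := GrMod.shift (deg n {n - i}) (2 * ((n - i : ℕ) : ℤ) - n))
      (SigProj h) (Iso.refl _) (SigProj h') (flipShift h h' (by omega)) :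
      (Sig n ⋙ K n ⋙ Sig n) ⋙ proj n ⟨i, by omega⟩ ≅
        proj n ⟨i, by omega⟩ ⋙ GrMod.shift (deg n {i}) (-(2 * (i : ℤ) - n)))

/-- Flipping commutes with shifts. -/
def SigShiftSig (n : ℕ) (k : ℤ) : Sig n ⋙ shiftC n k ⋙ Sig n ≅ shiftC n k :=
  NatIso.pi' fun ⟨i, hi⟩ =>
    have h : i + (n - i) = n := by omega
    have h' : (n - i) + i = n := by omega
    (sigConj (T := shiftC n k) (t := GrMod.shift (deg n {n - i}) k)
      (SigProj h) (Iso.refl _) (SigProj h') (flipShift h h' rfl) :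
      (Sig n ⋙ shiftC n k ⋙ Sig n) ⋙ proj n ⟨i, by omega⟩ ≅
        proj n ⟨i, by omega⟩ ⋙ GrMod.shift (deg n {i}) k)

end Flip

end

end SlTwoCat

open CategoryTheory CategoryTheory.Limits
open scoped TensorProduct LaurentPolynomial

namespace SlTwoCat

noncomputable section

set_option linter.unusedSectionVars false

/-! ## Duality, adjunctions and exactness -/

section Duality

variable {n : ℕ}

/-- The graded duality is an involution. -/
def dualCDual (n : ℕ) : (dualC n).rightOp ⋙ dualC n ≅ 𝟭 (GCat n) :=
  NatIso.pi' fun i => Functor.isoWhiskerLeft (proj n i) (GrMod.dualDual (deg n {(i : ℕ)})).symm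

/-- The graded duality as an equivalence. -/
def dualEquiv (n : ℕ) : (GCat n)ᵒᵖ ≌ GCat n :=
  CategoryTheory.Equivalence.mk (dualC n) (dualC n).rightOp
    (NatIso.ofComponents (fun X => ((dualCDual n).app X.unop).op)
      fun f => congrArg Quiver.Hom.op ((dualCDual n).hom.naturality f.unop).symm)
    (dualCDual n)

/-- Conjugating shifts by the duality. -/
def dualShift {A : Type} [CommRing A] [Algebra ℂ A] [Module.Finite ℂ A]
    (𝒜 : ℤ → Submodule ℂ A) {k l : ℤ} (h : k + l = 0) :
    (GrMod.dual 𝒜).rightOp ⋙ (GrMod.shift 𝒜 k).op ⋙ GrMod.dual 𝒜 ≅ GrMod.shift 𝒜 l :=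
  Functor.isoWhiskerLeft (GrMod.dual 𝒜).rightOp (GrMod.shiftDual 𝒜 h) ≪≫
    Functor.isoWhiskerRight (GrMod.dualDual 𝒜).symm (GrMod.shift 𝒜 l)

/-- Conjugating `K` by the duality. -/
def dualKDual (n : ℕ) : (dualC n).rightOp ⋙ (K n).op ⋙ dualC n ≅ Kinv n :=
  NatIso.pi' fun i => Functor.isoWhiskerLeft (proj n i)
    (dualShift (deg n {(i : ℕ)}) (k := 2 * (i : ℤ) - n) (l := -(2 * (i : ℤ) - n)) (by ring))

/-- Conjugating shifts by the duality. -/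
def dualShiftDual (n : ℕ) (k : ℤ) : (dualC n).rightOp ⋙ (shiftC n k).op ⋙ dualC n ≅ shiftC n (-k) :=
  NatIso.pi' fun i => Functor.isoWhiskerLeft (proj n i)
    (dualShift (deg n {(i : ℕ)}) (k := k) (l := -k) (by ring))

/-- Conjugating a functor followed by a shift. -/
def dualConj {A A' : Type} [CommRing A] [Algebra ℂ A] [Module.Finite ℂ A] [CommRing A']
    [Algebra ℂ A'] [Module.Finite ℂ A'] {𝒜 : ℤ → Submodule ℂ A} {𝒜' : ℤ → Submodule ℂ A'}
    {u : GrMod 𝒜 ⥤ GrMod 𝒜'} {a s : ℤ}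
    (h : u ⋙ GrMod.shift 𝒜' s ≅ (GrMod.dual 𝒜).rightOp ⋙ u.op ⋙ GrMod.dual 𝒜')
    (hs : s = a + a) :
    (GrMod.dual 𝒜).rightOp ⋙ (u ⋙ GrMod.shift 𝒜' a).op ⋙ GrMod.dual 𝒜' ≅
      u ⋙ GrMod.shift 𝒜' a :=
  Functor.isoWhiskerLeft ((GrMod.dual 𝒜).rightOp ⋙ u.op)
      (GrMod.shiftDual 𝒜' (k := a) (l := -a) (by ring)) ≪≫
    Functor.isoWhiskerRight h.symm (GrMod.shift 𝒜' (-a)) ≪≫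
    Functor.isoWhiskerLeft u (GrMod.shiftAddEq 𝒜' (by subst hs; ring))

/-- The components of the conjugate of a functor by a duality. -/
def dualComp {X Z W : Type 1} [Category.{0} X] [Category.{0} Z] [Category.{0} W]
    {d : Xᵒᵖ ⥤ X} {dz : Zᵒᵖ ⥤ Z} {dw : Wᵒᵖ ⥤ W} {T : X ⥤ X} {p : X ⥤ Z} {p' : X ⥤ W} {t e : W ⥤ Z}
    (hd : d ⋙ p ≅ p.op ⋙ dz) (hd' : d.rightOp ⋙ p'.op ≅ p' ⋙ dw.rightOp)
    (hT : T ⋙ p ≅ p' ⋙ t) (h : dw.rightOp ⋙ t.op ⋙ dz ≅ e) :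
    (d.rightOp ⋙ T.op ⋙ d) ⋙ p ≅ p' ⋙ e :=
  Functor.isoWhiskerLeft (d.rightOp ⋙ T.op) hd ≪≫
    Functor.isoWhiskerLeft d.rightOp (Functor.isoWhiskerRight (NatIso.op hT.symm) dz) ≪≫
    Functor.isoWhiskerRight hd' (t.op ⋙ dz) ≪≫ Functor.isoWhiskerLeft p' h

/-- The components of the duality. -/
def dualProj (n : ℕ) (i : Fin (n + 1)) :
    dualC n ⋙ proj n i ≅ (proj n i).op ⋙ GrMod.dual (deg n {(i : ℕ)}) := Iso.refl _

/-- The components of the duality. -/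
def dualProjOp (n : ℕ) (i : Fin (n + 1)) :
    (dualC n).rightOp ⋙ (proj n i).op ≅ proj n i ⋙ (GrMod.dual (deg n {(i : ℕ)})).rightOp :=
  Iso.refl _

/-- The duality and the upward functor. -/
def upDual {k : ℕ} (hk : k < n) : (GrMod.dual (deg n {k})).rightOp ⋙
    (upF n k ⋙ GrMod.shift (deg n {k + 1}) (-n + k + 1)).op ⋙ GrMod.dual (deg n {k + 1}) ≅
      upF n k ⋙ GrMod.shift (deg n {k + 1}) (-n + k + 1) :=
  -- The normalizing shift of E is exactly half of the shift -2(n-k-1) produced by the trace; this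
  -- is why no shift remains after conjugation.
  dualConj (GrMod.dualIndIso (degUp n k) (degDown n k) (powUp hk)) (by
    change -2 * (((n - k : ℕ) : ℤ) - 1) = _
    omega)

/-- The duality and the downward functor. -/
def downDual {k : ℕ} (hk : k < n) : (GrMod.dual (deg n {k + 1})).rightOp ⋙
    (downF n k ⋙ GrMod.shift (deg n {k}) (-((k : ℤ) + 1) + 1)).op ⋙ GrMod.dual (deg n {k}) ≅
      downF n k ⋙ GrMod.shift (deg n {k}) (-((k : ℤ) + 1) + 1) :=
  dualConj (GrMod.dualIndIso (degDown n k) (degUp n k) (powDown hk)) (by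
    change -2 * (((k + 1 : ℕ) : ℤ) - 1) = _
    push_cast; ring)

/-- `E` commutes with the duality. -/
def dualEDual (n : ℕ) : (dualC n).rightOp ⋙ (E n).op ⋙ dualC n ≅ E n :=
  glueUp (GrMod.isoOfSubsingleton
      (fun _ => (show Subsingleton (Module.Dual ℂ PUnit) from inferInstance))
      (fun _ => (show Subsingleton PUnit from inferInstance)))
    fun _ hk => dualComp (dualProj n _) (dualProjOp n _) (EProj hk) (upDual hk) ≪≫ (EProj hk).symm

theorem dual_subsingleton {A : Type} [CommRing A] [Algebra ℂ A] [Module.Finite ℂ A]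
    {𝒜 : ℤ → Submodule ℂ A} {M : GrMod 𝒜} (h : Subsingleton M.carrier) :
    Subsingleton (GrMod.dualObj M).carrier :=
  show Subsingleton (Module.Dual ℂ M.carrier) from inferInstance

/-- `F` commutes with the duality. -/
def dualFDual (n : ℕ) : (dualC n).rightOp ⋙ (F n).op ⋙ dualC n ≅ F n :=
  glueDown (fun X i hi => dual_subsingleton (F_top_subsingleton ((dualC n).obj (Opposite.op X)) i hi))
    (fun X i hi => F_top_subsingleton X i hi)
    fun _ hk => dualComp (dualProj n _) (dualProjOp n _) (FProj hk) (downDual hk) ≪≫ (FProj hk).symm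

/-- Conjugating an adjunction by an involution. -/
def conjAdj {X : Type 1} [Category.{0} X] {σ L R : X ⥤ X} (e : σ ⋙ σ ≅ 𝟭 X) (adj : L ⊣ R) :
    σ ⋙ L ⋙ σ ⊣ σ ⋙ R ⋙ σ :=
  have h : σ ⊣ σ := (CategoryTheory.Equivalence.mk σ σ e.symm e).toAdjunction
  h.comp (adj.comp h)

/-- The right adjoint of `F`. -/
def FAdj (n : ℕ) : F n ⊣ shiftC n 1 ⋙ K n ⋙ E n :=
  -- The adjunction for E is conjugated by the flip. Squares of the flip are inserted between the
  -- factors of the right adjoint, so that each factor is conjugated separately.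
  ((conjAdj (SigSig n) (EAdj n)).ofNatIsoLeft (SigESig n)).ofNatIsoRight
    (Functor.isoWhiskerLeft (Sig n ⋙ shiftC n 1) (Functor.isoWhiskerRight (SigSig n).symm
        (Kinv n ⋙ F n ⋙ Sig n)) ≪≫
      Functor.isoWhiskerRight (SigShiftSig n 1) (Sig n ⋙ Kinv n ⋙ F n ⋙ Sig n) ≪≫
      Functor.isoWhiskerLeft (shiftC n 1 ⋙ Sig n ⋙ Kinv n)
        (Functor.isoWhiskerRight (SigSig n).symm (F n ⋙ Sig n)) ≪≫
      Functor.isoWhiskerLeft (shiftC n 1 ⋙ Sig n ⋙ Kinv n ⋙ Sig n) (SigFSig n) ≪≫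
      Functor.isoWhiskerLeft (shiftC n 1)
        (Functor.isoWhiskerRight (Functor.isoWhiskerLeft (Sig n)
          (Functor.isoWhiskerRight (SigKSig n).symm (Sig n)) ≪≫
          Functor.isoWhiskerRight (SigSig n) (K n ⋙ Sig n ⋙ Sig n) ≪≫
          Functor.isoWhiskerLeft (K n) (SigSig n)) (E n)))

instance (n : ℕ) : (K n).IsEquivalence := (KEquiv n).isEquivalence_functor

instance (n : ℕ) : (Kinv n).IsEquivalence := (KEquiv n).isEquivalence_inverse

instance (n : ℕ) : (Sig n).IsEquivalence := (SigEquiv n).isEquivalence_functor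

instance (n : ℕ) : (dualC n).IsEquivalence := (dualEquiv n).isEquivalence_functor

instance (n : ℕ) : PreservesFiniteColimits (E n) :=
  have := (EAdj n).leftAdjoint_preservesColimits
  inferInstance

instance (n : ℕ) : PreservesFiniteColimits (F n) :=
  have := (FAdj n).leftAdjoint_preservesColimits
  inferInstance

/-- The right adjoint of F is E composed with K and a shift. Composing with the inverses of these
two equivalences recovers E. -/
instance (n : ℕ) : PreservesFiniteLimits (E n) :=
  have := (FAdj n).rightAdjoint_preservesLimits
  have e : (Kinv n ⋙ shiftC n (-1)) ⋙ shiftC n 1 ⋙ K n ⋙ E n ≅ E n :=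
    Functor.isoWhiskerLeft (Kinv n) (Functor.isoWhiskerRight
      (shiftCAdd n (-1) 1 ≪≫ shiftCZero n (by ring)) (K n ⋙ E n)) ≪≫
    Functor.isoWhiskerRight (KinvK n) (E n)
  preservesFiniteLimits_of_natIso e

instance (n : ℕ) : PreservesFiniteLimits (F n) :=
  have := (EAdj n).rightAdjoint_preservesLimits
  have e : (K n ⋙ shiftC n (-1)) ⋙ shiftC n 1 ⋙ Kinv n ⋙ F n ≅ F n :=
    Functor.isoWhiskerLeft (K n) (Functor.isoWhiskerRight
      (shiftCAdd n (-1) 1 ≪≫ shiftCZero n (by ring)) (Kinv n ⋙ F n)) ≪≫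
    Functor.isoWhiskerRight (KKinv n) (F n)
  preservesFiniteLimits_of_natIso e

end Duality

end

end SlTwoCat

open CategoryTheory CategoryTheory.Limits
open scoped TensorProduct LaurentPolynomial

namespace SlTwoCat

noncomputable section

set_option linter.unusedSectionVars false

/-! ## Connected gradings and Frobenius forms -/

section Frobenius

variable {A B : Type} [CommRing A] [Algebra ℂ A] [CommRing B] [Algebra ℂ B]

/-- The grading is nonnegative and connected, with augmentation `ε`. -/
structure AugGrading (𝒜 : ℤ → Submodule ℂ A) (ε : A →ₐ[ℂ] ℂ) : Prop where
  zero : ∀ a ∈ 𝒜 0, a = algebraMap ℂ A (ε a)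
  neg : ∀ d < 0, ∀ a ∈ 𝒜 d, a = 0
  pos : ∀ d a, d ≠ 0 → a ∈ 𝒜 d → ε a = 0

/-- A homogeneous functional of degree `-N` inducing a perfect pairing. -/
structure FrobForm (𝒜 : ℤ → Submodule ℂ A) (N : ℤ) where
  /-- The functional. -/
  form : A →ₗ[ℂ] ℂ
  vanish : ∀ d a, d ≠ N → a ∈ 𝒜 d → form a = 0
  nondeg : ∀ a, (∀ b, form (a * b) = 0) → a = 0

/-- A partner in the pairing for an element of degree above N would have negative degree, so
nondegeneracy kills the element. -/
theorem FrobForm.eq_zero {𝒜 : ℤ → Submodule ℂ A} [GradedAlgebra 𝒜] {N : ℤ} (φ : FrobForm 𝒜 N)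
    (hneg : ∀ d < 0, ∀ a ∈ 𝒜 d, a = 0) {d : ℤ} (hd : N < d) {a : A} (ha : a ∈ 𝒜 d) : a = 0 := by
  refine φ.nondeg a fun b => ?_
  refine grading_induction (DirectSum.Decomposition.isInternal 𝒜)
    (P := fun b => φ.form (a * b) = 0) (by simp) (fun x y hx hy => ?_) (fun i x hx => ?_) b
  · simp only [mul_add, map_add, hx, hy, add_zero]
  · by_cases h : d + i = N
    · rw [hneg i (by omega) x hx, mul_zero, map_zero]
    · exact φ.vanish _ _ h (SetLike.mul_mem_graded ha hx)

variable [Algebra A B] [IsScalarTower ℂ A B] {𝒜 : ℤ → Submodule ℂ A} {ℬ : ℤ → Submodule ℂ B}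
  [GradedAlgebra 𝒜] [GradedAlgebra ℬ] (P : PowExt 𝒜 ℬ)

/-- Composing a Frobenius form with the trace. -/
def PowExt.frobUp (hAB : ∀ (i : ℤ) (a : A), a ∈ 𝒜 i → algebraMap A B a ∈ ℬ i) {N N' : ℤ}
    (φ : FrobForm 𝒜 N) (h : N' = N + 2 * ((P.m : ℤ) - 1)) : FrobForm ℬ N' where
  form := φ.form ∘ₗ P.tr.restrictScalars ℂ
  vanish d b hd hb := φ.vanish _ _ (by omega) (P.tr_mem hAB hb)
  nondeg b hb := P.eq_zero_of_tr b fun k => φ.nondeg _ fun a => by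
    have := hb (a • P.basis k)
    rw [mul_smul_comm] at this
    change φ.form (P.tr (a • (b * P.basis k))) = 0 at this
    rwa [map_smul, smul_eq_mul, mul_comm] at this

theorem PowExt.eq_zero_of_smul_pow {k : ℕ} (hk : k < P.m) {a : A} (h : a • P.x ^ k = 0) :
    a = 0 := by
  have h1 := P.basis_apply ⟨k, hk⟩
  have h2 := congrArg (fun b => P.basis.repr b ⟨k, hk⟩) h
  simp only at h1
  simpa [← h1] using h2

/-- Restricting a Frobenius form to a subring. -/
def PowExt.frobDown (hAB : ∀ (i : ℤ) (a : A), a ∈ 𝒜 i → algebraMap A B a ∈ ℬ i)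
    (hneg : ∀ d < 0, ∀ b ∈ ℬ d, b = 0) {N N' : ℤ}
    (φ : FrobForm ℬ N) (h : N = N' + 2 * ((P.m : ℤ) - 1)) : FrobForm 𝒜 N' where
  -- The functional a ↦ φ(a x^(m-1)): the top power takes up the degree 2(m-1) by which the
  -- extension raises the top degree.
  form := φ.form ∘ₗ (LinearMap.toSpanSingleton A B (P.x ^ (P.m - 1))).restrictScalars ℂ
  vanish d a hd ha := φ.vanish (d + 2 * ((P.m - 1 : ℕ) : ℤ)) _ (by have := P.m_pos; omega)
    (PowExt.algebraMap_mul_mem hAB ha (P.pow_mem _))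
  nondeg a ha := by
    have hm := P.m_pos
    -- Only the top power of x contributes to φ. If c x^k has degree N with k < m-1, then c x^(m-1)
    -- lies above the top degree, so it is zero, and therefore c is zero.
    have key : ∀ k, k < P.m - 1 → ∀ c : A, φ.form (c • P.x ^ k) = 0 := fun k hk c => by
      refine grading_induction (DirectSum.Decomposition.isInternal 𝒜)
        (P := fun c => φ.form (c • P.x ^ k) = 0) (by simp) (fun x y hx hy => ?_)
        (fun i x hx => ?_) c
      · simp only [add_smul, map_add, hx, hy, add_zero]
      · by_cases hN : i + 2 * (k : ℤ) = N
        · have h1 : x • P.x ^ (P.m - 1) = 0 :=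
            φ.eq_zero hneg (d := i + 2 * ((P.m - 1 : ℕ) : ℤ)) (by omega)
              (PowExt.algebraMap_mul_mem hAB hx (P.pow_mem _))
          rw [P.eq_zero_of_smul_pow (by omega) h1, zero_smul, map_zero]
        · exact φ.vanish _ _ hN (PowExt.algebraMap_mul_mem hAB hx (P.pow_mem k))
    have h0 : algebraMap A B a = 0 := φ.nondeg _ fun b => by
      rw [← P.basis.sum_repr b, Finset.mul_sum, map_sum]
      refine Finset.sum_eq_zero fun k _ => ?_
      rw [mul_smul_comm, ← Algebra.smul_def, smul_smul, P.basis_apply]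
      by_cases hk : (k : ℕ) < P.m - 1
      · exact key k hk _
      · rw [show (k : ℕ) = P.m - 1 by have := k.2; omega, mul_comm]
        exact ha _
    exact P.eq_zero_of_smul_pow (k := 0) hm (by rw [Algebra.smul_def, h0, zero_mul])

end Frobenius

/-! ### Frobenius forms on the rings of the Grassmannians -/

section FrobeniusC

variable {n : ℕ}

theorem weight_wt (m : Fin n →₀ ℕ) : Finsupp.weight (wt n) m = 2 * ((∑ i, m i : ℕ) : ℤ) := by
  rw [Finsupp.weight_apply, Finsupp.sum_fintype _ _ (by simp)]
  simp only [wt, nsmul_eq_mul]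
  rw [← Finset.sum_mul, mul_comm]
  push_cast
  rfl

theorem augGrading (n : ℕ) (I : Set ℕ) : AugGrading (deg n I) (aug n I) where
  zero a ha := by
    obtain ⟨p, hp, hpa⟩ := ha
    have h1 : p = MvPolynomial.C (MvPolynomial.coeff 0 p) := by
      ext m
      rw [MvPolynomial.coeff_C]
      split_ifs with h
      · rw [h]
      · by_contra hne
        have := hp hne
        rw [weight_wt] at this
        refine h (Finsupp.ext fun i => ?_)
        have h2 : ∑ i, m i = 0 := by omega
        exact ((Finset.sum_eq_zero_iff.1 h2) i (Finset.mem_univ i)).symm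
    have h2 : a = algebraMap ℂ (C n I) (MvPolynomial.coeff 0 p) := Subtype.ext (by
      refine hpa.symm.trans ?_
      rw [h1]
      simp only [MvPolynomial.coeff_zero_C]
      rfl)
    rw [h2, AlgHom.commutes]
    rfl
  neg d hd a ha := by
    obtain ⟨p, hp, hpa⟩ := ha
    have h1 : p = 0 := by
      ext m
      rw [MvPolynomial.coeff_zero]
      by_contra hne
      have := hp hne
      rw [weight_wt] at this
      omega
    refine Subtype.ext (hpa.symm.trans ?_)
    rw [h1, map_zero]
    rfl
  pos d a hd ha := aug_eq_zero n I d a hd ha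

/-- The Young subgroup is all of S_n here, and the class of a symmetric polynomial is its constant
term. -/
theorem eq_algebraMap_of_bot (a : C n {0}) : a = algebraMap ℂ (C n {0}) (aug n {0} a) := by
  obtain ⟨p, hp, hpa⟩ := exists_lift a
  have hsymm : p.IsSymmetric := fun e => hp e fun i hi k => by
    rw [Set.mem_singleton_iff] at hi
    omega
  have h1 : p - MvPolynomial.C (MvPolynomial.constantCoeff p) ∈ symIdeal n :=
    Ideal.subset_span ⟨hsymm.sub (MvPolynomial.IsSymmetric.C _), by simp⟩
  have h2 : a = algebraMap ℂ (C n {0}) (MvPolynomial.constantCoeff p) :=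
    Subtype.ext (hpa.symm.trans (Ideal.Quotient.eq.2 h1))
  rw [h2, AlgHom.commutes]
  rfl

/-- Induction along the chain from C^k up to C^{k,k+1} and down to C^{k+1}, starting with C^0 = ℂ.
The degrees match because k(n-k) + (n-k-1) = (k+1)(n-k-1) + k. -/
theorem nonempty_frobForm (i : ℕ) (hi : i ≤ n) :
    Nonempty (FrobForm (deg n {i}) (2 * ((i : ℤ) * (n - i)))) := by
  induction i with
  | zero =>
    refine ⟨⟨(aug n {0}).toLinearMap, fun d a hd ha => aug_eq_zero n _ d a (by simpa using hd) ha,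
      fun a ha => ?_⟩⟩
    have := ha 1
    rw [mul_one] at this
    rw [eq_algebraMap_of_bot a]
    change aug n {0} a = 0 at this
    rw [this, map_zero]
  | succ k ih =>
    obtain ⟨φ⟩ := ih (by omega)
    refine ⟨(powDown hi).frobDown (degDown n k) (augGrading n _).neg
      ((powUp hi).frobUp (degUp n k) φ rfl) ?_⟩
    change 2 * ((k : ℤ) * (n - k)) + 2 * (((n - k : ℕ) : ℤ) - 1) =
      2 * (((k + 1 : ℕ) : ℤ) * (n - (k + 1 : ℕ))) + 2 * (((k + 1 : ℕ) : ℤ) - 1)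
    rw [Nat.cast_sub (by omega)]
    push_cast
    ring

end FrobeniusC

/-! ## Free modules -/

namespace GrMod

section Reg

variable {A : Type} [CommRing A] [Algebra ℂ A] [Module.Finite ℂ A] (𝒜 : ℤ → Submodule ℂ A)
  [GradedAlgebra 𝒜]

/-- The free module of rank one. -/
def regObj : GrMod 𝒜 where
  carrier := A
  deg := 𝒜
  internal := DirectSum.Decomposition.isInternal 𝒜
  smul_mem _ _ _ _ ha hm := SetLike.mul_mem_graded ha hm
  finite := inferInstance

variable {𝒜}

/-- The morphism from a free module given by a homogeneous element. -/
def ofElem {M : GrMod 𝒜} {k : ℤ} (m : M.carrier) (hm : m ∈ M.deg k) :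
    shiftObj k (regObj 𝒜) ⟶ M :=
  mkHom (M := shiftObj k (regObj 𝒜)) (N := M) (LinearMap.toSpanSingleton A M.carrier m)
    fun i a (ha : a ∈ 𝒜 (i - k)) => by
      have := M.smul_mem _ _ a m ha hm
      rwa [sub_add_cancel] at this

theorem one_mem (k : ℤ) : (1 : A) ∈ (shiftObj k (regObj 𝒜)).deg k :=
  (congrArg (fun i => (1 : A) ∈ 𝒜 i) (sub_self k)).mpr (SetLike.one_mem_graded 𝒜)

theorem reg_hom_ext {M : GrMod 𝒜} {k : ℤ} {f g : shiftObj k (regObj 𝒜) ⟶ M}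
    (h : lin f (1 : A) = lin g (1 : A)) : f = g :=
  hom_ext fun (a : A) => by
    have : ∀ f : shiftObj k (regObj 𝒜) ⟶ M, lin f a = a • lin f (1 : A) := fun f =>
      (congrArg (lin f) (mul_one a).symm).trans (map_smul (lin f) a _)
    rw [this f, this g, h]

theorem epi_of_surjective {M N : GrMod 𝒜} (f : M ⟶ N) (hf : Function.Surjective (lin f)) :
    Epi f :=
  ⟨fun g h hgh => hom_ext fun m => by
    obtain ⟨m, rfl⟩ := hf m
    exact LinearMap.congr_fun (congrArg lin hgh) m⟩

/-- The component of degree k of any preimage is again a preimage; this is the projectivity of free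
graded modules. -/
theorem exists_homogeneous {M N : GrMod 𝒜} (f : M ⟶ N) (hf : Function.Surjective (lin f))
    {k : ℤ} {y : N.carrier} (hy : y ∈ N.deg k) : ∃ x ∈ M.deg k, lin f x = y := by
  obtain ⟨x, hx⟩ := hf y
  exact ⟨gproj M.internal k x, gproj_mem _ _ _, by rw [lin_gproj, hx, gproj_same _ hy]⟩

theorem projective_reg (k : ℤ) : Projective (shiftObj k (regObj 𝒜)) where
  factors {X Y} f e _ := by
    obtain ⟨x, hx, hxy⟩ := exists_homogeneous e (surjective_of_epi e)
      (lin_mem f (one_mem (𝒜 := 𝒜) k))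
    exact ⟨ofElem x hx, reg_hom_ext
      ((congrArg (lin e) (one_smul A x)).trans hxy)⟩

/-- The augmentation, from the free module to the trivial module. -/
def augHom {ε : A →ₐ[ℂ] ℂ} (hε : AugGrading 𝒜 ε) (k : ℤ) :
    shiftObj k (regObj 𝒜) ⟶ shiftObj k (trivObj 𝒜 ε hε.pos) :=
  mkHom (M := shiftObj k (regObj 𝒜)) (N := shiftObj k (trivObj 𝒜 ε hε.pos))
    { toFun := fun a : A => ε a
      map_add' := map_add ε
      map_smul' := map_mul ε }
    fun i a (ha : a ∈ 𝒜 (i - k)) => by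
      change ε a ∈ (if i - k = 0 then (⊤ : Submodule ℂ ℂ) else ⊥)
      split_ifs with h
      · trivial
      · exact (Submodule.mem_bot ℂ).2 (hε.pos _ _ h ha)

theorem augHom_surjective {ε : A →ₐ[ℂ] ℂ} (hε : AugGrading 𝒜 ε) (k : ℤ) :
    Function.Surjective (lin (augHom hε k)) :=
  fun c => ⟨algebraMap ℂ A c, ε.commutes c⟩

/-- Graded Nakayama lemma: a morphism to the free module whose composite to the simple quotient is
surjective hits a degree zero element of augmentation one. In a connected grading this element is
the generator 1. -/
theorem isProjectiveCover_reg {ε : A →ₐ[ℂ] ℂ} (hε : AugGrading 𝒜 ε) (k : ℤ) :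
    IsProjectiveCover (shiftObj k (regObj 𝒜)) (shiftObj k (trivObj 𝒜 ε hε.pos)) := by
  refine ⟨projective_reg k, augHom hε k, epi_of_surjective _ (augHom_surjective hε k),
    fun Z g hg => epi_of_surjective _ ?_⟩
  obtain ⟨z, hz, hz1⟩ := exists_homogeneous (g ≫ augHom hε k) (surjective_of_epi _)
    (lin_mem (augHom hε k) (one_mem (𝒜 := 𝒜) k))
  let a : A := lin g z
  have ha : a ∈ 𝒜 0 := (congrArg (fun i => a ∈ 𝒜 i) (sub_self k)).mp (lin_mem g hz)
  have ha1 : ε a = 1 := hz1.trans (map_one ε)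
  have ha2 : a = 1 := by rw [hε.zero a ha, ha1, map_one]
  exact fun b : A => ⟨b • z, (map_smul (lin g) b z).trans
    ((congrArg (fun x : A => b * x) ha2).trans (mul_one b))⟩

/-- Free modules over a Frobenius algebra are self-dual. -/
def regDual {N : ℤ} (φ : FrobForm 𝒜 N) {k l : ℤ} (h : k + l = -N) :
    shiftObj k (regObj 𝒜) ≅ dualObj (shiftObj l (regObj 𝒜)) :=
  isoOfBijective (mkHom (M := shiftObj k (regObj 𝒜)) (N := dualObj (shiftObj l (regObj 𝒜)))
    { toFun := fun a : A => φ.form ∘ₗ LinearMap.mulLeft ℂ a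
      map_add' := fun a b : A => LinearMap.ext fun c : A =>
        (congrArg φ.form (add_mul a b c)).trans (map_add φ.form _ _)
      map_smul' := fun a b : A => LinearMap.ext fun c : A => congrArg φ.form
        ((mul_assoc a b c).trans (mul_left_comm a b c)) }
    fun i (a : A) (ha : a ∈ 𝒜 (i - k)) j hj (b : A) (hb : b ∈ 𝒜 (j - l)) =>
      φ.vanish _ _ (by omega) (SetLike.mul_mem_graded ha hb)) (by
    let J : A →ₗ[ℂ] Module.Dual ℂ A := LinearMap.llcomp ℂ A A ℂ φ.form ∘ₗ LinearMap.mul ℂ A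
    change Function.Bijective J
    have hinj : Function.Injective J := by
      refine (injective_iff_map_eq_zero J).2 fun a ha => φ.nondeg a fun b => ?_
      exact LinearMap.congr_fun ha b
    exact ⟨hinj, (LinearMap.injective_iff_surjective_of_finrank_eq_finrank
      Subspace.dual_finrank_eq.symm).1 hinj⟩)

end Reg

end GrMod

end

end SlTwoCat

open CategoryTheory CategoryTheory.Limits
open scoped TensorProduct LaurentPolynomial

namespace SlTwoCat

noncomputable section

set_option linter.unusedSectionVars false

/-! ## Objects concentrated in one block -/

section PiObjects

variable {ι : Type} {D : ι → Type 1} [∀ i, Category.{0} (D i)]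

theorem pi_epi_of {X Y : ∀ i, D i} (f : X ⟶ Y) (h : ∀ i, Epi (f i)) : Epi f :=
  ⟨fun _ _ hg => funext fun i => (cancel_epi (f i)).1 (congrFun hg i)⟩

variable [∀ i, Abelian (D i)]

theorem pi_projective (X : ∀ i, D i) (h : ∀ i, Projective (X i)) : Projective X where
  factors f e _ := by
    have he := fun i => pi_epi e i
    exact ⟨fun i => Projective.factorThru (f i) (e i), funext fun i => Projective.factorThru_comp _ _⟩

theorem pi_isProjectiveCover {P X : ∀ i, D i} (h : ∀ i, IsProjectiveCover (P i) (X i)) :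
    IsProjectiveCover P X := by
  choose hP f hf hess using h
  refine ⟨pi_projective P hP, f, pi_epi_of _ hf, fun Z g hg => pi_epi_of _ fun i => ?_⟩
  exact hess i (Z i) (g i) (pi_epi (g ≫ (show P ⟶ X from f)) i)

end PiObjects

section Objects

variable {n : ℕ}

theorem isProjectiveCover_zero {D : Type 1} [Category.{0} D] {P X : D} (hP : IsZero P)
    (hX : IsZero X) : IsProjectiveCover P X :=
  ⟨⟨fun _ _ _ => ⟨hP.to_ _, hP.eq_of_src _ _⟩⟩, hP.to_ X, hX.epi _,
    fun _ _ _ => hP.epi _⟩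

theorem isZero_of_subsingleton {A : Type} [CommRing A] [Algebra ℂ A] {𝒜 : ℤ → Submodule ℂ A}
    {M : GrMod 𝒜} (h : Subsingleton M.carrier) : IsZero M :=
  (IsZero.iff_id_eq_zero M).2 (GrMod.hom_ext fun _ => h.elim _ _)

/-- The object with value `X i` in the `i`-th block. -/
def atBlock (n : ℕ) (i : Fin (n + 1)) (X : ∀ j : Fin (n + 1), Block n j) : GCat n := fun j =>
  if j = i then X j else GrMod.zeroObj _

theorem atBlock_same (i : Fin (n + 1)) (X : ∀ j : Fin (n + 1), Block n j) :
    atBlock n i X i = X i := if_pos rfl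

theorem atBlock_ne {i j : Fin (n + 1)} (h : j ≠ i) (X : ∀ j : Fin (n + 1), Block n j) :
    atBlock n i X j = GrMod.zeroObj _ := if_neg h

theorem subsingleton_atBlock {i j : Fin (n + 1)} (h : j ≠ i) (X : ∀ j : Fin (n + 1), Block n j) :
    Subsingleton (atBlock n i X j).carrier := by
  rw [atBlock_ne h]
  exact inferInstanceAs (Subsingleton PUnit)

/-- The trivial simple module in every block. -/
def trivB (n : ℕ) (j : Fin (n + 1)) : Block n j :=
  GrMod.trivObj _ (aug n {(j : ℕ)}) (augGrading n _).pos

/-- The normalized free module in every block. -/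
def freeB (n : ℕ) (j : Fin (n + 1)) : Block n j :=
  GrMod.shiftObj (-((j : ℤ) * (n - j))) (GrMod.regObj (deg n {(j : ℕ)}))

/-- The projective covers of the simple objects. -/
def VT (n : ℕ) (i : Fin (n + 1)) : GCat n := atBlock n i (freeB n)

/-- An isomorphism of objects concentrated in one block. -/
theorem nonempty_iso_atBlock {i : Fin (n + 1)} {X : ∀ j : Fin (n + 1), Block n j} {Y : GCat n}
    (h : Nonempty (Y i ≅ X i)) (hY : ∀ j, j ≠ i → Subsingleton (Y j).carrier) :
    Nonempty (Y ≅ atBlock n i X) := by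
  have : ∀ j, Nonempty (Y j ≅ atBlock n i X j) := fun j => by
    by_cases hj : j = i
    · subst hj
      rw [atBlock_same]
      exact h
    · exact ⟨(isZero_of_subsingleton (hY j hj)).iso
        (isZero_of_subsingleton (subsingleton_atBlock hj X))⟩
  exact ⟨Pi.isoMk fun j => (this j).some⟩

theorem isProjectiveCover_VT (i : Fin (n + 1)) :
    IsProjectiveCover (VT n i) ((shiftC n (-((i : ℤ) * (n - i)))).obj (S n i)) := by
  refine pi_isProjectiveCover fun j => ?_
  by_cases hj : j = i
  · subst hj
    have h1 : VT n j j = freeB n j := atBlock_same _ _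
    have h2 : (shiftC n (-((j : ℤ) * (n - j)))).obj (S n j) j =
        GrMod.shiftObj (-((j : ℤ) * (n - j))) (trivB n j) :=
      congrArg (GrMod.shiftObj _) (atBlock_same j (trivB n))
    rw [h1, h2]
    exact GrMod.isProjectiveCover_reg (augGrading n _) _
  · exact isProjectiveCover_zero (isZero_of_subsingleton (subsingleton_atBlock hj _))
      (isZero_of_subsingleton (subsingleton_atBlock hj (trivB n)))

/-- The normalizing shift -i(n-i) is half of minus the top degree 2i(n-i), so the free module so
shifted is its own dual. -/
theorem nonempty_dual_VT (i : Fin (n + 1)) :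
    Nonempty ((dualC n).obj (Opposite.op (VT n i)) ≅ VT n i) := by
  refine nonempty_iso_atBlock ?_ fun j hj => dual_subsingleton (subsingleton_atBlock hj _)
  obtain ⟨φ⟩ := nonempty_frobForm (n := n) i (Nat.lt_succ_iff.1 i.2)
  have h : (dualC n).obj (Opposite.op (VT n i)) i = GrMod.dualObj (freeB n i) :=
    congrArg GrMod.dualObj (atBlock_same i (freeB n))
  rw [h]
  exact ⟨(GrMod.regDual φ (by ring)).symm⟩

/-- Flipping the trivial module. -/
def flipTriv {i j : ℕ} (h : i + j = n) :
    (flip n h).obj (GrMod.trivObj _ (aug n {j}) (augGrading n _).pos) ≅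
      GrMod.trivObj _ (aug n {i}) (augGrading n _).pos :=
  (GrMod.isoOfBijective (GrMod.mkHom
      (M := GrMod.trivObj (deg n {i}) (aug n {i}) (augGrading n _).pos)
      (N := (flip n h).obj (GrMod.trivObj (deg n {j}) (aug n {j}) (augGrading n _).pos))
    { toFun := fun c : ℂ => c
      map_add' := fun _ _ => rfl
      map_smul' := fun a (c : ℂ) => congrArg (fun z : ℂ => z * c) (aug_revAlg (single_rev h) a).symm }
    fun _ _ hc => hc) Function.bijective_id).symm

/-- Flipping free modules. -/
def flipReg {i j : ℕ} (h : i + j = n) (k : ℤ) :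
    (flip n h).obj (GrMod.shiftObj k (GrMod.regObj (deg n {j}))) ≅
      GrMod.shiftObj k (GrMod.regObj (deg n {i})) :=
  (GrMod.isoOfBijective (GrMod.mkHom
      (M := GrMod.shiftObj k (GrMod.regObj (deg n {i})))
      (N := (flip n h).obj (GrMod.shiftObj k (GrMod.regObj (deg n {j}))))
    { toFun := fun a : C n {i} => revAlg n (single_rev h) a
      map_add' := map_add (revAlg n (single_rev h))
      map_smul' := map_mul (revAlg n (single_rev h)) }
    fun d a ha => revAlg_mem (single_rev h) (d - k) a ha)
      (revAlg_bijective (single_rev h) (single_rev (by omega)))).symm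

theorem nonempty_Sig_atBlock (i : Fin (n + 1)) (X : ∀ j : Fin (n + 1), Block n j)
    (hX : ∀ (i j : Fin (n + 1)) (h : (i : ℕ) + j = n), Nonempty ((flip n h).obj (X j) ≅ X i)) :
    Nonempty ((Sig n).obj (atBlock n i X) ≅ atBlock n i.rev X) := by
  refine nonempty_iso_atBlock ?_ fun j hj => ?_
  · have h : (i.rev : ℕ) + (i.rev.rev : ℕ) = n := by rw [Fin.val_rev i.rev]; omega
    have h1 : (Sig n).obj (atBlock n i X) i.rev = (flip n h).obj (X i.rev.rev) :=
      congrArg (flip n h).obj (if_pos (Fin.rev_rev i))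
    rw [h1]
    exact hX _ _ h
  · exact subsingleton_atBlock (i := i) (j := j.rev)
      (fun h => hj (by rw [← h, Fin.rev_rev])) X

theorem nonempty_Sig_S (i : Fin (n + 1)) : Nonempty ((Sig n).obj (S n i) ≅ S n i.rev) :=
  nonempty_Sig_atBlock i (trivB n) fun _ _ h => ⟨flipTriv h⟩

theorem nonempty_Sig_VT (i : Fin (n + 1)) : Nonempty ((Sig n).obj (VT n i) ≅ VT n i.rev) :=
  nonempty_Sig_atBlock i (freeB n) fun i j h => ⟨flipReg h _ ≪≫
    eqToIso (congrArg (fun k => GrMod.shiftObj k (GrMod.regObj (deg n {(i : ℕ)}))) (by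
      have h' : (n : ℤ) = (i : ℤ) + (j : ℤ) := by omega
      rw [h']; ring))⟩

end Objects

end

end SlTwoCat

open CategoryTheory CategoryTheory.Limits
open scoped TensorProduct LaurentPolynomial

namespace SlTwoCat

noncomputable section

set_option linter.unusedSectionVars false

open LaurentPolynomial (T invert)

/-! ## Characters of graded vector spaces -/

section Characters

/-- The Laurent polynomial with given coefficients. -/
def lau (f : ℤ → ℤ) : ℤ[T;T⁻¹] := ∑ᶠ d, LaurentPolynomial.C (f d) * T d

theorem lau_support {f : ℤ → ℤ} (hf : (Function.support f).Finite) :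
    (Function.support fun d => (LaurentPolynomial.C (f d) * T d : ℤ[T;T⁻¹])).Finite :=
  hf.subset fun d hd => by
    contrapose hd
    rw [Function.mem_support, not_not] at hd ⊢
    rw [hd, map_zero, zero_mul]

theorem lau_add {f g : ℤ → ℤ} (hf : (Function.support f).Finite)
    (hg : (Function.support g).Finite) : lau (fun d => f d + g d) = lau f + lau g := by
  rw [lau, lau, lau, ← finsum_add_distrib (lau_support hf) (lau_support hg)]
  exact finsum_congr fun d => by rw [map_add, add_mul]

theorem lau_shift {f : ℤ → ℤ} (hf : (Function.support f).Finite) (k : ℤ) :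
    lau (fun d => f (d - k)) = T k * lau f := by
  rw [lau, lau, mul_finsum' _ _ (lau_support hf),
    ← finsum_comp_equiv (Equiv.subRight k) (f := fun d => T k * (LaurentPolynomial.C (f d) * T d))]
  refine finsum_congr fun d => ?_
  rw [Equiv.subRight_apply, LaurentPolynomial.T_mul, mul_assoc, ← LaurentPolynomial.T_add,
    sub_add_cancel]

theorem lau_invert {f : ℤ → ℤ} (hf : (Function.support f).Finite) :
    lau (fun d => f (-d)) = invert (lau f) := by
  have h := AddMonoidHom.map_finsum (invert (R := ℤ)).toAlgHom.toRingHom.toAddMonoidHom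
    (lau_support hf)
  refine Eq.trans ?_ h.symm
  rw [lau, ← finsum_comp_equiv (Equiv.neg ℤ)]
  refine finsum_congr fun d => ?_
  change _ = invert (LaurentPolynomial.C (f d) * T d : ℤ[T;T⁻¹])
  simp

theorem lau_single (k : ℤ) : lau (fun d => if d = k then 1 else 0) = T k := by
  rw [lau, finsum_eq_single _ k]
  · simp
  · intro d hd
    rw [if_neg hd, map_zero, zero_mul]

/-- The polynomial `1 + T² + ⋯ + T^(2(m-1))`. -/
def pint (m : ℕ) : ℤ[T;T⁻¹] := ∑ k ∈ Finset.range m, T (2 * (k : ℤ))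

theorem pint_succ (m : ℕ) : pint (m + 1) = pint m + T (2 * (m : ℤ)) := Finset.sum_range_succ _ _

theorem pint_mul (m : ℕ) : (T 2 - 1) * pint m = T (2 * (m : ℤ)) - 1 := by
  induction m with
  | zero => simp [pint]
  | succ m ih =>
    rw [pint_succ, mul_add, ih, sub_mul, one_mul, ← LaurentPolynomial.T_add,
      show (2 : ℤ) + 2 * (m : ℤ) = 2 * ((m + 1 : ℕ) : ℤ) by push_cast; ring]
    ring

theorem lau_pint {f : ℤ → ℤ} (hf : (Function.support f).Finite) (m : ℕ) :
    lau (fun d => ∑ k ∈ Finset.range m, f (d - 2 * (k : ℤ))) = pint m * lau f := by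
  have hs : ∀ k : ℤ, (Function.support fun d => f (d - k)).Finite := fun k =>
    Set.Finite.preimage (f := fun d => d - k) ((Equiv.subRight k).injective.injOn) hf
  induction m with
  | zero => simp [pint, lau]
  | succ m ih =>
    simp only [Finset.sum_range_succ]
    rw [lau_add _ (hs _), ih, lau_shift hf, pint_succ, add_mul]
    refine (Set.Finite.biUnion (Finset.finite_toSet (Finset.range m)) fun k _ =>
      hs (2 * (k : ℤ))).subset fun d hd => ?_
    obtain ⟨k, hk, h⟩ := Finset.exists_ne_zero_of_sum_ne_zero hd
    exact Set.mem_biUnion hk h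

variable {M N : Type} [AddCommGroup M] [Module ℂ M] [AddCommGroup N] [Module ℂ N]

/-- The character of a graded vector space. -/
def gch (ℳ : ℤ → Submodule ℂ M) : ℤ[T;T⁻¹] := lau fun d => Module.finrank ℂ (ℳ d)

theorem gch_support [Module.Finite ℂ M] {ℳ : ℤ → Submodule ℂ M} (h : DirectSum.IsInternal ℳ) :
    (Function.support fun d => (Module.finrank ℂ (ℳ d) : ℤ)).Finite := by
  refine (WellFoundedGT.finite_ne_bot_of_iSupIndep h.submodule_iSupIndep).subset fun d hd => ?_
  rintro hbot
  rw [Function.mem_support, hbot] at hd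
  simp at hd

/-- The equivalence `e` gives coordinates with respect to generators in degrees 0, 2, …, 2(m-1). -/
theorem gch_pint [Module.Finite ℂ M] {ℳ : ℤ → Submodule ℂ M} (hℳ : DirectSum.IsInternal ℳ)
    {𝒩 : ℤ → Submodule ℂ N} {m : ℕ} (e : N ≃ₗ[ℂ] (Fin m → M))
    (h : ∀ d x, x ∈ 𝒩 d ↔ ∀ k : Fin m, e x k ∈ ℳ (d - 2 * (k : ℤ))) :
    gch 𝒩 = pint m * gch ℳ := by
  rw [gch, gch, ← lau_pint (gch_support hℳ)]
  refine congrArg lau (funext fun d => ?_)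
  rw [Finset.sum_range fun k => (Module.finrank ℂ (ℳ (d - 2 * (k : ℤ))) : ℤ), ← Nat.cast_sum,
    ← Module.finrank_pi_fintype]
  refine congrArg _ (LinearEquiv.finrank_eq ?_)
  exact LinearEquiv.ofBijective
    (LinearMap.pi fun k : Fin m => ((LinearMap.proj k ∘ₗ e.toLinearMap).restrict
      fun x hx => (h d x).1 hx k : 𝒩 d →ₗ[ℂ] ℳ (d - 2 * (k : ℤ))))
    ⟨fun x y hxy => Subtype.ext (e.injective (funext fun k =>
      congrArg Subtype.val (congrFun hxy k))),
    fun y => ⟨⟨e.symm fun k => (y k).1, (h d _).2 fun k => by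
      rw [e.apply_symm_apply]; exact (y k).2⟩, funext fun k => Subtype.ext (by
        change e (e.symm _) k = _
        rw [e.apply_symm_apply])⟩⟩

theorem gch_dual [Module.Finite ℂ M] {ℳ : ℤ → Submodule ℂ M} (hℳ : DirectSum.IsInternal ℳ)
    {𝒩 : ℤ → Submodule ℂ (Module.Dual ℂ M)}
    (h : ∀ j f, f ∈ 𝒩 j ↔ ∀ k, k ≠ -j → ∀ m ∈ ℳ k, f m = 0) :
    gch 𝒩 = invert (gch ℳ) := by
  rw [gch, gch, ← lau_invert (gch_support hℳ)]
  refine congrArg lau (funext fun j => congrArg _ ?_)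
  rw [← Subspace.dual_finrank_eq (V := ℳ (-j))]
  refine LinearEquiv.finrank_eq (LinearEquiv.ofBijective
    ((LinearMap.lcomp ℂ ℂ (ℳ (-j)).subtype) ∘ₗ (𝒩 j).subtype) ⟨?_, fun g => ?_⟩)
  · refine (injective_iff_map_eq_zero _).2 fun f hf => Subtype.ext ?_
    refine hom_ext_of_grading hℳ fun k m hm => ?_
    by_cases hk : k = -j
    · subst hk
      exact LinearMap.congr_fun hf ⟨m, hm⟩
    · exact (h j f.1).1 f.2 k hk m hm
  · refine ⟨⟨g ∘ₗ (gproj hℳ (-j)).codRestrict _ (gproj_mem hℳ (-j)), (h j _).2 fun k hk m hm => ?_⟩,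
      LinearMap.ext fun m => ?_⟩
    · have : (gproj hℳ (-j)).codRestrict _ (gproj_mem hℳ (-j)) m = 0 :=
        Subtype.ext (gproj_ne hℳ hk hm)
      rw [LinearMap.comp_apply, this, map_zero]
    · exact congrArg g (Subtype.ext (gproj_same hℳ m.2))

end Characters

namespace GrMod

section Ch

variable {A B : Type} [CommRing A] [Algebra ℂ A] {𝒜 : ℤ → Submodule ℂ A} [Module.Finite ℂ A]

/-- The character of a graded module. -/
def ch (M : GrMod 𝒜) : ℤ[T;T⁻¹] := gch M.deg

theorem ch_support (M : GrMod 𝒜) :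
    (Function.support fun d => (Module.finrank ℂ (M.deg d) : ℤ)).Finite :=
  have := finiteC M
  gch_support M.internal

theorem ch_shift (k : ℤ) (M : GrMod 𝒜) : ch (shiftObj k M) = T k * ch M :=
  lau_shift (ch_support M) k

theorem ch_of_subsingleton {M : GrMod 𝒜} (h : Subsingleton M.carrier) : ch M = 0 := by
  have : ∀ d, Module.finrank ℂ (M.deg d) = 0 := fun d => Module.finrank_zero_of_subsingleton
  simp [ch, gch, lau, this]

theorem finrank_deg_eq_of_exact {M₁ M₂ M₃ : GrMod 𝒜} (f : M₁ ⟶ M₂) (g : M₂ ⟶ M₃)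
    (hf : Function.Injective (lin f)) (hg : Function.Surjective (lin g)) (hfg : f ≫ g = 0)
    (hex : ∀ y, lin g y = 0 → ∃ x, lin f x = y) (d : ℤ) :
    Module.finrank ℂ (M₂.deg d) = Module.finrank ℂ (M₁.deg d) + Module.finrank ℂ (M₃.deg d) := by
  have hf2 := finiteC M₂
  let fd : M₁.deg d →ₗ[ℂ] M₂.deg d :=
    ((lin f).restrictScalars ℂ).restrict fun m hm => lin_mem f hm
  let gd : M₂.deg d →ₗ[ℂ] M₃.deg d :=
    ((lin g).restrictScalars ℂ).restrict fun m hm => lin_mem g hm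
  have h1 : Function.Injective fd := fun x y hxy => Subtype.ext (hf (congrArg Subtype.val hxy))
  have h2 : Function.Surjective gd := fun y => by
    obtain ⟨x, hx⟩ := hg y.1
    refine ⟨⟨gproj M₂.internal d x, gproj_mem _ _ _⟩, Subtype.ext ?_⟩
    change lin g (gproj M₂.internal d x) = y.1
    rw [lin_gproj, hx, gproj_same _ y.2]
  have h3 : LinearMap.ker gd = LinearMap.range fd := by
    ext y
    constructor
    · intro hy
      obtain ⟨x, hx⟩ := hex y.1 (congrArg Subtype.val hy)
      refine ⟨⟨gproj M₁.internal d x, gproj_mem _ _ _⟩, Subtype.ext ?_⟩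
      change lin f (gproj M₁.internal d x) = y.1
      rw [lin_gproj, hx, gproj_same _ y.2]
    · rintro ⟨x, rfl⟩
      exact Subtype.ext (apply_eq_zero hfg x.1)
  have h4 := gd.finrank_range_add_finrank_ker
  rw [LinearMap.range_eq_top.2 h2, finrank_top, h3, LinearMap.finrank_range_of_inj h1] at h4
  omega

theorem ch_eq_of_exact {M₁ M₂ M₃ : GrMod 𝒜} (f : M₁ ⟶ M₂) (g : M₂ ⟶ M₃)
    (hf : Function.Injective (lin f)) (hg : Function.Surjective (lin g)) (hfg : f ≫ g = 0)
    (hex : ∀ y, lin g y = 0 → ∃ x, lin f x = y) : ch M₂ = ch M₁ + ch M₃ := by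
  refine (congrArg lau (funext fun d => ?_)).trans (lau_add (ch_support M₁) (ch_support M₃))
  rw [finrank_deg_eq_of_exact f g hf hg hfg hex d]
  push_cast
  rfl

theorem ch_dual (M : GrMod 𝒜) : ch (dualObj M) = invert (ch M) :=
  have := finiteC M
  gch_dual M.internal fun _ _ => Iff.rfl

theorem ch_triv (ε : A →ₐ[ℂ] ℂ) (hε) : ch (trivObj 𝒜 ε hε) = 1 := by
  rw [← LaurentPolynomial.T_zero, ← lau_single 0]
  refine congrArg lau (funext fun d => ?_)
  change ((Module.finrank ℂ (if d = 0 then (⊤ : Submodule ℂ ℂ) else ⊥ : Submodule ℂ ℂ) : ℕ) : ℤ) = _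
  by_cases h : d = 0
  · rw [if_pos h, if_pos h, finrank_top, Module.finrank_self]
    rfl
  · rw [if_neg h, if_neg h, finrank_bot]
    rfl

variable [CommRing B] [Algebra ℂ B] [Algebra A B] [IsScalarTower ℂ A B]
  {ℬ : ℤ → Submodule ℂ B} [GradedAlgebra 𝒜] [GradedAlgebra ℬ]

theorem ch_ind (hAB : ∀ (i : ℤ) (a : A), a ∈ 𝒜 i → algebraMap A B a ∈ ℬ i) (P : PowExt 𝒜 ℬ)
    (M : GrMod 𝒜) : ch (indObj ℬ hAB M) = pint P.m * ch M := by
  have := finiteC M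
  refine gch_pint M.internal ((P.coordsEquiv M.carrier).restrictScalars ℂ) fun d t => ?_
  constructor
  · intro ht k
    refine mem_of_indDeg (M := M) (M.deg (d - 2 * (k : ℤ))) (P.coordM M.carrier k).toAddMonoidHom
      (fun c t => (P.coordM M.carrier k).map_smul_of_tower c t) (fun i j b m h hb hm => ?_) ht
    have h1 := M.smul_mem _ _ _ m (P.repr_mem hAB hb k) hm
    rwa [show i - 2 * (k : ℤ) + j = d - 2 * (k : ℤ) by omega] at h1
  · intro ht
    rw [← (P.coordsEquiv M.carrier).symm_apply_apply t]
    change ∑ k, P.basis k ⊗ₜ[A] (P.coordsEquiv M.carrier t k) ∈ indDeg ℬ M d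
    refine Submodule.sum_mem _ fun k _ => ?_
    rw [P.basis_apply]
    exact tmul_mem_indDeg (M := M) (P.pow_mem k) (ht k) (by ring)

theorem gch_powExt (hAB : ∀ (i : ℤ) (a : A), a ∈ 𝒜 i → algebraMap A B a ∈ ℬ i) (P : PowExt 𝒜 ℬ) :
    gch ℬ = pint P.m * gch 𝒜 := by
  refine gch_pint (DirectSum.Decomposition.isInternal 𝒜) (P.basis.equivFun.restrictScalars ℂ)
    fun d b => ⟨fun hb k => P.repr_mem hAB hb k, fun h => ?_⟩
  rw [← P.basis.sum_repr b]
  refine Submodule.sum_mem _ fun k _ => ?_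
  rw [P.basis_apply]
  have := PowExt.algebraMap_mul_mem hAB (h k) (P.pow_mem k)
  rwa [sub_add_cancel] at this

end Ch

end GrMod

end

end SlTwoCat

open CategoryTheory CategoryTheory.Limits
open scoped TensorProduct LaurentPolynomial

namespace SlTwoCat

noncomputable section

set_option linter.unusedSectionVars false


open LaurentPolynomial (T invert)

/-! ## Dévissage -/

theorem pi_mono_of {ι : Type} {D : ι → Type 1} [∀ i, Category.{0} (D i)] {X Y : ∀ i, D i}
    (f : X ⟶ Y) (h : ∀ i, Mono (f i)) : Mono f :=
  ⟨fun _ _ hg => funext fun i => (cancel_mono (f i)).1 (congrFun hg i)⟩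

namespace GrMod

section Socle

variable {A : Type} [CommRing A] [Algebra ℂ A] {𝒜 : ℤ → Submodule ℂ A} [Module.Finite ℂ A]

theorem mono_of_injective {M N : GrMod 𝒜} (f : M ⟶ N) (hf : Function.Injective (lin f)) : Mono f :=
  ⟨fun _ _ hgh => hom_ext fun m => hf (LinearMap.congr_fun (congrArg lin hgh) m)⟩

theorem finrank_eq_of_exact {M₁ M₂ M₃ : GrMod 𝒜} (f : M₁ ⟶ M₂) (g : M₂ ⟶ M₃)
    (hf : Function.Injective (lin f)) (hg : Function.Surjective (lin g)) (hfg : f ≫ g = 0)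
    (hex : ∀ y, lin g y = 0 → ∃ x, lin f x = y) :
    Module.finrank ℂ M₂.carrier = Module.finrank ℂ M₁.carrier + Module.finrank ℂ M₃.carrier := by
  have := finiteC M₂
  have h1 := ((lin g).restrictScalars ℂ).finrank_range_add_finrank_ker
  have h3 : LinearMap.range ((lin g).restrictScalars ℂ) = ⊤ := LinearMap.range_eq_top.2 hg
  have h2 : LinearMap.ker ((lin g).restrictScalars ℂ) =
      LinearMap.range ((lin f).restrictScalars ℂ) := by
    ext y
    exact ⟨fun hy => hex y hy, fun ⟨x, hx⟩ => hx ▸ apply_eq_zero hfg x⟩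
  rw [h3, finrank_top, h2, LinearMap.finrank_range_of_inj
    (f := (lin f).restrictScalars ℂ) hf] at h1
  omega

/-- A nonzero graded module has a nonzero element of highest degree. -/
theorem exists_top {M : GrMod 𝒜} (h : Nontrivial M.carrier) :
    ∃ d, ∃ m ∈ M.deg d, m ≠ 0 ∧ ∀ d' > d, M.deg d' = ⊥ := by
  have := finiteC M
  have hfin := WellFoundedGT.finite_ne_bot_of_iSupIndep M.internal.submodule_iSupIndep
  have hne : {d | M.deg d ≠ ⊥}.Nonempty := by
    by_contra hemp
    rw [Set.not_nonempty_iff_eq_empty, Set.eq_empty_iff_forall_notMem] at hemp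
    obtain ⟨m, hm⟩ := exists_ne (0 : M.carrier)
    refine hm (grading_induction M.internal (P := fun m => m = 0) rfl (fun x y hx hy => ?_)
      (fun i x hx => ?_) m)
    · rw [hx, hy, add_zero]
    · rwa [not_not.1 (hemp i), Submodule.mem_bot] at hx
  obtain ⟨d, hd, hmax⟩ := hfin.exists_maximal hne
  obtain ⟨m, hm, hm0⟩ := Submodule.exists_mem_ne_zero_of_ne_bot hd
  exact ⟨d, m, hm, hm0, fun d' hd' => by_contra fun hbot => absurd (hmax hbot hd'.le) (not_le.2 hd')⟩

variable [GradedAlgebra 𝒜]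

/-- A nonzero graded module contains a shift of the trivial module. -/
theorem exists_socle {ε : A →ₐ[ℂ] ℂ} (hε : AugGrading 𝒜 ε) {M : GrMod 𝒜}
    (h : Nontrivial M.carrier) :
    ∃ d, ∃ f : shiftObj d (trivObj 𝒜 ε hε.pos) ⟶ M, Mono f := by
  obtain ⟨d, m, hm, hm0, hmax⟩ := exists_top h
  -- Elements of positive degree carry m beyond the highest degree of the module, and elements of
  -- degree zero are scalars.
  have key : ∀ a : A, a • m = ε a • m := fun a => by
    refine grading_induction (DirectSum.Decomposition.isInternal 𝒜)
      (P := fun a => a • m = ε a • m) (by simp) (fun x y hx hy => ?_) (fun i x hx => ?_) a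
    · rw [add_smul, hx, hy, map_add, add_smul]
    · rcases lt_trichotomy i 0 with hi | hi | hi
      · rw [hε.neg i hi x hx]; simp
      · subst hi
        nth_rewrite 1 [hε.zero x hx]
        rw [algebraMap_smul]
      · have h1 := M.smul_mem _ _ x m hx hm
        rw [hmax (i + d) (by omega), Submodule.mem_bot] at h1
        rw [h1, hε.pos i x hi.ne' hx, zero_smul]
  refine ⟨d, mkHom (M := shiftObj d (trivObj 𝒜 ε hε.pos)) (N := M)
    { toFun := fun c : ℂ => c • m
      map_add' := fun c c' : ℂ => add_smul c c' m
      map_smul' := fun (a : A) (c : ℂ) => by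
        change (ε a * c) • m = a • c • m
        rw [mul_smul, smul_comm a c m, key, smul_comm] } fun i (c : ℂ) hc => ?_,
    mono_of_injective _ fun (c c' : ℂ) hcc => ?_⟩
  · change c ∈ (if i - d = 0 then (⊤ : Submodule ℂ ℂ) else ⊥) at hc
    change c • m ∈ M.deg i
    split_ifs at hc with hi
    · rw [show i = d by omega]
      exact Submodule.smul_mem _ _ hm
    · rw [Submodule.mem_bot] at hc
      rw [hc, zero_smul]
      exact Submodule.zero_mem _
  · exact smul_left_injective ℂ hm0 hcc

end Socle

end GrMod

section Devissage

variable {n : ℕ}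

theorem exists_lift_of_shortExact {D : Type*} [Category* D] [Abelian D] {s : ShortComplex D}
    (hs : s.ShortExact) {Z : D} (k : Z ⟶ s.X₂) (hk : k ≫ s.g = 0) : ∃ l, l ≫ s.f = k :=
  have := hs.mono_f
  ⟨hs.exact.lift k hk, hs.exact.lift_f k hk⟩

theorem exists_shortExact_of_mono {D : Type*} [Category* D] [Abelian D] {X Y : D} (f : X ⟶ Y)
    (hf : Mono f) : ∃ (Z : D) (g : Y ⟶ Z) (w : f ≫ g = 0), (ShortComplex.mk f g w).ShortExact :=
  ⟨_, _, cokernel.condition f,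
    { exact := ShortComplex.exact_cokernel f
      mono_f := hf
      epi_g := inferInstance }⟩

/-- The exactness properties of the components of a short exact sequence. -/
theorem component_exact {s : ShortComplex (GCat n)} (hs : s.ShortExact) (i : Fin (n + 1)) :
    Function.Injective (GrMod.lin (s.f i)) ∧ Function.Surjective (GrMod.lin (s.g i)) ∧
      (s.f i ≫ s.g i = 0) ∧ ∀ y, GrMod.lin (s.g i) y = 0 → ∃ x, GrMod.lin (s.f i) x = y := by
  have := hs.mono_f
  have := hs.epi_g
  have := pi_mono s.f i
  have := pi_epi s.g i
  refine ⟨GrMod.injective_of_mono _, GrMod.surjective_of_epi _, congrFun s.zero i, fun y hy => ?_⟩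
  let Z : GCat n := fun j => GrMod.kerObj (s.g j)
  let k : Z ⟶ s.X₂ := fun j => GrMod.kerι (s.g j)
  have hk : k ≫ s.g = 0 := funext fun j => GrMod.kerι_comp (s.g j)
  obtain ⟨l, hl⟩ := exists_lift_of_shortExact (D := GCat n) (s := s) hs k hk
  have h := congrFun hl i
  exact ⟨GrMod.lin (l i) ⟨y, hy⟩,
    LinearMap.congr_fun (congrArg GrMod.lin h) (⟨y, hy⟩ : (GrMod.kerObj (s.g i)).carrier)⟩

/-- A morphism from an object concentrated in one block. -/
theorem exists_atBlockHom {i : Fin (n + 1)} {X : ∀ j : Fin (n + 1), Block n j} {M : GCat n}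
    (g : X i ⟶ M i) (hg : Mono g) : ∃ f : atBlock n i X ⟶ M, Mono f := by
  have : ∀ j, ∃ f : atBlock n i X j ⟶ M j, Mono f := fun j => by
    by_cases hj : j = i
    · subst hj
      exact ⟨eqToHom (atBlock_same j X) ≫ g, inferInstance⟩
    · exact ⟨0, (isZero_of_subsingleton (subsingleton_atBlock hj X)).mono _⟩
  choose f hf using this
  exact ⟨f, pi_mono_of _ hf⟩

/-- The total dimension. -/
def totalDim (M : GCat n) : ℕ := ∑ i, Module.finrank ℂ (M i).carrier

theorem totalDim_eq {s : ShortComplex (GCat n)} (hs : s.ShortExact) :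
    totalDim s.X₂ = totalDim s.X₁ + totalDim s.X₃ := by
  rw [totalDim, totalDim, totalDim, ← Finset.sum_add_distrib]
  refine Finset.sum_congr rfl fun i _ => ?_
  obtain ⟨h1, h2, h3, h4⟩ := component_exact hs i
  exact GrMod.finrank_eq_of_exact _ _ h1 h2 h3 h4

theorem isZero_of_components {M : GCat n} (h : ∀ i, Subsingleton (M i).carrier) : IsZero M :=
  (IsZero.iff_id_eq_zero M).2 (funext fun i => GrMod.hom_ext fun _ => (h i).elim _ _)

theorem nonempty_shift_S (d : ℤ) (i : Fin (n + 1)) : Nonempty ((shiftC n d).obj (S n i) ≅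
    atBlock n i fun j => GrMod.shiftObj d (trivB n j)) :=
  nonempty_iso_atBlock ⟨eqToIso (congrArg (GrMod.shiftObj d) (atBlock_same i (trivB n)))⟩
    fun _ hj => subsingleton_atBlock hj (trivB n)

/-- Every property stable under extensions which holds for the shifted simple objects holds for
all objects. -/
theorem devissage {P : GCat n → Prop} (zero : ∀ M, IsZero M → P M)
    (simple : ∀ d i, P ((shiftC n d).obj (S n i)))
    (ext : ∀ s : ShortComplex (GCat n), s.ShortExact → P s.X₁ → P s.X₃ → P s.X₂) (M : GCat n) :
    P M := by
  obtain ⟨N, hN⟩ : ∃ N, totalDim M = N := ⟨_, rfl⟩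
  induction N using Nat.strong_induction_on generalizing M with
  | _ N ih =>
    by_cases h : ∀ i, Subsingleton (M i).carrier
    · exact zero M (isZero_of_components h)
    · obtain ⟨i, hi⟩ := not_forall.1 h
      obtain ⟨d, g, hg⟩ := GrMod.exists_socle (augGrading n {(i : ℕ)})
        (not_subsingleton_iff_nontrivial.1 hi)
      obtain ⟨e⟩ := nonempty_shift_S d i
      obtain ⟨f, hf⟩ := exists_atBlockHom (X := fun j => GrMod.shiftObj d (trivB n j)) g hg
      obtain ⟨Z, g, w, hs⟩ := exists_shortExact_of_mono (D := GCat n) (e.hom ≫ f) (mono_comp _ _)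
      -- The induction hypothesis applies to the quotient, because the shifted simple object has
      -- positive total dimension.
      refine ext _ hs (simple d i) (ih _ ?_ _ rfl)
      have h1 := totalDim_eq hs
      have h2 : 0 < totalDim ((shiftC n d).obj (S n i)) := by
        refine Finset.sum_pos' (fun _ _ => Nat.zero_le _) ⟨i, Finset.mem_univ i, ?_⟩
        have h3 : ((shiftC n d).obj (S n i)) i = GrMod.shiftObj d (trivB n i) :=
          congrArg (GrMod.shiftObj d) (atBlock_same i (trivB n))
        rw [h3]
        exact Nat.lt_of_lt_of_eq Nat.zero_lt_one (Module.finrank_self ℂ).symm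
      change totalDim M = totalDim ((shiftC n d).obj (S n i)) + _ at h1
      omega

end Devissage

/-! ## The Grothendieck group -/

section Grothendieck

variable {n : ℕ}

/-- The characters of the components. -/
def chC (M : GCat n) : Fin (n + 1) → ℤ[T;T⁻¹] := fun i => GrMod.ch (M i)

theorem chC_exact {s : ShortComplex (GCat n)} (hs : s.ShortExact) :
    chC s.X₂ = chC s.X₁ + chC s.X₃ := by
  funext i
  obtain ⟨h1, h2, h3, h4⟩ := component_exact hs i
  exact GrMod.ch_eq_of_exact _ _ h1 h2 h3 h4

theorem chC_of_isZero {M : GCat n} (h : IsZero M) : chC M = 0 := by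
  funext i
  refine GrMod.ch_of_subsingleton ⟨fun x y => ?_⟩
  have h1 : GrMod.lin (𝟙 (M i)) = GrMod.lin (0 : M i ⟶ M i) :=
    congrArg GrMod.lin (congrFun (h.eq_of_src (𝟙 M) 0) i)
  exact (LinearMap.congr_fun h1 x).trans (LinearMap.congr_fun h1 y).symm

theorem chC_shift (k : ℤ) (M : GCat n) :
    chC ((shiftC n k).obj M) = (T k : ℤ[T;T⁻¹]) • chC M :=
  funext fun i => GrMod.ch_shift k (M i)

theorem chC_S (i : Fin (n + 1)) : chC (S n i) = Pi.single i 1 := by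
  funext j
  by_cases h : j = i
  · subst h
    rw [Pi.single_eq_same]
    exact (congrArg GrMod.ch (atBlock_same j (trivB n))).trans (GrMod.ch_triv _ _)
  · rw [Pi.single_eq_of_ne h]
    exact GrMod.ch_of_subsingleton (subsingleton_atBlock h (trivB n))

theorem K0.mk_of_isZero {M : GCat n} (h : IsZero M) : K0.mk n M = 0 := by
  have hs : (ShortComplex.mk (0 : M ⟶ M) (0 : M ⟶ M) (by simp)).ShortExact :=
    { exact := ShortComplex.exact_of_isZero_X₂ _ h
      mono_f := h.mono _
      epi_g := h.epi _ }
  simpa using K0.exact hs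

/-- A map to a module over the Laurent polynomials is linear if it respects powers of `T`. -/
def laurentLinear {X Y : Type*} [AddCommGroup X] [AddCommGroup Y] [Module ℤ[T;T⁻¹] X]
    [Module ℤ[T;T⁻¹] Y] (f : X →+ Y)
    (hf : ∀ k x, f ((T k : ℤ[T;T⁻¹]) • x) = (T k : ℤ[T;T⁻¹]) • f x) : X →ₗ[ℤ[T;T⁻¹]] Y where
  __ := f
  map_smul' p x := by
    change f (p • x) = p • f x
    induction p using LaurentPolynomial.induction_on' with
    | add p q hp hq => rw [add_smul, map_add, hp, hq, add_smul]
    | C_mul_T k a =>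
      have h : (LaurentPolynomial.C a : ℤ[T;T⁻¹]) = (a : ℤ[T;T⁻¹]) := by simp
      rw [h, mul_smul, mul_smul, Int.cast_smul_eq_zsmul, Int.cast_smul_eq_zsmul, map_zsmul, hf]

/-- The additive map underlying the character. -/
def chAdd (n : ℕ) : K0 n →+ (Fin (n + 1) → ℤ[T;T⁻¹]) :=
  QuotientAddGroup.lift (K0Rel n) (FreeAbelianGroup.lift chC) (by
    refine (AddSubgroup.closure_le _).2 ?_
    rintro _ ⟨s, hs, rfl⟩
    simp only [SetLike.mem_coe, AddMonoidHom.mem_ker, map_sub, map_add,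
      FreeAbelianGroup.lift_apply_of]
    exact sub_eq_zero.2 (chC_exact hs))

theorem chAdd_mk (M : GCat n) : chAdd n (K0.mk n M) = chC M := FreeAbelianGroup.lift_apply_of _ _

/-- The character, as a linear map. -/
def chHom (n : ℕ) : K0 n →ₗ[ℤ[T;T⁻¹]] (Fin (n + 1) → ℤ[T;T⁻¹]) :=
  laurentLinear (chAdd n) fun k x => by
    have : (chAdd n).comp (DistribSMul.toAddMonoidHom (K0 n) (T k : ℤ[T;T⁻¹])) =
        (DistribSMul.toAddMonoidHom _ (T k : ℤ[T;T⁻¹])).comp (chAdd n) :=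
      K0.hom_ext fun M => by
        simp only [AddMonoidHom.comp_apply, DistribSMul.toAddMonoidHom_apply]
        rw [K0.T_smul, chAdd_mk, chAdd_mk, chC_shift]
    exact DFunLike.congr_fun this x

theorem chHom_mk (M : GCat n) : chHom n (K0.mk n M) = chC M := chAdd_mk M

/-- Both sides are additive on short exact sequences, so it suffices to treat shifted simple
objects, whose character is a single power of T in one component. -/
theorem K0.mk_eq_sum (M : GCat n) : K0.mk n M = ∑ i, chC M i • K0.mk n (S n i) := by
  refine devissage (P := fun M => K0.mk n M = ∑ i, chC M i • K0.mk n (S n i)) (fun M hM => ?_)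
    (fun d i => ?_) (fun s hs h1 h3 => ?_) M
  · rw [K0.mk_of_isZero hM, chC_of_isZero hM]
    simp
  · rw [← K0.T_smul, chC_shift, chC_S, Finset.sum_eq_single i]
    · simp
    · intro j _ hj
      simp [hj]
    · simp
  · rw [K0.exact hs, chC_exact hs, h1, h3, ← Finset.sum_add_distrib]
    exact Finset.sum_congr rfl fun i _ => (add_smul _ _ _).symm

/-- The Grothendieck group is free with basis the classes of the simple objects. -/
def K0.equiv (n : ℕ) : K0 n ≃ₗ[ℤ[T;T⁻¹]] (Fin (n + 1) → ℤ[T;T⁻¹]) :=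
  LinearEquiv.ofLinearMap (chHom n)
    (Fintype.linearCombination ℤ[T;T⁻¹] fun i => K0.mk n (S n i))
    (LinearMap.pi_ext' fun i => LinearMap.ext_ring (by
      simp [Fintype.linearCombination_apply_single, chHom_mk, chC_S]))
    (LinearMap.toAddMonoidHom_injective (K0.hom_ext fun M => by
      change Fintype.linearCombination ℤ[T;T⁻¹] _ (chHom n (K0.mk n M)) = K0.mk n M
      rw [chHom_mk, Fintype.linearCombination_apply, ← K0.mk_eq_sum]))

/-- The basis of classes of simple objects. -/
def clsBasis (n : ℕ) : Module.Basis (Fin (n + 1)) Cq (G n) :=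
  (Module.Basis.ofEquivFun (K0.equiv n)).baseChange Cq

theorem clsBasis_apply (i : Fin (n + 1)) : clsBasis n i = cls n (S n i) := by
  rw [clsBasis, Module.Basis.baseChange_apply, cls]
  congr 1
  rw [Module.Basis.coe_ofEquivFun]
  exact (K0.equiv n).symm_apply_eq.2 ((chHom_mk _).trans (chC_S i)).symm

/-- The characters of the components, as rational functions. -/
def chq (M : GCat n) (i : Fin (n + 1)) : Cq := algebraMap ℤ[T;T⁻¹] Cq (chC M i)

theorem cls_eq_sum (M : GCat n) : cls n M = ∑ i, chq M i • cls n (S n i) := by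
  rw [cls, K0.mk_eq_sum, TensorProduct.tmul_sum]
  refine Finset.sum_congr rfl fun i _ => ?_
  rw [← TensorProduct.smul_tmul, cls, TensorProduct.smul_tmul', Algebra.smul_def, smul_eq_mul, chq]

end Grothendieck

end

end SlTwoCat

open CategoryTheory CategoryTheory.Limits
open scoped TensorProduct LaurentPolynomial

namespace SlTwoCat

noncomputable section

set_option linter.unusedSectionVars false


open LaurentPolynomial (T invert)

/-! ## Characters of the functors -/

section QuantumIntegers

/-- The quantum integer as a Laurent polynomial. -/
def lint (m : ℕ) : ℤ[T;T⁻¹] := T (1 - m) * pint m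

theorem lint_zero : lint 0 = 0 := by simp [lint, pint]

theorem T_mul_T (a b : ℤ) : (T a * T b : ℤ[T;T⁻¹]) = T (a + b) := (LaurentPolynomial.T_add a b).symm

theorem sub_mul_lint (m : ℕ) : (T 1 - T (-1)) * lint m = T (m : ℤ) - T (-(m : ℤ)) := by
  have h := pint_mul m
  have e1 : (T 1 * T (1 - m) : ℤ[T;T⁻¹]) = T (-m) * T 2 := by rw [T_mul_T, T_mul_T]; congr 1; ring
  have e2 : (T (-1) * T (1 - m) : ℤ[T;T⁻¹]) = T (-m) := by rw [T_mul_T]; congr 1; ring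
  have e3 : (T (-m) * T (2 * m) : ℤ[T;T⁻¹]) = T m := by rw [T_mul_T]; congr 1; ring
  rw [lint]
  linear_combination pint m * e1 - pint m * e2 + T (-m) * h + e3

theorem lint_succ (m : ℕ) : lint (m + 1) = T (m : ℤ) + T (-1) * lint m := by
  rw [lint, lint, pint_succ, mul_add, T_mul_T, ← mul_assoc, T_mul_T, add_comm]
  congr 2
  · push_cast; ring
  · congr 1; push_cast; ring

/-- The identity [a+1][b] - [b+1][a] = [b-a] behind the commutator of E and F, multiplied by q - q⁻¹
in order to stay within the Laurent polynomials. -/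
theorem lint_comm (a b : ℕ) :
    (T 1 - T (-1)) * (lint (a + 1) * lint b - lint (b + 1) * lint a) =
      T ((b : ℤ) - a) - T ((a : ℤ) - b) := by
  have e1 : (T a * T (-b) : ℤ[T;T⁻¹]) = T ((a : ℤ) - b) := T_mul_T _ _
  have e2 : (T b * T (-a) : ℤ[T;T⁻¹]) = T ((b : ℤ) - a) := T_mul_T _ _
  rw [lint_succ, lint_succ]
  linear_combination T (a : ℤ) * sub_mul_lint b - T (b : ℤ) * sub_mul_lint a - e1 + e2

theorem algebraMap_lint (m : ℕ) : algebraMap ℤ[T;T⁻¹] Cq (lint m) = qInt m := by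
  have h := congrArg (algebraMap ℤ[T;T⁻¹] Cq) (sub_mul_lint m)
  rw [map_mul, map_sub, map_sub, algebraMap_T, algebraMap_T, algebraMap_T, algebraMap_T, zpow_one,
    zpow_neg_one] at h
  rw [qInt, eq_div_iff q_sub_inv_ne_zero, mul_comm, h]

theorem bar_qInt (a : ℤ) : bar (qInt a) = qInt a := by
  have h := q_sub_inv_ne_zero
  have h' : q⁻¹ - q ≠ 0 := fun h0 => h (by rw [← neg_sub, h0, neg_zero])
  rw [qInt, map_div₀, map_sub, map_sub, map_zpow₀, map_zpow₀, map_inv₀, bar_q, inv_inv,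
    div_eq_div_iff h' h, inv_zpow', inv_zpow', neg_neg]
  ring

theorem bar_qFact (a : ℕ) : bar (qFact a) = qFact a := by
  induction a with
  | zero => exact map_one bar
  | succ a ih => rw [qFact, map_mul, ih, bar_qInt]

theorem bar_qBinom (a b : ℕ) : bar (qBinom a b) = qBinom a b := by
  rw [qBinom, map_div₀, map_mul, bar_qFact, bar_qFact, bar_qFact]

theorem qBinom_symm {a b c : ℕ} (h : b + c = a) : qBinom a b = qBinom a c := by
  subst h
  rw [qBinom, qBinom, Nat.add_sub_cancel_left, Nat.add_sub_cancel, mul_comm]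

theorem qBinom_zero (a : ℕ) : qBinom a 0 = 1 := by
  rw [qBinom, qFact, one_mul, Nat.sub_zero, div_self (qFact_ne_zero a)]

/-- Used twice: it is the recursion of the Hilbert series, and it passes between the actions of E
and F in the canonical basis and on characters. -/
theorem qBinom_succ {n k : ℕ} (hk : k < n) :
    qBinom n (k + 1) * qInt (k + 1 : ℕ) = qBinom n k * qInt (n - k : ℕ) := by
  obtain ⟨m, rfl⟩ : ∃ m, n = k + 1 + m := ⟨n - k - 1, by omega⟩
  have h1 := qFact_ne_zero k
  have h2 := qFact_ne_zero m
  have h3 : qInt ((k + 1 : ℕ) : ℤ) ≠ 0 := qInt_ne_zero (by omega)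
  have h4 : qInt ((m + 1 : ℕ) : ℤ) ≠ 0 := qInt_ne_zero (by omega)
  have e1 : qFact (k + 1) = qInt ((k + 1 : ℕ) : ℤ) * qFact k := by rw [qFact]; push_cast; rfl
  have e2 : qFact (m + 1) = qInt ((m + 1 : ℕ) : ℤ) * qFact m := by rw [qFact]; push_cast; rfl
  rw [qBinom, qBinom, show k + 1 + m - (k + 1) = m by omega, show k + 1 + m - k = m + 1 by omega,
    e1, e2]
  field_simp

theorem bar_algebraMap (p : ℤ[T;T⁻¹]) :
    bar (algebraMap ℤ[T;T⁻¹] Cq p) = algebraMap ℤ[T;T⁻¹] Cq (invert p) := by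
  induction p using LaurentPolynomial.induction_on' with
  | add p q hp hq => rw [map_add, map_add, map_add, map_add, hp, hq]
  | C_mul_T k a =>
    have h : (LaurentPolynomial.C a : ℤ[T;T⁻¹]) = (a : ℤ[T;T⁻¹]) := by simp
    rw [h, map_mul, map_mul, map_mul, map_mul, map_intCast, map_intCast, map_intCast, map_intCast,
      LaurentPolynomial.invert_T, algebraMap_T, algebraMap_T, map_zpow₀, bar_q, inv_zpow']

end QuantumIntegers

/-! ### Effect of the functors on characters -/

section FunctorCharacters

variable {n : ℕ}

theorem ch_congr {A : Type} [CommRing A] [Algebra ℂ A] {𝒜 : ℤ → Submodule ℂ A}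
    [Module.Finite ℂ A] {M N : GrMod 𝒜} (h : M = N) : GrMod.ch M = GrMod.ch N := congrArg _ h

theorem ch_res {A B : Type} [CommRing A] [CommRing B] [Algebra ℂ A] [Algebra ℂ B] [Algebra A B]
    [IsScalarTower ℂ A B] [Module.Finite ℂ A] [Module.Finite ℂ B] {𝒜 : ℤ → Submodule ℂ A}
    {ℬ : ℤ → Submodule ℂ B} (hAB : ∀ (i : ℤ) (a : A), a ∈ 𝒜 i → algebraMap A B a ∈ ℬ i)
    (N : GrMod ℬ) : GrMod.ch (GrMod.resObj 𝒜 hAB N) = GrMod.ch N := rfl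

theorem chC_E_zero (M : GCat n) : chC ((E n).obj M) ⟨0, by omega⟩ = 0 :=
  GrMod.ch_of_subsingleton (show Subsingleton PUnit from inferInstance)

theorem E_proj_eq {k : ℕ} (hk : k < n) : E n ⋙ proj n ⟨k + 1, by omega⟩ =
    proj n ⟨k, by omega⟩ ⋙ upF n k ⋙ GrMod.shift (deg n {k + 1}) (-n + k + 1) := rfl

/-- Freeness of rank n-k contributes 1 + T² + ⋯ + T^(2(n-k-1)), and the shift of E centres this sum
at zero, which makes it the quantum integer [n-k]. -/
theorem chC_E {k : ℕ} (hk : k < n) (M : GCat n) :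
    chC ((E n).obj M) ⟨k + 1, by omega⟩ = lint (n - k) * chC M ⟨k, by omega⟩ := by
  have h0 : ((E n).obj M) ⟨k + 1, by omega⟩ = GrMod.shiftObj (-n + k + 1)
      (GrMod.resObj (deg n {k + 1}) (degDown n k)
        (GrMod.indObj (deg n {k, k + 1}) (degUp n k) (M ⟨k, by omega⟩))) :=
    congrArg (fun T : GCat n ⥤ Block n (k + 1) => T.obj M) (E_proj_eq hk)
  refine (ch_congr h0).trans ?_
  rw [GrMod.ch_shift, ch_res, GrMod.ch_ind (degUp n k) (powUp hk), ← mul_assoc, lint,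
    show (powUp hk).m = n - k from rfl, show (-n + k + 1 : ℤ) = 1 - ((n - k : ℕ) : ℤ) by omega]
  rfl

theorem chC_F_top (M : GCat n) : chC ((F n).obj M) ⟨n, by omega⟩ = 0 :=
  GrMod.ch_of_subsingleton (F_top_subsingleton M _ (lt_irrefl n))

theorem chC_F {k : ℕ} (hk : k < n) (M : GCat n) :
    chC ((F n).obj M) ⟨k, by omega⟩ = lint (k + 1) * chC M ⟨k + 1, by omega⟩ := by
  have h0 : ((F n).obj M) ⟨k, by omega⟩ = GrMod.shiftObj (-((k : ℤ) + 1) + 1)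
      (GrMod.resObj (deg n {k}) (degUp n k)
        (GrMod.indObj (deg n {k, k + 1}) (degDown n k) (M ⟨k + 1, by omega⟩))) :=
    congrArg (fun T : GCat n ⥤ Block n k => T.obj M) (F_proj_eq hk)
  refine (ch_congr h0).trans ?_
  rw [GrMod.ch_shift, ch_res, GrMod.ch_ind (degDown n k) (powDown hk), ← mul_assoc, lint,
    show (powDown hk).m = k + 1 from rfl,
    show (-((k : ℤ) + 1) + 1 : ℤ) = 1 - ((k + 1 : ℕ) : ℤ) by omega]
  rfl

theorem chC_K (M : GCat n) (i : Fin (n + 1)) :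
    chC ((K n).obj M) i = T (2 * (i : ℤ) - n) * chC M i := GrMod.ch_shift _ _

theorem chC_Kinv (M : GCat n) (i : Fin (n + 1)) :
    chC ((Kinv n).obj M) i = T (-(2 * (i : ℤ) - n)) * chC M i := GrMod.ch_shift _ _

theorem chC_EF (M : GCat n) (i : Fin (n + 1)) :
    chC ((E n).obj ((F n).obj M)) i = lint (n - i + 1) * lint i * chC M i := by
  obtain ⟨i, hi⟩ := i
  cases i with
  | zero => rw [chC_E_zero, lint_zero, mul_zero, zero_mul]
  | succ k =>
    rw [chC_E (by omega), chC_F (by omega), mul_assoc]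
    congr 2
    change n - k = n - (k + 1) + 1
    omega

theorem chC_FE (M : GCat n) (i : Fin (n + 1)) :
    chC ((F n).obj ((E n).obj M)) i = lint (i + 1) * lint (n - i) * chC M i := by
  obtain ⟨i, hi⟩ := i
  rcases Nat.lt_or_ge i n with h | h
  · rw [chC_F h, chC_E h, mul_assoc]
  · obtain rfl : i = n := by omega
    rw [chC_F_top, show lint (i - i) = 0 by rw [Nat.sub_self, lint_zero], mul_zero, zero_mul]

theorem chC_dual (M : GCat n) (i : Fin (n + 1)) :
    chC ((dualC n).obj (Opposite.op M)) i = invert (chC M i) := GrMod.ch_dual (M i)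

/-- The commutation relation on the Grothendieck group. -/
theorem K0.commutator (M : GCat n) : (T 1 - T (-1) : ℤ[T;T⁻¹]) •
      (K0.mk n ((E n).obj ((F n).obj M)) - K0.mk n ((F n).obj ((E n).obj M))) =
    K0.mk n ((K n).obj M) - K0.mk n ((Kinv n).obj M) := by
  refine (K0.equiv n).injective ?_
  change chHom n _ = chHom n _
  rw [map_smul, map_sub, map_sub, chHom_mk, chHom_mk, chHom_mk, chHom_mk]
  funext i
  have h := lint_comm (n - i) i
  have hi : (((n - (i : ℕ) : ℕ)) : ℤ) = n - i := by omega
  simp only [Pi.smul_apply, Pi.sub_apply, smul_eq_mul, chC_EF, chC_FE, chC_K, chC_Kinv]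
  rw [← sub_mul, ← sub_mul, ← mul_assoc, h, hi]
  congr 3 <;> ring

/-- The Hilbert series of the cohomology ring of a Grassmannian. -/
theorem hilb {k : ℕ} (hk : k ≤ n) : algebraMap ℤ[T;T⁻¹] Cq (gch (deg n {k})) =
    q ^ (k * (n - k)) * qBinom n k := by
  have hpint : ∀ m : ℕ, algebraMap ℤ[T;T⁻¹] Cq (pint m) = q ^ ((m : ℤ) - 1) * qInt m := fun m => by
    rw [← algebraMap_lint, ← algebraMap_T, ← map_mul, lint, ← mul_assoc, T_mul_T]
    simp
  induction k with
  | zero =>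
    rw [zero_mul, pow_zero, one_mul, qBinom_zero]
    have h : gch (deg n {0}) = 1 := by
      rw [← LaurentPolynomial.T_zero, ← lau_single 0]
      refine congrArg lau (funext fun d => ?_)
      by_cases h : d = 0
      · subst h
        rw [if_pos rfl]
        have h1 : deg n {0} 0 = ⊤ := eq_top_iff.2 fun a _ => by
          rw [eq_algebraMap_of_bot a]
          exact SetLike.algebraMap_mem_graded (deg n {0}) _
        rw [h1, finrank_top, ← Nat.cast_one, Nat.cast_inj]
        refine finrank_eq_one_iff'.2 ⟨1, fun h0 => ?_, fun a => ⟨aug n {0} a, ?_⟩⟩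
        · have := congrArg (aug n {0}) h0
          rw [map_one, map_zero] at this
          exact one_ne_zero this
        · rw [← Algebra.algebraMap_eq_smul_one, ← eq_algebraMap_of_bot]
      · rw [if_neg h]
        have h1 : deg n {0} d = ⊥ := eq_bot_iff.2 fun a ha => by
          rw [Submodule.mem_bot, eq_algebraMap_of_bot a, (augGrading n {0}).pos d a h ha, map_zero]
        rw [h1, finrank_bot]
        rfl
    rw [h, map_one]
  | succ k ih =>
    -- The Hilbert series of C^{k,k+1} is computed over C^k and over C^{k+1}. Equating the results
    -- gives the recursion of the quantum binomial coefficients.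
    have h1 := GrMod.gch_powExt (degUp n k) (powUp hk)
    have h2 := GrMod.gch_powExt (degDown n k) (powDown hk)
    have h3 := congrArg (algebraMap ℤ[T;T⁻¹] Cq) (h2.symm.trans h1)
    rw [show (powUp hk).m = n - k from rfl, show (powDown hk).m = k + 1 from rfl, map_mul, map_mul,
      ih (by omega), hpint, hpint] at h3
    have h4 := qBinom_succ hk
    have h5 : q ^ (((k + 1 : ℕ) : ℤ) - 1) * qInt (k + 1 : ℕ) ≠ 0 :=
      mul_ne_zero (zpow_ne_zero _ q_ne_zero) (qInt_ne_zero (by omega))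
    refine mul_left_cancel₀ h5 (h3.trans ?_)
    have e : q ^ (((n - k : ℕ) : ℤ) - 1) * q ^ (k * (n - k)) =
        q ^ (((k + 1 : ℕ) : ℤ) - 1) * q ^ ((k + 1) * (n - (k + 1))) := by
      rw [← zpow_natCast, ← zpow_natCast, ← zpow_add₀ q_ne_zero, ← zpow_add₀ q_ne_zero]
      congr 1
      push_cast [Nat.cast_sub (show k ≤ n by omega), Nat.cast_sub hk]
      ring
    linear_combination qInt (n - k : ℕ) * qBinom n k * e -
      q ^ (((k + 1 : ℕ) : ℤ) - 1) * q ^ ((k + 1) * (n - (k + 1))) * h4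

/-- The normalizing shift cancels the power q^(i(n-i)) of the Hilbert series. -/
theorem chC_VT (i : Fin (n + 1)) : algebraMap ℤ[T;T⁻¹] Cq (chC (VT n i) i) = qBinom n i := by
  have h1 : chC (VT n i) i = GrMod.ch (freeB n i) := ch_congr (atBlock_same i (freeB n))
  have h2 : GrMod.ch (freeB n i) = T (-((i : ℤ) * (n - i))) * gch (deg n {(i : ℕ)}) :=
    GrMod.ch_shift _ _
  rw [h1, h2, map_mul, algebraMap_T, hilb (Nat.lt_succ_iff.1 i.2), ← mul_assoc, ← zpow_natCast,
    ← zpow_add₀ q_ne_zero]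
  have : (-((i : ℤ) * (n - i)) + (((i : ℕ) * (n - i) : ℕ) : ℤ)) = 0 := by
    push_cast [Nat.cast_sub (Nat.lt_succ_iff.1 i.2)]
    ring
  rw [this, zpow_zero, one_mul]

theorem chC_VT_ne {i j : Fin (n + 1)} (h : j ≠ i) : chC (VT n i) j = 0 :=
  GrMod.ch_of_subsingleton (subsingleton_atBlock h (freeB n))

end FunctorCharacters

/-! ### The isomorphism of V_n with the Grothendieck group -/

section Comparison

variable {n : ℕ}

/-- The isomorphism of `V_n` with the Grothendieck group. -/
def Phi (n : ℕ) : V n ≃ₗ[Cq] G n :=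
  (Pi.basisFun Cq (Fin (n + 1))).equiv
    ((clsBasis n).unitsSMul fun i => Units.mk0 (qBinom n i) (qBinom_ne_zero n i)) (Equiv.refl _)

theorem Phi_can_eq (i : Fin (n + 1)) : Phi n (can n i) = qBinom n i • cls n (S n i) := by
  rw [Phi, can, Module.Basis.equiv_apply, Equiv.refl_apply, Module.Basis.unitsSMul_apply,
    clsBasis_apply]
  rfl

theorem Phi_dualCan (i : Fin (n + 1)) : Phi n (dualCan n i) = cls n (S n i) := by
  rw [dualCan, map_smul, Phi_can_eq, smul_smul, inv_mul_cancel₀ (qBinom_ne_zero n i), one_smul]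

theorem Phi_symm_cls (M : GCat n) :
    (Phi n).symm (cls n M) = fun i => chq M i * (qBinom n i)⁻¹ := by
  rw [LinearEquiv.symm_apply_eq, cls_eq_sum]
  have h : (fun i => chq M i * (qBinom n i)⁻¹) = ∑ i, chq M i • dualCan n i := by
    funext j
    rw [Finset.sum_apply, Finset.sum_eq_single j]
    · simp [dualCan, can]
    · intro i _ hi
      simp [dualCan, can, hi.symm]
    · simp
  rw [h, map_sum]
  simp only [map_smul, Phi_dualCan]

/-- Reduces identities of classes to characters. The simple objects correspond to the dual canonical
basis, so coordinates in the canonical basis are multiplied by [n,i]. -/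
theorem cls_eq_iff {M : GCat n} {v : V n} :
    cls n M = Phi n v ↔ ∀ i, chq M i = v i * qBinom n i := by
  rw [← LinearEquiv.symm_apply_eq, Phi_symm_cls, funext_iff]
  exact forall_congr' fun i => mul_inv_eq_iff_eq_mul₀ (qBinom_ne_zero n i)

theorem Phi_can (i : Fin (n + 1)) : Phi n (can n i) = cls n (VT n i) := by
  refine (cls_eq_iff.2 fun j => ?_).symm
  by_cases h : j = i
  · subst h
    rw [chq, chC_VT]
    simp [can]
  · rw [chq, chC_VT_ne h]
    simp [can, h]

theorem apply_eq_of_can {f : Module.End Cq (V n)} {i j : Fin (n + 1)} {c : Cq}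
    (h : ∀ l, f (can n l) i = c * can n l j) (v : V n) : f v i = c * v j := by
  have : LinearMap.proj i ∘ₗ f = c • (LinearMap.proj j : V n →ₗ[Cq] Cq) :=
    (Pi.basisFun Cq (Fin (n + 1))).ext h
  exact LinearMap.congr_fun this v

theorem can_apply (i j : Fin (n + 1)) : can n i j = if j = i then 1 else 0 := by
  rw [can, Pi.basisFun_apply, Pi.single_apply]

theorem actE_zero (v : V n) : actE n v ⟨0, by omega⟩ = 0 := by
  rw [apply_eq_of_can (f := actE n) (j := ⟨0, by omega⟩) (c := 0) (fun l => ?_), zero_mul]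
  rw [actE_can, zero_mul]
  split_ifs
  · rw [Pi.smul_apply, can_apply, if_neg (by simp), smul_zero]
  · rfl

theorem actE_succ {k : ℕ} (hk : k < n) (v : V n) :
    actE n v ⟨k + 1, by omega⟩ = qInt (k + 1 : ℕ) * v ⟨k, by omega⟩ := by
  refine apply_eq_of_can (fun l => ?_) v
  rw [actE_can, can_apply]
  by_cases h : k = l
  · subst h
    rw [dif_pos (by omega), Pi.smul_apply, can_apply, if_pos rfl, if_pos rfl, smul_eq_mul]
    push_cast
    rfl
  · rw [if_neg (fun h' => h (congrArg Fin.val h')), mul_zero]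
    split_ifs
    · rw [Pi.smul_apply, can_apply, if_neg (by simpa using h), smul_zero]
    · rfl

theorem actF_top (v : V n) : actF n v ⟨n, by omega⟩ = 0 := by
  rw [apply_eq_of_can (f := actF n) (j := ⟨0, by omega⟩) (c := 0) (fun l => ?_), zero_mul]
  rw [actF_can, zero_mul]
  split_ifs
  · rw [Pi.smul_apply, can_apply, if_neg (by rw [Fin.ext_iff]; simp only; omega), smul_zero]
  · rfl

theorem actF_apply {k : ℕ} (hk : k < n) (v : V n) :
    actF n v ⟨k, by omega⟩ = qInt (n - k : ℕ) * v ⟨k + 1, by omega⟩ := by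
  refine apply_eq_of_can (fun l => ?_) v
  rw [actF_can, can_apply]
  by_cases h : k + 1 = l
  · rw [if_pos (by omega), Pi.smul_apply, can_apply,
      if_pos (by rw [Fin.ext_iff]; simp only; omega), if_pos (Fin.ext h), smul_eq_mul]
    congr 2
    omega
  · rw [if_neg (fun h' => h (congrArg Fin.val h')), mul_zero]
    split_ifs
    · rw [Pi.smul_apply, can_apply, if_neg (by rw [Fin.ext_iff]; simp only; omega), smul_zero]
    · rfl

theorem actK_apply (v : V n) (i : Fin (n + 1)) : actK n v i = q ^ (2 * (i : ℤ) - n) * v i := by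
  refine apply_eq_of_can (fun l => ?_) v
  rw [actK_can, Pi.smul_apply, can_apply, smul_eq_mul]
  split_ifs with h
  · rw [h]
  · rw [mul_zero, mul_zero]

theorem actKinv_apply (v : V n) (i : Fin (n + 1)) :
    actKinv n v i = q ^ (-(2 * (i : ℤ) - n)) * v i := by
  refine apply_eq_of_can (fun l => ?_) v
  rw [actKinv_can, Pi.smul_apply, can_apply, smul_eq_mul]
  split_ifs with h
  · rw [h]
  · rw [mul_zero, mul_zero]

/-- On canonical coordinates E multiplies by [k+1], on characters by [n-k]. The ratio of consecutive
binomial coefficients accounts for the difference. -/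
theorem cls_E (M : GCat n) : cls n ((E n).obj M) = Phi n (actE n ((Phi n).symm (cls n M))) := by
  rw [Phi_symm_cls]
  refine cls_eq_iff.2 fun ⟨i, hi⟩ => ?_
  cases i with
  | zero => rw [chq, chC_E_zero, map_zero, actE_zero, zero_mul]
  | succ k =>
    have h := qBinom_succ (n := n) (k := k) (by omega)
    have h0 := qBinom_ne_zero n k
    rw [chq, chC_E (by omega), map_mul, algebraMap_lint, actE_succ (by omega)]
    simp only [chq]
    rw [mul_right_comm, mul_comm (qInt (k + 1 : ℕ)), h]
    field_simp

theorem cls_F (M : GCat n) : cls n ((F n).obj M) = Phi n (actF n ((Phi n).symm (cls n M))) := by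
  rw [Phi_symm_cls]
  refine cls_eq_iff.2 fun ⟨i, hi⟩ => ?_
  rcases Nat.lt_or_ge i n with hk | hk
  · have h := qBinom_succ hk
    have h0 := qBinom_ne_zero n (i + 1)
    rw [chq, chC_F hk, map_mul, algebraMap_lint, actF_apply hk]
    simp only [chq]
    rw [mul_right_comm, mul_comm (qInt (n - i : ℕ)), ← h]
    field_simp
  · obtain rfl : i = n := by omega
    rw [chq, chC_F_top, map_zero, actF_top, zero_mul]

theorem cls_K (M : GCat n) : cls n ((K n).obj M) = Phi n (actK n ((Phi n).symm (cls n M))) := by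
  rw [Phi_symm_cls]
  refine cls_eq_iff.2 fun i => ?_
  rw [chq, chC_K, map_mul, algebraMap_T, actK_apply, mul_assoc,
    inv_mul_cancel_right₀ (qBinom_ne_zero n i)]
  rfl

theorem cls_Kinv (M : GCat n) :
    cls n ((Kinv n).obj M) = Phi n (actKinv n ((Phi n).symm (cls n M))) := by
  rw [Phi_symm_cls]
  refine cls_eq_iff.2 fun i => ?_
  rw [chq, chC_Kinv, map_mul, algebraMap_T, actKinv_apply, mul_assoc,
    inv_mul_cancel_right₀ (qBinom_ne_zero n i)]
  rfl

/-- The flip permutes the characters of the blocks, and [n,i] = [n,n-i]. -/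
theorem cls_Sig (M : GCat n) :
    cls n ((Sig n).obj M) = Phi n (sigmaV n ((Phi n).symm (cls n M))) := by
  rw [Phi_symm_cls]
  refine cls_eq_iff.2 fun i => ?_
  change algebraMap _ _ (chC M i.rev) = chq M i.rev * (qBinom n i.rev)⁻¹ * qBinom n i
  rw [qBinom_symm (b := i) (c := i.rev) (by rw [Fin.val_rev]; omega),
    inv_mul_cancel_right₀ (qBinom_ne_zero n _)]
  rfl

/-- Duality inverts the variable of the characters, and the quantum binomial coefficients are
invariant under the bar involution. -/
theorem cls_dual (M : GCat n) :
    cls n ((dualC n).obj (Opposite.op M)) = Phi n (psiV n ((Phi n).symm (cls n M))) := by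
  rw [Phi_symm_cls]
  refine cls_eq_iff.2 fun i => ?_
  change algebraMap _ _ _ = bar (chq M i * (qBinom n i)⁻¹) * qBinom n i
  rw [chC_dual, map_mul, map_inv₀, bar_qBinom, inv_mul_cancel_right₀ (qBinom_ne_zero n _), chq,
    bar_algebraMap]

/-- The representation of the quantum group on the Grothendieck group. -/
def rhoG (n : ℕ) : Uq →ₐ[Cq] Module.End Cq (G n) :=
  ((Phi n).conjAlgEquiv Cq).toAlgHom.comp (repV n)

theorem rhoG_apply (x : Uq) (v : G n) : rhoG n x v = Phi n (repV n x ((Phi n).symm v)) := rfl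

end Comparison

end

end SlTwoCat

open CategoryTheory CategoryTheory.Limits
open scoped TensorProduct LaurentPolynomial

namespace SlTwoCat

noncomputable section

set_option linter.unusedSectionVars false


/-! ## Extension groups and short exact sequences -/

section LinearExact

variable {X Y Z : Type*} [AddCommGroup X] [Module ℂ X] [AddCommGroup Y] [Module ℂ Y]
  [AddCommGroup Z] [Module ℂ Z] (f : X →ₗ[ℂ] Y) (g : Y →ₗ[ℂ] Z)

theorem finite_of_exact (h : ∀ y, g y = 0 → ∃ x, f x = y) [Module.Finite ℂ X] [Module.Finite ℂ Z] :
    Module.Finite ℂ Y := by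
  have h1 : LinearMap.ker g ≤ LinearMap.range f := fun y hy => h y hy
  have h2 : Module.Finite ℂ (LinearMap.ker g) := Submodule.finiteDimensional_of_le h1
  have h3 : Module.Finite ℂ (Y ⧸ LinearMap.ker g) :=
    Module.Finite.equiv g.quotKerEquivRange.symm
  exact Module.Finite.of_submodule_quotient (LinearMap.ker g)

theorem subsingleton_of_exact (h : ∀ y, g y = 0 → ∃ x, f x = y) [Subsingleton X]
    [Subsingleton Z] : Subsingleton Y :=
  subsingleton_of_forall_eq 0 fun y => by
    obtain ⟨x, rfl⟩ := h y (Subsingleton.elim _ _)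
    rw [Subsingleton.elim x 0, map_zero]

theorem finrank_ker_eq_of_exact (h : ∀ y, g y = 0 → ∃ x, f x = y) (h0 : ∀ x, g (f x) = 0) :
    Module.finrank ℂ (LinearMap.ker g) = Module.finrank ℂ (LinearMap.range f) := by
  have : LinearMap.ker g = LinearMap.range f := by
    ext y
    exact ⟨fun hy => h y hy, fun ⟨x, hx⟩ => hx ▸ h0 x⟩
  rw [this]

/-- Euler characteristic of a long exact sequence cut off at J. The numbers a, b, c are the
dimensions of its terms and r, s, t the ranks of its maps; the sum telescopes up to a boundary term.
-/
theorem alternating_sum {a b c r s t : ℕ → ℤ} (ha : ∀ j, a j = r j + s j)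
    (hb : ∀ j, b j = s j + t j) (hc : ∀ j, c j = t j + r (j + 1)) (h0 : r 0 = 0) (J : ℕ) :
    ∑ j ∈ Finset.range J, (-1) ^ j * b j = ∑ j ∈ Finset.range J, (-1) ^ j * a j +
      ∑ j ∈ Finset.range J, (-1) ^ j * c j + (-1) ^ J * r J := by
  induction J with
  | zero => simp [h0]
  | succ J ih =>
    rw [Finset.sum_range_succ, Finset.sum_range_succ, Finset.sum_range_succ, ih, ha, hb, hc]
    ring

end LinearExact

section ExtExact

open Abelian

variable {D : Type 1} [Category.{0} D] [Abelian D] [Linear ℂ D] [HasExt.{1} D]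
  {s : ShortComplex D}

/-- Restriction of extensions along a morphism. -/
def extMap {X Y : D} (f : X ⟶ Y) (N : D) (j : ℕ) : Ext Y N j →ₗ[ℂ] Ext X N j :=
  Ext.precompOfLinear (Ext.mk₀ f) ℂ N (zero_add j)

/-- The connecting homomorphism. -/
def extδ (hs : s.ShortExact) (N : D) (j : ℕ) : Ext s.X₁ N j →ₗ[ℂ] Ext s.X₃ N (j + 1) :=
  Ext.precompOfLinear hs.extClass ℂ N (add_comm 1 j)

theorem extMap_zero_injective {X Y : D} (f : X ⟶ Y) [Epi f] (N : D) :
    Function.Injective (extMap f N 0) := Ext.precomp_mk₀_injective_of_epi N f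

theorem ext_exact₁ (hs : s.ShortExact) (N : D) (j : ℕ) (x : Ext s.X₁ N j) (h : extδ hs N j x = 0) :
    ∃ y, extMap s.f N j y = x := Ext.contravariant_sequence_exact₁ hs N x (add_comm 1 j) h

theorem ext_exact₂ (hs : s.ShortExact) (N : D) (j : ℕ) (x : Ext s.X₂ N j) (h : extMap s.f N j x = 0) :
    ∃ y, extMap s.g N j y = x := Ext.contravariant_sequence_exact₂ hs N x h

theorem ext_exact₃ (hs : s.ShortExact) (N : D) (j : ℕ) (x : Ext s.X₃ N (j + 1)) (h : extMap s.g N (j + 1) x = 0) :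
    ∃ y, extδ hs N j y = x := Ext.contravariant_sequence_exact₃ hs N x h (add_comm 1 j)

theorem extδ_extMap (hs : s.ShortExact) (N : D) (j : ℕ) (x : Ext s.X₂ N j) : extδ hs N j (extMap s.f N j x) = 0 :=
  hs.extClass_comp_assoc x (h := add_comm 1 j)

theorem extMap_extMap (N : D) (j : ℕ) (x : Ext s.X₃ N j) : extMap s.f N j (extMap s.g N j x) = 0 := by
  change (Ext.mk₀ s.f).comp ((Ext.mk₀ s.g).comp x (zero_add j)) (zero_add j) = 0
  rw [Ext.mk₀_comp_mk₀_assoc, s.zero, Ext.mk₀_zero, Ext.zero_comp]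

theorem extMap_extδ (hs : s.ShortExact) (N : D) (j : ℕ) (x : Ext s.X₁ N j) : extMap s.g N (j + 1) (extδ hs N j x) = 0 :=
  hs.comp_extClass_assoc x (add_comm 1 j)

theorem ext_finite₂ (hs : s.ShortExact) (N : D) (j : ℕ) (h1 : Module.Finite ℂ (Ext s.X₁ N j))
    (h3 : Module.Finite ℂ (Ext s.X₃ N j)) : Module.Finite ℂ (Ext s.X₂ N j) :=
  finite_of_exact _ _ (ext_exact₂ hs N j)

theorem ext_subsingleton₂ (hs : s.ShortExact) (N : D) (j : ℕ) (h1 : Subsingleton (Ext s.X₁ N j))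
    (h3 : Subsingleton (Ext s.X₃ N j)) : Subsingleton (Ext s.X₂ N j) :=
  subsingleton_of_exact _ _ (ext_exact₂ hs N j)

theorem ext_finite₃ (hs : s.ShortExact) (N : D) (j : ℕ) (h1 : Module.Finite ℂ (Ext s.X₁ N j)) (h2 : Projective s.X₂) :
    Module.Finite ℂ (Ext s.X₃ N (j + 1)) :=
  have := Ext.subsingleton_of_projective s.X₂ N j
  finite_of_exact _ _ (ext_exact₃ hs N j)

theorem ext_subsingleton₃ (hs : s.ShortExact) (N : D) (j : ℕ) (h1 : Subsingleton (Ext s.X₁ N j)) (h2 : Projective s.X₂) :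
    Subsingleton (Ext s.X₃ N (j + 1)) :=
  have := Ext.subsingleton_of_projective s.X₂ N j
  subsingleton_of_exact _ _ (ext_exact₃ hs N j)

/-- The truncated Euler characteristic. -/
def eulerTrunc (M N : D) (J : ℕ) : ℤ :=
  ∑ j ∈ Finset.range J, (-1) ^ j * (Module.finrank ℂ (Ext M N j) : ℤ)

/-- The boundary term at J is the dimension of a subspace of the group which is assumed to vanish.
-/
theorem eulerTrunc_add (hs : s.ShortExact) (N : D) (h1 : ∀ j, Module.Finite ℂ (Ext s.X₁ N j))
    (h2 : ∀ j, Module.Finite ℂ (Ext s.X₂ N j)) (h3 : ∀ j, Module.Finite ℂ (Ext s.X₃ N j)) {J : ℕ}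
    (hJ : Subsingleton (Ext s.X₃ N J)) :
    eulerTrunc s.X₂ N J = eulerTrunc s.X₁ N J + eulerTrunc s.X₃ N J := by
  have h := alternating_sum
    (a := fun j => (Module.finrank ℂ (Ext s.X₃ N j) : ℤ))
    (b := fun j => (Module.finrank ℂ (Ext s.X₂ N j) : ℤ))
    (c := fun j => (Module.finrank ℂ (Ext s.X₁ N j) : ℤ))
    (r := fun j => (Module.finrank ℂ (LinearMap.ker (extMap s.g N j)) : ℤ))
    (s := fun j => (Module.finrank ℂ (LinearMap.range (extMap s.g N j)) : ℤ))
    (t := fun j => (Module.finrank ℂ (LinearMap.range (extMap s.f N j)) : ℤ))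
    (fun j => by
      have := (extMap s.g N j).finrank_range_add_finrank_ker
      omega)
    (fun j => by
      have := (extMap s.f N j).finrank_range_add_finrank_ker
      rw [finrank_ker_eq_of_exact _ _ (ext_exact₂ hs N j) (extMap_extMap N j)] at this
      omega)
    (fun j => by
      have := (extδ hs N j).finrank_range_add_finrank_ker
      rw [finrank_ker_eq_of_exact _ _ (ext_exact₁ hs N j) (extδ_extMap hs N j)] at this
      rw [finrank_ker_eq_of_exact _ _ (ext_exact₃ hs N j) (extMap_extδ hs N j)]
      omega)
    (by
      have := hs.epi_g
      rw [LinearMap.ker_eq_bot.2 (extMap_zero_injective s.g N), finrank_bot]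
      rfl) J
  have h0 : Module.finrank ℂ (LinearMap.ker (extMap s.g N J)) = 0 :=
    Module.finrank_zero_of_subsingleton
  simp only [h0, Nat.cast_zero, mul_zero, add_zero] at h
  rw [eulerTrunc, eulerTrunc, eulerTrunc, h, add_comm]

theorem eulerTrunc_of_projective (P N : D) [Projective P] (J : ℕ) :
    eulerTrunc P N (J + 1) = Module.finrank ℂ (P ⟶ N) := by
  rw [eulerTrunc, Finset.sum_range_succ', Finset.sum_eq_zero, zero_add, pow_zero, one_mul,
    (Ext.linearEquiv₀ (R := ℂ) (X := P) (Y := N)).finrank_eq]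
  intro j _
  have := Ext.subsingleton_of_projective P N j
  rw [Module.finrank_zero_of_subsingleton, Nat.cast_zero, mul_zero]

end ExtExact

end

end SlTwoCat

open CategoryTheory CategoryTheory.Limits
open scoped TensorProduct LaurentPolynomial

namespace SlTwoCat

noncomputable section

set_option linter.unusedSectionVars false


/-! ## Degree bounds and minimal presentations -/

theorem exists_shortExact_of_epi {D : Type*} [Category* D] [Abelian D] {X Y : D} (g : X ⟶ Y)
    (hg : Epi g) : ∃ (Z : D) (f : Z ⟶ X) (w : f ≫ g = 0), (ShortComplex.mk f g w).ShortExact :=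
  ⟨_, _, kernel.condition g,
    { exact := ShortComplex.exact_kernel g
      mono_f := inferInstance
      epi_g := hg }⟩

theorem ext_subsingleton_of_isZero {D : Type 1} [Category.{0} D] [Abelian D] [HasExt.{1} D] {M : D}
    (h : IsZero M) (N : D) (j : ℕ) : Subsingleton (Abelian.Ext M N j) :=
  subsingleton_of_forall_eq 0 fun x => by
    rw [← Abelian.Ext.mk₀_id_comp x, h.eq_of_src (𝟙 M) 0, Abelian.Ext.mk₀_zero,
      Abelian.Ext.zero_comp]

section RegHom

open GrMod

variable {A : Type} [CommRing A] [Algebra ℂ A] {𝒜 : ℤ → Submodule ℂ A} [GradedAlgebra 𝒜]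
  [Module.Finite ℂ A]

/-- Homomorphisms from a shifted free module of rank one. -/
def regHomEquiv (d : ℤ) (M : GrMod 𝒜) : (shiftObj d (regObj 𝒜) ⟶ M) ≃ₗ[ℂ] M.deg d :=
  LinearEquiv.ofBijective
    { toFun := fun f => ⟨lin f (1 : A), lin_mem f (one_mem (𝒜 := 𝒜) d)⟩
      map_add' := fun _ _ => rfl
      map_smul' := fun _ _ => rfl }
    ⟨fun _ _ h => reg_hom_ext (congrArg Subtype.val h),
      fun m => ⟨ofElem m.1 m.2, Subtype.ext (one_smul A m.1)⟩⟩

end RegHom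

section Degrees

variable {n : ℕ}

theorem finrank_component {s : ShortComplex (GCat n)} (hs : s.ShortExact) (k : Fin (n + 1))
    (d : ℤ) : Module.finrank ℂ ((s.X₂ k).deg d) =
      Module.finrank ℂ ((s.X₁ k).deg d) + Module.finrank ℂ ((s.X₃ k).deg d) := by
  obtain ⟨h1, h2, h3, h4⟩ := component_exact hs k
  exact GrMod.finrank_deg_eq_of_exact _ _ h1 h2 h3 h4 d

theorem subsingleton_of_isZero {M : GCat n} (h : IsZero M) (i : Fin (n + 1)) :
    Subsingleton (M i).carrier := by
  have h1 : GrMod.lin (𝟙 (M i)) = GrMod.lin (0 : M i ⟶ M i) :=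
    congrArg GrMod.lin (congrFun (h.eq_of_src (𝟙 M) 0) i)
  exact ⟨fun x y => (LinearMap.congr_fun h1 x).trans (LinearMap.congr_fun h1 y).symm⟩

/-- The object lives in degrees at least `a`. -/
def DegGE (a : ℤ) (M : GCat n) : Prop := ∀ k d, d < a → Module.finrank ℂ ((M k).deg d) = 0

/-- The object lives in degrees at most `b`. -/
def DegLE (b : ℤ) (M : GCat n) : Prop := ∀ k d, b < d → Module.finrank ℂ ((M k).deg d) = 0

theorem DegGE.of_isZero {M : GCat n} (h : IsZero M) (a : ℤ) : DegGE a M := fun k _ _ =>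
  have := subsingleton_of_isZero h k
  Module.finrank_zero_of_subsingleton

theorem finrank_simple (d : ℤ) (i : Fin (n + 1)) :
    Module.finrank ℂ ((((shiftC n d).obj (S n i)) i).deg d) = 1 := by
  have h3 : ((shiftC n d).obj (S n i)) i = GrMod.shiftObj d (trivB n i) :=
    congrArg (GrMod.shiftObj d) (atBlock_same i (trivB n))
  rw [h3]
  change Module.finrank ℂ (if d - d = 0 then (⊤ : Submodule ℂ ℂ) else ⊥ : Submodule ℂ ℂ) = 1
  rw [if_pos (sub_self d), finrank_top, Module.finrank_self]

theorem finrank_simple_ne (d : ℤ) (i k : Fin (n + 1)) {e : ℤ} (h : e ≠ d) :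
    Module.finrank ℂ ((((shiftC n d).obj (S n i)) k).deg e) = 0 := by
  by_cases hk : k = i
  · subst hk
    have h3 : ((shiftC n d).obj (S n k)) k = GrMod.shiftObj d (trivB n k) :=
      congrArg (GrMod.shiftObj d) (atBlock_same k (trivB n))
    rw [h3]
    change Module.finrank ℂ (if e - d = 0 then (⊤ : Submodule ℂ ℂ) else ⊥ : Submodule ℂ ℂ) = 0
    rw [if_neg (by omega), finrank_bot]
  · have : Subsingleton (((shiftC n d).obj (S n i)) k).carrier :=
      subsingleton_atBlock hk (trivB n)
    exact Module.finrank_zero_of_subsingleton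

theorem exists_degGE (M : GCat n) : ∃ a, DegGE a M := by
  refine devissage (P := fun M => ∃ a, DegGE a M) (fun M hM => ⟨0, .of_isZero hM 0⟩)
    (fun d i => ⟨d, fun k e he => finrank_simple_ne d i k he.ne⟩) (fun s hs ⟨a, ha⟩ ⟨b, hb⟩ =>
      ⟨min a b, fun k d hd => ?_⟩) M
  rw [finrank_component hs, ha k d (lt_of_lt_of_le hd (min_le_left _ _)),
    hb k d (lt_of_lt_of_le hd (min_le_right _ _))]

theorem exists_degLE (M : GCat n) : ∃ b, DegLE b M := by
  refine devissage (P := fun M => ∃ b, DegLE b M) (fun M hM => ⟨0, fun k _ _ => ?_⟩)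
    (fun d i => ⟨d, fun k e he => finrank_simple_ne d i k he.ne'⟩) (fun s hs ⟨a, ha⟩ ⟨b, hb⟩ =>
      ⟨max a b, fun k d hd => ?_⟩) M
  · have := subsingleton_of_isZero hM k
    exact Module.finrank_zero_of_subsingleton
  · rw [finrank_component hs, ha k d (lt_of_le_of_lt (le_max_left _ _) hd),
      hb k d (lt_of_le_of_lt (le_max_right _ _) hd)]

theorem DegGE.sub {s : ShortComplex (GCat n)} (hs : s.ShortExact) {a : ℤ} (h : DegGE a s.X₂) :
    DegGE a s.X₁ := fun k d hd => by
  have := finrank_component hs k d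
  rw [h k d hd] at this
  omega

theorem DegGE.quot {s : ShortComplex (GCat n)} (hs : s.ShortExact) {a : ℤ} (h : DegGE a s.X₂) :
    DegGE a s.X₃ := fun k d hd => by
  have := finrank_component hs k d
  rw [h k d hd] at this
  omega

theorem DegGE.le_of_simple {a d : ℤ} {i : Fin (n + 1)} (h : DegGE a ((shiftC n d).obj (S n i))) :
    a ≤ d := by
  by_contra hlt
  have := h i d (not_le.1 hlt)
  rw [finrank_simple] at this
  exact one_ne_zero this

theorem DegLE.shift {b : ℤ} {M : GCat n} (h : DegLE b M) (i : ℤ) :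
    DegLE (b - i) ((shiftC n (-i)).obj M) := fun k d hd => h k (d - -i) (by omega)

/-- The free module of rank one over `C^k`, generated in degree `d`. -/
def freeAt (n : ℕ) (k : Fin (n + 1)) (d : ℤ) : GCat n :=
  atBlock n k fun j => GrMod.shiftObj d (GrMod.regObj (deg n {(j : ℕ)}))

theorem projective_freeAt (k : Fin (n + 1)) (d : ℤ) : Projective (freeAt n k d) := by
  refine pi_projective _ fun j => ?_
  by_cases hj : j = k
  · subst hj
    have h : freeAt n j d j = GrMod.shiftObj d (GrMod.regObj (deg n {(j : ℕ)})) :=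
      atBlock_same j _
    rw [h]
    exact GrMod.projective_reg d
  · have h := isZero_of_subsingleton (subsingleton_atBlock hj
      fun j => GrMod.shiftObj d (GrMod.regObj (deg n {(j : ℕ)})))
    exact ⟨fun _ _ _ => ⟨h.to_ _, h.eq_of_src _ _⟩⟩

theorem finrank_free_ne {k j : Fin (n + 1)} (h : j ≠ k) (d e : ℤ) :
    Module.finrank ℂ ((freeAt n k d j).deg e) = 0 :=
  have : Subsingleton (freeAt n k d j).carrier := subsingleton_atBlock h _
  Module.finrank_zero_of_subsingleton

theorem finrank_free (k : Fin (n + 1)) (d e : ℤ) :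
    Module.finrank ℂ ((freeAt n k d k).deg e) = Module.finrank ℂ (deg n {(k : ℕ)} (e - d)) := by
  have h : freeAt n k d k = GrMod.shiftObj d (GrMod.regObj (deg n {(k : ℕ)})) :=
    atBlock_same k _
  rw [h]
  rfl

theorem finrank_deg_zero (I : Set ℕ) : Module.finrank ℂ (deg n I 0) ≤ 1 :=
  finrank_le_one ⟨1, SetLike.one_mem_graded (deg n I)⟩ fun a => ⟨aug n I a.1, Subtype.ext (by
    change aug n I a.1 • (1 : C n I) = a.1
    rw [← Algebra.algebraMap_eq_smul_one, ← (augGrading n I).zero a.1 a.2])⟩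

theorem finrank_deg_neg (I : Set ℕ) {d : ℤ} (hd : d < 0) : Module.finrank ℂ (deg n I d) = 0 := by
  have h : deg n I d = ⊥ := eq_bot_iff.2 fun a ha => (augGrading n I).neg d hd a ha
  rw [h, finrank_bot]

/-- The simple objects have a free cover whose kernel lives in higher degrees. -/
theorem exists_presentation (k : Fin (n + 1)) (d : ℤ) :
    ∃ (R : GCat n) (f : R ⟶ freeAt n k d) (g : freeAt n k d ⟶ (shiftC n d).obj (S n k))
      (w : f ≫ g = 0), (ShortComplex.mk f g w).ShortExact ∧ DegGE (d + 1) R := by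
  have h : ∀ j, ∃ g : freeAt n k d j ⟶ ((shiftC n d).obj (S n k)) j, Epi g := fun j => by
    by_cases hj : j = k
    · subst hj
      have h1 : freeAt n j d j = GrMod.shiftObj d (GrMod.regObj (deg n {(j : ℕ)})) :=
        atBlock_same j _
      have h2 : GrMod.shiftObj d (GrMod.trivObj _ (aug n {(j : ℕ)}) (augGrading n _).pos) =
          ((shiftC n d).obj (S n j)) j :=
        congrArg (GrMod.shiftObj d) (atBlock_same j (trivB n)).symm
      have := GrMod.epi_of_surjective _ (GrMod.augHom_surjective (augGrading n {(j : ℕ)}) d)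
      exact ⟨eqToHom h1 ≫ GrMod.augHom (augGrading n {(j : ℕ)}) d ≫ eqToHom h2, epi_comp _ _⟩
    · exact ⟨0, (isZero_of_subsingleton (M := ((shiftC n d).obj (S n k)) j)
        (subsingleton_atBlock hj (trivB n))).epi _⟩
  choose g hg using h
  obtain ⟨R, f, w, hs⟩ := exists_shortExact_of_epi (D := GCat n) (X := freeAt n k d)
    (Y := (shiftC n d).obj (S n k)) g (pi_epi_of _ hg)
  refine ⟨R, f, g, w, hs, fun j e he => ?_⟩
  have h1 := finrank_component hs j e
  change Module.finrank ℂ ((freeAt n k d j).deg e) = Module.finrank ℂ ((R j).deg e) +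
    Module.finrank ℂ ((((shiftC n d).obj (S n k)) j).deg e) at h1
  by_cases hj : j = k
  · subst hj
    rw [finrank_free] at h1
    -- In degree d the free module has dimension at most one, and its simple quotient already has
    -- dimension one. So the kernel starts in degree d+1.
    rcases eq_or_lt_of_le (show e ≤ d by omega) with h2 | h2
    · subst h2
      rw [finrank_simple] at h1
      have := finrank_deg_zero (n := n) {(j : ℕ)}
      rw [sub_self] at h1
      omega
    · rw [finrank_deg_neg _ (by omega)] at h1
      omega
  · rw [finrank_free_ne hj] at h1
    omega

/-- Homomorphisms from an object concentrated in one block. -/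
theorem bijective_component {k : Fin (n + 1)} (X : ∀ j : Fin (n + 1), Block n j) (N : GCat n) :
    Function.Bijective fun f : atBlock n k X ⟶ N => f k := by
  refine ⟨fun f f' h => funext fun j => ?_, fun g => ?_⟩
  · by_cases hj : j = k
    · subst hj
      exact h
    · exact (isZero_of_subsingleton (subsingleton_atBlock hj X)).eq_of_src _ _
  · refine ⟨fun j => if h : j = k then (by subst h; exact g) else 0, ?_⟩
    exact dif_pos rfl

theorem nonempty_freeHom (k : Fin (n + 1)) (d : ℤ) (N : GCat n) :
    Nonempty ((freeAt n k d ⟶ N) ≃ₗ[ℂ] (N k).deg d) := by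
  have e1 : (freeAt n k d ⟶ N) ≃ₗ[ℂ] (freeAt n k d k ⟶ N k) := LinearEquiv.ofBijective
    { toFun := fun f : freeAt n k d ⟶ N => (f k : freeAt n k d k ⟶ N k)
      map_add' := fun _ _ => rfl
      map_smul' := fun _ _ => rfl }
    (bijective_component (k := k) (fun j => GrMod.shiftObj d (GrMod.regObj (deg n {(j : ℕ)}))) N)
  have h : freeAt n k d k = GrMod.shiftObj d (GrMod.regObj (deg n {(k : ℕ)})) := atBlock_same k _
  rw [h] at e1
  exact ⟨e1.trans (regHomEquiv d (N k))⟩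

/-- A property which holds for free objects and in high degrees, and which is stable under
extensions and cokernels of monomorphisms, holds for all objects. -/
theorem free_devissage {P : GCat n → Prop} (a₀ : ℤ) (high : ∀ M, DegGE a₀ M → P M)
    (free : ∀ k d, P (freeAt n k d))
    (ext : ∀ s : ShortComplex (GCat n), s.ShortExact → P s.X₁ → P s.X₃ → P s.X₂)
    (coker : ∀ s : ShortComplex (GCat n), s.ShortExact → P s.X₁ → P s.X₂ → P s.X₃) (M : GCat n) :
    P M := by
  -- Induction on how far the degrees may reach below a₀. For a simple object generated in degree at
  -- least a₀-(m+1), the kernel of its free cover lives in degrees at least a₀-m.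
  have key : ∀ m : ℕ, ∀ M, DegGE (a₀ - m) M → P M := fun m => by
    induction m with
    | zero => simpa using high
    | succ m ih =>
      refine devissage (P := fun M => DegGE (a₀ - (m + 1 : ℕ)) M → P M)
        (fun M hM _ => high M (.of_isZero hM a₀)) (fun d i h => ?_)
        (fun s hs h1 h3 h => ext s hs (h1 (h.sub hs)) (h3 (h.quot hs)))
      obtain ⟨R, f, g, w, hs, hR⟩ := exists_presentation i d
      refine coker _ hs (ih R fun k e he => hR k e ?_) (free i d)
      have := h.le_of_simple
      push_cast at this
      omega
  obtain ⟨a, ha⟩ := exists_degGE M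
  exact key (a₀ - a).toNat M fun k d hd => ha k d (by omega)

end Degrees

end

end SlTwoCat

open CategoryTheory CategoryTheory.Limits
open scoped TensorProduct LaurentPolynomial

namespace SlTwoCat

noncomputable section

set_option linter.unusedSectionVars false


open Abelian

/-! ### Finiteness and vanishing of the extension groups -/

section Finiteness

variable {n : ℕ}

/-- Dimension shifting: the cover of a simple object is projective, so its Ext^(j+1) is a quotient
of the Ext^j of the kernel. Extensions of simple objects then give all objects. -/
theorem finite_ext (N : GCat n) (j : ℕ) (M : GCat n) : Module.Finite ℂ (Ext M N j) := by
  induction j generalizing M with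
  | zero =>
    refine devissage (P := fun M => Module.Finite ℂ (Ext M N 0)) (fun M hM => ?_) (fun d i => ?_)
      (fun s hs h1 h3 => ext_finite₂ hs N 0 h1 h3) M
    · have := ext_subsingleton_of_isZero hM N 0
      infer_instance
    · obtain ⟨R, f, g, w, hs, hR⟩ := exists_presentation i d
      have := hs.epi_g
      have := GrMod.finiteC (N i)
      obtain ⟨e⟩ := nonempty_freeHom i d N
      have : Module.Finite ℂ (Ext (freeAt n i d) N 0) :=
        Module.Finite.equiv ((Ext.linearEquiv₀ (R := ℂ)).trans e).symm
      have : Epi g := hs.epi_g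
      exact Module.Finite.of_injective _ (extMap_zero_injective g N)
  | succ j ih =>
    refine devissage (P := fun M => Module.Finite ℂ (Ext M N (j + 1))) (fun M hM => ?_)
      (fun d i => ?_) (fun s hs h1 h3 => ext_finite₂ hs N (j + 1) h1 h3) M
    · have := ext_subsingleton_of_isZero hM N (j + 1)
      infer_instance
    · obtain ⟨R, f, g, w, hs, hR⟩ := exists_presentation i d
      exact ext_finite₃ hs N j (ih R) (projective_freeAt i d)

/-- Every dimension shift raises the lowest degree of the first argument by one. After j steps all
morphisms run from degrees at least a+j to an object living in degrees at most b, so they vanish. -/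
theorem subsingleton_ext {b : ℤ} {N : GCat n} (hN : DegLE b N) (j : ℕ) (M : GCat n) {a : ℤ}
    (ha : DegGE a M) (hab : b < a + j) : Subsingleton (Ext M N j) := by
  induction j generalizing M a with
  | zero =>
    refine devissage (P := fun M => DegGE a M → Subsingleton (Ext M N 0)) (fun M hM _ => ?_)
      (fun d i h => ?_)
      (fun s hs h1 h3 h => ext_subsingleton₂ hs N 0 (h1 (h.sub hs)) (h3 (h.quot hs))) M ha
    · exact ext_subsingleton_of_isZero hM N 0
    · obtain ⟨R, f, g, w, hs, hR⟩ := exists_presentation i d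
      have := GrMod.finiteC (N i)
      obtain ⟨e⟩ := nonempty_freeHom i d N
      have h1 := h.le_of_simple
      have : Subsingleton ((N i).deg d) :=
        Module.finrank_zero_iff.1 (hN i d (by push_cast at hab; omega))
      have : Subsingleton (Ext (freeAt n i d) N 0) :=
        ((Ext.linearEquiv₀ (R := ℂ)).trans e).toEquiv.subsingleton
      have : Epi g := hs.epi_g
      exact (extMap_zero_injective g N).subsingleton
  | succ j ih =>
    refine devissage (P := fun M => DegGE a M → Subsingleton (Ext M N (j + 1))) (fun M hM _ => ?_)
      (fun d i h => ?_)
      (fun s hs h1 h3 h => ext_subsingleton₂ hs N (j + 1) (h1 (h.sub hs)) (h3 (h.quot hs))) M ha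
    · exact ext_subsingleton_of_isZero hM N (j + 1)
    · obtain ⟨R, f, g, w, hs, hR⟩ := exists_presentation i d
      have h1 := h.le_of_simple
      exact ext_subsingleton₃ hs N j (ih R hR (by push_cast at hab; omega)) (projective_freeAt i d)

theorem finite_grExt (M N : GCat n) (i : ℤ) (j : ℕ) : Module.Finite ℂ (GrExt n M N i j) :=
  finite_ext _ j M

theorem finite_support_grExt (M N : GCat n) (i : ℤ) :
    {j | ¬ Subsingleton (GrExt n M N i j)}.Finite := by
  obtain ⟨a, ha⟩ := exists_degGE M
  obtain ⟨b, hb⟩ := exists_degLE N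
  refine (Set.finite_le_nat (b - i - a).toNat).subset fun j hj => ?_
  by_contra hlt
  rw [Set.mem_ofPred_eq, not_le] at hlt
  exact hj (subsingleton_ext (hb.shift i) j M ha (by omega))

theorem exists_bound_grExt (M N : GCat n) :
    ∃ b : ℤ, ∀ i, b < i → ∀ j, Subsingleton (GrExt n M N i j) := by
  obtain ⟨a, ha⟩ := exists_degGE M
  obtain ⟨b, hb⟩ := exists_degLE N
  exact ⟨b - a, fun i hi j => subsingleton_ext (hb.shift i) j M ha (by omega)⟩

theorem extEuler_eq (M N : GCat n) (i : ℤ) {J : ℕ}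
    (hJ : ∀ j, J ≤ j → Subsingleton (GrExt n M N i j)) :
    extEuler n M N i = eulerTrunc M ((shiftC n (-i)).obj N) J := by
  refine finsum_eq_sum_of_support_subset _ fun j hj => ?_
  rw [Finset.coe_range, Set.mem_Iio]
  by_contra hlt
  have := hJ j (not_lt.1 hlt)
  exact hj (by
    change (-1) ^ j * (Module.finrank ℂ (GrExt n M N i j) : ℤ) = 0
    rw [Module.finrank_zero_of_subsingleton, Nat.cast_zero, mul_zero])

theorem exists_truncation (M N : GCat n) (i : ℤ) :
    ∃ J, ∀ j, J ≤ j → Subsingleton (GrExt n M N i j) := by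
  obtain ⟨J, hJ⟩ := (finite_support_grExt M N i).bddAbove
  exact ⟨J + 1, fun j hj => by_contra fun h => absurd (hJ h) (by omega)⟩

/-- All three sums are truncated at a common index beyond which the extension groups vanish. -/
theorem extEuler_add {s : ShortComplex (GCat n)} (hs : s.ShortExact) (N : GCat n) (i : ℤ) :
    extEuler n s.X₂ N i = extEuler n s.X₁ N i + extEuler n s.X₃ N i := by
  obtain ⟨J₁, h1⟩ := exists_truncation s.X₁ N i
  obtain ⟨J₂, h2⟩ := exists_truncation s.X₂ N i
  obtain ⟨J₃, h3⟩ := exists_truncation s.X₃ N i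
  rw [extEuler_eq s.X₁ N i (J := max J₁ (max J₂ J₃)) fun j hj => h1 j (by omega),
    extEuler_eq s.X₂ N i (J := max J₁ (max J₂ J₃)) fun j hj => h2 j (by omega),
    extEuler_eq s.X₃ N i (J := max J₁ (max J₂ J₃)) fun j hj => h3 j (by omega)]
  exact eulerTrunc_add hs _ (fun j => finite_ext _ j _) (fun j => finite_ext _ j _)
    (fun j => finite_ext _ j _) (h3 _ (by omega))

/-- Only Hom contributes for a projective object, and Hom from a free module of rank one picks out
one graded component of N. -/
theorem extEuler_free (k : Fin (n + 1)) (d : ℤ) (N : GCat n) (i : ℤ) :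
    extEuler n (freeAt n k d) N i = Module.finrank ℂ ((N k).deg (d + i)) := by
  have := projective_freeAt k d
  rw [extEuler_eq (freeAt n k d) N i (J := 0 + 1) fun j hj => by
    obtain ⟨j, rfl⟩ := Nat.exists_eq_add_of_le' hj
    exact Ext.subsingleton_of_projective _ _ j, eulerTrunc_of_projective]
  obtain ⟨e⟩ := nonempty_freeHom k d ((shiftC n (-i)).obj N)
  rw [e.finrank_eq]
  change ((Module.finrank ℂ ((N k).deg (d - -i)) : ℕ) : ℤ) = _
  rw [sub_neg_eq_add]

end Finiteness

end

end SlTwoCat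

open CategoryTheory CategoryTheory.Limits
open scoped TensorProduct LaurentPolynomial

namespace SlTwoCat

noncomputable section

set_option linter.unusedSectionVars false


open LaurentPolynomial (T invert)

/-! ### Expansion of rational functions -/

section Expansion

theorem ratFunc_coe_mul {F : Type*} [Field F] (f g : RatFunc F) :
    ((f * g : RatFunc F) : LaurentSeries F) = (f : LaurentSeries F) * (g : LaurentSeries F) :=
  map_mul _ f g

theorem ratFunc_coe_X_zpow {F : Type*} [Field F] (k : ℤ) :
    ((RatFunc.X ^ k : RatFunc F) : LaurentSeries F) = HahnSeries.single k 1 := by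
  rw [map_zpow₀, RatFunc.coe_X, ← RatFunc.single_zpow]

/-- The coefficient of `q ^ d` in the expansion at `q = 0`. -/
def coeffAtZero (d : ℤ) : Cq →+ ℂ where
  toFun f := HahnSeries.coeff (f : LaurentSeries ℂ) d
  map_zero' := by rw [map_zero, HahnSeries.coeff_zero]
  map_add' f g := by rw [map_add, HahnSeries.coeff_add]

theorem coeffAtZero_zpow (k d : ℤ) : coeffAtZero d (q ^ k) = if d = k then 1 else 0 := by
  refine (congrArg (fun x => HahnSeries.coeff x d) (ratFunc_coe_X_zpow k)).trans ?_
  split_ifs with h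
  · rw [h, HahnSeries.coeff_single_same]
  · rw [HahnSeries.coeff_single_of_ne h]

theorem coeffAtZero_lau {f : ℤ → ℤ} (hf : (Function.support f).Finite) (d : ℤ) :
    coeffAtZero d (algebraMap ℤ[T;T⁻¹] Cq (lau f)) = f d := by
  have h := AddMonoidHom.map_finsum
    ((coeffAtZero d).comp (algebraMap ℤ[T;T⁻¹] Cq).toAddMonoidHom) (lau_support hf)
  refine h.trans ?_
  have h1 : ∀ e, coeffAtZero d (algebraMap ℤ[T;T⁻¹] Cq (LaurentPolynomial.C (f e) * T e)) =
      if d = e then (f e : ℂ) else 0 := fun e => by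
    have h2 : (LaurentPolynomial.C (f e) : ℤ[T;T⁻¹]) = (f e : ℤ[T;T⁻¹]) := by simp
    rw [h2, map_mul, map_intCast, algebraMap_T, ← zsmul_eq_mul, map_zsmul, coeffAtZero_zpow,
      zsmul_eq_mul]
    split_ifs
    · rw [mul_one]
    · rw [mul_zero]
  refine (finsum_congr h1).trans ?_
  rw [finsum_eq_single _ d fun e he => if_neg he.symm, if_pos rfl]

theorem coeffAtZero_mul_eq_zero {f g : Cq} {a d : ℤ} (hf : ∀ e < a, coeffAtZero e f = 0)
    (hd : d < a + HahnSeries.order (g : LaurentSeries ℂ)) : coeffAtZero d (f * g) = 0 := by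
  refine (congrArg (fun x => HahnSeries.coeff x d) (ratFunc_coe_mul f g)).trans ?_
  refine HahnSeries.coeff_mul.trans (Finset.sum_eq_zero fun ij hij => ?_)
  have hsum : ij.1 + ij.2 = d := (Finset.mem_antidiagonal.1 hij).2.2
  rcases lt_or_ge ij.1 a with h | h
  · exact mul_eq_zero_of_left (hf _ h) _
  · exact mul_eq_zero_of_right _ (HahnSeries.coeff_eq_zero_of_lt_order (by omega))

/-- The bar involution exchanges the expansions at infinity and at zero, so the rest of the
comparison takes place at zero. -/
theorem coeffAtInfty_eq (f : Cq) (i : ℤ) : coeffAtInfty f i = coeffAtZero (-i) (bar f) := rfl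

end Expansion

/-! ### The semilinear form as an Euler form -/

section EulerForm

variable {n : ℕ}

/-- The factor by which a component of the first object enters the semilinear form. -/
def weight (N : GCat n) (k : Fin (n + 1)) : Cq :=
  algebraMap ℤ[T;T⁻¹] Cq (invert (chC N k)) / algebraMap ℤ[T;T⁻¹] Cq (gch (deg n {(k : ℕ)}))

theorem hilb_ne_zero (k : Fin (n + 1)) :
    algebraMap ℤ[T;T⁻¹] Cq (gch (deg n {(k : ℕ)})) ≠ 0 := by
  rw [hilb (Nat.lt_succ_iff.1 k.2)]
  exact mul_ne_zero (pow_ne_zero _ q_ne_zero) (qBinom_ne_zero n k)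

/-- After the bar involution the form is linear in M. Passing to characters brings in [n,k]⁻¹ twice:
one factor cancels against the form, and the other combines with q^(-k(n-k)) to the inverse of the
Hilbert series. -/
theorem bar_form (M N : GCat n) :
    bar (form n ((Phi n).symm (cls n M)) ((Phi n).symm (cls n N))) =
      ∑ k, chq M k * weight N k := by
  rw [Phi_symm_cls, Phi_symm_cls, form, map_sum]
  refine Finset.sum_congr rfl fun k _ => ?_
  have hbb : ∀ p, bar (bar (algebraMap ℤ[T;T⁻¹] Cq p)) = algebraMap ℤ[T;T⁻¹] Cq p := fun p => by
    rw [bar_algebraMap, bar_algebraMap]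
    congr 1
    exact LaurentPolynomial.involutive_invert p
  have h1 := qBinom_ne_zero n k
  have h2 : q ^ ((k : ℕ) * (n - k)) ≠ 0 := pow_ne_zero _ q_ne_zero
  simp only [weight, hilb (Nat.lt_succ_iff.1 k.2), map_mul, map_inv₀, map_pow, bar_qBinom, bar_q,
    chq, hbb, inv_pow]
  rw [← bar_algebraMap]
  field_simp

/-- The coefficients of the semilinear form. -/
def formCoeff (M N : GCat n) (i : ℤ) : ℂ := coeffAtZero (-i) (∑ k, chq M k * weight N k)

theorem formCoeff_add {s : ShortComplex (GCat n)} (hs : s.ShortExact) (N : GCat n) (i : ℤ) :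
    formCoeff s.X₂ N i = formCoeff s.X₁ N i + formCoeff s.X₃ N i := by
  rw [formCoeff, formCoeff, formCoeff, ← map_add, ← Finset.sum_add_distrib]
  congr 1
  refine Finset.sum_congr rfl fun k _ => ?_
  rw [chq, chC_exact hs, Pi.add_apply, map_add, add_mul]
  rfl

theorem coeffAtZero_chq (M : GCat n) (k : Fin (n + 1)) (d : ℤ) :
    coeffAtZero d (chq M k) = Module.finrank ℂ ((M k).deg d) := by
  rw [chq, chC, GrMod.ch, gch, coeffAtZero_lau (GrMod.ch_support (M k)), Int.cast_natCast]

/-- The weights depend on N only and have bounded order at zero. Raising the degrees of M thus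
pushes the product beyond any given coefficient. This is the counterpart of the vanishing of the
extension groups. -/
theorem exists_formCoeff_eq_zero (N : GCat n) (i : ℤ) :
    ∃ a₀, ∀ a, a₀ ≤ a → ∀ M, DegGE a M → formCoeff M N i = 0 := by
  obtain ⟨c, hc⟩ := (Set.finite_range fun k : Fin (n + 1) =>
    HahnSeries.order (weight N k : LaurentSeries ℂ)).bddBelow
  refine ⟨-i - c + 1, fun a ha M hM => ?_⟩
  rw [formCoeff, map_sum]
  refine Finset.sum_eq_zero fun k _ => coeffAtZero_mul_eq_zero (a := a) (fun e he => ?_) ?_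
  · rw [coeffAtZero_chq, hM k e he, Nat.cast_zero]
  · have : c ≤ HahnSeries.order (weight N k : LaurentSeries ℂ) := hc (Set.mem_range_self k)
    omega

theorem chC_freeAt (k : Fin (n + 1)) (d : ℤ) :
    chC (freeAt n k d) k = T d * gch (deg n {(k : ℕ)}) :=
  (ch_congr (atBlock_same k _)).trans (GrMod.ch_shift d _)

theorem chC_freeAt_ne {k j : Fin (n + 1)} (h : j ≠ k) (d : ℤ) : chC (freeAt n k d) j = 0 :=
  GrMod.ch_of_subsingleton (subsingleton_atBlock h _)

/-- The Hilbert series in the character of the free module cancels the denominator of the weight,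
which leaves a shift of the inverted character of N. -/
theorem formCoeff_free (k : Fin (n + 1)) (d : ℤ) (N : GCat n) (i : ℤ) :
    formCoeff (freeAt n k d) N i = Module.finrank ℂ ((N k).deg (d + i)) := by
  rw [formCoeff, Finset.sum_eq_single k]
  · have h1 : chq (freeAt n k d) k * weight N k =
        algebraMap ℤ[T;T⁻¹] Cq (T d * invert (chC N k)) := by
      rw [chq, chC_freeAt, weight, map_mul, map_mul]
      field_simp [hilb_ne_zero k]
    have hs := GrMod.ch_support (N k)
    have hs' : (Function.support fun e => (Module.finrank ℂ ((N k).deg (-e)) : ℤ)).Finite :=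
      Set.Finite.preimage (f := fun e : ℤ => -e) neg_injective.injOn hs
    have hs'' : (Function.support fun e => (Module.finrank ℂ ((N k).deg (-(e - d))) : ℤ)).Finite :=
      Set.Finite.preimage (f := fun e : ℤ => e - d) (sub_left_injective).injOn hs'
    have h2 : T d * invert (chC N k) =
        lau fun e => (Module.finrank ℂ ((N k).deg (-(e - d))) : ℤ) := by
      rw [chC, GrMod.ch, gch, ← lau_invert hs]
      exact (lau_shift hs' d).symm
    rw [h1, h2, coeffAtZero_lau hs'', Int.cast_natCast, show -(-i - d) = d + i by ring]
  · intro j _ hj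
    rw [chq, chC_freeAt_ne hj, map_zero, zero_mul]
  · simp

/-- The semilinear form is the Euler form of graded extensions. -/
theorem coeffAtInfty_form (M N : GCat n) (i : ℤ) :
    coeffAtInfty (form n ((Phi n).symm (cls n M)) ((Phi n).symm (cls n N))) i =
      (extEuler n M N i : ℂ) := by
  rw [coeffAtInfty_eq, bar_form]
  change formCoeff M N i = _
  obtain ⟨a₀, h₀⟩ := exists_formCoeff_eq_zero N i
  obtain ⟨b, hb⟩ := exists_degLE N
  -- The threshold makes both sides vanish: the first entry settles the coefficient of the form, and
  -- the second one puts M above all degrees of the shifted N.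
  refine free_devissage (P := fun M => formCoeff M N i = (extEuler n M N i : ℂ))
    (max a₀ (b - i + 1)) (fun M hM => ?_) (fun k d => ?_) (fun s hs h1 h3 => ?_)
    (fun s hs h1 h2 => ?_) M
  · rw [h₀ _ (le_max_left _ _) M hM, extEuler_eq M N i (J := 0) fun j _ =>
      subsingleton_ext (hb.shift i) j M hM (by omega), eulerTrunc, Finset.sum_range_zero,
      Int.cast_zero]
  · rw [formCoeff_free, extEuler_free, Int.cast_natCast]
  · rw [formCoeff_add hs, extEuler_add hs, h1, h3, Int.cast_add]
  · have h4 := formCoeff_add hs N i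
    rw [h2, extEuler_add hs, h1, Int.cast_add] at h4
    exact (add_left_cancel h4).symm

end EulerForm

end

end SlTwoCat

/-! ### Assembly of the theorem -/

theorem theorem6p2 (n : ℕ) (hn : 0 < n) :
    ∃ VT : Fin (n + 1) → GCat n,
      -- `VT i` is the projective cover of `S_i⟨-i(n-i)⟩`
      (∀ i : Fin (n + 1),
        IsProjectiveCover (VT i) ((shiftC n (-((i : ℤ) * (n - i)))).obj (S n i))) ∧
      -- (a) exactness and the defining relations
      (PreservesFiniteLimits (E n) ∧ PreservesFiniteColimits (E n) ∧
        PreservesFiniteLimits (F n) ∧ PreservesFiniteColimits (F n) ∧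
        PreservesFiniteLimits (K n) ∧ PreservesFiniteColimits (K n) ∧
        PreservesFiniteLimits (Kinv n) ∧ PreservesFiniteColimits (Kinv n)) ∧
      Nonempty (E n ⋙ K n ≅ K n ⋙ E n ⋙ shiftC n 2) ∧
      Nonempty (F n ⋙ K n ≅ K n ⋙ F n ⋙ shiftC n (-2)) ∧
      Nonempty (Kinv n ⋙ K n ≅ 𝟭 (GCat n)) ∧
      Nonempty (K n ⋙ Kinv n ≅ 𝟭 (GCat n)) ∧
      (∀ i : Fin (n + 1), n ≤ 2 * (i : ℕ) →
        Nonempty (F n ⋙ E n ⋙ proj n i ≅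
          (E n ⋙ F n ⋙ proj n i) ⊞ (proj n i ⋙ quantumSum n i (2 * i - n)))) ∧
      (∀ i : Fin (n + 1), 2 * (i : ℕ) < n →
        Nonempty (E n ⋙ F n ⋙ proj n i ≅
          (F n ⋙ E n ⋙ proj n i) ⊞ (proj n i ⋙ quantumSum n i (n - 2 * i)))) ∧
      (∀ M : GCat n,
        (LaurentPolynomial.T 1 - LaurentPolynomial.T (-1) : ℤ[T;T⁻¹]) •
            (K0.mk n ((E n).obj ((F n).obj M)) - K0.mk n ((F n).obj ((E n).obj M))) =
          K0.mk n ((K n).obj M) - K0.mk n ((Kinv n).obj M)) ∧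
      -- (b) the induced action on the Grothendieck group and the isomorphism with `V_n`
      ∃ (ρ : Uq →ₐ[Cq] Module.End Cq (G n)) (Φ : V n ≃ₗ[Cq] G n),
        (∀ M : GCat n, ρ (gen Gen.E) (cls n M) = cls n ((E n).obj M) ∧
          ρ (gen Gen.F) (cls n M) = cls n ((F n).obj M) ∧
          ρ (gen Gen.K) (cls n M) = cls n ((K n).obj M) ∧
          ρ (gen Gen.Kinv) (cls n M) = cls n ((Kinv n).obj M)) ∧
        (∀ (x : Uq) (v : V n), Φ (repV n x v) = ρ x (Φ v)) ∧
        (∀ i, Φ (dualCan n i) = cls n (S n i)) ∧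
        (∀ i, Φ (can n i) = cls n (VT i)) ∧
        -- (c) the involution `σ_n` as an equivalence of categories
        (∃ Sig : GCat n ⥤ GCat n, Sig.IsEquivalence ∧
          (∀ i, Nonempty (Sig.obj (S n i) ≅ S n i.rev)) ∧
          (∀ i, Nonempty (Sig.obj (VT i) ≅ VT i.rev)) ∧
          Nonempty (Sig ⋙ Sig ≅ 𝟭 (GCat n)) ∧
          Nonempty (Sig ⋙ E n ⋙ Sig ≅ F n) ∧
          Nonempty (Sig ⋙ F n ⋙ Sig ≅ E n) ∧
          Nonempty (Sig ⋙ K n ⋙ Sig ≅ Kinv n) ∧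
          (∀ k : ℤ, Nonempty (Sig ⋙ shiftC n k ⋙ Sig ≅ shiftC n k)) ∧
          ∀ M, cls n (Sig.obj M) = Φ (sigmaV n (Φ.symm (cls n M)))) ∧
        -- (d) the involution `ψ_n` as the graded duality
        ((dualC n).IsEquivalence ∧
          Nonempty ((dualC n).rightOp ⋙ dualC n ≅ 𝟭 (GCat n)) ∧
          (∀ i, Nonempty ((dualC n).obj (Opposite.op (VT i)) ≅ VT i)) ∧
          Nonempty ((dualC n).rightOp ⋙ (E n).op ⋙ dualC n ≅ E n) ∧
          Nonempty ((dualC n).rightOp ⋙ (F n).op ⋙ dualC n ≅ F n) ∧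
          Nonempty ((dualC n).rightOp ⋙ (K n).op ⋙ dualC n ≅ Kinv n) ∧
          (∀ k : ℤ, Nonempty ((dualC n).rightOp ⋙ (shiftC n k).op ⋙ dualC n ≅ shiftC n (-k))) ∧
          ∀ M, cls n ((dualC n).obj (Opposite.op M)) = Φ (psiV n (Φ.symm (cls n M)))) ∧
        -- (e) the semilinear form as the Euler form of graded extensions
        (∀ M N : GCat n,
          (∀ i j, Module.Finite ℂ (GrExt n M N i j)) ∧
          (∀ i, {j | ¬ Subsingleton (GrExt n M N i j)}.Finite) ∧
          (∃ b : ℤ, ∀ i, b < i → ∀ j, Subsingleton (GrExt n M N i j)) ∧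
          ∀ i, coeffAtInfty (form n (Φ.symm (cls n M)) (Φ.symm (cls n N))) i =
            (extEuler n M N i : ℂ)) ∧
        -- (f) the anti-automorphism `τ` as taking right adjoints
        (Nonempty (E n ⊣ shiftC n 1 ⋙ Kinv n ⋙ F n) ∧
          Nonempty (F n ⊣ shiftC n 1 ⋙ K n ⋙ E n) ∧
          Nonempty (K n ⊣ Kinv n) ∧
          Nonempty (Kinv n ⊣ K n) ∧
          ∀ k : ℤ, Nonempty (shiftC n (-k) ⊣ shiftC n k)) := by
  obtain ⟨eE, eF, eK, eKinv⟩ := repV_gen n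
  refine ⟨VT n, isProjectiveCover_VT,
    ⟨inferInstance, inferInstance, inferInstance, inferInstance, inferInstance, inferInstance,
      inferInstance, inferInstance⟩,
    ⟨(KEIso n).symm⟩, ⟨(KFIso n).symm⟩, ⟨KinvK n⟩, ⟨KKinv n⟩, fun i hi => nonempty_EF i hn hi,
    fun i hi => nonempty_FE i hi, K0.commutator, rhoG n, Phi n,
    fun M => ⟨?_, ?_, ?_, ?_⟩, fun x v => ?_, Phi_dualCan, Phi_can,
    ⟨Sig n, inferInstance, nonempty_Sig_S, nonempty_Sig_VT, ⟨SigSig n⟩, ⟨SigESig n⟩, ⟨SigFSig n⟩,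
      ⟨SigKSig n⟩, fun k => ⟨SigShiftSig n k⟩, cls_Sig⟩,
    ⟨inferInstance, ⟨dualCDual n⟩, nonempty_dual_VT, ⟨dualEDual n⟩, ⟨dualFDual n⟩, ⟨dualKDual n⟩,
      fun k => ⟨dualShiftDual n k⟩, cls_dual⟩,
    fun M N => ⟨finite_grExt M N, finite_support_grExt M N, exists_bound_grExt M N,
      coeffAtInfty_form M N⟩,
    ⟨EAdj n⟩, ⟨FAdj n⟩, ⟨(KEquiv n).toAdjunction⟩, ⟨(KEquiv n).symm.toAdjunction⟩,
    fun k => ⟨(shiftEquiv n k).toAdjunction⟩⟩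
  · rw [rhoG_apply, eE, cls_E]
  · rw [rhoG_apply, eF, cls_F]
  · rw [rhoG_apply, eK, cls_K]
  · rw [rhoG_apply, eKinv, cls_Kinv]
  · rw [rhoG_apply, LinearEquiv.symm_apply_apply]
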